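/- **Setting.** Fix $T\ge 1$, $r\ge 0$, positive integers $\mu_j,s_j,d_j$ ($1\le j\le r$). Let $\chi(e^{-i\lambda})=\prod_{j}(1-e^{-i\lambda\mu_js_j})^{d_j}$, $\beta(i\lambda)=\prod_j\prod_{|k|\le[s_j/2]}(i\lambda-2\pi ik/s_j)^{d_j}$, $G(\lambda)=|\chi(e^{-i\lambda})|^2/|\beta(i\lambda)|^2$, $n=\sum_j\mu_js_jd_j$, $\prod_j(1-x^{\mu_js_j})^{d_j}=\sum_{k=0}^n e(k)x^k$, $\prod_j(\sum_{i\ge0}x^{\mu_js_ji})^{d_j}=\sum_{k\ge0}d(k)x^k$. A *spectral density* is an integrable function $f$ on $(-\pi,\pi]$ whose values are a.e. positive semidefinite Hermitian $T\times T$ matrices. It satisfies the *minimality condition* if it is a.e. invertible and $\int_{-\pi}^{\pi}\mathrm{Tr}[G^{-1}f^{-1}]\,d\lambda<\infty$. Let $a(k)\in\mathbb C^T$, $k\ge0$, be such that the series $b(k)=(Da)_k=\sum_{m\ge k}d(m-k)a(m)$ converge absolutely, and $\sum\|a(k)\|$, $\sum(k+1)\|a(k)\|^2$, $\sum\|b(k)\|$,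 $\sum(k+1)\|b(k)\|^2$ are finite; put $B(\lambda)=\sum_{k\ge0}b(k)e^{i\lambda k}$. For a sequence $\xi(m)\in\mathbb C^T$, $m\in\mathbb Z$, let $\chi\xi(m)=\sum_{k=0}^n e(k)\xi(m-k)$; the functional $A\xi=\sum_{k\ge0}a(k)^\top\xi(k)$ is understood as $A\xi=\sum_{k\ge0}b(k)^\top\chi\xi(k)-V\xi$, where $V\xi=\sum_{k=-n}^{-1}v(k)^\top\xi(k)$, $v(k)=\sum_{l=0}^{k+n}e(l-k)b(l)$, is observed. Linear estimates are (limits of) finite combinations of the components of $\chi\xi(k)$, $k\le-1$, minus $V\xi$. A centred stochastic sequence $\xi$ has stationary GM increments with spectral density $f$ if for all vectors of positive steps $\mu',\mu''$ (and the same $s,d$) the increments $\chi_{\mu'}\xi,\chi_{\mu''}\xi$ have mean zero, finite second moments and $\mathsf E\,\chi_{\mu'}\xi_p(m_0+m)\overline{\chi_{\mu''}\xi_l(m_0)}=\frac1{2\pi}\int_{-\pi}^{\pi}e^{i\lambda m}\chi_{\mu'}(e^{-i\lambda})\overline{\chi_{\mu''}(e^{-i\lambda})}|\beta(i\lambda)|^{-2}f_{pl}(\lambda)\,d\lambda$.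 $L_2^{0-}(f)$ is the closure of the span of $e^{i\lambda k}\chi(e^{-i\lambda})\beta(i\lambda)^{-1}\delta_l$, $k\le-1$, $1\le l\le T$, in $L_2(f)$ with squared norm $\frac1{2\pi}\int u^\top f\bar u\,d\lambda$. Put $\Delta(h;f)=\|B\chi/\beta-h\|^2_{L_2(f)}$ and $\Delta(f)=\min_{h\in L_2^{0-}(f)}\Delta(h;f)$; the minimizer is the optimal spectral characteristic. A density $f_0\in\mathcal D$ is *least favourable* in $\mathcal D$ if $\Delta(f_0)=\max_{f\in\mathcal D}\Delta(f)$; $h^0\in H_{\mathcal D}=\bigcap_{f\in\mathcal D}L_2^{0-}(f)$ is *minimax-robust* if $\sup_{f\in\mathcal D}\Delta(h^0;f)=\min_{h\in H_{\mathcal D}}\sup_{f\in\mathcal D}\Delta(h;f)$. For a minimal $f$, $F_f$ is the Toeplitz operator with entries $F_f(j,k)=\frac1{2\pi}\int e^{i\lambda(k-j)}G^{-1}(f^{-1})^\top d\lambda$, $j,k\ge0$. We write $c=F_f^{-1}Da$ if there is an integrable $C(\lambda)$ with Fourier series $\sum_{k\ge0}c(k)e^{i\lambda k}$ and $\int G^{-1}C^\top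 f^{-1}\overline C\,d\lambda<\infty$, such that $G^{-1}(f^{-1})^\top C$ is integrable with $j$-th Fourier coefficient $b(j)$ for all $j\ge0$. **Classes.** Let $0\le\varepsilon\le1$, $f_1$ a spectral density, $p,p_k$ real, $B_1,P$ positive definite Hermitian, $\langle B_1,f\rangle=\mathrm{Tr}(B_1f)$. The classes consist of the spectral densities $f$ for which, for some spectral density $W$, * $\mathcal D^1_\varepsilon$: $\mathrm{Tr}f=(1-\varepsilon)\mathrm{Tr}f_1+\varepsilon\mathrm{Tr}W$, $\frac1{2\pi}\int G\,\mathrm{Tr}f\,d\lambda=p$; * $\mathcal D^2_\varepsilon$: $f_{kk}=(1-\varepsilon)f^1_{kk}+\varepsilon w_{kk}$, $\frac1{2\pi}\int Gf_{kk}\,d\lambda=p_k$, $k=1,\dots,T$; * $\mathcal D^3_\varepsilon$: $\langle B_1,f\rangle=(1-\varepsilon)\langle B_1,f_1\rangle+\varepsilon\langle B_1,W\rangle$, $\frac1{2\pi}\int G\langle B_1,f\rangle d\lambda=p$; * $\mathcal D^4_\varepsilon$: $f=(1-\varepsilon)f_1+\varepsilon W$, $\frac1{2\pi}\int Gf\,d\lambda=P$.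 The class is called nondegenerate if the prescribed moment strictly exceeds that of $(1-\varepsilon)f_1$ (for each $k$ in $\mathcal D^2_\varepsilon$; the difference is positive definite in $\mathcal D^4_\varepsilon$). **Theorem.** Let $\mathcal D$ be one of these classes, and let $f_0\in\mathcal D$ satisfy the minimality condition. 0. For every spectral density $f$ and every stochastic sequence $\xi$ with stationary GM increments with spectral density $f$: the mean square error of the estimate of $A\xi$ given by a finite combination with spectral characteristic $h$ is $\Delta(h;f)$, and the infimum of these errors is $\Delta(f)$. 1. $c=F_0^{-1}Da$ (with $F_0=F_{f_0}$) exists and is unique. With the corresponding $C$, the optimal spectral characteristic under $f_0$ is $$h^0(\lambda)^\top=B(\lambda)^\top\frac{\chi(e^{-i\lambda})}{\beta(i\lambda)}-\frac{\overline{\beta(i\lambda)}}{\chi(e^{i\lambda})}C(\lambda)^\top f_0^{-1}(\lambda),\qquad(\ast)$$ and $\Delta(f_0)=\langle Da,F_0^{-1}Da\rangle=\sum_kb(k)^\top\overline{c(k)}$. 2. $f_0$ is least favourable in $\mathcal D$ if and only if $\langle Da,F_f^{-1}Da\rangle\le\langle Da,F_0^{-1}Da\rangle$ for all minimal $f\in\mathcal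 D$. 3. Consider the equation, a.e. in $\lambda$, $$C(\lambda)C(\lambda)^*=(Gf_0^\top)\,X(\lambda)\,(Gf_0^\top),$$ where, respectively for the four classes, * $X=(\alpha^2+\gamma_1(\lambda))I$, $\gamma_1\le0$, $\gamma_1=0$ where $\mathrm{Tr}f_0>(1-\varepsilon)\mathrm{Tr}f_1$; * $X=\mathrm{diag}(\alpha_k^2+\gamma^1_k(\lambda))$, $\gamma^1_k\le0$, $\gamma^1_k=0$ where $f^0_{kk}>(1-\varepsilon)f^1_{kk}$; * $X=(\alpha^2+\gamma_1'(\lambda))B_1^\top$, $\gamma_1'\le0$, $\gamma'_1=0$ where $\langle B_1,f_0\rangle>(1-\varepsilon)\langle B_1,f_1\rangle$; * $X=\mathbf A+\Gamma(\lambda)$, $\mathbf A\ge0$ a constant matrix, $\Gamma\le0$, $\Gamma(f_0-(1-\varepsilon)f_1)^\top=0$ (so $\Gamma=0$ where $f_0-(1-\varepsilon)f_1$ is positive definite), and $\mathbf A=\vec\alpha\vec\alpha^*$ for a vector $\vec\alpha$ whenever $f_0-(1-\varepsilon)f_1$ is positive definite on a set of positive measure; with real constants $\alpha,\alpha_k$.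 If the equation holds for some such $X$, then $f_0$ is least favourable in $\mathcal D$. Conversely, if $\mathcal D$ is nondegenerate and $f_0$ is least favourable in $\mathcal D$, then the equation holds for some such $X$. 4. Let $f_0$ admit a canonical factorization $Gf_0=\Phi\Phi^*$, $\Phi=\sum_{k\ge0}\varphi(k)e^{-i\lambda k}$ square integrable with values in $\mathbb C^{T\times q}$, where each constant row $\delta_l^\top$ ($1\le l\le q$) is an $L_2$-limit of finite sums $\sum_{k\ge0}e^{-i\lambda k}g_k^\top\Phi$. Then there is an integrable $R(\lambda)$ with Fourier series $\sum_{k\ge0}r(k)e^{i\lambda k}$, $r(k)=\sum_{m\ge0}\varphi(m)^\top b(m+k)$, and item 3 holds with the equation replaced by $R R^*=\Phi^\top X\overline{\Phi}$ with the same $X$. 5. If $f_0$ is least favourable in $\mathcal D$, then $h^0$ given by $(\ast)$ is minimax-robust for $\mathcal D$. -/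

import Mathlib

noncomputable section

namespace GMForecast

open MeasureTheory Complex Matrix
open scoped ENNReal ComplexConjugate ComplexOrder

/-! ### Generalized multiple (GM) increments -/

/-- Parameters of the operator `∏ j, (1 - B ^ (μ_j s_j)) ^ d_j`: steps, seasons and orders. -/
structure GMIndex (r : ℕ) where
  mu : Fin r → ℕ
  s : Fin r → ℕ
  d : Fin r → ℕ

variable {r T q : ℕ}

def GMIndex.Positive (γ : GMIndex r) : Prop :=
  ∀ j, 0 < γ.mu j ∧ 0 < γ.s j ∧ 0 < γ.d j

/-- The same seasons and orders with another vector of steps. -/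
def GMIndex.withStep (γ : GMIndex r) (mu : Fin r → ℕ) : GMIndex r :=
  { γ with mu := mu }

/-- `n(γ) = ∑ μ_j s_j d_j`. -/
def GMIndex.order (γ : GMIndex r) : ℕ := ∑ j, γ.mu j * γ.s j * γ.d j

/-- `e_γ(k)`: the coefficient of `x ^ k` in `∏ j, (1 - x ^ (μ_j s_j)) ^ d_j`. -/
def eCoef (γ : GMIndex r) (k : ℕ) : ℂ :=
  (∏ j, ((1 : Polynomial ℂ) - Polynomial.X ^ (γ.mu j * γ.s j)) ^ γ.d j).coeff k

/-- `d_μ(k)`: the coefficient of `x ^ k` in `∏ j, (∑ i, x ^ (μ_j s_j i)) ^ d_j`. -/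
def dCoef (γ : GMIndex r) (k : ℕ) : ℂ :=
  PowerSeries.coeff k
    (∏ j, (PowerSeries.mk fun n => if γ.mu j * γ.s j ∣ n then (1 : ℂ) else 0) ^ γ.d j)

/-- The GM increment of a numerical sequence. -/
def gmInc (γ : GMIndex r) (x : ℤ → ℂ) (m : ℤ) : ℂ :=
  ∑ k ∈ Finset.range (γ.order + 1), eCoef γ k * x (m - k)

/-- `χ(e^{-it}) = ∏ j, (1 - e^{-i t μ_j s_j}) ^ d_j`. -/
def chi (γ : GMIndex r) (t : ℝ) : ℂ :=
  ∏ j, (1 - exp (-(I * (t : ℂ) * ((γ.mu j * γ.s j : ℕ) : ℂ)))) ^ γ.d j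

/-- `β(it) = ∏ j, ∏_{|k| ≤ [s_j / 2]} (it - 2πik / s_j) ^ d_j`. -/
def beta (γ : GMIndex r) (t : ℝ) : ℂ :=
  ∏ j, ∏ k ∈ Finset.Icc (-((γ.s j / 2 : ℕ) : ℤ)) ((γ.s j / 2 : ℕ) : ℤ),
    (I * (t : ℂ) - 2 * (Real.pi : ℂ) * I * (k : ℂ) / (γ.s j : ℂ)) ^ γ.d j

/-- `|χ(e^{-it})|² / |β(it)|²`. -/
def gain (γ : GMIndex r) (t : ℝ) : ℝ := ‖chi γ t‖ ^ 2 / ‖beta γ t‖ ^ 2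

/-! ### Fourier coefficients and spectral densities -/

/-- Lebesgue measure on one period. -/
def circ : Measure ℝ := volume.restrict (Set.Ioc (-Real.pi) Real.pi)

/-- `(1 / 2π) ∫ g(t) e^{-int} dt`. -/
def fourierCoef (g : ℝ → ℂ) (n : ℤ) : ℂ :=
  (1 / (2 * (Real.pi : ℂ))) * ∫ t, exp (-(I * (n : ℂ) * (t : ℂ))) * g t ∂circ

/-- `C(t) = ∑_{k ≥ 0} c(k) e^{ikt}`: the integrable function `C` has this Fourier series. -/
structure IsAnalyticSum (c : ℕ → Fin q → ℂ) (C : ℝ → Fin q → ℂ) : Prop where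
  integrable : ∀ p, Integrable (fun t => C t p) circ
  coef : ∀ p (k : ℕ), fourierCoef (fun t => C t p) (k : ℤ) = c k p
  coef_neg : ∀ p (k : ℕ), fourierCoef (fun t => C t p) (-((k : ℤ) + 1)) = 0

structure IsSpectralDensity (f : ℝ → Matrix (Fin T) (Fin T) ℂ) : Prop where
  posSemidef : ∀ᵐ t ∂circ, (f t).PosSemidef
  integrable : ∀ p l, Integrable (fun t => f t p l) circ

/-- The minimality condition. -/
structure IsMinimal (γ : GMIndex r) (f : ℝ → Matrix (Fin T) (Fin T) ℂ) : Prop where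
  isUnit_det : ∀ᵐ t ∂circ, IsUnit (f t).det
  integrable : Integrable (fun t => (gain γ t)⁻¹ * ((f t)⁻¹).trace.re) circ

/-! ### The functional to be estimated -/

/-- `b(k) = (D a)_k = ∑_{m ≥ k} d_μ(m - k) a(m)`. -/
def bCoef (γ : GMIndex r) (a : ℕ → Fin T → ℂ) (k : ℕ) : Fin T → ℂ :=
  ∑' m, dCoef γ m • a (m + k)

/-- `B(e^{it}) = ∑_k b(k) e^{ikt}`. -/
def bFun (γ : GMIndex r) (a : ℕ → Fin T → ℂ) (t : ℝ) : Fin T → ℂ :=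
  ∑' k : ℕ, exp (I * (k : ℂ) * (t : ℂ)) • bCoef γ a k

/-- Standing conditions on the coefficients `a` (`D a` is well defined; `a` and `D a` decay). -/
structure IsAdmissible (γ : GMIndex r) (a : ℕ → Fin T → ℂ) : Prop where
  summable_D : ∀ k, Summable fun m => dCoef γ m • a (m + k)
  summable_a : Summable fun k => ‖a k‖
  summable_a_sq : Summable fun k : ℕ => ((k : ℝ) + 1) * ‖a k‖ ^ 2
  summable_b : Summable fun k => ‖bCoef γ a k‖
  summable_b_sq : Summable fun k : ℕ => ((k : ℝ) + 1) * ‖bCoef γ a k‖ ^ 2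

/-! ### Spectral characteristics and mean square errors -/

/-- `∫ u(t)ᵀ f(t) conj(u(t)) dt / 2π`, the squared norm of `L₂(f)`. -/
def normSqL2 (f : ℝ → Matrix (Fin T) (Fin T) ℂ) (u : ℝ → Fin T → ℂ) : ℝ≥0∞ :=
  ENNReal.ofReal (1 / (2 * Real.pi)) *
    ∫⁻ t, ENNReal.ofReal (u t ⬝ᵥ (f t *ᵥ star (u t))).re ∂circ

/-- A finite linear combination of `e^{ikt} χ(e^{-it}) / β(it) δ_l`, `k ≤ -1`
(the coefficient `g k` belongs to the frequency `-(k + 1)`). -/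
def pastPoly (γ : GMIndex r) (g : ℕ →₀ (Fin T → ℂ)) (t : ℝ) : Fin T → ℂ :=
  (chi γ t / beta γ t) • g.sum fun k v => exp (-(I * ((k : ℂ) + 1) * (t : ℂ))) • v

/-- `L₂^{0-}(f)`, the closure in `L₂(f)` of these linear combinations. -/
def L2past (γ : GMIndex r) (f : ℝ → Matrix (Fin T) (Fin T) ℂ) : Set (ℝ → Fin T → ℂ) :=
  {h | (∀ p, AEStronglyMeasurable (fun t => h t p) circ) ∧
    ∀ δ : ℝ, 0 < δ → ∃ g : ℕ →₀ (Fin T → ℂ),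
      normSqL2 f (fun t => h t - pastPoly γ g t) < ENNReal.ofReal δ}

/-- `Δ(h; f)`: the mean square error, under the density `f`, of the estimate with spectral
characteristic `h`. -/
def mse (γ : GMIndex r) (a : ℕ → Fin T → ℂ) (h : ℝ → Fin T → ℂ)
    (f : ℝ → Matrix (Fin T) (Fin T) ℂ) : ℝ≥0∞ :=
  normSqL2 f fun t => (chi γ t / beta γ t) • bFun γ a t - h t

/-- `h` is the spectral characteristic of the optimal estimate under `f`. -/
def IsOptimal (γ : GMIndex r) (a : ℕ → Fin T → ℂ) (f : ℝ → Matrix (Fin T) (Fin T) ℂ)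
    (h : ℝ → Fin T → ℂ) : Prop :=
  h ∈ L2past γ f ∧ ∀ h' ∈ L2past γ f, mse γ a h f ≤ mse γ a h' f

/-- `Δ(f)`: the mean square error of the optimal estimate under `f`. -/
def optMse (γ : GMIndex r) (a : ℕ → Fin T → ℂ) (f : ℝ → Matrix (Fin T) (Fin T) ℂ) : ℝ≥0∞ :=
  ⨅ h ∈ L2past γ f, mse γ a h f

def IsLeastFavorable (γ : GMIndex r) (a : ℕ → Fin T → ℂ)
    (D : Set (ℝ → Matrix (Fin T) (Fin T) ℂ)) (f₀ : ℝ → Matrix (Fin T) (Fin T) ℂ) : Prop :=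
  f₀ ∈ D ∧ ∀ f ∈ D, optMse γ a f ≤ optMse γ a f₀

def IsMinimaxRobust (γ : GMIndex r) (a : ℕ → Fin T → ℂ)
    (D : Set (ℝ → Matrix (Fin T) (Fin T) ℂ)) (h₀ : ℝ → Fin T → ℂ) : Prop :=
  (∀ f ∈ D, h₀ ∈ L2past γ f) ∧
    ∀ h : ℝ → Fin T → ℂ, (∀ f ∈ D, h ∈ L2past γ f) →
      (⨆ f ∈ D, mse γ a h₀ f) ≤ ⨆ f ∈ D, mse γ a h f

/-! ### Stochastic sequences with stationary GM increments -/

/-- The centred vector sequence `ξ` has wide sense stationary GM increments (of the seasons and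
orders of `γ`, for all positive steps) with spectral density `f`. -/
structure HasSpectralDensity {Ω : Type*} [MeasurableSpace Ω] (P : Measure Ω) (γ : GMIndex r)
    (ξ : Fin T → ℤ → Ω → ℂ) (f : ℝ → Matrix (Fin T) (Fin T) ℂ) : Prop where
  memLp : ∀ mu : Fin r → ℕ, (∀ j, 0 < mu j) → ∀ p m,
    MemLp (fun ω => gmInc (γ.withStep mu) (fun k => ξ p k ω) m) 2 P
  mean : ∀ mu : Fin r → ℕ, (∀ j, 0 < mu j) → ∀ p m,
    ∫ ω, gmInc (γ.withStep mu) (fun k => ξ p k ω) m ∂P = 0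
  cov : ∀ mu nu : Fin r → ℕ, (∀ j, 0 < mu j) → (∀ j, 0 < nu j) → ∀ p l (m₀ m : ℤ),
    ∫ ω, gmInc (γ.withStep mu) (fun k => ξ p k ω) (m₀ + m) *
        conj (gmInc (γ.withStep nu) (fun k => ξ l k ω) m₀) ∂P =
      (1 / (2 * (Real.pi : ℂ))) * ∫ t, exp (I * (m : ℂ) * (t : ℂ)) *
        (chi (γ.withStep mu) t * conj (chi (γ.withStep nu) t) / ((‖beta γ t‖ ^ 2 : ℝ) : ℂ)) *
          f t p l ∂circ

/-- `V ξ = ∑_{k=-n(γ)}^{-1} v(k)ᵀ ξ(k)`, `v(k) = ∑_{l=0}^{k+n(γ)} e_γ(l - k) b(l)`: the observed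
initial values (written with `k = -(j + 1)`). -/
def initialV (γ : GMIndex r) (a : ℕ → Fin T → ℂ) (x : Fin T → ℤ → ℂ) : ℂ :=
  ∑ j ∈ Finset.range γ.order,
    (∑ l ∈ Finset.range (γ.order - j), eCoef γ (l + (j + 1)) • bCoef γ a l) ⬝ᵥ
      fun p => x p (-((j : ℤ) + 1))

/-- `A ξ = B χ ξ - V ξ`, `B χ ξ = ∑_{k ≥ 0} b(k)ᵀ χ(ξ(k))`: the functional
`∑_{k ≥ 0} a(k)ᵀ ξ(k)` in terms of the increments and of the initial values. -/
def functionalA (γ : GMIndex r) (a : ℕ → Fin T → ℂ) (x : Fin T → ℤ → ℂ) : ℂ :=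
  (∑' k : ℕ, bCoef γ a k ⬝ᵥ fun p => gmInc γ (x p) (k : ℤ)) - initialV γ a x

/-- A linear estimate of `A ξ` from the observations at `m = -1, -2, …`. -/
def estimateA (γ : GMIndex r) (a : ℕ → Fin T → ℂ) (g : ℕ →₀ (Fin T → ℂ))
    (x : Fin T → ℤ → ℂ) : ℂ :=
  (g.sum fun k v => v ⬝ᵥ fun p => gmInc γ (x p) (-((k : ℤ) + 1))) - initialV γ a x

/-! ### The operator `F` and the spectral characteristic -/

/-- `|β|² / |χ|² (f⁻¹)ᵀ`, the symbol of the Toeplitz operator `F`. -/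
def symbolF (γ : GMIndex r) (f : ℝ → Matrix (Fin T) (Fin T) ℂ) (t : ℝ) :
    Matrix (Fin T) (Fin T) ℂ :=
  (((gain γ t)⁻¹ : ℝ) : ℂ) • ((f t)⁻¹)ᵀ

/-- The matrix entries `F(j, k) = (1 / 2π) ∫ e^{i(k-j)t} |β|² / |χ|² (f⁻¹)ᵀ dt`. -/
def entryF (γ : GMIndex r) (f : ℝ → Matrix (Fin T) (Fin T) ℂ) (j k : ℕ) :
    Matrix (Fin T) (Fin T) ℂ :=
  Matrix.of fun p l => fourierCoef (fun t => symbolF γ f t p l) ((j : ℤ) - (k : ℤ))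

/-- `c = F⁻¹ D a`, `C(t) = ∑_k c(k) e^{ikt}`. The symbol of `F` is integrable but in general
neither bounded nor bounded away from zero, so `F` is an unbounded operator: `(F c)(j)` is the
`j`-th Fourier coefficient of the symbol times `C` (for finite sums this is `∑ k, F(j, k) c(k)`,
see `apply_entryF`), and `c` has to have finite `F`-energy. -/
structure IsFInverse (γ : GMIndex r) (a : ℕ → Fin T → ℂ) (f : ℝ → Matrix (Fin T) (Fin T) ℂ)
    (c : ℕ → Fin T → ℂ) (C : ℝ → Fin T → ℂ) : Prop where
  analytic : IsAnalyticSum c C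
  energy : ∫⁻ t, ENNReal.ofReal (star (C t) ⬝ᵥ (symbolF γ f t *ᵥ C t)).re ∂circ < ∞
  integrable : ∀ p, Integrable (fun t => (symbolF γ f t *ᵥ C t) p) circ
  apply_eq : ∀ p (j : ℕ),
    fourierCoef (fun t => (symbolF γ f t *ᵥ C t) p) (j : ℤ) = bCoef γ a j p

theorem apply_entryF (γ : GMIndex r) (f : ℝ → Matrix (Fin T) (Fin T) ℂ)
    (hf : ∀ p l, Integrable (fun t => symbolF γ f t p l) circ)
    (c : ℕ → Fin T → ℂ) (N j : ℕ) (p : Fin T) :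
    fourierCoef (fun t => (symbolF γ f t *ᵥ
        ∑ k ∈ Finset.range N, exp (I * (k : ℂ) * (t : ℂ)) • c k) p) (j : ℤ) =
      (∑ k ∈ Finset.range N, entryF γ f j k *ᵥ c k) p := by
  have hint : ∀ (l : Fin T) (k : ℕ), Integrable (fun t : ℝ =>
      exp (-(I * (((j : ℤ) - (k : ℤ) : ℤ) : ℂ) * (t : ℂ))) * symbolF γ f t p l) circ := by
    intro l k
    refine (hf p l).bdd_mul (c := 1) ?_ ?_
    · exact Continuous.aestronglyMeasurable (by fun_prop)
    · refine Filter.Eventually.of_forall fun t => ?_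
      have : -(I * (((j : ℤ) - k : ℤ) : ℂ) * (t : ℂ)) =
          ((-(((j : ℤ) - k : ℤ) : ℝ) * t : ℝ) : ℂ) * I := by push_cast; ring
      rw [this, Complex.norm_exp_ofReal_mul_I]
  have key : ∀ t : ℝ, exp (-(I * ((j : ℤ) : ℂ) * (t : ℂ))) * (symbolF γ f t *ᵥ
        ∑ k ∈ Finset.range N, exp (I * (k : ℂ) * (t : ℂ)) • c k) p =
      ∑ k ∈ Finset.range N, ∑ l, exp (-(I * (((j : ℤ) - (k : ℤ) : ℤ) : ℂ) * (t : ℂ))) *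
        symbolF γ f t p l * c k l := by
    intro t
    simp only [Matrix.mulVec, dotProduct, Finset.sum_apply, Pi.smul_apply, smul_eq_mul,
      Finset.mul_sum]
    rw [Finset.sum_comm]
    refine Finset.sum_congr rfl fun k _ => Finset.sum_congr rfl fun l _ => ?_
    have : exp (-(I * (((j : ℤ) - (k : ℤ) : ℤ) : ℂ) * (t : ℂ))) =
        exp (-(I * ((j : ℤ) : ℂ) * (t : ℂ))) * exp (I * (k : ℂ) * (t : ℂ)) := by
      rw [← Complex.exp_add]; congr 1; push_cast; ring
    rw [this]; ring
  have hI : ∫ t, exp (-(I * ((j : ℤ) : ℂ) * (t : ℂ))) * (symbolF γ f t *ᵥ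
        ∑ k ∈ Finset.range N, exp (I * (k : ℂ) * (t : ℂ)) • c k) p ∂circ =
      ∑ k ∈ Finset.range N, ∑ l, ∫ t,
        exp (-(I * (((j : ℤ) - (k : ℤ) : ℤ) : ℂ) * (t : ℂ))) *
          symbolF γ f t p l * c k l ∂circ := by
    rw [integral_congr_ae (Filter.Eventually.of_forall key),
      integral_finsetSum _ fun k _ => integrable_finsetSum _ fun l _ => (hint l k).mul_const _]
    exact Finset.sum_congr rfl fun k _ => integral_finsetSum _ fun l _ => (hint l k).mul_const _
  rw [fourierCoef, hI]
  simp only [Finset.sum_apply, Matrix.mulVec, dotProduct, entryF, Matrix.of_apply, fourierCoef]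
  rw [Finset.mul_sum]
  refine Finset.sum_congr rfl fun k _ => ?_
  rw [Finset.mul_sum]
  refine Finset.sum_congr rfl fun l _ => ?_
  rw [integral_mul_const, mul_assoc]

/-- `h(t)ᵀ = B(e^{it})ᵀ χ(e^{-it}) / β(it) - (conj β(it) / χ(e^{it})) C(t)ᵀ f(t)⁻¹`. -/
def specChar (γ : GMIndex r) (a : ℕ → Fin T → ℂ) (f : ℝ → Matrix (Fin T) (Fin T) ℂ)
    (C : ℝ → Fin T → ℂ) (t : ℝ) : Fin T → ℂ :=
  (chi γ t / beta γ t) • bFun γ a t - (conj (beta γ t) / conj (chi γ t)) • (C t ᵥ* (f t)⁻¹)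

/-- `⟨D a, c⟩`, which for `c = F⁻¹ D a` is `⟨D a, F⁻¹ D a⟩`. -/
def pairing (γ : GMIndex r) (a c : ℕ → Fin T → ℂ) : ℝ :=
  (∑' k, bCoef γ a k ⬝ᵥ star (c k)).re

/-- `f₀`, with `c₀ = F₀⁻¹ D a`, solves the problem `max_{f ∈ D} ⟨D a, F⁻¹ D a⟩` (over the densities
in `D` for which `F` is defined). -/
def SolvesMaxProblem (γ : GMIndex r) (a : ℕ → Fin T → ℂ)
    (D : Set (ℝ → Matrix (Fin T) (Fin T) ℂ)) (c₀ : ℕ → Fin T → ℂ) : Prop :=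
  ∀ f ∈ D, IsMinimal γ f → ∀ c C, IsFInverse γ a f c C → pairing γ a c ≤ pairing γ a c₀

/-! ### Canonical factorization -/

/-- `|χ|² / |β|² f = Φ(e^{-it}) Φ(e^{-it})ᴴ` with `Φ(e^{-it}) = ∑_{k ≥ 0} φ(k) e^{-ikt}` square
integrable; it is canonical: each innovation belongs to the closed span of the present and the past
of the increments. -/
structure IsCanonicalFactorization (γ : GMIndex r) (f : ℝ → Matrix (Fin T) (Fin T) ℂ)
    (φ : ℕ → Matrix (Fin T) (Fin q) ℂ) (Φ : ℝ → Matrix (Fin T) (Fin q) ℂ) : Prop where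
  memLp : ∀ p l, MemLp (fun t => Φ t p l) 2 circ
  coef : ∀ p l (k : ℕ), fourierCoef (fun t => Φ t p l) (-(k : ℤ)) = φ k p l
  coef_pos : ∀ p l (k : ℕ), fourierCoef (fun t => Φ t p l) ((k : ℤ) + 1) = 0
  factor : ∀ᵐ t ∂circ, ((gain γ t : ℝ) : ℂ) • f t = Φ t * (Φ t)ᴴ
  canonical : ∀ (l : Fin q) (δ : ℝ), 0 < δ → ∃ g : ℕ →₀ (Fin T → ℂ),
    ∫⁻ t, ∑ i, ‖((g.sum fun k v => exp (-(I * (k : ℂ) * (t : ℂ))) • v) ᵥ* Φ t) i -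
      (Pi.single l 1 : Fin q → ℂ) i‖ₑ ^ 2 ∂circ < ENNReal.ofReal δ

/-- `(D A φ)_k = ∑_m φ(m)ᵀ ∑_{l ≥ k} d_μ(l - k) a(m + l) = ∑_m φ(m)ᵀ b(m + k)`. -/
def rCoef (γ : GMIndex r) (a : ℕ → Fin T → ℂ) (φ : ℕ → Matrix (Fin T) (Fin q) ℂ) (k : ℕ) :
    Fin q → ℂ :=
  ∑' m, (φ m)ᵀ *ᵥ bCoef γ a (m + k)

/-! ### The four `ε`-contamination classes -/

/-- The four kinds of restrictions with their moments: on the trace, on the diagonal entries, on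
`⟨B₁, f⟩`, and on the whole matrix. -/
inductive ContamClass (T : ℕ) where
  | trace (p : ℝ)
  | diagonal (p : Fin T → ℝ)
  | weighted (B₁ : Matrix (Fin T) (Fin T) ℂ) (p : ℝ)
  | full (P : Matrix (Fin T) (Fin T) ℂ)

/-- `B₁` and `P` are positive definite. -/
def ContamClass.Valid : ContamClass T → Prop
  | .trace _ => True
  | .diagonal _ => True
  | .weighted B₁ _ => B₁.PosDef
  | .full P => P.PosDef

/-- `(1 / 2π) ∫ |χ|² / |β|² u dt`. -/
def moment (γ : GMIndex r) (u : ℝ → ℂ) : ℂ :=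
  (1 / (2 * (Real.pi : ℂ))) * ∫ t, ((gain γ t : ℝ) : ℂ) * u t ∂circ

/-- The classes `D_ε^k`; `⟨B₁, f⟩ = Tr (B₁ f)`. -/
def ContamClass.densities (γ : GMIndex r) (ε : ℝ) (f₁ : ℝ → Matrix (Fin T) (Fin T) ℂ) :
    ContamClass T → Set (ℝ → Matrix (Fin T) (Fin T) ℂ)
  | .trace p => {f | IsSpectralDensity f ∧ (∃ W : ℝ → Matrix (Fin T) (Fin T) ℂ, IsSpectralDensity W ∧ ∀ᵐ t ∂circ,
        (f t).trace = (1 - (ε : ℂ)) * (f₁ t).trace + (ε : ℂ) * (W t).trace) ∧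
      moment γ (fun t => (f t).trace) = p}
  | .diagonal p => {f | IsSpectralDensity f ∧ (∃ W : ℝ → Matrix (Fin T) (Fin T) ℂ, IsSpectralDensity W ∧ ∀ᵐ t ∂circ,
        ∀ k, f t k k = (1 - (ε : ℂ)) * f₁ t k k + (ε : ℂ) * W t k k) ∧
      ∀ k, moment γ (fun t => f t k k) = p k}
  | .weighted B₁ p => {f | IsSpectralDensity f ∧ (∃ W : ℝ → Matrix (Fin T) (Fin T) ℂ, IsSpectralDensity W ∧ ∀ᵐ t ∂circ,
        (B₁ * f t).trace = (1 - (ε : ℂ)) * (B₁ * f₁ t).trace + (ε : ℂ) * (B₁ * W t).trace) ∧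
      moment γ (fun t => (B₁ * f t).trace) = p}
  | .full P => {f | IsSpectralDensity f ∧ (∃ W : ℝ → Matrix (Fin T) (Fin T) ℂ, IsSpectralDensity W ∧ ∀ᵐ t ∂circ,
        f t = (1 - (ε : ℂ)) • f₁ t + (ε : ℂ) • W t) ∧
      ∀ k l, moment γ (fun t => f t k l) = P k l}

/-- The contamination has a non-degenerate moment: the prescribed moment strictly exceeds that
of `(1 - ε) f₁`. -/
def ContamClass.Nondegenerate (γ : GMIndex r) (ε : ℝ) (f₁ : ℝ → Matrix (Fin T) (Fin T) ℂ) :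
    ContamClass T → Prop
  | .trace p => (1 - ε) * (moment γ fun t => (f₁ t).trace).re < p
  | .diagonal p => ∀ k, (1 - ε) * (moment γ fun t => f₁ t k k).re < p k
  | .weighted B₁ p => (1 - ε) * (moment γ fun t => (B₁ * f₁ t).trace).re < p
  | .full P =>
      (P - (1 - (ε : ℂ)) • Matrix.of fun k l => moment γ fun t => f₁ t k l).PosDef

/-- The matrix function `X` has the form of the multiplier in the equation for the class:
`(α² + γ₁) I`, `diag (α_k² + γ_k)`, `(α² + γ₁') B₁ᵀ` and `A + Γ`, with the sign and slackness
conditions. In the last case the slackness condition gives `Γ = 0` wherever `f₀ - (1 - ε) f₁` is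
positive definite, and `A` has the form `α α*` as soon as this happens on a set of positive
measure. -/
def ContamClass.IsMultiplier (ε : ℝ) (f₁ f₀ X : ℝ → Matrix (Fin T) (Fin T) ℂ) :
    ContamClass T → Prop
  | .trace _ => ∃ (α : ℝ) (η : ℝ → ℝ), ∀ᵐ t ∂circ, η t ≤ 0 ∧
      ((1 - ε) * (f₁ t).trace.re < (f₀ t).trace.re → η t = 0) ∧
      X t = ((α ^ 2 + η t : ℝ) : ℂ) • (1 : Matrix (Fin T) (Fin T) ℂ)
  | .diagonal _ => ∃ (α : Fin T → ℝ) (η : Fin T → ℝ → ℝ), ∀ᵐ t ∂circ,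
      (∀ k, η k t ≤ 0 ∧ ((1 - ε) * (f₁ t k k).re < (f₀ t k k).re → η k t = 0)) ∧
      X t = Matrix.diagonal fun k => ((α k ^ 2 + η k t : ℝ) : ℂ)
  | .weighted B₁ _ => ∃ (α : ℝ) (η : ℝ → ℝ), ∀ᵐ t ∂circ, η t ≤ 0 ∧
      ((1 - ε) * (B₁ * f₁ t).trace.re < (B₁ * f₀ t).trace.re → η t = 0) ∧
      X t = ((α ^ 2 + η t : ℝ) : ℂ) • B₁ᵀ
  | .full _ => ∃ (A : Matrix (Fin T) (Fin T) ℂ) (Γ : ℝ → Matrix (Fin T) (Fin T) ℂ),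
      A.PosSemidef ∧
      ((∃ᵐ t ∂circ, (f₀ t - (1 - (ε : ℂ)) • f₁ t).PosDef) →
        ∃ α : Fin T → ℂ, A = vecMulVec α (star α)) ∧
      ∀ᵐ t ∂circ, (-Γ t).PosSemidef ∧
        Γ t * (f₀ t - (1 - (ε : ℂ)) • f₁ t)ᵀ = 0 ∧ X t = A + Γ t

/-- `C C* = (|χ|² / |β|² f₀ᵀ) X (|χ|² / |β|² f₀ᵀ)`. -/
def SpectralEquation (γ : GMIndex r) (f₀ X : ℝ → Matrix (Fin T) (Fin T) ℂ)
    (C : ℝ → Fin T → ℂ) : Prop :=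
  ∀ᵐ t ∂circ, vecMulVec (C t) (star (C t)) =
    (((gain γ t : ℝ) : ℂ) • (f₀ t)ᵀ) * X t * (((gain γ t : ℝ) : ℂ) • (f₀ t)ᵀ)

/-- `R R* = Φᵀ X conj Φ`. -/
def FactorizedEquation (Φ : ℝ → Matrix (Fin T) (Fin q) ℂ) (X : ℝ → Matrix (Fin T) (Fin T) ℂ)
    (R : ℝ → Fin q → ℂ) : Prop :=
  ∀ᵐ t ∂circ, vecMulVec (R t) (star (R t)) = (Φ t)ᵀ * X t * (Φ t).map star

end GMForecast

end

/-!
Everything is transported to the weight `g = G f` of the stationary increments, `G = |χ|² / |β|²`: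
multiplication by `χ / β` maps `L₂(g)` isometrically onto `L₂(f)` and takes the closure of the
polynomials with negative frequencies (`InPast`, "the past") onto `L2past`. Thus `Δ(f)` is the
squared distance in `L₂(g)` of the function `bFun` to the past, and an error of a finite estimate is
a squared distance to a polynomial, since the increments are mapped isometrically to exponentials
(`HasSpectralDensity.lintegral_error`).

For a minimal density, the integrability of `Tr g⁻¹` makes `g` control `L¹` (`Coercive`). So
minimizing sequences have subsequences that converge almost everywhere, the residual `w` of the
projection of `bFun` onto the past exists (`exists_residual`), and elements of the past have Fourier
coefficients. Conversely, an integrable element of `L₂(g)` with negative frequencies belongs to the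
past (`InPast.of_fourierCoef`): it becomes bounded after multiplication by squares of scalar outer
functions close to `1`, which are themselves residuals for scalar weights (`exists_outer`).
Orthogonality of `w` to the past says that `C = gᵀ w` has no negative frequencies, and `bFun - w`
having only negative ones is the Toeplitz equation for `C`; hence `c = F⁻¹ D a` exists, is unique,
and gives `Δ(f)` and the optimal characteristic (`IsResidual.isFInverse`, `IsFInverse.isResidual`).

Since the classes are convex, comparing the least favourable `f₀` with its mixtures and passing to
the limit with Fatou's lemma yields a saddle point: the residual `w` under `f₀` has under *every*
`f` in the class, minimal or not, a finite norm, which does not exceed its norm under `f₀`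
(`IsLeastFavorable.nq_le`). Then `bFun - w` is integrable with negative frequencies, hence in the
past for every `f` of the class, and `h⁰` is minimax-robust (`IsLeastFavorable.isMinimaxRobust`).
Mixtures with `f₀` are minimal, so that it is enough to compare with minimal densities
(`isLeastFavorable_iff`).

As `C = gᵀ w` with `gᵀ` invertible, the equation for `C` reads `w w* = X` (`spectralEquation_iff`).
If it holds, `∫ w* (G f)ᵀ w` is the integral of `Tr (G f Xᵀ)`, and the sign and the complementary
slackness of the multiplier make it maximal at `f₀`; the saddle point inequality shows that `f₀` is
least favourable (`nq_le_of_isMultiplier`). Necessity is the converse: `f₀` maximizes the linear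
functional `f ↦ ∫ w* (G f)ᵀ w` over the class. Perturbing `f₀` in the directions that leave the
restricted functionals unchanged determines `w w*` up to a scalar factor, or up to its diagonal
(`ae_qf_eq_zero`), and moving mass concentrates `f₀ - (1 - ε) f₁` on the level where this factor is
largest (`exists_level`). For the matrix restriction, the constant multiplier is a majorant of `w
w*` that is attained on the range of `f₀ - (1 - ε) f₁`; it is found by moving an infinitesimal mass
along a rank one congruence that keeps the moment (`exists_majorant`).

For a canonical factorization `G f₀ = Φ Φ*` one has `R = Φᵀ w`: multiplication by `Φᵀ` takes the
past to functions with negative frequencies, which gives the coefficients `r(k)` of nonnegative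
index, and the negative frequencies vanish because the rows of the identity are limits of
combinations of those of `Φ` (`IsCanonicalFactorization.isAnalyticSum`). Multiplying `R R*` by the
conjugate of `Φ` and by `Φᵀ` leads back to the equation for `C`.
-/

noncomputable section

namespace GMForecast

open MeasureTheory Complex Matrix Filter Topology
open scoped ENNReal ComplexConjugate ComplexOrder

variable {r T q : ℕ}

/-! ### The quadratic form of a weight at a point -/

/-- The sesquilinear form `uᵀ M v̄` of a matrix. -/
def sf (M : Matrix (Fin T) (Fin T) ℂ) (u v : Fin T → ℂ) : ℂ := u ⬝ᵥ (M *ᵥ star v)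

/-- The quadratic form `Re uᵀ M ū` of a matrix. -/
def qf (M : Matrix (Fin T) (Fin T) ℂ) (u : Fin T → ℂ) : ℝ := (sf M u u).re

theorem sf_eq_sum (M : Matrix (Fin T) (Fin T) ℂ) (u v : Fin T → ℂ) :
    sf M u v = ∑ p, ∑ l, u p * (M p l * conj (v l)) := by
  simp [sf, dotProduct, mulVec, Finset.mul_sum]

theorem sf_add_left (M : Matrix (Fin T) (Fin T) ℂ) (u u' v : Fin T → ℂ) :
    sf M (u + u') v = sf M u v + sf M u' v := by
  simp [sf, add_dotProduct]

theorem sf_add_right (M : Matrix (Fin T) (Fin T) ℂ) (u v v' : Fin T → ℂ) :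
    sf M u (v + v') = sf M u v + sf M u v' := by
  simp [sf, mulVec_add, dotProduct_add]

theorem sf_smul_left (M : Matrix (Fin T) (Fin T) ℂ) (z : ℂ) (u v : Fin T → ℂ) :
    sf M (z • u) v = z * sf M u v := by
  simp [sf, smul_dotProduct]

theorem sf_smul_right (M : Matrix (Fin T) (Fin T) ℂ) (z : ℂ) (u v : Fin T → ℂ) :
    sf M u (z • v) = conj z * sf M u v := by
  simp [sf, mulVec_smul, dotProduct_smul]

theorem sf_add_weight (M N : Matrix (Fin T) (Fin T) ℂ) (u v : Fin T → ℂ) :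
    sf (M + N) u v = sf M u v + sf N u v := by
  simp [sf, add_mulVec, dotProduct_add]

theorem sf_smul_weight (z : ℂ) (M : Matrix (Fin T) (Fin T) ℂ) (u v : Fin T → ℂ) :
    sf (z • M) u v = z * sf M u v := by
  simp [sf, smul_mulVec, dotProduct_smul]

theorem sf_conj {M : Matrix (Fin T) (Fin T) ℂ} (hM : M.IsHermitian) (u v : Fin T → ℂ) :
    conj (sf M u v) = sf M v u := by
  rw [sf_eq_sum, sf_eq_sum, Finset.sum_comm, map_sum]
  refine Finset.sum_congr rfl fun p _ => ?_
  rw [map_sum]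
  refine Finset.sum_congr rfl fun l _ => ?_
  have : conj (M l p) = M p l := hM.apply p l
  simp only [map_mul, Complex.conj_conj, this]
  ring

theorem qf_add_smul {M : Matrix (Fin T) (Fin T) ℂ} (hM : M.IsHermitian) (u v : Fin T → ℂ) (z : ℂ) :
    qf M (u + z • v) = qf M u + 2 * (conj z * sf M u v).re + ‖z‖ ^ 2 * qf M v := by
  have h1 : sf M v u = conj (sf M u v) := (sf_conj hM u v).symm
  have h2 : (sf M v v).im = 0 := by
    have := congrArg Complex.im (sf_conj hM v v)
    simp only [Complex.conj_im] at this
    linarith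
  simp only [qf, sf_add_left, sf_add_right, sf_smul_left, sf_smul_right, h1]
  rw [Complex.sq_norm, Complex.normSq_apply]
  simp only [Complex.add_re, Complex.mul_re, Complex.add_im, Complex.conj_re, Complex.conj_im,
    Complex.mul_im, h2]
  ring

theorem qf_smul (M : Matrix (Fin T) (Fin T) ℂ) (z : ℂ) (u : Fin T → ℂ) :
    qf M (z • u) = ‖z‖ ^ 2 * qf M u := by
  rw [qf, sf_smul_left, sf_smul_right, ← mul_assoc, Complex.mul_conj, Complex.normSq_eq_norm_sq,
    Complex.re_ofReal_mul, qf]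

theorem qf_neg (M : Matrix (Fin T) (Fin T) ℂ) (u : Fin T → ℂ) : qf M (-u) = qf M u := by
  have := qf_smul M (-1) u
  simpa using this

theorem qf_zero (M : Matrix (Fin T) (Fin T) ℂ) : qf M 0 = 0 := by simp [qf, sf]

theorem qf_add_weight (M N : Matrix (Fin T) (Fin T) ℂ) (u : Fin T → ℂ) :
    qf (M + N) u = qf M u + qf N u := by
  simp [qf, sf_add_weight]

theorem qf_smul_weight (c : ℝ) (M : Matrix (Fin T) (Fin T) ℂ) (u : Fin T → ℂ) :
    qf ((c : ℂ) • M) u = c * qf M u := by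
  rw [qf, sf_smul_weight, Complex.re_ofReal_mul, qf]

theorem qf_sub_weight (M N : Matrix (Fin T) (Fin T) ℂ) (u : Fin T → ℂ) :
    qf (M - N) u = qf M u - qf N u := by
  have := qf_add_weight M ((-1 : ℝ) • N) u
  rw [sub_eq_add_neg, qf_add_weight]
  have h := qf_smul_weight (-1) N u
  simp only [Complex.ofReal_neg, Complex.ofReal_one, neg_smul, one_smul] at h
  rw [h]; ring

theorem qf_nonneg {M : Matrix (Fin T) (Fin T) ℂ} (hM : M.PosSemidef) (u : Fin T → ℂ) :
    0 ≤ qf M u := by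
  simpa [qf, sf] using hM.re_dotProduct_nonneg (star u)

theorem posSemidef_of_qf {M : Matrix (Fin T) (Fin T) ℂ} (hM : M.IsHermitian)
    (h : ∀ u, 0 ≤ qf M u) : M.PosSemidef := by
  refine Matrix.PosSemidef.of_dotProduct_mulVec_nonneg hM fun x => ?_
  have h1 := h (star x)
  have h2 := congrArg Complex.im (sf_conj hM (star x) (star x))
  simp only [qf, sf, star_star, Complex.conj_im] at h1 h2
  rw [Complex.le_def]
  exact ⟨by simpa using h1, by simp; linarith⟩

theorem qf_parallelogram (M : Matrix (Fin T) (Fin T) ℂ) (u v : Fin T → ℂ) :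
    qf M (u + v) + qf M (u - v) = 2 * qf M u + 2 * qf M v := by
  have h : u - v = u + (-1 : ℂ) • v := by simp [sub_eq_add_neg]
  rw [h]
  simp only [qf, sf_add_left, sf_add_right, sf_smul_left, sf_smul_right]
  simp
  ring

theorem qf_add_le {M : Matrix (Fin T) (Fin T) ℂ} (hM : M.PosSemidef) (u v : Fin T → ℂ) :
    qf M (u + v) ≤ 2 * qf M u + 2 * qf M v := by
  have := qf_parallelogram M u v
  have := qf_nonneg hM (u - v)
  linarith

theorem two_mul_norm_sf_le {M : Matrix (Fin T) (Fin T) ℂ} (hM : M.PosSemidef) (u v : Fin T → ℂ) :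
    2 * ‖sf M u v‖ ≤ qf M u + qf M v := by
  rcases eq_or_ne (sf M u v) 0 with h0 | h0
  · rw [h0]; simpa using add_nonneg (qf_nonneg hM u) (qf_nonneg hM v)
  set s := sf M u v with hs
  have hn : (‖s‖ : ℂ) ≠ 0 := by simpa using h0
  -- the unimodular factor aligning the two vectors
  have h1 := qf_nonneg hM (u + (-(s / ‖s‖)) • v)
  rw [qf_add_smul hM.1, ← hs] at h1
  have h2 : ‖-(s / ‖s‖)‖ = 1 := by
    rw [norm_neg, norm_div, Complex.norm_real, norm_norm, div_self (by simpa using h0)]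
  have h3 : (conj (-(s / ‖s‖)) * s).re = -‖s‖ := by
    have : conj (-(s / ‖s‖)) * s = ((-‖s‖ : ℝ) : ℂ) := by
      rw [map_neg, map_div₀, Complex.conj_ofReal]
      have := Complex.conj_mul' s
      push_cast
      field_simp
      rw [mul_comm, mul_comm s, this]
    rw [this, Complex.ofReal_re]
  rw [h2, h3] at h1
  linarith

/-- A linear functional is controlled by the form of `M` and the form of `M⁻¹`. -/
theorem two_mul_norm_apply_le {M : Matrix (Fin T) (Fin T) ℂ} (hM : M.PosSemidef)
    (hu : IsUnit M.det) (u : Fin T → ℂ) (l : Fin T) :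
    2 * ‖u l‖ ≤ qf M u + (M⁻¹ l l).re := by
  have h := two_mul_norm_sf_le hM u (star (M⁻¹ *ᵥ Pi.single l 1))
  have h1 : M *ᵥ (M⁻¹ *ᵥ Pi.single l 1) = Pi.single l 1 := by
    rw [mulVec_mulVec, mul_nonsing_inv _ hu, one_mulVec]
  have h2 : sf M u (star (M⁻¹ *ᵥ Pi.single l 1)) = u l := by
    rw [sf, star_star, h1, dotProduct_single, mul_one]
  have h3 : qf M (star (M⁻¹ *ᵥ Pi.single l 1)) = (M⁻¹ l l).re := by
    rw [qf, sf, star_star, h1, dotProduct_single, mul_one]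
    simp
  rwa [h2, h3] at h

theorem PosSemidef_diag_re_nonneg {M : Matrix (Fin T) (Fin T) ℂ} (hM : M.PosSemidef) (l : Fin T) :
    0 ≤ (M l l).re := by
  have := qf_nonneg hM (Pi.single l 1)
  simpa [qf, sf, Pi.single_apply, mulVec, dotProduct, apply_ite] using this

theorem diag_re_le_trace {M : Matrix (Fin T) (Fin T) ℂ} (hM : M.PosSemidef) (l : Fin T) :
    (M l l).re ≤ M.trace.re := by
  rw [Matrix.trace, Complex.re_sum]
  exact Finset.single_le_sum (f := fun l => (M l l).re)
    (fun i _ => PosSemidef_diag_re_nonneg hM i) (Finset.mem_univ l)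

theorem qf_single (M : Matrix (Fin T) (Fin T) ℂ) (l : Fin T) (z : ℂ) :
    qf M (Pi.single l z) = ‖z‖ ^ 2 * (M l l).re := by
  have h : (Pi.single l z : Fin T → ℂ) = z • Pi.single l (1 : ℂ) := by
    rw [← Pi.single_smul]; simp
  rw [h, qf_smul]
  congr 1
  simp [qf, sf, Pi.single_apply, mulVec, dotProduct, apply_ite]

open scoped MatrixOrder Matrix.Norms.L2Operator in
/-- The form of a positive semidefinite matrix is bounded by its trace. -/
theorem qf_le_trace {M : Matrix (Fin T) (Fin T) ℂ} (hM : M.PosSemidef) (u : Fin T → ℂ) :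
    qf M u ≤ (∑ l, ‖u l‖ ^ 2) * M.trace.re := by
  obtain ⟨R, hR'⟩ := CStarAlgebra.nonneg_iff_eq_star_mul_self.mp hM.nonneg
  have hR : M = Rᴴ * R := hR'
  have h1 : qf M u = ∑ i, ‖(R *ᵥ star u) i‖ ^ 2 := by
    have : sf M u u = star (R *ᵥ star u) ⬝ᵥ (R *ᵥ star u) := by
      rw [sf, hR, star_mulVec, star_star, ← mulVec_mulVec, dotProduct_mulVec]
    rw [qf, this, dotProduct, Complex.re_sum]
    refine Finset.sum_congr rfl fun i _ => ?_
    simp only [Pi.star_apply, RCLike.star_def]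
    rw [Complex.conj_mul', ← Complex.ofReal_pow, Complex.ofReal_re]
  have h2 : M.trace.re = ∑ i, ∑ l, ‖R i l‖ ^ 2 := by
    rw [hR, Matrix.trace, Complex.re_sum, Finset.sum_comm]
    refine Finset.sum_congr rfl fun l _ => ?_
    rw [Matrix.diag_apply, Matrix.mul_apply, Complex.re_sum]
    refine Finset.sum_congr rfl fun i _ => ?_
    rw [Matrix.conjTranspose_apply, RCLike.star_def, Complex.conj_mul', ← Complex.ofReal_pow,
      Complex.ofReal_re]
  rw [h1, h2, Finset.mul_sum]
  refine Finset.sum_le_sum fun i _ => ?_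
  have h3 : ‖(R *ᵥ star u) i‖ ≤ ∑ l, ‖u l‖ * ‖R i l‖ := by
    have e : (R *ᵥ star u) i = ∑ l, R i l * conj (u l) := by simp [mulVec, dotProduct]
    rw [e]
    refine (norm_sum_le _ _).trans (le_of_eq (Finset.sum_congr rfl fun l _ => ?_))
    rw [norm_mul, mul_comm]; simp
  refine (pow_le_pow_left₀ (norm_nonneg _) h3 2).trans ?_
  exact Finset.sum_mul_sq_le_sq_mul_sq _ _ _

/-! ### The space `L₂(g)` of a matrix weight -/

instance : IsFiniteMeasure circ := by
  unfold circ; infer_instance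

theorem circ_real_univ : circ.real Set.univ = 2 * Real.pi := by
  rw [circ, measureReal_restrict_apply_univ, Real.volume_real_Ioc]
  rw [max_eq_left (by linarith [Real.pi_pos])]; ring

theorem circ_ne_zero : circ ≠ 0 := by
  intro h
  have := circ_real_univ
  rw [h] at this
  simp at this

instance : NeZero circ := ⟨circ_ne_zero⟩

theorem inv_two_pi_nonneg : 0 ≤ 1 / (2 * Real.pi) := by positivity

theorem inv_two_pi_pos : 0 < 1 / (2 * Real.pi) := by positivity

/-- The components of `u` are measurable up to null sets. -/
def MeasV (u : ℝ → Fin T → ℂ) : Prop := ∀ p, AEStronglyMeasurable (fun t => u t p) circ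

/-- `u` belongs to `L₂(g)`. -/
structure MemW (g : ℝ → Matrix (Fin T) (Fin T) ℂ) (u : ℝ → Fin T → ℂ) : Prop where
  meas : MeasV u
  int : Integrable (fun t => qf (g t) (u t)) circ

/-- The squared norm of `L₂(g)` as a real number; it is meaningful on `MemW g`, and `0` where the
integral diverges. -/
def nq (g : ℝ → Matrix (Fin T) (Fin T) ℂ) (u : ℝ → Fin T → ℂ) : ℝ :=
  1 / (2 * Real.pi) * ∫ t, qf (g t) (u t) ∂circ

/-- The inner product of `L₂(g)`, linear in the first argument. -/
def sip (g : ℝ → Matrix (Fin T) (Fin T) ℂ) (u v : ℝ → Fin T → ℂ) : ℂ :=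
  (1 / (2 * Real.pi) : ℝ) * ∫ t, sf (g t) (u t) (v t) ∂circ

theorem MeasV.add {u v : ℝ → Fin T → ℂ} (hu : MeasV u) (hv : MeasV v) :
    MeasV (fun t => u t + v t) := fun p => (hu p).add (hv p)

theorem MeasV.sub {u v : ℝ → Fin T → ℂ} (hu : MeasV u) (hv : MeasV v) :
    MeasV (fun t => u t - v t) := fun p => (hu p).sub (hv p)

theorem MeasV.smul {φ : ℝ → ℂ} {u : ℝ → Fin T → ℂ} (hφ : AEStronglyMeasurable φ circ)
    (hu : MeasV u) : MeasV (fun t => φ t • u t) := fun p => hφ.mul (hu p)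

theorem MeasV.const_smul {u : ℝ → Fin T → ℂ} (hu : MeasV u) (z : ℂ) :
    MeasV (fun t => z • u t) := hu.smul aestronglyMeasurable_const

theorem MeasV.congr {u v : ℝ → Fin T → ℂ} (hu : MeasV u) (h : u =ᵐ[circ] v) : MeasV v :=
  fun p => (hu p).congr (h.mono fun t ht => by simp only [ht])

theorem MeasV.of_continuous {u : ℝ → Fin T → ℂ} (hu : Continuous u) : MeasV u :=
  fun p => ((continuous_apply p).comp hu).aestronglyMeasurable

theorem aestronglyMeasurable_sf {g : ℝ → Matrix (Fin T) (Fin T) ℂ}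
    (hg : ∀ p l, AEStronglyMeasurable (fun t => g t p l) circ) {u v : ℝ → Fin T → ℂ}
    (hu : MeasV u) (hv : MeasV v) :
    AEStronglyMeasurable (fun t => sf (g t) (u t) (v t)) circ := by
  simp only [sf_eq_sum]
  refine Finset.aestronglyMeasurable_fun_sum _ fun p _ =>
    Finset.aestronglyMeasurable_fun_sum _ fun l _ => ?_
  exact (hu p).mul ((hg p l).mul (Complex.continuous_conj.comp_aestronglyMeasurable (hv l)))

theorem IsSpectralDensity.meas {g : ℝ → Matrix (Fin T) (Fin T) ℂ} (hg : IsSpectralDensity g) :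
    ∀ p l, AEStronglyMeasurable (fun t => g t p l) circ := fun p l => (hg.integrable p l).1

theorem aestronglyMeasurable_qf {g : ℝ → Matrix (Fin T) (Fin T) ℂ} (hg : IsSpectralDensity g)
    {u : ℝ → Fin T → ℂ} (hu : MeasV u) :
    AEStronglyMeasurable (fun t => qf (g t) (u t)) circ :=
  Complex.continuous_re.comp_aestronglyMeasurable (aestronglyMeasurable_sf hg.meas hu hu)

theorem IsSpectralDensity.trace_integrable {g : ℝ → Matrix (Fin T) (Fin T) ℂ}
    (hg : IsSpectralDensity g) : Integrable (fun t => (g t).trace.re) circ := by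
  have : (fun t => (g t).trace.re) = fun t => ∑ l, (g t l l).re := by
    ext t; rw [Matrix.trace, Complex.re_sum]; rfl
  rw [this]
  exact integrable_finsetSum _ fun l _ => (hg.integrable l l).re

theorem IsSpectralDensity.add {g k : ℝ → Matrix (Fin T) (Fin T) ℂ} (hg : IsSpectralDensity g)
    (hk : IsSpectralDensity k) : IsSpectralDensity (fun t => g t + k t) where
  posSemidef := by
    filter_upwards [hg.posSemidef, hk.posSemidef] with t h1 h2 using h1.add h2
  integrable p l := (hg.integrable p l).add (hk.integrable p l)

theorem IsSpectralDensity.const_smul {g : ℝ → Matrix (Fin T) (Fin T) ℂ} (hg : IsSpectralDensity g)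
    {c : ℝ} (hc : 0 ≤ c) : IsSpectralDensity (fun t => (c : ℂ) • g t) where
  posSemidef := by
    filter_upwards [hg.posSemidef] with t h1 using h1.smul (by exact_mod_cast hc)
  integrable p l := (hg.integrable p l).const_mul _

section weights

variable {g : ℝ → Matrix (Fin T) (Fin T) ℂ} {u v : ℝ → Fin T → ℂ}

theorem nq_congr (h : u =ᵐ[circ] v) : nq g u = nq g v := by
  rw [nq, nq, integral_congr_ae (h.mono fun t ht => congrArg (qf (g t)) ht)]

theorem MemW.congr (hu : MemW g u) (h : u =ᵐ[circ] v) : MemW g v :=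
  ⟨hu.meas.congr h, hu.int.congr (h.mono fun t ht => by simp only [ht])⟩

theorem nq_nonneg (hg : IsSpectralDensity g) (u : ℝ → Fin T → ℂ) : 0 ≤ nq g u :=
  mul_nonneg inv_two_pi_nonneg
    (integral_nonneg_of_ae (hg.posSemidef.mono fun _ ht => qf_nonneg ht _))

theorem MemW.of_le (hg : IsSpectralDensity g) (hu : MeasV u) {F : ℝ → ℝ}
    (hF : Integrable F circ) (h : ∀ᵐ t ∂circ, qf (g t) (u t) ≤ F t) : MemW g u :=
  ⟨hu, hF.mono' (aestronglyMeasurable_qf hg hu) (by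
    filter_upwards [hg.posSemidef, h] with t h1 h2
    rwa [Real.norm_eq_abs, abs_of_nonneg (qf_nonneg h1 _)])⟩

theorem MemW.add (hg : IsSpectralDensity g) (hu : MemW g u) (hv : MemW g v) :
    MemW g (fun t => u t + v t) :=
  MemW.of_le hg (hu.meas.add hv.meas) ((hu.int.const_mul 2).add (hv.int.const_mul 2))
    (hg.posSemidef.mono fun _ ht => qf_add_le ht _ _)

theorem MemW.const_smul (hu : MemW g u) (z : ℂ) : MemW g (fun t => z • u t) :=
  ⟨hu.meas.const_smul z, by simpa only [qf_smul] using hu.int.const_mul _⟩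

theorem MemW.sub (hg : IsSpectralDensity g) (hu : MemW g u) (hv : MemW g v) :
    MemW g (fun t => u t - v t) := by
  simpa [sub_eq_add_neg] using hu.add hg (hv.const_smul (-1))

theorem integrable_sf (hg : IsSpectralDensity g) (hu : MemW g u) (hv : MemW g v) :
    Integrable (fun t => sf (g t) (u t) (v t)) circ := by
  refine ((hu.int.add hv.int)).mono' (aestronglyMeasurable_sf hg.meas hu.meas hv.meas) ?_
  filter_upwards [hg.posSemidef] with t ht
  have := two_mul_norm_sf_le ht (u t) (v t)
  have := norm_nonneg (sf (g t) (u t) (v t))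
  simp only [Pi.add_apply]
  linarith

theorem nq_add_smul (hg : IsSpectralDensity g) (hu : MemW g u) (hv : MemW g v) (z : ℂ) :
    nq g (fun t => u t + z • v t) =
      nq g u + 2 * (conj z * sip g u v).re + ‖z‖ ^ 2 * nq g v := by
  have h1 : ∫ t, qf (g t) (u t + z • v t) ∂circ = ∫ t, (qf (g t) (u t) +
      2 * (conj z * sf (g t) (u t) (v t)).re) + ‖z‖ ^ 2 * qf (g t) (v t) ∂circ :=
    integral_congr_ae (hg.posSemidef.mono fun t ht => qf_add_smul ht.1 _ _ _)
  have hs := (integrable_sf hg hu hv).const_mul (conj z)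
  have hs' : Integrable (fun t => 2 * (conj z * sf (g t) (u t) (v t)).re) circ := hs.re.const_mul 2
  have hi : Integrable (fun t => qf (g t) (u t) +
      2 * (conj z * sf (g t) (u t) (v t)).re) circ := hu.int.add hs'
  rw [nq, h1, integral_add hi (hv.int.const_mul _), integral_add hu.int hs',
    integral_const_mul, integral_const_mul]
  have h2 : ∫ t, (conj z * sf (g t) (u t) (v t)).re ∂circ =
      (∫ t, conj z * sf (g t) (u t) (v t) ∂circ).re := integral_re hs
  rw [h2, integral_const_mul, nq, nq, sip, mul_left_comm (conj z), Complex.re_ofReal_mul]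
  ring

theorem nq_add (hg : IsSpectralDensity g) (hu : MemW g u) (hv : MemW g v) :
    nq g (fun t => u t + v t) = nq g u + 2 * (sip g u v).re + nq g v := by
  simpa using nq_add_smul hg hu hv 1

theorem nq_const_smul (z : ℂ) : nq g (fun t => z • u t) = ‖z‖ ^ 2 * nq g u := by
  simp only [nq, qf_smul, integral_const_mul]; ring

theorem nq_neg : nq g (fun t => -u t) = nq g u := by
  simp only [nq, qf_neg]

theorem nq_sub_comm : nq g (fun t => u t - v t) = nq g (fun t => v t - u t) := by
  rw [← nq_neg]; simp only [neg_sub]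

theorem nq_parallelogram (hg : IsSpectralDensity g) (hu : MemW g u) (hv : MemW g v) :
    nq g (fun t => u t + v t) + nq g (fun t => u t - v t) = 2 * nq g u + 2 * nq g v := by
  simp only [nq, ← mul_add]
  rw [← integral_add (hu.add hg hv).int (hu.sub hg hv).int]
  simp only [qf_parallelogram]
  rw [integral_add (hu.int.const_mul 2) (hv.int.const_mul 2), integral_const_mul,
    integral_const_mul]
  ring

theorem nq_add_le (hg : IsSpectralDensity g) (hu : MemW g u) (hv : MemW g v) :
    nq g (fun t => u t + v t) ≤ 2 * nq g u + 2 * nq g v := by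
  have := nq_parallelogram hg hu hv
  have := nq_nonneg hg (fun t => u t - v t)
  linarith

theorem two_mul_norm_sip_le (hg : IsSpectralDensity g) (hu : MemW g u) (hv : MemW g v) :
    2 * ‖sip g u v‖ ≤ nq g u + nq g v := by
  have h : 2 * ‖∫ t, sf (g t) (u t) (v t) ∂circ‖ ≤
      ∫ t, (qf (g t) (u t) + qf (g t) (v t)) ∂circ := by
    refine le_trans (mul_le_mul_of_nonneg_left (norm_integral_le_integral_norm _) zero_le_two) ?_
    rw [← integral_const_mul]
    refine integral_mono_ae ((integrable_sf hg hu hv).norm.const_mul 2) (hu.int.add hv.int) ?_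
    filter_upwards [hg.posSemidef] with t ht using two_mul_norm_sf_le ht _ _
  rw [integral_add hu.int hv.int] at h
  rw [sip, norm_mul, Complex.norm_real, Real.norm_of_nonneg inv_two_pi_nonneg, nq, nq]
  have := mul_le_mul_of_nonneg_left h inv_two_pi_nonneg
  linarith

theorem sip_add_right (hg : IsSpectralDensity g) {w : ℝ → Fin T → ℂ} (hu : MemW g u)
    (hv : MemW g v) (hw : MemW g w) :
    sip g w (fun t => u t + v t) = sip g w u + sip g w v := by
  simp only [sip, sf_add_right]
  rw [integral_add (integrable_sf hg hw hu) (integrable_sf hg hw hv)]; ring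

theorem sip_smul_right (z : ℂ) : sip g u (fun t => z • v t) = conj z * sip g u v := by
  simp only [sip, sf_smul_right, integral_const_mul]; ring

theorem sip_self (hg : IsSpectralDensity g) : sip g u u = (nq g u : ℂ) := by
  have h : ∫ t, sf (g t) (u t) (u t) ∂circ = ∫ t, ((qf (g t) (u t) : ℝ) : ℂ) ∂circ := by
    refine integral_congr_ae (hg.posSemidef.mono fun t ht => ?_)
    exact (Complex.conj_eq_iff_re.mp (sf_conj ht.1 _ _)).symm
  rw [sip, h, integral_complex_ofReal, nq]; push_cast; ring

/-- A vector of least norm in its class modulo multiples of `v` is orthogonal to `v`. -/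
theorem sip_eq_zero_of_forall_le (hg : IsSpectralDensity g) (hu : MemW g u) (hv : MemW g v)
    (h : ∀ z : ℂ, nq g u ≤ nq g (fun t => u t + z • v t)) : sip g u v = 0 := by
  by_contra h0
  set s := sip g u v with hs
  have hn : 0 < ‖s‖ := norm_pos_iff.mpr h0
  set N := nq g v with hN
  have hN0 : 0 ≤ N := nq_nonneg hg v
  have h1 := h (((-(1 / (N + 1)) : ℝ) : ℂ) * s)
  rw [nq_add_smul hg hu hv, ← hs, ← hN, map_mul, Complex.conj_ofReal, mul_assoc,
    Complex.re_ofReal_mul, Complex.conj_mul', ← Complex.ofReal_pow, Complex.ofReal_re, norm_mul,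
    Complex.norm_real, Real.norm_eq_abs, abs_neg, abs_of_pos (by positivity)] at h1
  have h2 : (1 / (N + 1)) * N ≤ 1 := by
    rw [one_div, inv_mul_le_iff₀ (by positivity)]; linarith
  have h3 : 0 < 1 / (N + 1) := by positivity
  nlinarith [mul_pos h3 (pow_pos hn 2),
    mul_le_mul_of_nonneg_left h2 (mul_pos h3 (pow_pos hn 2)).le]

/-- On `L₂(g)`, where the defining integral converges, `normSqL2` is `nq`. -/
theorem normSqL2_eq (hg : IsSpectralDensity g) (hu : MemW g u) :
    normSqL2 g u = ENNReal.ofReal (nq g u) := by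
  rw [normSqL2, nq, ENNReal.ofReal_mul inv_two_pi_nonneg,
    ofReal_integral_eq_lintegral_ofReal hu.int (hg.posSemidef.mono fun t ht => qf_nonneg ht _)]
  rfl

theorem MemW.of_normSqL2_lt_top (hg : IsSpectralDensity g) (hu : MeasV u)
    (h : normSqL2 g u < ∞) : MemW g u := by
  refine ⟨hu, aestronglyMeasurable_qf hg hu, ?_⟩
  rw [hasFiniteIntegral_iff_ofReal (hg.posSemidef.mono fun t ht => qf_nonneg ht _)]
  rw [normSqL2] at h
  refine lt_of_le_of_ne le_top fun h' => ?_
  rw [show (fun t => ENNReal.ofReal (u t ⬝ᵥ (g t *ᵥ star (u t))).re) =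
    fun t => ENNReal.ofReal (qf (g t) (u t)) from rfl, h', ENNReal.mul_top] at h
  · exact lt_irrefl _ h
  · simpa using Real.pi_pos

/-- Fatou's lemma in `L₂(g)`. -/
theorem MemW.of_tendsto (hg : IsSpectralDensity g) {U : ℕ → ℝ → Fin T → ℂ}
    (hU : ∀ n, MemW g (U n)) (hlim : ∀ᵐ t ∂circ, Tendsto (fun n => U n t) atTop (𝓝 (u t)))
    {c : ℝ} {b : ℕ → ℝ} (hb : Tendsto b atTop (𝓝 c)) (hle : ∀ n, nq g (U n) ≤ b n) :
    MemW g u ∧ nq g u ≤ c := by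
  have hum : MeasV u := fun p => aestronglyMeasurable_of_tendsto_ae atTop
    (fun n => (hU n).meas p) (hlim.mono fun t ht => (tendsto_pi_nhds.mp ht) p)
  have hc : 0 ≤ c := ge_of_tendsto' hb fun n => (nq_nonneg hg _).trans (hle n)
  have h1 : normSqL2 g u ≤ ENNReal.ofReal c := by
    have hF : ∫⁻ t, ENNReal.ofReal (qf (g t) (u t)) ∂circ ≤
        liminf (fun n => ∫⁻ t, ENNReal.ofReal (qf (g t) (U n t)) ∂circ) atTop := by
      refine le_trans (le_of_eq ?_) (lintegral_liminf_le' fun n =>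
        (aestronglyMeasurable_qf hg (hU n).meas).aemeasurable.ennreal_ofReal)
      refine lintegral_congr_ae (hlim.mono fun t ht => ?_)
      refine (Tendsto.liminf_eq ?_).symm
      refine (ENNReal.continuous_ofReal.tendsto _).comp ?_
      simp only [qf, sf_eq_sum]
      refine (Complex.continuous_re.tendsto _).comp ?_
      refine tendsto_finsetSum _ fun p _ => tendsto_finsetSum _ fun l _ => ?_
      refine ((tendsto_pi_nhds.mp ht) p).mul (tendsto_const_nhds.mul ?_)
      exact (Complex.continuous_conj.tendsto _).comp ((tendsto_pi_nhds.mp ht) l)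
    have h2 : ∀ n, ∫⁻ t, ENNReal.ofReal (qf (g t) (U n t)) ∂circ ≤
        ENNReal.ofReal (2 * Real.pi * b n) := by
      intro n
      rw [← ofReal_integral_eq_lintegral_ofReal (hU n).int
        (hg.posSemidef.mono fun t ht => qf_nonneg ht _)]
      refine ENNReal.ofReal_le_ofReal ?_
      have := hle n
      rw [nq, one_div, inv_mul_le_iff₀ (by positivity)] at this
      exact this
    have h3 : Tendsto (fun n => ENNReal.ofReal (2 * Real.pi * b n)) atTop
        (𝓝 (ENNReal.ofReal (2 * Real.pi * c))) :=
      (ENNReal.continuous_ofReal.tendsto _).comp (hb.const_mul _)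
    have h4 : ∫⁻ t, ENNReal.ofReal (qf (g t) (u t)) ∂circ ≤ ENNReal.ofReal (2 * Real.pi * c) := by
      refine hF.trans ?_
      rw [← h3.liminf_eq]
      exact liminf_le_liminf (Eventually.of_forall h2)
    calc normSqL2 g u ≤ ENNReal.ofReal (1 / (2 * Real.pi)) * ENNReal.ofReal (2 * Real.pi * c) :=
          mul_le_mul_right h4 _
      _ = ENNReal.ofReal c := by
          rw [← ENNReal.ofReal_mul inv_two_pi_nonneg]; congr 1; field_simp
  have h2 : MemW g u := MemW.of_normSqL2_lt_top hg hum (h1.trans_lt ENNReal.ofReal_lt_top)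
  refine ⟨h2, ?_⟩
  rw [normSqL2_eq hg h2] at h1
  exact (ENNReal.ofReal_le_ofReal_iff hc).mp h1

/-- Bounded measurable functions belong to `L₂(g)`. -/
theorem MemW.of_bdd (hg : IsSpectralDensity g) (hu : MeasV u) {M : ℝ}
    (hM : ∀ᵐ t ∂circ, ∀ l, ‖u t l‖ ≤ M) : MemW g u := by
  refine MemW.of_le hg hu (hg.trace_integrable.const_mul (∑ _l : Fin T, M ^ 2)) ?_
  filter_upwards [hg.posSemidef, hM] with t h1 h2
  refine (qf_le_trace h1 _).trans (mul_le_mul_of_nonneg_right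
    (Finset.sum_le_sum fun l _ => pow_le_pow_left₀ (norm_nonneg _) (h2 l) 2) ?_)
  rw [Matrix.trace, Complex.re_sum]
  exact Finset.sum_nonneg fun l _ => PosSemidef_diag_re_nonneg h1 l

end weights

theorem nq_add_weight {g k : ℝ → Matrix (Fin T) (Fin T) ℂ} {u : ℝ → Fin T → ℂ}
    (h : MemW g u) (h' : MemW k u) : nq (fun t => g t + k t) u = nq g u + nq k u := by
  simp only [nq, qf_add_weight]
  rw [integral_add h.int h'.int]; ring

theorem MemW.smul_weight {g : ℝ → Matrix (Fin T) (Fin T) ℂ} {u : ℝ → Fin T → ℂ}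
    (h : MemW g u) (c : ℝ) : MemW (fun t => (c : ℂ) • g t) u :=
  ⟨h.meas, by simpa only [qf_smul_weight] using h.int.const_mul c⟩

theorem nq_smul_weight {g : ℝ → Matrix (Fin T) (Fin T) ℂ} {u : ℝ → Fin T → ℂ} (c : ℝ) :
    nq (fun t => (c : ℂ) • g t) u = c * nq g u := by
  simp only [nq, qf_smul_weight, integral_const_mul]; ring

/-! ### Fourier coefficients and Fejér means -/

/-- The exponential `e^{int}`. -/
def ee (n : ℤ) (t : ℝ) : ℂ := exp (I * (n : ℂ) * (t : ℂ))

theorem ee_add (m n : ℤ) (t : ℝ) : ee (m + n) t = ee m t * ee n t := by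
  rw [ee, ee, ee, ← Complex.exp_add]; congr 1; push_cast; ring

theorem ee_zero (t : ℝ) : ee 0 t = 1 := by simp [ee]

theorem conj_ee (n : ℤ) (t : ℝ) : conj (ee n t) = ee (-n) t := by
  rw [ee, ee, ← Complex.exp_conj]; congr 1; simp

theorem norm_ee (n : ℤ) (t : ℝ) : ‖ee n t‖ = 1 := by
  have : I * (n : ℂ) * (t : ℂ) = ((n * t : ℝ) : ℂ) * I := by push_cast; ring
  rw [ee, this, Complex.norm_exp_ofReal_mul_I]

theorem continuous_ee (n : ℤ) : Continuous (ee n) := by unfold ee; fun_prop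

theorem Integrable.ee_mul {u : ℝ → ℂ} (hu : Integrable u circ) (n : ℤ) :
    Integrable (fun t => ee n t * u t) circ :=
  hu.bdd_mul (c := 1) (continuous_ee n).aestronglyMeasurable
    (Eventually.of_forall fun t => (norm_ee n t).le)

theorem integrable_ee (n : ℤ) : Integrable (ee n) circ := by
  simpa using Integrable.ee_mul (integrable_const (1 : ℂ)) n

theorem fourierCoef_eq (u : ℝ → ℂ) (n : ℤ) :
    fourierCoef u n = (1 / (2 * (Real.pi : ℂ))) * ∫ t, ee (-n) t * u t ∂circ := by
  simp only [fourierCoef, ee]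
  congr 3; ext t; congr 2; push_cast; ring

theorem integral_ee (n : ℤ) : ∫ t, ee n t ∂circ = if n = 0 then (2 * Real.pi : ℂ) else 0 := by
  split_ifs with h
  · subst h
    simp only [ee_zero, integral_const, circ_real_univ]; simp
  · rw [circ, ← intervalIntegral.integral_of_le (by linarith [Real.pi_pos])]
    simp only [ee]
    have hc : I * (n : ℂ) ≠ 0 := by simp [h]
    rw [integral_exp_mul_complex hc]
    have : exp (I * n * (Real.pi : ℂ)) = exp (I * n * ((-Real.pi : ℝ) : ℂ)) := by
      rw [Complex.exp_eq_exp_iff_exists_int]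
      exact ⟨n, by push_cast; ring⟩
    rw [this, sub_self, zero_div]

theorem two_pi_ne_zero' : (2 * (Real.pi : ℂ)) ≠ 0 := by
  simp [Real.pi_ne_zero]

theorem fourierCoef_ee (k n : ℤ) : fourierCoef (ee k) n = if n = k then 1 else 0 := by
  rw [fourierCoef_eq]
  simp only [← ee_add, integral_ee]
  have := two_pi_ne_zero'
  rcases eq_or_ne n k with h | h
  · rw [if_pos h, if_pos (by omega)]; field_simp
  · rw [if_neg h, if_neg (by omega), mul_zero]

theorem fourierCoef_congr {u v : ℝ → ℂ} (h : u =ᵐ[circ] v) (n : ℤ) :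
    fourierCoef u n = fourierCoef v n := by
  rw [fourierCoef_eq, fourierCoef_eq]
  congr 1
  exact integral_congr_ae (h.mono fun t ht => by simp only [ht])

theorem fourierCoef_const_mul (u : ℝ → ℂ) (z : ℂ) (n : ℤ) :
    fourierCoef (fun t => z * u t) n = z * fourierCoef u n := by
  simp only [fourierCoef_eq, mul_left_comm _ z, integral_const_mul]

theorem fourierCoef_sub {u v : ℝ → ℂ} (hu : Integrable u circ) (hv : Integrable v circ) (n : ℤ) :
    fourierCoef (fun t => u t - v t) n = fourierCoef u n - fourierCoef v n := by
  simp only [fourierCoef_eq, mul_sub]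
  rw [integral_sub (Integrable.ee_mul hu _) (Integrable.ee_mul hv _), mul_sub]

theorem fourierCoef_finsetSum {ι : Type*} (S : Finset ι) {u : ι → ℝ → ℂ}
    (hu : ∀ i ∈ S, Integrable (u i) circ) (n : ℤ) :
    fourierCoef (fun t => ∑ i ∈ S, u i t) n = ∑ i ∈ S, fourierCoef (u i) n := by
  simp only [fourierCoef_eq, Finset.mul_sum]
  rw [integral_finsetSum _ fun i hi => Integrable.ee_mul (hu i hi) _, Finset.mul_sum]

theorem fourierCoef_ee_mul (u : ℝ → ℂ) (k n : ℤ) :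
    fourierCoef (fun t => ee k t * u t) n = fourierCoef u (n - k) := by
  simp only [fourierCoef_eq, ← mul_assoc, ← ee_add]
  congr 3; ext t; congr 2; ring

theorem norm_fourierCoef_le {u : ℝ → ℂ} (n : ℤ) :
    ‖fourierCoef u n‖ ≤ 1 / (2 * Real.pi) * ∫ t, ‖u t‖ ∂circ := by
  rw [fourierCoef_eq, norm_mul]
  have h1 : ‖(1 / (2 * (Real.pi : ℂ)))‖ = 1 / (2 * Real.pi) := by
    rw [norm_div, norm_mul, Complex.norm_real, Real.norm_of_nonneg Real.pi_pos.le]; simp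
  rw [h1]
  refine mul_le_mul_of_nonneg_left ((norm_integral_le_integral_norm _).trans (le_of_eq ?_))
    inv_two_pi_nonneg
  simp only [norm_mul, norm_ee, one_mul]

theorem fourierCoef_conj (u : ℝ → ℂ) (n : ℤ) :
    fourierCoef (fun t => conj (u t)) n = conj (fourierCoef u (-n)) := by
  have h : conj (1 / (2 * (Real.pi : ℂ))) = 1 / (2 * (Real.pi : ℂ)) := by
    have : (1 / (2 * (Real.pi : ℂ))) = ((1 / (2 * Real.pi) : ℝ) : ℂ) := by push_cast; ring
    rw [this, Complex.conj_ofReal]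
  rw [fourierCoef_eq, fourierCoef_eq, map_mul, ← integral_conj, h]
  simp only [map_mul, conj_ee, neg_neg]

/-- The Fejér mean of order `N`. -/
def fejer (N : ℕ) (u : ℝ → ℂ) (t : ℝ) : ℂ :=
  ∑ j ∈ Finset.range N, ∑ l ∈ Finset.range N,
    (1 / (N : ℂ)) * (fourierCoef u ((j : ℤ) - l) * ee ((j : ℤ) - l) t)

/-- The Fejér kernel times `N`, written as a square. -/
theorem fejerKernel_eq (N : ℕ) (s t : ℝ) :
    ∑ j ∈ Finset.range N, ∑ l ∈ Finset.range N, ee (-((j : ℤ) - l)) s * ee ((j : ℤ) - l) t =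
      ((‖∑ j ∈ Finset.range N, ee (-(j : ℤ)) s * ee j t‖ ^ 2 : ℝ) : ℂ) := by
  rw [Complex.ofReal_pow, ← Complex.mul_conj', map_sum, Finset.sum_mul_sum]
  refine Finset.sum_congr rfl fun j _ => Finset.sum_congr rfl fun l _ => ?_
  rw [map_mul, conj_ee, conj_ee, neg_neg, show -((j : ℤ) - l) = -(j : ℤ) + l by ring, ee_add,
    sub_eq_add_neg, ee_add]
  ring

theorem fejer_eq_integral {u : ℝ → ℂ} (hu : Integrable u circ) (N : ℕ) (t : ℝ) :
    fejer N u t = (1 / (2 * (Real.pi : ℂ))) * (1 / (N : ℂ)) *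
      ∫ s, ((‖∑ j ∈ Finset.range N, ee (-(j : ℤ)) s * ee j t‖ ^ 2 : ℝ) : ℂ) * u s ∂circ := by
  simp only [← fejerKernel_eq, Finset.sum_mul]
  have hi : ∀ j l : ℕ, Integrable (fun s => ee (-((j : ℤ) - l)) s * ee ((j : ℤ) - l) t * u s)
      circ := fun j l => by
    have := (Integrable.ee_mul hu (-((j : ℤ) - l))).const_mul (ee ((j : ℤ) - l) t)
    refine this.congr (Eventually.of_forall fun s => ?_)
    simp only; ring
  rw [integral_finsetSum _ fun j _ => integrable_finsetSum _ fun l _ => hi j l, Finset.mul_sum,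
    fejer]
  refine Finset.sum_congr rfl fun j _ => ?_
  rw [integral_finsetSum _ fun l _ => hi j l, Finset.mul_sum]
  refine Finset.sum_congr rfl fun l _ => ?_
  have : ∫ s, ee (-((j : ℤ) - l)) s * ee ((j : ℤ) - l) t * u s ∂circ =
      ee ((j : ℤ) - l) t * ∫ s, ee (-((j : ℤ) - l)) s * u s ∂circ := by
    rw [← integral_const_mul]; congr 1; ext s; ring
  rw [this, fourierCoef_eq]; ring

theorem integrable_fejerKernel_mul {u : ℝ → ℂ} (hu : Integrable u circ) (N : ℕ) (t : ℝ) :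
    Integrable (fun s => ((‖∑ j ∈ Finset.range N, ee (-(j : ℤ)) s * ee j t‖ ^ 2 : ℝ) : ℂ) * u s)
      circ := by
  refine hu.bdd_mul (c := (N : ℝ) ^ 2) ?_ (Eventually.of_forall fun s => ?_)
  · refine Continuous.aestronglyMeasurable ?_
    have := fun n => continuous_ee n
    fun_prop
  · rw [Complex.norm_real, Real.norm_of_nonneg (by positivity)]
    refine pow_le_pow_left₀ (norm_nonneg _) ((norm_sum_le _ _).trans ?_) 2
    simp [norm_ee]

theorem norm_fejer_le {u : ℝ → ℂ} (hu : Integrable u circ) (N : ℕ) (t : ℝ) :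
    (fejer N (fun s => ((‖u s‖ : ℝ) : ℂ)) t).im = 0 ∧
      ‖fejer N u t‖ ≤ (fejer N (fun s => ((‖u s‖ : ℝ) : ℂ)) t).re := by
  have hu' : Integrable (fun s => ((‖u s‖ : ℝ) : ℂ)) circ := hu.norm.ofReal
  set K : ℝ → ℝ := fun s => ‖∑ j ∈ Finset.range N, ee (-(j : ℤ)) s * ee j t‖ ^ 2 with hK
  have h : fejer N (fun s => ((‖u s‖ : ℝ) : ℂ)) t =
      ((1 / (2 * Real.pi) * (1 / N) * ∫ s, K s * ‖u s‖ ∂circ : ℝ) : ℂ) := by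
    rw [fejer_eq_integral hu']
    push_cast
    rw [← integral_complex_ofReal]
    push_cast [hK]
    rfl
  rw [h, Complex.ofReal_im, Complex.ofReal_re]
  refine ⟨rfl, ?_⟩
  have h1 : ‖(1 / (2 * (Real.pi : ℂ))) * (1 / (N : ℂ))‖ = 1 / (2 * Real.pi) * (1 / N) := by
    have : (1 / (2 * (Real.pi : ℂ))) * (1 / (N : ℂ)) = ((1 / (2 * Real.pi) * (1 / N) : ℝ) : ℂ) := by
      push_cast; ring
    rw [this, Complex.norm_real, Real.norm_of_nonneg (by positivity)]
  rw [fejer_eq_integral hu, norm_mul, h1]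
  refine mul_le_mul_of_nonneg_left ((norm_integral_le_integral_norm _).trans (le_of_eq ?_))
    (by positivity)
  refine integral_congr_ae (Eventually.of_forall fun s => ?_)
  simp only [norm_mul, Complex.norm_real, hK]
  rw [Real.norm_of_nonneg (by positivity)]

theorem integral_fejer {u : ℝ → ℂ} {N : ℕ} (hN : 0 < N) :
    ∫ t, fejer N u t ∂circ = ∫ t, u t ∂circ := by
  simp only [fejer]
  have hi : ∀ j l : ℕ, Integrable (fun t => (1 / (N : ℂ)) * (fourierCoef u ((j : ℤ) - l) *
      ee ((j : ℤ) - l) t)) circ := fun j l => ((integrable_ee _).const_mul _).const_mul _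
  rw [integral_finsetSum _ fun j _ => integrable_finsetSum _ fun l _ => hi j l]
  have : ∀ j ∈ Finset.range N, ∫ t, ∑ l ∈ Finset.range N, (1 / (N : ℂ)) *
      (fourierCoef u ((j : ℤ) - l) * ee ((j : ℤ) - l) t) ∂circ =
        (1 / (N : ℂ)) * ∫ t, u t ∂circ := by
    intro j hj
    rw [integral_finsetSum _ fun l _ => hi j l, Finset.sum_eq_single j]
    · rw [integral_const_mul, integral_const_mul, integral_ee, sub_self, if_pos rfl,
        fourierCoef_eq]
      simp only [neg_zero, ee_zero, one_mul]
      have := two_pi_ne_zero'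
      field_simp
    · intro l _ hl
      rw [integral_const_mul, integral_const_mul, integral_ee, if_neg (by omega)]; simp
    · intro h; exact absurd hj h
  rw [Finset.sum_congr rfl this]
  have : (N : ℂ) ≠ 0 := by exact_mod_cast hN.ne'
  simp only [Finset.sum_const, Finset.card_range, nsmul_eq_mul]
  field_simp

theorem continuous_fejer (N : ℕ) (u : ℝ → ℂ) : Continuous (fejer N u) := by
  unfold fejer
  have := fun n => continuous_ee n
  fun_prop

theorem integrable_fejer (N : ℕ) (u : ℝ → ℂ) : Integrable (fejer N u) circ :=
  integrable_finsetSum _ fun _ _ => integrable_finsetSum _ fun _ _ =>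
    ((integrable_ee _).const_mul _).const_mul _

/-- Fejér means are contractions of `L¹`. -/
theorem integral_norm_fejer_le {u : ℝ → ℂ} (hu : Integrable u circ) {N : ℕ} (hN : 0 < N) :
    ∫ t, ‖fejer N u t‖ ∂circ ≤ ∫ t, ‖u t‖ ∂circ := by
  have h1 : ∫ t, ‖fejer N u t‖ ∂circ ≤ ∫ t, (fejer N (fun s => ((‖u s‖ : ℝ) : ℂ)) t).re ∂circ :=
    integral_mono (integrable_fejer N u).norm (integrable_fejer N _).re
      fun t => (norm_fejer_le hu N t).2
  refine h1.trans (le_of_eq ?_)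
  have h2 : ∫ t, (fejer N (fun s => ((‖u s‖ : ℝ) : ℂ)) t).re ∂circ =
      (∫ t, fejer N (fun s => ((‖u s‖ : ℝ) : ℂ)) t ∂circ).re := integral_re (integrable_fejer N _)
  rw [h2, integral_fejer hN, integral_complex_ofReal, Complex.ofReal_re]

/-- Fejér means are contractions of `L^∞`. -/
theorem norm_fejer_le_of_bdd {u : ℝ → ℂ} (hu : AEStronglyMeasurable u circ) {M : ℝ}
    (hM : ∀ᵐ t ∂circ, ‖u t‖ ≤ M) {N : ℕ} (hN : 0 < N) (t : ℝ) : ‖fejer N u t‖ ≤ M := by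
  have hui : Integrable u circ := (integrable_const M).mono' hu hM
  have hM0 : 0 ≤ M := by
    obtain ⟨s, hs⟩ := hM.exists
    exact (norm_nonneg _).trans hs
  have hone : Integrable (fun _ : ℝ => (1 : ℂ)) circ := integrable_const _
  have hK := (integrable_fejerKernel_mul hone N t).norm
  have h0 : fejer N (fun _ => (1 : ℂ)) t = 1 := by
    have hc : ∀ n : ℤ, fourierCoef (fun _ => (1 : ℂ)) n = if n = 0 then 1 else 0 := by
      intro n
      rw [← fourierCoef_ee 0 n]
      congr 1; ext t; rw [ee_zero]
    rw [fejer, Finset.sum_congr rfl (g := fun _ => 1 / (N : ℂ))]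
    · have : (N : ℂ) ≠ 0 := by exact_mod_cast hN.ne'
      simp [this]
    · intro j hj
      rw [Finset.sum_eq_single j]
      · simp [hc, ee_zero]
      · intro l _ hl
        rw [hc, if_neg (by omega)]; simp
      · intro h; exact absurd hj h
  rw [fejer_eq_integral hone] at h0
  set K : ℝ → ℝ := fun s => ‖∑ j ∈ Finset.range N, ee (-(j : ℤ)) s * ee j t‖ ^ 2 with hKdef
  have hKn : ∀ s, ‖((K s : ℝ) : ℂ)‖ = K s := fun s => by
    rw [Complex.norm_real, Real.norm_of_nonneg (by positivity)]
  have h0' : 1 / (2 * Real.pi) * (1 / N) * ∫ s, K s ∂circ = 1 := by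
    have : ∫ s, ((K s : ℝ) : ℂ) * 1 ∂circ = ((∫ s, K s ∂circ : ℝ) : ℂ) := by
      rw [← integral_complex_ofReal]; simp only [mul_one]
    rw [this] at h0
    apply Complex.ofReal_injective
    refine Eq.trans ?_ (h0.trans Complex.ofReal_one.symm)
    push_cast; ring
  have h1 : ‖(1 / (2 * (Real.pi : ℂ))) * (1 / (N : ℂ))‖ = 1 / (2 * Real.pi) * (1 / N) := by
    have : (1 / (2 * (Real.pi : ℂ))) * (1 / (N : ℂ)) = ((1 / (2 * Real.pi) * (1 / N) : ℝ) : ℂ) := by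
      push_cast; ring
    rw [this, Complex.norm_real, Real.norm_of_nonneg (by positivity)]
  rw [fejer_eq_integral hui, norm_mul, h1]
  have hKi : Integrable K circ := by
    refine hK.congr (Eventually.of_forall fun s => ?_)
    simp only [mul_one]
    exact hKn s
  have h2 : ‖∫ s, ((K s : ℝ) : ℂ) * u s ∂circ‖ ≤ ∫ s, K s * M ∂circ := by
    refine norm_integral_le_of_norm_le (hKi.mul_const M) ?_
    filter_upwards [hM] with s hs
    rw [norm_mul, hKn]
    exact mul_le_mul_of_nonneg_left hs (by positivity)
  refine (mul_le_mul_of_nonneg_left h2 (by positivity)).trans (le_of_eq ?_)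
  rw [integral_mul_const, ← mul_assoc, h0', one_mul]

/-- Trigonometric polynomials are dense in `L¹`. -/
theorem exists_trigPoly_integral_sub_lt {u : ℝ → ℂ} (hu : Integrable u circ) {δ : ℝ}
    (hδ : 0 < δ) : ∃ (S : Finset ℤ) (a : ℤ → ℂ),
      ∫ t, ‖u t - ∑ k ∈ S, a k * ee k t‖ ∂circ < δ := by
  have : Fact (0 < 2 * Real.pi) := ⟨by positivity⟩
  have hcirc : circ = volume.restrict (Set.Ioc (-Real.pi) (-Real.pi + 2 * Real.pi)) := by
    rw [circ]; congr 2; ring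
  have hmp := AddCircle.measurePreserving_mk (2 * Real.pi) (-Real.pi)
  rw [← hcirc] at hmp
  set u' := hu.1.mk u with hu'
  have huu' : u =ᵐ[circ] u' := hu.1.ae_eq_mk
  set U : AddCircle (2 * Real.pi) → ℂ :=
    fun x => u' (AddCircle.measurableEquivIoc (2 * Real.pi) (-Real.pi) x) with hUdef
  have hUm : StronglyMeasurable U := hu.1.stronglyMeasurable_mk.comp_measurable
    (measurable_subtype_coe.comp (AddCircle.measurableEquivIoc (2 * Real.pi) (-Real.pi)).measurable)
  have hUu : ∀ᵐ t : ℝ ∂circ, U (t : AddCircle (2 * Real.pi)) = u t := by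
    have h1 : ∀ᵐ t ∂circ, t ∈ Set.Ioc (-Real.pi) (-Real.pi + 2 * Real.pi) := by
      rw [hcirc]; exact ae_restrict_mem measurableSet_Ioc
    filter_upwards [huu', h1] with t h2 h3
    rw [h2, hUdef]
    simp only
    congr 1
    have := (AddCircle.equivIoc (2 * Real.pi) (-Real.pi)).apply_symm_apply ⟨t, h3⟩
    exact congrArg Subtype.val this
  have hUi : Integrable U volume := by
    rw [← hmp.integrable_comp hUm.aestronglyMeasurable]
    exact hu.congr (hUu.mono fun t ht => ht.symm)
  obtain ⟨G, hG, hGi⟩ := hUi.exists_boundedContinuous_integral_sub_le (half_pos hδ)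
  have hη : 0 < δ / (8 * Real.pi) := by positivity
  have hmem : G.toContinuousMap ∈
      (Submodule.span ℂ (Set.range (@fourier (2 * Real.pi)))).topologicalClosure := by
    rw [span_fourier_closure_eq_top]; trivial
  rw [← SetLike.mem_coe, Submodule.topologicalClosure_coe, Metric.mem_closure_iff] at hmem
  obtain ⟨p, hp, hpd⟩ := hmem _ hη
  rw [SetLike.mem_coe, Finsupp.mem_span_range_iff_exists_finsupp] at hp
  obtain ⟨c, hc⟩ := hp
  refine ⟨c.support, c, ?_⟩
  have hpe : ∀ t : ℝ, p (t : AddCircle (2 * Real.pi)) = ∑ k ∈ c.support, c k * ee k t := by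
    intro t
    rw [← hc, Finsupp.sum, ContinuousMap.sum_apply]
    refine Finset.sum_congr rfl fun k _ => ?_
    rw [ContinuousMap.smul_apply, smul_eq_mul, fourier_coe_apply, ee]
    congr 2
    have := two_pi_ne_zero'
    push_cast
    field_simp
  have h1 : ∫ t, ‖u t - ∑ k ∈ c.support, c k * ee k t‖ ∂circ ≤
      ∫ t, (‖u t - G (t : AddCircle (2 * Real.pi))‖ + δ / (8 * Real.pi)) ∂circ := by
    have hGc : Integrable (fun t : ℝ => G (t : AddCircle (2 * Real.pi))) circ :=
      (hmp.integrable_comp hGi.1).mpr hGi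
    refine integral_mono ?_ ((hu.sub hGc).norm.add (integrable_const _)) fun t => ?_
    · exact (hu.sub (integrable_finsetSum _ fun k _ => (integrable_ee k).const_mul _)).norm
    · simp only
      rw [← hpe t]
      have h2 : ‖G (t : AddCircle (2 * Real.pi)) - p t‖ ≤ δ / (8 * Real.pi) := by
        rw [← dist_eq_norm]
        exact (ContinuousMap.dist_apply_le_dist (f := G.toContinuousMap) _).trans hpd.le
      calc ‖u t - p t‖ = ‖(u t - G (t : AddCircle (2 * Real.pi))) +
            (G (t : AddCircle (2 * Real.pi)) - p t)‖ := by congr 1; ring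
        _ ≤ _ := (norm_add_le _ _).trans (by linarith)
  have hGc : Integrable (fun t : ℝ => G (t : AddCircle (2 * Real.pi))) circ :=
    (hmp.integrable_comp hGi.1).mpr hGi
  have h3 : ∫ t, ‖u t - G (t : AddCircle (2 * Real.pi))‖ ∂circ = ∫ x, ‖U x - G x‖ := by
    rw [← hmp.map_eq, integral_map hmp.measurable.aemeasurable]
    · exact integral_congr_ae (hUu.mono fun t ht => by simp only [ht])
    · rw [hmp.map_eq]; exact (hUi.sub hGi).1.norm
  have h5 : Integrable (fun t : ℝ => ‖u t - G (t : AddCircle (2 * Real.pi))‖) circ :=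
    (hu.sub hGc).norm
  rw [integral_add h5 (integrable_const _), h3, integral_const, circ_real_univ,
    smul_eq_mul] at h1
  have h4 : 2 * Real.pi * (δ / (8 * Real.pi)) = δ / 4 := by
    field_simp; ring
  rw [h4] at h1
  linarith

theorem fejer_sub {u v : ℝ → ℂ} (hu : Integrable u circ) (hv : Integrable v circ) (N : ℕ) (t : ℝ) :
    fejer N (fun t => u t - v t) t = fejer N u t - fejer N v t := by
  simp only [fejer, fourierCoef_sub hu hv, ← Finset.sum_sub_distrib]
  refine Finset.sum_congr rfl fun j _ => Finset.sum_congr rfl fun l _ => ?_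
  ring

theorem fejer_finsetSum (S : Finset ℤ) (a : ℤ → ℂ) (N : ℕ) (t : ℝ) :
    fejer N (fun t => ∑ k ∈ S, a k * ee k t) t = ∑ k ∈ S, a k * fejer N (ee k) t := by
  simp only [fejer, Finset.mul_sum]
  rw [eq_comm, Finset.sum_comm]
  refine Finset.sum_congr rfl fun j _ => ?_
  rw [Finset.sum_comm]
  refine Finset.sum_congr rfl fun l _ => ?_
  rw [fourierCoef_finsetSum S fun k _ => (integrable_ee k).const_mul _, Finset.sum_mul,
    Finset.mul_sum]
  refine Finset.sum_congr rfl fun k (_ : k ∈ S) => ?_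
  rw [fourierCoef_const_mul]; ring

theorem norm_fejer_ee_sub_le (k : ℤ) {N : ℕ} (hN : 0 < N) (t : ℝ) :
    ‖fejer N (ee k) t - ee k t‖ ≤ (k.natAbs : ℝ) / N := by
  have hN' : (0 : ℝ) < N := by exact_mod_cast hN
  set S := (Finset.range N).filter fun j : ℕ => 0 ≤ (j : ℤ) - k ∧ (j : ℤ) - k < N with hS
  have h1 : fejer N (ee k) t = ((S.card : ℝ) / N : ℝ) * ee k t := by
    have : ∀ j ∈ Finset.range N, (∑ l ∈ Finset.range N, (1 / (N : ℂ)) *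
        (fourierCoef (ee k) ((j : ℤ) - l) * ee ((j : ℤ) - l) t)) =
        if 0 ≤ (j : ℤ) - k ∧ (j : ℤ) - k < N then (1 / (N : ℂ)) * ee k t else 0 := by
      intro j _
      split_ifs with h
      · rw [Finset.sum_eq_single ((j : ℤ) - k).toNat]
        · rw [fourierCoef_ee]
          have : (j : ℤ) - (((j : ℤ) - k).toNat : ℤ) = k := by omega
          rw [this, if_pos rfl, one_mul]
        · intro l _ hl
          rw [fourierCoef_ee, if_neg (by omega)]; simp
        · intro hn
          rw [Finset.mem_range] at hn; omega
      · refine Finset.sum_eq_zero fun l hl => ?_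
        rw [Finset.mem_range] at hl
        rw [fourierCoef_ee, if_neg (by omega)]; simp
    rw [fejer, Finset.sum_congr rfl this, ← Finset.sum_filter, ← hS, Finset.sum_const, nsmul_eq_mul]
    push_cast; ring
  have h2 : S.card ≤ N := by
    simpa using Finset.card_filter_le (Finset.range N) _
  have h3 : N ≤ S.card + k.natAbs := by
    have hsub : Finset.range N ⊆ S ∪ ((Finset.range N).filter fun j : ℕ =>
        ¬ (0 ≤ (j : ℤ) - k ∧ (j : ℤ) - k < N)) := by
      rw [hS, Finset.filter_union_filter_not_eq]
    have hc : ((Finset.range N).filter fun j : ℕ =>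
        ¬ (0 ≤ (j : ℤ) - k ∧ (j : ℤ) - k < N)).card ≤ k.natAbs := by
      rcases le_total 0 k with hk | hk
      · calc _ ≤ (Finset.range k.natAbs).card := by
              refine Finset.card_le_card fun j hj => ?_
              simp only [Finset.mem_filter, Finset.mem_range] at hj ⊢
              omega
          _ = _ := Finset.card_range _
      · calc _ ≤ (Finset.Ico (N - k.natAbs) N).card := by
              refine Finset.card_le_card fun j hj => ?_
              simp only [Finset.mem_filter, Finset.mem_range, Finset.mem_Ico] at hj ⊢
              omega
          _ ≤ _ := by rw [Nat.card_Ico]; omega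
    have := (Finset.card_le_card hsub).trans (Finset.card_union_le _ _)
    rw [Finset.card_range] at this
    omega
  have h4 : fejer N (ee k) t - ee k t = (((S.card : ℝ) / N - 1 : ℝ) : ℂ) * ee k t := by
    rw [h1]; push_cast; ring
  rw [h4, norm_mul, norm_ee, mul_one, Complex.norm_real, Real.norm_eq_abs, abs_le]
  have h2' : (S.card : ℝ) ≤ N := by exact_mod_cast h2
  have h3' : (N : ℝ) ≤ S.card + k.natAbs := by exact_mod_cast h3
  have h5 : (S.card : ℝ) / N ≤ 1 := (div_le_one hN').mpr h2'
  have h6 : 1 ≤ (S.card : ℝ) / N + k.natAbs / N := by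
    rw [← add_div, le_div_iff₀ hN']; linarith
  have h7 : 0 ≤ (k.natAbs : ℝ) / N := by positivity
  constructor <;> linarith

/-- Fejér's theorem in `L¹`. -/
theorem tendsto_integral_norm_fejer_sub {u : ℝ → ℂ} (hu : Integrable u circ) :
    Tendsto (fun N => ∫ t, ‖fejer N u t - u t‖ ∂circ) atTop (𝓝 0) := by
  rw [Metric.tendsto_atTop]
  intro δ hδ
  obtain ⟨S, a, hS⟩ := exists_trigPoly_integral_sub_lt hu (δ := δ / 3) (by positivity)
  set p : ℝ → ℂ := fun t => ∑ k ∈ S, a k * ee k t with hp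
  have hpi : Integrable p circ := integrable_finsetSum _ fun k _ => (integrable_ee k).const_mul _
  set A : ℝ := ∑ k ∈ S, ‖a k‖ * k.natAbs with hA
  have hA0 : 0 ≤ A := Finset.sum_nonneg fun k _ => by positivity
  obtain ⟨N₀, hN₀⟩ := exists_nat_gt (2 * Real.pi * A / (δ / 3))
  refine ⟨N₀ + 1, fun N hN => ?_⟩
  have hN1 : 0 < N := by omega
  have hN' : (0 : ℝ) < N := by exact_mod_cast hN1
  have h1 : ∀ t, ‖fejer N p t - p t‖ ≤ A / N := by
    intro t
    rw [hp, fejer_finsetSum, ← Finset.sum_sub_distrib, hA, Finset.sum_div]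
    refine norm_sum_le_of_le _ fun k _ => ?_
    rw [← mul_sub, norm_mul, mul_div_assoc]
    exact mul_le_mul_of_nonneg_left (norm_fejer_ee_sub_le k hN1 t) (norm_nonneg _)
  have h2 : ∫ t, ‖fejer N p t - p t‖ ∂circ < δ / 3 := by
    have : ∫ t, ‖fejer N p t - p t‖ ∂circ ≤ ∫ _t, A / N ∂circ :=
      integral_mono ((integrable_fejer N p).sub hpi).norm (integrable_const _) h1
    rw [integral_const, circ_real_univ, smul_eq_mul] at this
    refine this.trans_lt ?_
    have hN2 : (N₀ : ℝ) < N := by exact_mod_cast hN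
    have := hN₀.trans hN2
    rw [div_lt_iff₀ (by positivity)] at this
    rw [← mul_div_assoc, div_lt_iff₀ hN']
    linarith
  have h3 : ∫ t, ‖fejer N (fun t => u t - p t) t‖ ∂circ ≤ ∫ t, ‖u t - p t‖ ∂circ :=
    integral_norm_fejer_le (hu.sub hpi) hN1
  have i1 : Integrable (fun t => ‖fejer N (fun t => u t - p t) t‖) circ :=
    (integrable_fejer N _).norm
  have i2 : Integrable (fun t => ‖fejer N p t - p t‖) circ := ((integrable_fejer N p).sub hpi).norm
  have i3 : Integrable (fun t => ‖u t - p t‖) circ := (hu.sub hpi).norm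
  have h4 : ∫ t, ‖fejer N u t - u t‖ ∂circ ≤ ∫ t, ((‖fejer N (fun t => u t - p t) t‖ +
      ‖fejer N p t - p t‖) + ‖u t - p t‖) ∂circ := by
    refine integral_mono ((integrable_fejer N u).sub hu).norm ((i1.add i2).add i3) fun t => ?_
    simp only
    rw [fejer_sub hu hpi]
    calc ‖fejer N u t - u t‖ = ‖(fejer N u t - fejer N p t) + (fejer N p t - p t) -
          (u t - p t)‖ := by congr 1; ring
      _ ≤ _ := (norm_sub_le _ _).trans (add_le_add_left (norm_add_le _ _) _)
  have i12 : Integrable (fun t => ‖fejer N (fun t => u t - p t) t‖ + ‖fejer N p t - p t‖) circ :=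
    i1.add i2
  rw [integral_add i12 i3, integral_add i1 i2] at h4
  have hS' : ∫ t, ‖u t - p t‖ ∂circ < δ / 3 := hS
  rw [Real.dist_eq, sub_zero, abs_of_nonneg (integral_nonneg fun t => norm_nonneg _)]
  linarith

/-- An integrable function is determined by its Fourier coefficients. -/
theorem ae_eq_zero_of_fourierCoef {u : ℝ → ℂ} (hu : Integrable u circ)
    (h : ∀ n, fourierCoef u n = 0) : u =ᵐ[circ] 0 := by
  have h1 := tendsto_integral_norm_fejer_sub hu
  have h2 : ∀ N t, fejer N u t = 0 := fun N t => by simp [fejer, h]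
  simp only [h2, zero_sub, norm_neg] at h1
  have h3 := tendsto_nhds_unique h1 tendsto_const_nhds
  rw [eq_comm, integral_eq_zero_iff_of_nonneg (fun t => norm_nonneg _) hu.norm] at h3
  filter_upwards [h3] with t ht
  simpa using ht

/-- Convergence in mean yields almost everywhere convergence along a subsequence. -/
theorem exists_subseq_ae_tendsto {u : ℕ → ℝ → ℂ} {v : ℝ → ℂ} (hu : ∀ n, Integrable (u n) circ)
    (hv : Integrable v circ)
    (h : Tendsto (fun n => ∫ t, ‖u n t - v t‖ ∂circ) atTop (𝓝 0)) :
    ∃ ns : ℕ → ℕ, StrictMono ns ∧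
      ∀ᵐ t ∂circ, Tendsto (fun i => u (ns i) t) atTop (𝓝 (v t)) := by
  refine TendstoInMeasure.exists_seq_tendsto_ae (tendstoInMeasure_of_tendsto_eLpNorm one_ne_zero
    (fun n => (hu n).1) hv.1 ?_)
  have h1 : ∀ n, eLpNorm (u n - v) 1 circ = ENNReal.ofReal (∫ t, ‖u n t - v t‖ ∂circ) := by
    intro n
    rw [eLpNorm_one_eq_lintegral_enorm, ← ofReal_integral_norm_eq_lintegral_enorm ((hu n).sub hv)]
    rfl
  simp only [h1]
  rw [← ENNReal.ofReal_zero]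
  exact (ENNReal.continuous_ofReal.tendsto _).comp h

theorem exists_subseq_fejer {u : ℝ → ℂ} (hu : Integrable u circ) :
    ∃ ns : ℕ → ℕ, StrictMono ns ∧
      ∀ᵐ t ∂circ, Tendsto (fun i => fejer (ns i + 1) u t) atTop (𝓝 (u t)) := by
  have h := (tendsto_add_atTop_iff_nat 1).mpr (tendsto_integral_norm_fejer_sub hu)
  exact exists_subseq_ae_tendsto (u := fun n => fejer (n + 1) u)
    (fun n => integrable_fejer (n + 1) u) hu h

/-- The product of a bounded function with frequencies `≤ 0` and an integrable function with
frequencies `< m` has frequencies `< m`. -/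
theorem fourierCoef_mul_eq_zero {v u : ℝ → ℂ} (hv : AEStronglyMeasurable v circ) {M : ℝ}
    (hM : ∀ᵐ t ∂circ, ‖v t‖ ≤ M) (hu : Integrable u circ)
    (hv0 : ∀ n : ℤ, 0 < n → fourierCoef v n = 0)
    {m : ℤ} (hu0 : ∀ n : ℤ, m ≤ n → fourierCoef u n = 0) {n : ℤ} (hn : m ≤ n) :
    fourierCoef (fun t => v t * u t) n = 0 := by
  have hvi : Integrable v circ := (integrable_const M).mono' hv hM
  obtain ⟨ns, -, hns⟩ := exists_subseq_fejer hvi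
  have h1 : ∀ N : ℕ, ∫ t, ee (-n) t * (fejer N v t * u t) ∂circ = 0 := by
    intro N
    have hi : ∀ j l : ℕ, Integrable (fun t => (1 / (N : ℂ)) * fourierCoef v ((j : ℤ) - l) *
        (ee (-(n - ((j : ℤ) - l))) t * u t)) circ := fun j l => (Integrable.ee_mul hu _).const_mul _
    have he : (fun t => ee (-n) t * (fejer N v t * u t)) = fun t => ∑ j ∈ Finset.range N,
        ∑ l ∈ Finset.range N, (1 / (N : ℂ)) * fourierCoef v ((j : ℤ) - l) *
          (ee (-(n - ((j : ℤ) - l))) t * u t) := by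
      ext t
      rw [fejer, Finset.sum_mul, Finset.mul_sum]
      refine Finset.sum_congr rfl fun j _ => ?_
      rw [Finset.sum_mul, Finset.mul_sum]
      refine Finset.sum_congr rfl fun l _ => ?_
      rw [show -(n - ((j : ℤ) - l)) = -n + ((j : ℤ) - l) by ring, ee_add]; ring
    rw [he, integral_finsetSum _ fun j _ => integrable_finsetSum _ fun l _ => hi j l]
    refine Finset.sum_eq_zero fun j _ => ?_
    rw [integral_finsetSum _ fun l _ => hi j l]
    refine Finset.sum_eq_zero fun l _ => ?_
    rw [integral_const_mul]
    rcases lt_or_ge 0 ((j : ℤ) - l) with h | h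
    · rw [hv0 _ h]; simp
    · have := hu0 (n - ((j : ℤ) - l)) (by omega)
      rw [fourierCoef_eq] at this
      rcases mul_eq_zero.mp this with h' | h'
      · exact absurd h' (by simp [Real.pi_ne_zero])
      · rw [h', mul_zero]
  have h2 : Tendsto (fun i => ∫ t, ee (-n) t * (fejer (ns i + 1) v t * u t) ∂circ) atTop
      (𝓝 (∫ t, ee (-n) t * (v t * u t) ∂circ)) := by
    refine tendsto_integral_of_dominated_convergence (fun t => M * ‖u t‖) (fun i => ?_)
      (hu.norm.const_mul M) (fun i => ?_) ?_
    · exact (continuous_ee _).aestronglyMeasurable.mul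
        ((continuous_fejer _ _).aestronglyMeasurable.mul hu.1)
    · refine Eventually.of_forall fun t => ?_
      rw [norm_mul, norm_ee, one_mul, norm_mul]
      exact mul_le_mul_of_nonneg_right (norm_fejer_le_of_bdd hv hM (Nat.succ_pos _) t)
        (norm_nonneg _)
    · filter_upwards [hns] with t ht
      exact (ht.mul_const _).const_mul _
  simp only [h1] at h2
  have h3 := tendsto_nhds_unique h2 tendsto_const_nhds
  rw [fourierCoef_eq, h3, mul_zero]

/-! ### The past: closures of polynomials with negative frequencies -/

/-- The trigonometric polynomial `∑ k, e^{-i(k+1)t} p(k)`. -/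
def pastTrig (p : ℕ →₀ (Fin T → ℂ)) (t : ℝ) : Fin T → ℂ :=
  p.sum fun k v => exp (-(I * ((k : ℂ) + 1) * (t : ℂ))) • v

theorem pastPoly_eq (γ : GMIndex r) (p : ℕ →₀ (Fin T → ℂ)) (t : ℝ) :
    pastPoly γ p t = (chi γ t / beta γ t) • pastTrig p t := rfl

theorem exp_eq_ee (k : ℕ) (t : ℝ) :
    exp (-(I * ((k : ℂ) + 1) * (t : ℂ))) = ee (-((k : ℤ) + 1)) t := by
  rw [ee]; congr 1; push_cast; ring

theorem pastTrig_add (p p' : ℕ →₀ (Fin T → ℂ)) (t : ℝ) :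
    pastTrig (p + p') t = pastTrig p t + pastTrig p' t :=
  Finsupp.sum_add_index' (fun _ => smul_zero _) (fun _ _ _ => smul_add _ _ _)

theorem pastTrig_smul (z : ℂ) (p : ℕ →₀ (Fin T → ℂ)) (t : ℝ) :
    pastTrig (z • p) t = z • pastTrig p t := by
  rw [pastTrig, Finsupp.sum_smul_index' (fun _ => smul_zero _), pastTrig, Finsupp.smul_sum]
  refine Finset.sum_congr rfl fun k _ => ?_
  simp only
  rw [smul_comm]

theorem pastTrig_zero (t : ℝ) : pastTrig (0 : ℕ →₀ (Fin T → ℂ)) t = 0 := Finsupp.sum_zero_index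

theorem pastTrig_single (k : ℕ) (v : Fin T → ℂ) (t : ℝ) :
    pastTrig (Finsupp.single k v) t = ee (-((k : ℤ) + 1)) t • v := by
  rw [pastTrig, Finsupp.sum_single_index (by exact smul_zero _), exp_eq_ee]

theorem pastTrig_apply (p : ℕ →₀ (Fin T → ℂ)) (t : ℝ) (l : Fin T) :
    pastTrig p t l = ∑ k ∈ p.support, p k l * ee (-((k : ℤ) + 1)) t := by
  rw [pastTrig, Finsupp.sum, Finset.sum_apply]
  refine Finset.sum_congr rfl fun k _ => ?_
  rw [Pi.smul_apply, smul_eq_mul, exp_eq_ee, mul_comm]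

theorem continuous_pastTrig (p : ℕ →₀ (Fin T → ℂ)) : Continuous (pastTrig p) := by
  refine continuous_pi fun l => ?_
  simp only [pastTrig_apply]
  have := fun n => continuous_ee n
  fun_prop

theorem norm_pastTrig_le (p : ℕ →₀ (Fin T → ℂ)) (t : ℝ) (l : Fin T) :
    ‖pastTrig p t l‖ ≤ ∑ k ∈ p.support, ‖p k‖ := by
  rw [pastTrig_apply]
  refine norm_sum_le_of_le _ fun k _ => ?_
  rw [norm_mul, norm_ee, mul_one]
  exact norm_le_pi_norm _ _

theorem memW_pastTrig {g : ℝ → Matrix (Fin T) (Fin T) ℂ} (hg : IsSpectralDensity g)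
    (p : ℕ →₀ (Fin T → ℂ)) : MemW g (pastTrig p) :=
  MemW.of_bdd hg (MeasV.of_continuous (continuous_pastTrig p))
    (Eventually.of_forall fun t l => norm_pastTrig_le p t l)

theorem fourierCoef_pastTrig (p : ℕ →₀ (Fin T → ℂ)) (l : Fin T) {n : ℤ} (hn : 0 ≤ n) :
    fourierCoef (fun t => pastTrig p t l) n = 0 := by
  simp only [pastTrig_apply]
  rw [fourierCoef_finsetSum _ fun k _ => (integrable_ee _).const_mul _]
  refine Finset.sum_eq_zero fun k _ => ?_
  rw [fourierCoef_const_mul, fourierCoef_ee, if_neg (by omega), mul_zero]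

/-- `v` lies in the closure in `L₂(g)` of the polynomials with negative frequencies. -/
structure InPast (g : ℝ → Matrix (Fin T) (Fin T) ℂ) (v : ℝ → Fin T → ℂ) : Prop where
  memW : MemW g v
  approx : ∀ δ : ℝ, 0 < δ → ∃ p : ℕ →₀ (Fin T → ℂ), nq g (fun t => v t - pastTrig p t) < δ

section past

variable {g : ℝ → Matrix (Fin T) (Fin T) ℂ} {u v : ℝ → Fin T → ℂ}

theorem inPast_pastTrig (hg : IsSpectralDensity g) (p : ℕ →₀ (Fin T → ℂ)) :
    InPast g (pastTrig p) :=
  ⟨memW_pastTrig hg p, fun δ hδ => ⟨p, by simpa [nq, qf_zero] using hδ⟩⟩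

theorem InPast.congr (hu : InPast g u) (h : u =ᵐ[circ] v) : InPast g v :=
  ⟨hu.memW.congr h, fun δ hδ => by
    obtain ⟨p, hp⟩ := hu.approx δ hδ
    have h' : (fun t => u t - pastTrig p t) =ᵐ[circ] fun t => v t - pastTrig p t :=
      h.mono fun t ht => by simp only [ht]
    exact ⟨p, (nq_congr h').symm.trans_lt hp⟩⟩

theorem InPast.of_approx (hg : IsSpectralDensity g) (hv : MemW g v)
    (h : ∀ δ : ℝ, 0 < δ → ∃ u, InPast g u ∧ nq g (fun t => v t - u t) < δ) : InPast g v := by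
  refine ⟨hv, fun δ hδ => ?_⟩
  obtain ⟨u, hu, hu'⟩ := h (δ / 4) (by positivity)
  obtain ⟨p, hp⟩ := hu.approx (δ / 4) (by positivity)
  refine ⟨p, ?_⟩
  have h1 := nq_add_le hg (hv.sub hg hu.memW) (hu.memW.sub hg (memW_pastTrig hg p))
  simp only [sub_add_sub_cancel] at h1
  linarith

theorem InPast.add (hg : IsSpectralDensity g) (hu : InPast g u) (hv : InPast g v) :
    InPast g (fun t => u t + v t) := by
  refine ⟨hu.memW.add hg hv.memW, fun δ hδ => ?_⟩
  obtain ⟨p, hp⟩ := hu.approx (δ / 4) (by positivity)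
  obtain ⟨p', hp'⟩ := hv.approx (δ / 4) (by positivity)
  refine ⟨p + p', ?_⟩
  have h1 := nq_add_le hg (hu.memW.sub hg (memW_pastTrig hg p))
    (hv.memW.sub hg (memW_pastTrig hg p'))
  simp only [pastTrig_add]
  have : ∀ t, u t + v t - (pastTrig p t + pastTrig p' t) =
    u t - pastTrig p t + (v t - pastTrig p' t) := fun t => by abel
  simp only [this]
  linarith

theorem InPast.const_smul (hu : InPast g u) (z : ℂ) :
    InPast g (fun t => z • u t) := by
  refine ⟨hu.memW.const_smul z, fun δ hδ => ?_⟩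
  obtain ⟨p, hp⟩ := hu.approx (δ / (‖z‖ ^ 2 + 1)) (by positivity)
  refine ⟨z • p, ?_⟩
  simp only [pastTrig_smul, ← smul_sub]
  rw [nq_const_smul]
  rw [lt_div_iff₀ (by positivity)] at hp
  rcases le_or_gt 0 (nq g fun t => u t - pastTrig p t) with h | h
  · nlinarith
  · nlinarith [mul_nonneg (sq_nonneg ‖z‖) (neg_nonneg.mpr h.le)]

theorem InPast.sub (hg : IsSpectralDensity g) (hu : InPast g u) (hv : InPast g v) :
    InPast g (fun t => u t - v t) := by
  simpa [sub_eq_add_neg] using hu.add hg (hv.const_smul (-1))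

/-- Bounded functions with negative frequencies belong to the past, for every weight. -/
theorem InPast.of_bdd (hg : IsSpectralDensity g) (hv : MeasV v) {M : ℝ}
    (hM : ∀ᵐ t ∂circ, ∀ l, ‖v t l‖ ≤ M)
    (h0 : ∀ l, ∀ n : ℤ, 0 ≤ n → fourierCoef (fun t => v t l) n = 0) : InPast g v := by
  -- it suffices to treat one component at a time
  have key : ∀ l, InPast g (fun t => Pi.single l (v t l)) := by
    intro l
    have hMl : ∀ᵐ t ∂circ, ‖v t l‖ ≤ M := hM.mono fun t ht => ht l
    have hvi : Integrable (fun t => v t l) circ := (integrable_const M).mono' (hv l) hMl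
    obtain ⟨ns, -, hns⟩ := exists_subseq_fejer hvi
    have hmeas : ∀ {φ : ℝ → ℂ}, AEStronglyMeasurable φ circ →
        MeasV (fun t => (Pi.single l (φ t) : Fin T → ℂ)) := by
      intro φ hφ p
      by_cases h : p = l
      · subst h; simpa using hφ
      · simpa [Pi.single_eq_of_ne h] using aestronglyMeasurable_const
    have hmem : MemW g (fun t => Pi.single l (v t l)) := by
      refine MemW.of_bdd hg (hmeas (hv l)) (M := M) (hMl.mono fun t ht p => ?_)
      by_cases h : p = l
      · subst h; simpa using ht
      · simpa [Pi.single_eq_of_ne h] using (norm_nonneg _).trans ht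
    refine ⟨hmem, fun δ hδ => ?_⟩
    -- the Fejér means as polynomials with negative frequencies
    have hpoly : ∀ N : ℕ, ∃ p : ℕ →₀ (Fin T → ℂ), ∀ t, pastTrig p t =
        Pi.single l (fejer N (fun t => v t l) t) := by
      intro N
      have h1 : ∀ S : Finset (ℕ × ℕ), ∃ p : ℕ →₀ (Fin T → ℂ), ∀ t, pastTrig p t =
          Pi.single l (∑ x ∈ S, (1 / (N : ℂ)) * (fourierCoef (fun t => v t l) ((x.1 : ℤ) - x.2) *
            ee ((x.1 : ℤ) - x.2) t)) := by
        intro S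
        induction S using Finset.induction_on with
        | empty => exact ⟨0, fun t => by simp [pastTrig_zero]⟩
        | insert x S hx ih =>
          obtain ⟨p, hp⟩ := ih
          rcases lt_or_ge ((x.1 : ℤ) - x.2) 0 with hneg | hpos
          · refine ⟨Finsupp.single (x.2 - x.1 - 1) (Pi.single l ((1 / (N : ℂ)) *
              fourierCoef (fun t => v t l) ((x.1 : ℤ) - x.2))) + p, fun t => ?_⟩
            rw [pastTrig_add, hp, pastTrig_single, Finset.sum_insert hx, Pi.single_add,
              ← Pi.single_smul]
            congr 2
            have : -(((x.2 - x.1 - 1 : ℕ) : ℤ) + 1) = (x.1 : ℤ) - x.2 := by omega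
            rw [this, smul_eq_mul]; ring
          · refine ⟨p, fun t => ?_⟩
            rw [hp, Finset.sum_insert hx, h0 l _ hpos]; simp
      obtain ⟨p, hp⟩ := h1 (Finset.range N ×ˢ Finset.range N)
      refine ⟨p, fun t => ?_⟩
      rw [hp, Finset.sum_product]; rfl
    have hlim : Tendsto (fun i => ∫ t, qf (g t) (Pi.single l (v t l) -
        Pi.single l (fejer (ns i + 1) (fun t => v t l) t)) ∂circ) atTop
        (𝓝 (∫ _t, (0 : ℝ) ∂circ)) := by
      have he : ∀ i t, qf (g t) (Pi.single l (v t l) -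
          Pi.single l (fejer (ns i + 1) (fun t => v t l) t)) =
          ‖v t l - fejer (ns i + 1) (fun t => v t l) t‖ ^ 2 * (g t l l).re := by
        intro i t
        rw [← Pi.single_sub, qf_single]
      simp only [he]
      refine tendsto_integral_of_dominated_convergence (fun t => (2 * M) ^ 2 * (g t l l).re)
        (fun i => ?_) ((hg.integrable l l).re.const_mul _) (fun i => ?_) ?_
      · exact (((hv l).sub (continuous_fejer _ _).aestronglyMeasurable).norm.pow 2).mul
          (hg.integrable l l).re.1
      · filter_upwards [hg.posSemidef, hMl] with t h1 h2
        rw [norm_mul, Real.norm_of_nonneg (PosSemidef_diag_re_nonneg h1 l),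
          Real.norm_of_nonneg (by positivity)]
        refine mul_le_mul_of_nonneg_right (pow_le_pow_left₀ (norm_nonneg _) ?_ 2)
          (PosSemidef_diag_re_nonneg h1 l)
        have := norm_fejer_le_of_bdd (hv l) hMl (Nat.succ_pos (ns i)) t
        exact (norm_sub_le _ _).trans (by simp only [Nat.succ_eq_add_one] at this; linarith)
      · filter_upwards [hns] with t ht
        have h1 : Tendsto (fun i => ‖v t l - fejer (ns i + 1) (fun t => v t l) t‖ ^ 2 *
            (g t l l).re) atTop (𝓝 (‖v t l - v t l‖ ^ 2 * (g t l l).re)) :=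
          (((ht.const_sub _).norm).pow 2).mul_const _
        simpa using h1
    rw [integral_zero] at hlim
    have hlim' := hlim.const_mul (1 / (2 * Real.pi))
    rw [mul_zero] at hlim'
    obtain ⟨i, hi⟩ := (hlim'.eventually (gt_mem_nhds hδ)).exists
    obtain ⟨p, hp⟩ := hpoly (ns i + 1)
    refine ⟨p, ?_⟩
    simp only [hp]
    exact hi
  have hsum : ∀ S : Finset (Fin T), InPast g (fun t => ∑ l ∈ S, Pi.single l (v t l)) := by
    intro S
    induction S using Finset.induction_on with
    | empty =>
      refine (inPast_pastTrig hg 0).congr (Eventually.of_forall fun t => ?_)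
      simp [pastTrig_zero]
    | insert l S hl ih =>
      simp only [Finset.sum_insert hl]
      exact (key l).add hg ih
  refine (hsum Finset.univ).congr (Eventually.of_forall fun t => ?_)
  simp only
  exact Finset.univ_sum_single (v t)

end past

/-! ### Projection onto the past -/

/-- The weight `g` controls `L¹`: every component of a vector is bounded by the form of `g` up to an
integrable function. This is what the integrability of `Tr g⁻¹` is used for. -/
def Coercive (g : ℝ → Matrix (Fin T) (Fin T) ℂ) : Prop :=
  ∃ K : ℝ → ℝ, Integrable K circ ∧
    ∀ᵐ t ∂circ, ∀ (u : Fin T → ℂ) (l : Fin T), 2 * ‖u l‖ ≤ qf (g t) u + K t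

section residual

variable {g : ℝ → Matrix (Fin T) (Fin T) ℂ} {u v : ℝ → Fin T → ℂ}

theorem Coercive.integrable (hc : Coercive g) (hu : MemW g u) (l : Fin T) :
    Integrable (fun t => u t l) circ := by
  obtain ⟨K, hK, h⟩ := hc
  refine (hu.int.add hK).mono' (hu.meas l) ?_
  filter_upwards [h] with t ht
  have := ht (u t) l
  have := norm_nonneg (u t l)
  simp only [Pi.add_apply]
  linarith

theorem Coercive.exists_bound (hc : Coercive g) : ∃ K₀ : ℝ, 0 ≤ K₀ ∧ ∀ u, MemW g u →
    ∀ (l : Fin T) (η : ℝ), 0 < η → ∫ t, ‖u t l‖ ∂circ ≤ η⁻¹ * (2 * Real.pi * nq g u) + η * K₀ := by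
  have hc' := hc
  obtain ⟨K, hK, h⟩ := hc'
  refine ⟨∫ t, |K t| ∂circ, integral_nonneg fun t => abs_nonneg _, fun u hu l η hη => ?_⟩
  have h1 : ∫ t, ‖u t l‖ ∂circ ≤ ∫ t, (η⁻¹ * qf (g t) (u t) + η * |K t|) ∂circ := by
    refine integral_mono_ae (hc.integrable hu l).norm
      ((hu.int.const_mul _).add (hK.abs.const_mul _)) ?_
    filter_upwards [h] with t ht
    have h2 := ht ((η⁻¹ : ℂ) • u t) l
    rw [qf_smul, Pi.smul_apply, norm_smul] at h2
    have h3 : ‖(η⁻¹ : ℂ)‖ = η⁻¹ := by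
      rw [← Complex.ofReal_inv, Complex.norm_real, Real.norm_of_nonneg (by positivity)]
    rw [h3] at h2
    have h4 : 2 * ‖u t l‖ ≤ η⁻¹ * qf (g t) (u t) + η * K t := by
      have := mul_le_mul_of_nonneg_left h2 hη.le
      calc 2 * ‖u t l‖ = η * (2 * (η⁻¹ * ‖u t l‖)) := by field_simp
        _ ≤ _ := this
        _ = _ := by field_simp
    have h5 : η * K t ≤ η * |K t| := mul_le_mul_of_nonneg_left (le_abs_self _) hη.le
    have := norm_nonneg (u t l)
    linarith
  rw [integral_add (hu.int.const_mul _) (hK.abs.const_mul _), integral_const_mul,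
    integral_const_mul] at h1
  refine h1.trans (le_of_eq ?_)
  rw [nq]; field_simp

theorem nq_add_le_of_pos (hg : IsSpectralDensity g) (hu : MemW g u) (hv : MemW g v) {η : ℝ}
    (hη : 0 < η) : nq g (fun t => u t + v t) ≤ (1 + η) * nq g u + (1 + η⁻¹) * nq g v := by
  have h1 := nq_nonneg hg (fun t => u t + ((-η⁻¹ : ℝ) : ℂ) • v t)
  rw [nq_add_smul hg hu hv, Complex.conj_ofReal, Complex.re_ofReal_mul, Complex.norm_real,
    Real.norm_eq_abs, sq_abs] at h1
  rw [nq_add hg hu hv]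
  have h2 := mul_le_mul_of_nonneg_left h1 hη.le
  have h3 : η * (nq g u + 2 * (-η⁻¹ * (sip g u v).re) + (-η⁻¹) ^ 2 * nq g v) =
      η * nq g u - 2 * (sip g u v).re + η⁻¹ * nq g v := by field_simp; ring
  rw [h3] at h2
  linarith

/-- A lower bound for the distance to polynomials is a lower bound for the distance to the past. -/
theorem InPast.le_nq_sub (hg : IsSpectralDensity g) {B : ℝ → Fin T → ℂ} (hB : MemW g B) {c : ℝ}
    (h : ∀ p, c ≤ nq g (fun t => B t - pastTrig p t)) (hv : InPast g v) :
    c ≤ nq g (fun t => B t - v t) := by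
  set X := nq g (fun t => B t - v t) with hX
  have hX0 : 0 ≤ X := nq_nonneg hg _
  have h1 : ∀ η : ℝ, 0 < η → c ≤ (1 + η) * X + η := by
    intro η hη
    obtain ⟨p, hp⟩ := hv.approx (η / (1 + η⁻¹)) (by positivity)
    have h2 := nq_add_le_of_pos hg (hB.sub hg hv.memW) (hv.memW.sub hg (memW_pastTrig hg p)) hη
    simp only [sub_add_sub_cancel] at h2
    rw [lt_div_iff₀ (by positivity)] at hp
    have := h p
    nlinarith
  refine le_of_forall_pos_le_add fun ε hε => ?_
  have h2 := h1 (ε / (X + 1)) (by positivity)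
  have h3 : ε / (X + 1) * (X + 1) = ε := div_mul_cancel₀ _ (by positivity)
  nlinarith

/-- `w` is the residual of the orthogonal projection of `B` onto the past in `L₂(g)`. -/
structure IsResidual (g : ℝ → Matrix (Fin T) (Fin T) ℂ) (B w : ℝ → Fin T → ℂ) : Prop where
  memW : MemW g w
  inPast : InPast g (fun t => B t - w t)
  orth : ∀ v, InPast g v → sip g w v = 0

/-- Existence of the projection onto the past. Since `g` controls `L¹`, a minimizing sequence of
polynomials converges almost everywhere, so that the minimizer is a genuine function. -/
theorem exists_residual (hg : IsSpectralDensity g) (hc : Coercive g) {B : ℝ → Fin T → ℂ}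
    (hB : MemW g B) : ∃ w, IsResidual g B w := by
  set I := ⨅ p, nq g (fun t => B t - pastTrig p t) with hI
  have hbdd : BddBelow (Set.range fun p => nq g (fun t => B t - pastTrig p t)) :=
    ⟨0, by rintro _ ⟨p, rfl⟩; exact nq_nonneg hg _⟩
  have hIle : ∀ p, I ≤ nq g (fun t => B t - pastTrig p t) := fun p => ciInf_le hbdd p
  have hex : ∀ n : ℕ, ∃ p, nq g (fun t => B t - pastTrig p t) < I + (1 / 4) ^ n := fun n =>
    exists_lt_of_ciInf_lt (lt_add_of_pos_right _ (by positivity))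
  choose p hp using hex
  have hm : ∀ p, MemW g (fun t => B t - pastTrig p t) := fun p => hB.sub hg (memW_pastTrig hg p)
  -- nearly minimal polynomials are close to each other, by the parallelogram identity
  have hcau : ∀ N n m, N ≤ n → N ≤ m →
      nq g (fun t => pastTrig (p n) t - pastTrig (p m) t) ≤ 4 * (1 / 4) ^ N := by
    intro N n m hn hm'
    have h1 := nq_parallelogram hg (hm (p m)) (hm (p n))
    have h2 : ∀ t, B t - pastTrig (p m) t - (B t - pastTrig (p n) t) =
        pastTrig (p n) t - pastTrig (p m) t := fun t => by abel
    have h3 : ∀ t, B t - pastTrig (p m) t + (B t - pastTrig (p n) t) =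
        (2 : ℂ) • (B t - pastTrig ((1 / 2 : ℂ) • (p m + p n)) t) := by
      intro t
      rw [pastTrig_smul, pastTrig_add]
      module
    simp only [h2, h3] at h1
    rw [nq_const_smul] at h1
    have h4 := hIle ((1 / 2 : ℂ) • (p m + p n))
    have h5 : (1 / 4 : ℝ) ^ n ≤ (1 / 4) ^ N := pow_le_pow_of_le_one (by norm_num) (by norm_num) hn
    have h6 : (1 / 4 : ℝ) ^ m ≤ (1 / 4) ^ N := pow_le_pow_of_le_one (by norm_num) (by norm_num) hm'
    have h7 := hp n
    have h8 := hp m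
    have h9 : ‖(2 : ℂ)‖ ^ 2 = 4 := by norm_num
    rw [h9] at h1
    linarith
  -- the `L¹` distances are summable
  have hlim1 : ∀ l, ∀ᵐ t ∂circ, ∃ y, Tendsto (fun n => pastTrig (p n) t l) atTop (𝓝 y) := by
    intro l
    obtain ⟨K₀, hK₀, hK⟩ := hc.exists_bound
    set C := 8 * Real.pi + K₀ + 1 with hC
    refine Lp.ae_tendsto_of_cauchy_eLpNorm (p := 1) (B := fun N => ENNReal.ofReal (C * (1 / 2) ^ N))
      (fun n => ((continuous_apply l).comp (continuous_pastTrig (p n))).aestronglyMeasurable)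
      le_rfl ?_ ?_
    · have hs : Summable fun N : ℕ => C * (1 / 2 : ℝ) ^ N :=
        (summable_geometric_of_lt_one (by norm_num) (by norm_num)).mul_left C
      rw [← ENNReal.ofReal_tsum_of_nonneg (fun N => by positivity) hs]
      exact ENNReal.ofReal_ne_top
    · intro N n m hn hm'
      have hmem := (memW_pastTrig hg (p n)).sub hg (memW_pastTrig hg (p m))
      rw [eLpNorm_one_eq_lintegral_enorm]
      have h1 := ofReal_integral_norm_eq_lintegral_enorm (hc.integrable hmem l)
      refine h1.symm.trans_lt ((ENNReal.ofReal_lt_ofReal_iff (by positivity)).mpr ?_)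
      refine (hK _ hmem l ((1 / 2) ^ N) (by positivity)).trans_lt ?_
      have h2 := hcau N n m hn hm'
      have h3 : ((1 / 2 : ℝ) ^ N)⁻¹ * (2 * Real.pi * (4 * (1 / 4) ^ N)) =
          8 * Real.pi * (1 / 2) ^ N := by
        have : (1 / 4 : ℝ) ^ N = (1 / 2) ^ N * (1 / 2) ^ N := by rw [← mul_pow]; norm_num
        rw [this]; field_simp; ring
      have h4 : ((1 / 2 : ℝ) ^ N)⁻¹ * (2 * Real.pi *
          nq g (fun t => pastTrig (p n) t - pastTrig (p m) t)) ≤ 8 * Real.pi * (1 / 2) ^ N := by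
        rw [← h3]
        exact mul_le_mul_of_nonneg_left (mul_le_mul_of_nonneg_left h2 (by positivity))
          (by positivity)
      have h5 : (0 : ℝ) < (1 / 2) ^ N := by positivity
      refine lt_of_le_of_lt (add_le_add_left h4 _) ?_
      rw [hC]; linarith
  have hlim2 : ∀ᵐ t ∂circ, ∃ y, Tendsto (fun n => pastTrig (p n) t) atTop (𝓝 y) := by
    filter_upwards [ae_all_iff.mpr hlim1] with t ht
    choose y hy using ht
    exact ⟨y, tendsto_pi_nhds.mpr hy⟩
  set v : ℝ → Fin T → ℂ := fun t => limUnder atTop (fun n => pastTrig (p n) t) with hv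
  have hlim : ∀ᵐ t ∂circ, Tendsto (fun n => pastTrig (p n) t) atTop (𝓝 (v t)) :=
    hlim2.mono fun t ht => tendsto_nhds_limUnder ht
  have hpow : Tendsto (fun n : ℕ => (1 / 4 : ℝ) ^ n) atTop (𝓝 0) :=
    tendsto_pow_atTop_nhds_zero_of_lt_one (by norm_num) (by norm_num)
  -- the limit is a minimizer, by Fatou's lemma
  have hw := MemW.of_tendsto (u := fun t => B t - v t) hg (fun n => hm (p n))
    (hlim.mono fun t ht => ht.const_sub _) (c := I) (b := fun n => I + (1 / 4) ^ n)
    (by simpa using hpow.const_add I) (fun n => (hp n).le)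
  have hvm : MemW g v := by
    refine (hB.sub hg hw.1).congr (Eventually.of_forall fun t => ?_)
    simp
  have hvp : InPast g v := by
    refine ⟨hvm, fun δ hδ => ?_⟩
    have h4 : Tendsto (fun n : ℕ => 4 * (1 / 4 : ℝ) ^ n) atTop (𝓝 0) := by
      simpa using hpow.const_mul 4
    obtain ⟨N, hN⟩ := (h4.eventually (gt_mem_nhds hδ)).exists
    refine ⟨p N, lt_of_le_of_lt ?_ hN⟩
    exact (MemW.of_tendsto (u := fun t => v t - pastTrig (p N) t)
      (U := fun n t => pastTrig (p (n + N)) t - pastTrig (p N) t) hg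
      (fun n => (memW_pastTrig hg _).sub hg (memW_pastTrig hg _))
      (hlim.mono fun t ht => (((tendsto_add_atTop_iff_nat N).mpr ht).sub_const _))
      tendsto_const_nhds (fun n => hcau N (n + N) N (by omega) le_rfl)).2
  refine ⟨fun t => B t - v t, hw.1, by simpa using hvp, fun v' hv' => ?_⟩
  refine sip_eq_zero_of_forall_le hg hw.1 hv'.memW fun z => hw.2.trans ?_
  have h1 := InPast.le_nq_sub hg hB hIle (hvp.sub hg (hv'.const_smul z))
  refine h1.trans (le_of_eq ?_)
  congr 1; ext t : 1; abel

/-- Pythagoras: the residual realizes the distance to the past. -/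
theorem IsResidual.nq_sub_eq (hg : IsSpectralDensity g) {B w : ℝ → Fin T → ℂ}
    (hw : IsResidual g B w) (hv : InPast g v) :
    nq g (fun t => B t - v t) = nq g w + nq g (fun t => B t - v t - w t) := by
  have h1 : InPast g (fun t => B t - v t - w t) := by
    refine (hw.inPast.sub hg hv).congr (Eventually.of_forall fun t => ?_)
    simp only; abel
  have h2 := nq_add hg hw.memW h1.memW
  rw [hw.orth _ h1, Complex.zero_re, mul_zero, add_zero] at h2
  rw [← h2]
  congr 1; ext t : 1; abel

/-- Elements of the past have negative frequencies. -/
theorem InPast.fourierCoef_eq_zero (hg : IsSpectralDensity g) (hc : Coercive g) (hv : InPast g v)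
    (l : Fin T) {n : ℤ} (hn : 0 ≤ n) : fourierCoef (fun t => v t l) n = 0 := by
  obtain ⟨K₀, hK₀, hK⟩ := hc.exists_bound
  rw [← norm_le_zero_iff]
  refine le_of_forall_pos_le_add fun ε hε => ?_
  -- the two terms of the `L¹` bound are balanced
  set η := ε / (K₀ + 1) with hη
  have hη0 : 0 < η := by positivity
  obtain ⟨p, hp⟩ := hv.approx (η * ε / (2 * Real.pi)) (by positivity)
  have hm := hv.memW.sub hg (memW_pastTrig hg p)
  have hip : Integrable (fun t => pastTrig p t l) circ := hc.integrable (memW_pastTrig hg p) l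
  have h1 : fourierCoef (fun t => v t l) n =
      fourierCoef (fun t => (v t - pastTrig p t) l) n := by
    simp only [Pi.sub_apply]
    rw [fourierCoef_sub (hc.integrable hv.memW l) hip, fourierCoef_pastTrig p l hn, sub_zero]
  rw [h1, zero_add]
  refine (norm_fourierCoef_le n).trans ?_
  have h2 := hK _ hm l η hη0
  have h3 : η⁻¹ * (2 * Real.pi * nq g (fun t => v t - pastTrig p t)) ≤ ε := by
    rw [lt_div_iff₀ (by positivity)] at hp
    rw [inv_mul_le_iff₀ hη0]; linarith
  have h4 : η * K₀ ≤ ε := by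
    rw [hη, div_mul_eq_mul_div, div_le_iff₀ (by positivity)]
    nlinarith
  have h5 : ∫ t, ‖(v t - pastTrig p t) l‖ ∂circ ≤ 2 * ε := by linarith
  rw [one_div, inv_mul_le_iff₀ (by positivity)]
  have := Real.pi_gt_three
  nlinarith

end residual

/-! ### Outer functions and the description of the past by frequencies -/

/-- A bounded outer function of modulus `(c / (1 + δψ))^{1/2}`, with frequencies `≤ 0`, close to
`1`. It is the residual of the constant `1` with respect to the scalar weight `1 + δψ`. -/
theorem exists_outer {ψ : ℝ → ℝ} (hψ : Integrable ψ circ) (hψ0 : ∀ t, 0 ≤ ψ t) {δ : ℝ}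
    (hδ : 0 < δ) : ∃ (O : ℝ → ℂ) (c : ℝ), AEStronglyMeasurable O circ ∧ 1 ≤ c ∧
      c ≤ 1 + δ * (1 / (2 * Real.pi) * ∫ t, ψ t ∂circ) ∧
      (∀ᵐ t ∂circ, ‖O t‖ ^ 2 * (1 + δ * ψ t) = c) ∧ (∀ n : ℤ, 0 < n → fourierCoef O n = 0) ∧
      1 / (2 * Real.pi) * ∫ t, ‖O t - 1‖ ^ 2 ∂circ ≤ c - 1 := by
  set g : ℝ → Matrix (Fin 1) (Fin 1) ℂ := fun t => Matrix.diagonal fun _ => ((1 + δ * ψ t : ℝ) : ℂ)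
    with hgdef
  have h1 : ∀ t, 1 ≤ 1 + δ * ψ t := fun t => by have := mul_nonneg hδ.le (hψ0 t); linarith
  have hhi : Integrable (fun t => 1 + δ * ψ t) circ := (integrable_const 1).add (hψ.const_mul δ)
  have hg : IsSpectralDensity g := by
    refine ⟨Eventually.of_forall fun t => ?_, fun p l => ?_⟩
    · refine Matrix.PosSemidef.diagonal fun _ => ?_
      simp only [Pi.zero_apply]
      exact_mod_cast (zero_le_one.trans (h1 t))
    · have : p = l := Subsingleton.elim _ _
      subst this
      simpa [hgdef] using hhi.ofReal (𝕜 := ℂ)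
  have hsf : ∀ t u v, sf (g t) u v = ((1 + δ * ψ t : ℝ) : ℂ) * (u 0 * conj (v 0)) := by
    intro t u v
    rw [sf_eq_sum]
    simp [hgdef]; ring
  have hqf : ∀ t u, qf (g t) u = (1 + δ * ψ t) * ‖u 0‖ ^ 2 := by
    intro t u
    rw [qf, hsf, Complex.re_ofReal_mul, Complex.mul_conj', ← Complex.ofReal_pow, Complex.ofReal_re]
  have hc : Coercive g := by
    refine ⟨fun _ => 1, integrable_const _, Eventually.of_forall fun t u l => ?_⟩
    have : l = 0 := Subsingleton.elim _ _
    subst this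
    rw [hqf]
    nlinarith [sq_nonneg (‖u 0‖ - 1), mul_nonneg (sub_nonneg.mpr (h1 t)) (sq_nonneg ‖u 0‖)]
  set B : ℝ → Fin 1 → ℂ := fun _ _ => 1 with hB
  have hBm : MemW g B := MemW.of_bdd hg (MeasV.of_continuous continuous_const) (M := 1)
    (Eventually.of_forall fun t l => by simp [hB])
  obtain ⟨w, hw, hBw, horth⟩ := exists_residual hg hc hBm
  have hwi : Integrable (fun t => w t 0) circ := hc.integrable hw 0
  have hone : ∀ n : ℤ, fourierCoef (fun _ => (1 : ℂ)) n = if n = 0 then 1 else 0 := by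
    intro n
    rw [← fourierCoef_ee 0 n]
    congr 1; ext t; rw [ee_zero]
  have hcoef : ∀ n : ℤ, 0 ≤ n → fourierCoef (fun t => w t 0) n = if n = 0 then 1 else 0 := by
    intro n hn
    have h2 := hBw.fourierCoef_eq_zero hg hc 0 hn
    simp only [Pi.sub_apply, hB] at h2
    rw [fourierCoef_sub (integrable_const _) hwi, hone] at h2
    exact (sub_eq_zero.mp h2).symm
  -- the residual is orthogonal to its own translates in frequency
  have hshift : ∀ k : ℕ, InPast g (fun t => ee (-((k : ℤ) + 1)) t • w t) := by
    intro k
    have hmul : ∀ {u : ℝ → Fin 1 → ℂ}, nq g (fun t => ee (-((k : ℤ) + 1)) t • u t) = nq g u := by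
      intro u; simp only [nq, qf_smul, norm_ee, one_pow, one_mul]
    have hwm : MemW g (fun t => ee (-((k : ℤ) + 1)) t • w t) := by
      refine ⟨hw.meas.smul (continuous_ee _).aestronglyMeasurable, ?_⟩
      simpa only [qf_smul, norm_ee, one_pow, one_mul] using hw.int
    refine InPast.of_approx hg hwm fun ε hε => ?_
    obtain ⟨p, hp⟩ := hBw.approx ε hε
    refine ⟨fun t => ee (-((k : ℤ) + 1)) t • (B t - pastTrig p t), ?_, ?_⟩
    · have hcont : Continuous fun t => B t - pastTrig p t :=
        continuous_const.sub (continuous_pastTrig p)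
      refine InPast.of_bdd hg ((MeasV.of_continuous hcont).smul
        (continuous_ee _).aestronglyMeasurable) (M := 1 + ∑ k ∈ p.support, ‖p k‖)
        (Eventually.of_forall fun t l => ?_) fun l n hn => ?_
      · rw [Pi.smul_apply, norm_smul, norm_ee, one_mul, Pi.sub_apply]
        refine (norm_sub_le _ _).trans (add_le_add ?_ (norm_pastTrig_le p t l))
        simp [hB]
      · simp only [Pi.smul_apply, Pi.sub_apply, smul_eq_mul]
        rw [fourierCoef_ee_mul, fourierCoef_sub (by exact integrable_const _)
          (hc.integrable (memW_pastTrig hg p) l), fourierCoef_pastTrig p l (by omega)]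
        simp only [hB]
        rw [hone, if_neg (by omega), sub_zero]
    · simp only [← smul_sub]
      rw [hmul, nq_sub_comm]
      refine lt_of_eq_of_lt ?_ hp
      congr 1; ext t : 1; abel
  -- hence `(1 + δψ) |w|²` has no frequency except `0`, and is constant
  set F : ℝ → ℂ := fun t => (((1 + δ * ψ t) * ‖w t 0‖ ^ 2 : ℝ) : ℂ) with hF
  have hFi : Integrable F circ := by
    have := hw.int
    simp only [hqf] at this
    exact this.ofReal
  set c := nq g w with hcdef
  have hF0 : fourierCoef F 0 = c := by
    rw [fourierCoef_eq, hcdef, nq]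
    simp only [neg_zero, ee_zero, one_mul, hF, hqf]
    rw [integral_complex_ofReal]; push_cast; ring
  have hFneg : ∀ k : ℕ, fourierCoef F (-((k : ℤ) + 1)) = 0 := by
    intro k
    have h2 := horth _ (hshift k)
    rw [sip, mul_eq_zero] at h2
    rcases h2 with h2 | h2
    · exact absurd h2 (by exact_mod_cast inv_two_pi_pos.ne')
    · rw [fourierCoef_eq]
      have h3 : ∀ t, ee (-(-((k : ℤ) + 1))) t * F t =
          sf (g t) (w t) (ee (-((k : ℤ) + 1)) t • w t) := by
        intro t
        rw [sf_smul_right, conj_ee, hsf, Complex.mul_conj', hF]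
        push_cast; ring
      simp only [h3]
      rw [h2, mul_zero]
  have hFpos : ∀ k : ℕ, fourierCoef F ((k : ℤ) + 1) = 0 := by
    intro k
    have h2 := fourierCoef_conj F ((k : ℤ) + 1)
    rw [hFneg k, map_zero] at h2
    rw [← h2]
    congr 1; ext t; simp only [hF, Complex.conj_ofReal]
  have hFc : F =ᵐ[circ] fun _ => (c : ℂ) := by
    have h2 : (fun t => F t - c) =ᵐ[circ] 0 := by
      refine ae_eq_zero_of_fourierCoef (hFi.sub (integrable_const _)) fun n => ?_
      rw [fourierCoef_sub hFi (integrable_const _)]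
      have h3 : fourierCoef (fun _ => (c : ℂ)) n = if n = 0 then (c : ℂ) else 0 := by
        have := fourierCoef_const_mul (fun _ => (1 : ℂ)) c n
        simp only [mul_one] at this
        rw [this, hone]; simp
      rw [h3]
      obtain ⟨m, hm⟩ := n.eq_nat_or_neg
      rcases Nat.eq_zero_or_pos m with h0 | h0
      · have : n = 0 := by omega
        rw [this, hF0]; simp
      · obtain ⟨k, rfl⟩ : ∃ k, m = k + 1 := ⟨m - 1, by omega⟩
        rw [if_neg (by omega), sub_zero]
        rcases hm with hm | hm
        · rw [hm]; push_cast; exact hFpos k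
        · rw [hm]; push_cast; exact hFneg k
    filter_upwards [h2] with t ht
    exact sub_eq_zero.mp ht
  have hw2 : Integrable (fun t => ‖w t 0‖ ^ 2) circ := by
    refine hw.int.mono' ((hw.meas 0).norm.pow 2) (Eventually.of_forall fun t => ?_)
    rw [Real.norm_of_nonneg (by positivity), hqf]
    nlinarith [mul_nonneg (sub_nonneg.mpr (h1 t)) (sq_nonneg ‖w t 0‖)]
  have hsq : ∀ t, ‖w t 0 - 1‖ ^ 2 = ‖w t 0‖ ^ 2 - 2 * (w t 0).re + 1 := by
    intro t
    rw [Complex.sq_norm, Complex.sq_norm, Complex.normSq_apply, Complex.normSq_apply]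
    simp; ring
  have hre : 1 / (2 * Real.pi) * ∫ t, (w t 0).re ∂circ = 1 := by
    have h2 := hcoef 0 le_rfl
    rw [fourierCoef_eq, if_pos rfl] at h2
    simp only [neg_zero, ee_zero, one_mul] at h2
    have h3 : ∫ t, (w t 0).re ∂circ = (∫ t, w t 0 ∂circ).re := integral_re hwi
    have h4 := congrArg Complex.re h2
    have h5 : (1 / (2 * (Real.pi : ℂ))) = ((1 / (2 * Real.pi) : ℝ) : ℂ) := by push_cast; ring
    rw [h5, Complex.re_ofReal_mul, Complex.one_re] at h4
    rw [h3, h4]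
  have hfin : 1 / (2 * Real.pi) * ∫ t, ‖w t 0 - 1‖ ^ 2 ∂circ =
      1 / (2 * Real.pi) * ∫ t, ‖w t 0‖ ^ 2 ∂circ - 1 := by
    simp only [hsq]
    have i1 : Integrable (fun t => ‖w t 0‖ ^ 2 - 2 * (w t 0).re) circ :=
      hw2.sub (hwi.re.const_mul 2)
    have i2 : Integrable (fun t => 2 * (w t 0).re) circ := hwi.re.const_mul 2
    rw [integral_add i1 (integrable_const _), integral_sub hw2 i2, integral_const_mul,
      integral_const, circ_real_univ, mul_add, mul_sub, mul_left_comm _ 2, hre, smul_eq_mul]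
    field_simp; ring
  have hcle : 1 / (2 * Real.pi) * ∫ t, ‖w t 0‖ ^ 2 ∂circ ≤ c := by
    rw [hcdef, nq]
    refine mul_le_mul_of_nonneg_left (integral_mono hw2 hw.int fun t => ?_) inv_two_pi_nonneg
    simp only [hqf]
    nlinarith [mul_nonneg (sub_nonneg.mpr (h1 t)) (sq_nonneg ‖w t 0‖)]
  have hnn : 0 ≤ 1 / (2 * Real.pi) * ∫ t, ‖w t 0 - 1‖ ^ 2 ∂circ :=
    mul_nonneg inv_two_pi_nonneg (integral_nonneg fun t => by positivity)
  refine ⟨fun t => w t 0, c, hw.meas 0, by linarith, ?_, ?_, fun n hn => ?_, by linarith⟩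
  · have h2 := IsResidual.nq_sub_eq hg ⟨hw, hBw, horth⟩ (inPast_pastTrig hg 0)
    simp only [pastTrig_zero, sub_zero] at h2
    have h3 : nq g B = 1 + δ * (1 / (2 * Real.pi) * ∫ t, ψ t ∂circ) := by
      simp only [nq, hqf, hB]
      simp only [norm_one, one_pow, mul_one]
      rw [integral_add (integrable_const _) (hψ.const_mul _), integral_const, circ_real_univ,
        integral_const_mul, smul_eq_mul]
      field_simp
    have := nq_nonneg hg (fun t => B t - w t)
    rw [← h3, h2]; linarith
  · filter_upwards [hFc] with t ht
    have : (1 + δ * ψ t) * ‖w t 0‖ ^ 2 = c := Complex.ofReal_injective ht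
    rw [mul_comm, this]
  · rw [hcoef n hn.le, if_neg hn.ne']

/-- An integrable element of `L₂(g)` with negative frequencies belongs to the past: multiplication
by the squares of outer functions close to `1` makes it bounded. -/
theorem InPast.of_fourierCoef {g : ℝ → Matrix (Fin T) (Fin T) ℂ} {d : ℝ → Fin T → ℂ}
    (hg : IsSpectralDensity g) (hd : MemW g d) (hdi : ∀ l, Integrable (fun t => d t l) circ)
    (h0 : ∀ l, ∀ n : ℤ, 0 ≤ n → fourierCoef (fun t => d t l) n = 0) : InPast g d := by
  set ψ : ℝ → ℝ := fun t => ∑ l, ‖d t l‖ with hψ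
  have hψi : Integrable ψ circ := integrable_finsetSum _ fun l _ => (hdi l).norm
  have hψ0 : ∀ t, 0 ≤ ψ t := fun t => Finset.sum_nonneg fun l _ => norm_nonneg _
  set m := 1 / (2 * Real.pi) * ∫ t, ψ t ∂circ with hm
  have hm0 : 0 ≤ m := mul_nonneg inv_two_pi_nonneg (integral_nonneg hψ0)
  have hδ : ∀ n : ℕ, (0 : ℝ) < 1 / ((n : ℝ) + 1) := fun n => by positivity
  choose O c hOm hc1 hc2 hOc hO0 hO1 using fun n => exists_outer hψi hψ0 (hδ n)
  have hcM : ∀ n, c n ≤ 1 + m := fun n => (hc2 n).trans (by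
    have : 1 / ((n : ℝ) + 1) * m ≤ 1 * m :=
      mul_le_mul_of_nonneg_right (by
        rw [div_le_one (by positivity)]; linarith [n.cast_nonneg (α := ℝ)])
        hm0
    linarith)
  have hOsq : ∀ n, ∀ᵐ t ∂circ, ‖O n t‖ ^ 2 ≤ 1 + m := fun n => by
    filter_upwards [hOc n] with t ht
    have h1 := mul_nonneg (hδ n).le (hψ0 t)
    have := hcM n
    nlinarith [mul_nonneg (sq_nonneg ‖O n t‖) h1]
  have hOb : ∀ n, ∀ᵐ t ∂circ, ‖O n t‖ ≤ 1 + m := fun n => by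
    filter_upwards [hOsq n] with t ht
    by_contra! h
    nlinarith
  have hOi : ∀ n, Integrable (O n) circ := fun n => (integrable_const _).mono' (hOm n) (hOb n)
  have hconv : Tendsto (fun n => ∫ t, ‖(O n t - 1) ^ 2 - 0‖ ∂circ) atTop (𝓝 0) := by
    have h1 : ∀ n, ∫ t, ‖(O n t - 1) ^ 2 - 0‖ ∂circ ≤ 2 * Real.pi * m * (1 / ((n : ℝ) + 1)) := by
      intro n
      simp only [sub_zero, norm_pow]
      have h2 := hO1 n
      rw [one_div, inv_mul_le_iff₀ (by positivity)] at h2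
      refine h2.trans ?_
      have h3 := hc2 n
      have : c n - 1 ≤ 1 / ((n : ℝ) + 1) * m := by linarith
      have := mul_le_mul_of_nonneg_left this Real.two_pi_pos.le
      linarith
    refine squeeze_zero (fun n => integral_nonneg fun t => norm_nonneg _) h1 ?_
    simpa using (tendsto_one_div_add_atTop_nhds_zero_nat (𝕜 := ℝ)).const_mul (2 * Real.pi * m)
  have hsqb : ∀ n, ∀ᵐ t ∂circ, ‖(O n t - 1) ^ 2‖ ≤ (2 + m) ^ 2 := fun n => by
    filter_upwards [hOb n] with t ht
    rw [norm_pow]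
    refine pow_le_pow_left₀ (norm_nonneg _) ((norm_sub_le _ _).trans ?_) 2
    rw [norm_one]; linarith
  obtain ⟨ns, -, hns⟩ := exists_subseq_ae_tendsto (u := fun n t => (O n t - 1) ^ 2)
    (v := fun _ => 0) (fun n => (integrable_const _).mono'
      (((hOm n).sub aestronglyMeasurable_const).pow 2) (hsqb n)) (integrable_const _) hconv
  have hOlim : ∀ᵐ t ∂circ, Tendsto (fun i => O (ns i) t) atTop (𝓝 1) := by
    filter_upwards [hns] with t ht
    have h1 : Tendsto (fun i => ‖O (ns i) t - 1‖ ^ 2) atTop (𝓝 0) := by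
      simpa using ht.norm
    have h2 : Tendsto (fun i => ‖O (ns i) t - 1‖) atTop (𝓝 0) := by
      have := (Real.continuous_sqrt.tendsto 0).comp h1
      simpa [Function.comp_def, Real.sqrt_sq (norm_nonneg _)] using this
    exact tendsto_iff_norm_sub_tendsto_zero.mpr h2
  -- the square of the modulus of the outer function compensates the growth of `d`
  have hpast : ∀ n, InPast g (fun t => O n t • O n t • d t) := by
    intro n
    refine InPast.of_bdd hg ((hd.meas.smul (hOm n)).smul (hOm n))
      (M := (1 + m) / (1 / ((n : ℝ) + 1))) ?_ fun l k hk => ?_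
    · filter_upwards [hOc n] with t ht l
      simp only [Pi.smul_apply, smul_eq_mul, norm_mul]
      have h1 : ‖d t l‖ ≤ ψ t :=
        Finset.single_le_sum (f := fun l => ‖d t l‖) (fun i _ => norm_nonneg _) (Finset.mem_univ l)
      rw [le_div_iff₀ (hδ n)]
      have h2 : ‖O n t‖ ^ 2 * ‖d t l‖ ≤ ‖O n t‖ ^ 2 * ψ t :=
        mul_le_mul_of_nonneg_left h1 (by positivity)
      have h3 := mul_le_mul_of_nonneg_left h2 (hδ n).le
      have := hcM n
      nlinarith [sq_nonneg ‖O n t‖]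
    · simp only [Pi.smul_apply, smul_eq_mul]
      refine fourierCoef_mul_eq_zero (hOm n) (hOb n) ((hdi l).bdd_mul (hOm n) (hOb n)) (hO0 n)
        (m := 0) (fun j hj => ?_) hk
      exact fourierCoef_mul_eq_zero (hOm n) (hOb n) (hdi l) (hO0 n) (h0 l) hj
  refine InPast.of_approx hg hd fun ε hε => ?_
  have hlim : Tendsto (fun i => ∫ t, qf (g t) (d t - O (ns i) t • O (ns i) t • d t) ∂circ) atTop
      (𝓝 (∫ _t, (0 : ℝ) ∂circ)) := by
    have he : ∀ i t, qf (g t) (d t - O (ns i) t • O (ns i) t • d t) =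
        ‖1 - O (ns i) t * O (ns i) t‖ ^ 2 * qf (g t) (d t) := by
      intro i t
      rw [← qf_smul]; congr 1; module
    simp only [he]
    refine tendsto_integral_of_dominated_convergence
      (fun t => (1 + (1 + m)) ^ 2 * qf (g t) (d t)) (fun i => ?_) (hd.int.const_mul _)
      (fun i => ?_) ?_
    · exact ((aestronglyMeasurable_const.sub ((hOm _).mul (hOm _))).norm.pow 2).mul hd.int.1
    · filter_upwards [hg.posSemidef, hOsq (ns i)] with t h1 h2
      rw [norm_mul, Real.norm_of_nonneg (qf_nonneg h1 _), Real.norm_of_nonneg (by positivity)]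
      refine mul_le_mul_of_nonneg_right (pow_le_pow_left₀ (norm_nonneg _)
        ((norm_sub_le _ _).trans ?_) 2) (qf_nonneg h1 _)
      rw [norm_one, norm_mul, ← sq]; linarith
    · filter_upwards [hOlim] with t ht
      have h1 : Tendsto (fun i => ‖1 - O (ns i) t * O (ns i) t‖ ^ 2 * qf (g t) (d t)) atTop
          (𝓝 (‖(1 : ℂ) - 1 * 1‖ ^ 2 * qf (g t) (d t))) :=
        ((((ht.mul ht).const_sub 1).norm).pow 2).mul_const _
      simpa using h1
  rw [integral_zero] at hlim
  have hlim' := hlim.const_mul (1 / (2 * Real.pi))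
  rw [mul_zero] at hlim'
  obtain ⟨i, hi⟩ := (hlim'.eventually (gt_mem_nhds hε)).exists
  exact ⟨_, hpast (ns i), hi⟩

/-! ### The gain of the increment operator -/

/-- An entire function is divisible by the linear factors of its zeros. -/
theorem exists_differentiable_eq_prod_mul (S : Finset ℂ) : ∀ f : ℂ → ℂ, Differentiable ℂ f →
    (∀ a ∈ S, f a = 0) → ∃ g : ℂ → ℂ, Differentiable ℂ g ∧ ∀ z, f z = (∏ a ∈ S, (z - a)) * g z := by
  induction S using Finset.induction_on with
  | empty => exact fun f hf _ => ⟨f, hf, fun z => by simp⟩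
  | insert a S ha ih =>
    intro f hf h0
    have h1 : ∀ z, f z = (z - a) * dslope f a z := fun z => by
      have := sub_smul_dslope f a z
      rw [h0 a (Finset.mem_insert_self _ _), sub_zero, smul_eq_mul] at this
      exact this.symm
    have h2 : Differentiable ℂ (dslope f a) := by
      rw [← differentiableOn_univ] at hf ⊢
      exact (Complex.differentiableOn_dslope Filter.univ_mem).mpr hf
    obtain ⟨g, hg, hgz⟩ := ih (dslope f a) h2 fun b hb => by
      have h3 := h1 b
      rw [h0 b (Finset.mem_insert_of_mem hb), eq_comm, mul_eq_zero] at h3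
      exact h3.resolve_left (sub_ne_zero.mpr fun h => ha (h ▸ hb))
    refine ⟨g, hg, fun z => ?_⟩
    rw [h1, hgz, Finset.prod_insert ha, mul_assoc]

/-- On `[-π, π]`, one factor of `χ` is bounded by a multiple of the corresponding factor of `β`: the
zeros of the latter are simple, and are zeros of the former. -/
theorem exists_factor_le (n s : ℕ) (hs : 0 < s) (hn : s ∣ n) : ∃ M : ℝ, 0 ≤ M ∧
    ∀ t ∈ Set.Icc (-Real.pi) Real.pi, ‖1 - exp (-(I * (t : ℂ) * (n : ℂ)))‖ ≤
      M * ∏ k ∈ Finset.Icc (-((s / 2 : ℕ) : ℤ)) ((s / 2 : ℕ) : ℤ),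
        ‖I * (t : ℂ) - 2 * (Real.pi : ℂ) * I * (k : ℂ) / (s : ℂ)‖ := by
  obtain ⟨m, rfl⟩ := hn
  have hs' : (s : ℂ) ≠ 0 := by exact_mod_cast hs.ne'
  set z : ℤ → ℂ := fun k => 2 * (Real.pi : ℂ) * k / s with hz
  have hinj : Function.Injective z := by
    intro k l hkl
    simp only [hz] at hkl
    have := two_pi_ne_zero'
    field_simp at hkl
    exact_mod_cast hkl
  obtain ⟨g, hg, hgz⟩ := exists_differentiable_eq_prod_mul
    ((Finset.Icc (-((s / 2 : ℕ) : ℤ)) ((s / 2 : ℕ) : ℤ)).image z)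
    (fun w => 1 - exp (-(I * w * ((s * m : ℕ) : ℂ)))) (by fun_prop) (by
      intro a ha
      obtain ⟨k, -, rfl⟩ := Finset.mem_image.mp ha
      rw [sub_eq_zero, eq_comm, Complex.exp_eq_one_iff]
      refine ⟨-(k * m), ?_⟩
      simp only [hz]; push_cast; field_simp)
  obtain ⟨M, hM⟩ := (isCompact_Icc (a := -Real.pi) (b := Real.pi)).exists_bound_of_continuousOn
    (f := fun t : ℝ => g t) (hg.continuous.comp Complex.continuous_ofReal).continuousOn
  refine ⟨max M 0, le_max_right _ _, fun t ht => ?_⟩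
  rw [hgz, norm_mul, mul_comm, Finset.prod_image hinj.injOn, norm_prod]
  refine mul_le_mul ((hM t ht).trans (le_max_left _ _)) (le_of_eq ?_)
    (Finset.prod_nonneg fun _ _ => norm_nonneg _) (le_max_right _ _)
  refine Finset.prod_congr rfl fun k _ => ?_
  have : I * (t : ℂ) - 2 * (Real.pi : ℂ) * I * (k : ℂ) / (s : ℂ) = I * (t - z k) := by
    simp only [hz]; ring
  rw [this, norm_mul, Complex.norm_I, one_mul]

theorem exists_norm_chi_le (γ : GMIndex r) (hγ : γ.Positive) : ∃ M : ℝ, 0 ≤ M ∧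
    ∀ t ∈ Set.Icc (-Real.pi) Real.pi, ‖chi γ t‖ ≤ M * ‖beta γ t‖ := by
  choose M hM0 hM using fun j => exists_factor_le (γ.mu j * γ.s j) (γ.s j) (hγ j).2.1
    (Dvd.intro_left _ rfl)
  refine ⟨∏ j, M j ^ γ.d j, Finset.prod_nonneg fun j _ => pow_nonneg (hM0 j) _, fun t ht => ?_⟩
  rw [chi, beta, norm_prod, norm_prod, ← Finset.prod_mul_distrib]
  refine Finset.prod_le_prod (fun _ _ => norm_nonneg _) fun j _ => ?_
  rw [norm_pow, Finset.prod_pow, norm_pow, ← mul_pow, norm_prod]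
  exact pow_le_pow_left₀ (norm_nonneg _) (hM j t ht) _

theorem ae_mem_Icc : ∀ᵐ t ∂circ, t ∈ Set.Icc (-Real.pi) Real.pi := by
  filter_upwards [ae_restrict_mem (μ := volume) (measurableSet_Ioc (a := -Real.pi) (b := Real.pi))]
    with t ht using ⟨ht.1.le, ht.2⟩

theorem ae_chi_ne_zero (γ : GMIndex r) (hγ : γ.Positive) : ∀ᵐ t ∂circ, chi γ t ≠ 0 := by
  have h1 : ∀ j, ∀ᵐ t : ℝ ∂circ, 1 - exp (-(I * (t : ℂ) * ((γ.mu j * γ.s j : ℕ) : ℂ))) ≠ 0 := by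
    intro j
    have hn : ((γ.mu j * γ.s j : ℕ) : ℂ) ≠ 0 := by
      exact_mod_cast (Nat.mul_pos (hγ j).1 (hγ j).2.1).ne'
    refine ae_restrict_of_ae ?_
    rw [ae_iff]
    refine (Set.Countable.mono ?_ (Set.countable_range fun m : ℤ =>
      -(m * (2 * Real.pi)) / ((γ.mu j * γ.s j : ℕ) : ℝ))).measure_zero volume
    intro t ht
    simp only [ne_eq, not_not, Set.mem_ofPred_eq] at ht
    rw [sub_eq_zero, eq_comm, Complex.exp_eq_one_iff] at ht
    obtain ⟨m, hm⟩ := ht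
    refine ⟨m, ?_⟩
    apply Complex.ofReal_injective
    have h2 : (t : ℂ) * ((γ.mu j * γ.s j : ℕ) : ℂ) = -(m * (2 * Real.pi)) := by
      have : I * ((t : ℂ) * ((γ.mu j * γ.s j : ℕ) : ℂ) + m * (2 * Real.pi)) = 0 := by
        linear_combination -hm
      linear_combination (mul_eq_zero.mp this).resolve_left Complex.I_ne_zero
    simp only [Complex.ofReal_div, Complex.ofReal_neg, Complex.ofReal_mul, Complex.ofReal_intCast,
      Complex.ofReal_ofNat, Complex.ofReal_natCast]
    rw [div_eq_iff hn, h2]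
  filter_upwards [ae_all_iff.mpr h1] with t ht
  exact Finset.prod_ne_zero_iff.mpr fun j _ => pow_ne_zero _ (ht j)

theorem ae_beta_ne_zero (γ : GMIndex r) (hγ : γ.Positive) : ∀ᵐ t ∂circ, beta γ t ≠ 0 := by
  obtain ⟨M, -, hM⟩ := exists_norm_chi_le γ hγ
  filter_upwards [ae_chi_ne_zero γ hγ, ae_mem_Icc] with t h1 h2 h3
  have := hM t h2
  rw [h3, norm_zero, mul_zero, norm_le_zero_iff] at this
  exact h1 this

theorem measurable_chi_div_beta (γ : GMIndex r) : Measurable fun t => chi γ t / beta γ t := by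
  have h1 : Measurable (chi γ) := by
    refine Continuous.measurable ?_
    unfold chi; fun_prop
  have h2 : Measurable (beta γ) := by
    refine Continuous.measurable ?_
    unfold beta; fun_prop
  exact h1.div h2

theorem gain_eq (γ : GMIndex r) (t : ℝ) : gain γ t = ‖chi γ t / beta γ t‖ ^ 2 := by
  rw [gain, norm_div, div_pow]

theorem gain_nonneg (γ : GMIndex r) (t : ℝ) : 0 ≤ gain γ t := by
  rw [gain_eq]; positivity

theorem ae_gain_pos (γ : GMIndex r) (hγ : γ.Positive) : ∀ᵐ t ∂circ, 0 < gain γ t := by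
  filter_upwards [ae_chi_ne_zero γ hγ, ae_beta_ne_zero γ hγ] with t h1 h2
  rw [gain_eq]
  have := norm_pos_iff.mpr (div_ne_zero h1 h2)
  positivity

theorem measurable_gain (γ : GMIndex r) : Measurable (gain γ) := by
  have : gain γ = fun t => ‖chi γ t / beta γ t‖ ^ 2 := funext (gain_eq γ)
  rw [this]
  exact (measurable_chi_div_beta γ).norm.pow_const 2

theorem exists_gain_le (γ : GMIndex r) (hγ : γ.Positive) : ∃ M : ℝ, ∀ᵐ t ∂circ, gain γ t ≤ M := by
  obtain ⟨M, hM0, hM⟩ := exists_norm_chi_le γ hγ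
  refine ⟨M ^ 2, ?_⟩
  filter_upwards [ae_mem_Icc, ae_beta_ne_zero γ hγ] with t h1 h2
  rw [gain_eq, norm_div]
  refine pow_le_pow_left₀ (by positivity) ?_ 2
  rw [div_le_iff₀ (norm_pos_iff.mpr h2)]
  exact hM t h1

theorem Integrable.gain_mul {γ : GMIndex r} (hγ : γ.Positive) {u : ℝ → ℂ}
    (hu : Integrable u circ) : Integrable (fun t => ((gain γ t : ℝ) : ℂ) * u t) circ := by
  obtain ⟨M, hM⟩ := exists_gain_le γ hγ
  refine hu.bdd_mul (c := M) (Complex.measurable_ofReal.comp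
    (measurable_gain γ)).aestronglyMeasurable (hM.mono fun t ht => ?_)
  rwa [Complex.norm_real, Real.norm_of_nonneg (gain_nonneg γ t)]

/-- The weight `|χ|² / |β|² f`, the spectral density of the stationary increments themselves.
Multiplication by `χ / β` maps its `L₂` isometrically onto `L₂(f)`. -/
def wgt (γ : GMIndex r) (f : ℝ → Matrix (Fin T) (Fin T) ℂ) (t : ℝ) : Matrix (Fin T) (Fin T) ℂ :=
  ((gain γ t : ℝ) : ℂ) • f t

theorem IsSpectralDensity.wgt {γ : GMIndex r} (hγ : γ.Positive)
    {f : ℝ → Matrix (Fin T) (Fin T) ℂ} (hf : IsSpectralDensity f) :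
    IsSpectralDensity (wgt γ f) where
  posSemidef := hf.posSemidef.mono fun t ht => ht.smul (by exact_mod_cast gain_nonneg γ t)
  integrable p l := Integrable.gain_mul hγ (hf.integrable p l)

/-- Minimality of `f` makes the weight of the increments coercive. -/
theorem IsMinimal.coercive {γ : GMIndex r} (hγ : γ.Positive) {f : ℝ → Matrix (Fin T) (Fin T) ℂ}
    (hf : IsSpectralDensity f) (hm : IsMinimal γ f) : Coercive (GMForecast.wgt γ f) := by
  refine ⟨_, hm.integrable, ?_⟩
  filter_upwards [hf.posSemidef, hm.isUnit_det, ae_gain_pos γ hγ] with t h1 h2 h3 u l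
  set G := gain γ t with hG
  -- the estimate for `f` at the vector scaled by the gain
  have h4 := two_mul_norm_apply_le h1 h2 ((G : ℂ) • u) l
  rw [qf_smul, Pi.smul_apply, norm_smul, Complex.norm_real, Real.norm_of_nonneg h3.le] at h4
  have h5 := (diag_re_le_trace h1.inv l)
  have h6 : G * (2 * ‖u l‖) ≤ G * (qf (GMForecast.wgt γ f t) u + G⁻¹ * ((f t)⁻¹).trace.re) := by
    rw [GMForecast.wgt, ← hG, qf_smul_weight, mul_add, mul_inv_cancel_left₀ h3.ne']
    nlinarith
  exact le_of_mul_le_mul_left h6 h3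

/-! ### The generating function of the coefficients -/

theorem bFun_apply {γ : GMIndex r} {a : ℕ → Fin T → ℂ} (ha : IsAdmissible γ a) (t : ℝ) (l : Fin T) :
    bFun γ a t l = ∑' k : ℕ, ee k t * bCoef γ a k l := by
  have hs : Summable fun k : ℕ => ee k t • bCoef γ a k := by
    refine Summable.of_norm ?_
    simpa only [norm_smul, norm_ee, one_mul] using ha.summable_b
  have : bFun γ a t = ∑' k : ℕ, ee k t • bCoef γ a k := by
    rw [bFun]; congr 1
  rw [this, tsum_apply hs]
  rfl

theorem summable_bCoef_apply {γ : GMIndex r} {a : ℕ → Fin T → ℂ} (ha : IsAdmissible γ a)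
    (l : Fin T) : Summable fun k => ‖bCoef γ a k l‖ :=
  ha.summable_b.of_nonneg_of_le (fun _ => norm_nonneg _) fun _ => norm_le_pi_norm _ _

theorem measV_bFun {γ : GMIndex r} {a : ℕ → Fin T → ℂ} (ha : IsAdmissible γ a) :
    MeasV (bFun γ a) := by
  intro l
  refine Continuous.aestronglyMeasurable ?_
  simp only [bFun_apply ha]
  refine continuous_tsum (fun k => (continuous_ee k).mul continuous_const)
    (summable_bCoef_apply ha l) fun k t => ?_
  rw [norm_mul, norm_ee, one_mul]

theorem norm_bFun_le {γ : GMIndex r} {a : ℕ → Fin T → ℂ} (ha : IsAdmissible γ a) (t : ℝ)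
    (l : Fin T) : ‖bFun γ a t l‖ ≤ ∑' k, ‖bCoef γ a k‖ := by
  rw [bFun_apply ha]
  refine tsum_of_norm_bounded ha.summable_b.hasSum fun k => ?_
  rw [norm_mul, norm_ee, one_mul]
  exact norm_le_pi_norm _ _

theorem memW_bFun {γ : GMIndex r} {a : ℕ → Fin T → ℂ} (ha : IsAdmissible γ a)
    {g : ℝ → Matrix (Fin T) (Fin T) ℂ} (hg : IsSpectralDensity g) : MemW g (bFun γ a) :=
  MemW.of_bdd hg (measV_bFun ha) (Eventually.of_forall fun t l => norm_bFun_le ha t l)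

/-- Fourier coefficients of the product with an absolutely convergent power series. -/
theorem hasSum_fourierCoef_mul_series {φ : ℝ → ℂ} (hφ : Integrable φ circ) {b : ℕ → ℂ}
    (hb : Summable fun k => ‖b k‖) (n : ℤ) :
    HasSum (fun k : ℕ => b k * fourierCoef φ (n - k))
      (fourierCoef (fun t => φ t * ∑' k : ℕ, ee k t * b k) n) := by
  have hi : ∀ k : ℕ, Integrable (fun t => ee (-n) t * (φ t * (ee k t * b k))) circ := by
    intro k
    refine ((Integrable.ee_mul (Integrable.ee_mul hφ k) (-n)).mul_const (b k)).congr
      (Eventually.of_forall fun t => ?_)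
    simp only; ring
  have h := hasSum_integral_of_summable_integral_norm hi (by
    have : ∀ k : ℕ, ∫ t, ‖ee (-n) t * (φ t * (ee k t * b k))‖ ∂circ =
        ‖b k‖ * ∫ t, ‖φ t‖ ∂circ := by
      intro k
      simp only [norm_mul, norm_ee, one_mul]
      rw [integral_mul_const, mul_comm]
    simp only [this]
    exact hb.mul_right _)
  have h1 := h.mul_left (1 / (2 * (Real.pi : ℂ)))
  have h2 : fourierCoef (fun t => φ t * ∑' k : ℕ, ee k t * b k) n = 1 / (2 * (Real.pi : ℂ)) *
      ∫ t, ∑' k : ℕ, ee (-n) t * (φ t * (ee k t * b k)) ∂circ := by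
    rw [fourierCoef_eq]
    congr 2; ext t
    rw [← tsum_mul_left, ← tsum_mul_left]
  rw [h2]
  refine h1.congr_fun fun k => ?_
  rw [fourierCoef_eq, mul_left_comm, ← integral_const_mul]
  congr 2; ext t
  rw [show -(n - (k : ℤ)) = -n + k by ring, ee_add]; ring

theorem fourierCoef_one (n : ℤ) : fourierCoef (fun _ => (1 : ℂ)) n = if n = 0 then 1 else 0 := by
  rw [← fourierCoef_ee 0 n]
  congr 1; ext t; rw [ee_zero]

theorem fourierCoef_bFun {γ : GMIndex r} {a : ℕ → Fin T → ℂ} (ha : IsAdmissible γ a) (l : Fin T)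
    (j : ℕ) : fourierCoef (fun t => bFun γ a t l) j = bCoef γ a j l := by
  have h := hasSum_fourierCoef_mul_series (integrable_const (1 : ℂ)) (summable_bCoef_apply ha l) j
  simp only [one_mul, fourierCoef_one, ← bFun_apply ha] at h
  refine h.unique ?_
  have := hasSum_single (f := fun k : ℕ => bCoef γ a k l * if (j : ℤ) - k = 0 then (1 : ℂ) else 0) j
    (fun k hk => by rw [if_neg (by omega), mul_zero])
  simpa using this

theorem integrable_bFun {γ : GMIndex r} {a : ℕ → Fin T → ℂ} (ha : IsAdmissible γ a) (l : Fin T) :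
    Integrable (fun t => bFun γ a t l) circ :=
  (integrable_const _).mono' (measV_bFun ha l) (Eventually.of_forall fun t => norm_bFun_le ha t l)

/-! ### Spectral characteristics in terms of the weight of the increments -/

theorem normSqL2_congr {f : ℝ → Matrix (Fin T) (Fin T) ℂ} {u v : ℝ → Fin T → ℂ}
    (h : u =ᵐ[circ] v) : normSqL2 f u = normSqL2 f v := by
  rw [normSqL2, normSqL2]
  congr 1
  exact lintegral_congr_ae (h.mono fun t ht => by simp only [ht])

theorem normSqL2_smul_chi (γ : GMIndex r) (f : ℝ → Matrix (Fin T) (Fin T) ℂ)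
    (u : ℝ → Fin T → ℂ) :
    normSqL2 f (fun t => (chi γ t / beta γ t) • u t) = normSqL2 (wgt γ f) u := by
  rw [normSqL2, normSqL2]
  congr 1
  refine lintegral_congr fun t => ?_
  congr 1
  have h1 := qf_smul (f t) (chi γ t / beta γ t) (u t)
  have h2 := qf_smul_weight (gain γ t) (f t) (u t)
  rw [← gain_eq, ← h2] at h1
  exact h1

section translate

variable {γ : GMIndex r} {f : ℝ → Matrix (Fin T) (Fin T) ℂ} {a : ℕ → Fin T → ℂ}

theorem smul_mem_L2past (hγ : γ.Positive) (hf : IsSpectralDensity f) {v : ℝ → Fin T → ℂ}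
    (hv : InPast (wgt γ f) v) : (fun t => (chi γ t / beta γ t) • v t) ∈ L2past γ f := by
  refine ⟨hv.memW.meas.smul (measurable_chi_div_beta γ).aestronglyMeasurable, fun δ hδ => ?_⟩
  obtain ⟨p, hp⟩ := hv.approx δ hδ
  refine ⟨p, ?_⟩
  simp only [pastPoly_eq, ← smul_sub]
  rw [normSqL2_smul_chi, normSqL2_eq (hf.wgt hγ)
    (hv.memW.sub (hf.wgt hγ) (memW_pastTrig (hf.wgt hγ) p))]
  exact (ENNReal.ofReal_lt_ofReal_iff hδ).mpr hp

theorem mem_L2past_congr {h h' : ℝ → Fin T → ℂ} (hh : h ∈ L2past γ f) (e : h =ᵐ[circ] h') :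
    h' ∈ L2past γ f := by
  refine ⟨MeasV.congr hh.1 e, fun δ hδ => ?_⟩
  obtain ⟨p, hp⟩ := hh.2 δ hδ
  refine ⟨p, lt_of_eq_of_lt (normSqL2_congr ?_) hp⟩
  filter_upwards [e] with t ht
  simp only [ht]

theorem ae_smul_inv_smul (hγ : γ.Positive) (h : ℝ → Fin T → ℂ) :
    (fun t => (chi γ t / beta γ t) • (chi γ t / beta γ t)⁻¹ • h t) =ᵐ[circ] h := by
  filter_upwards [ae_chi_ne_zero γ hγ, ae_beta_ne_zero γ hγ] with t h1 h2
  rw [smul_inv_smul₀ (div_ne_zero h1 h2)]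

theorem inPast_of_mem_L2past (hγ : γ.Positive) (hf : IsSpectralDensity f) {h : ℝ → Fin T → ℂ}
    (hh : h ∈ L2past γ f) : InPast (wgt γ f) (fun t => (chi γ t / beta γ t)⁻¹ • h t) := by
  have hg := hf.wgt hγ
  set v : ℝ → Fin T → ℂ := fun t => (chi γ t / beta γ t)⁻¹ • h t with hv
  have hvm : MeasV v :=
    MeasV.smul (measurable_chi_div_beta γ).inv.aestronglyMeasurable hh.1
  have key : ∀ p, normSqL2 f (fun t => h t - pastPoly γ p t) =
      normSqL2 (wgt γ f) (fun t => v t - pastTrig p t) := by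
    intro p
    rw [← normSqL2_smul_chi]
    refine normSqL2_congr ?_
    filter_upwards [ae_smul_inv_smul hγ h] with t ht
    rw [smul_sub, hv, ht, pastPoly_eq]
  have hmem : ∀ p δ, normSqL2 f (fun t => h t - pastPoly γ p t) < ENNReal.ofReal δ →
      MemW (wgt γ f) (fun t => v t - pastTrig p t) := fun p δ hp =>
    MemW.of_normSqL2_lt_top hg (hvm.sub (MeasV.of_continuous (continuous_pastTrig p)))
      (by rw [← key]; exact hp.trans ENNReal.ofReal_lt_top)
  refine ⟨?_, fun δ hδ => ?_⟩
  · obtain ⟨p, hp⟩ := hh.2 1 one_pos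
    refine ((hmem p 1 hp).add hg (memW_pastTrig hg p)).congr (Eventually.of_forall fun t => ?_)
    simp
  · obtain ⟨p, hp⟩ := hh.2 δ hδ
    refine ⟨p, ?_⟩
    have hm := hmem p δ hp
    rw [key, normSqL2_eq hg hm] at hp
    exact (ENNReal.ofReal_lt_ofReal_iff hδ).mp hp

theorem mse_smul (v : ℝ → Fin T → ℂ) :
    mse γ a (fun t => (chi γ t / beta γ t) • v t) f =
      normSqL2 (wgt γ f) (fun t => bFun γ a t - v t) := by
  rw [mse, ← normSqL2_smul_chi]
  simp only [smul_sub]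

theorem mse_congr {h h' : ℝ → Fin T → ℂ} (e : h =ᵐ[circ] h') : mse γ a h f = mse γ a h' f :=
  normSqL2_congr (e.mono fun t ht => by simp only [ht])

theorem mse_pastPoly (hγ : γ.Positive) (ha : IsAdmissible γ a) (hf : IsSpectralDensity f)
    (p : ℕ →₀ (Fin T → ℂ)) : mse γ a (pastPoly γ p) f =
      ENNReal.ofReal (nq (wgt γ f) (fun t => bFun γ a t - pastTrig p t)) := by
  have hg := hf.wgt hγ
  rw [← normSqL2_eq hg ((memW_bFun ha hg).sub hg (memW_pastTrig hg p)), ← mse_smul]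
  rfl

/-- The optimal error is the infimum of the errors of finite linear estimates. -/
theorem optMse_eq_iInf (hγ : γ.Positive) (ha : IsAdmissible γ a) (hf : IsSpectralDensity f) :
    optMse γ a f = ⨅ p, mse γ a (pastPoly γ p) f := by
  have hg := hf.wgt hγ
  refine le_antisymm (le_iInf fun p => ?_) (le_iInf₂ fun h hh => ?_)
  · exact iInf₂_le _ (smul_mem_L2past hγ hf (inPast_pastTrig hg p))
  · set v : ℝ → Fin T → ℂ := fun t => (chi γ t / beta γ t)⁻¹ • h t
    have hv : InPast (wgt γ f) v := inPast_of_mem_L2past hγ hf hh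
    rw [mse_congr (ae_smul_inv_smul hγ h).symm, mse_smul,
      normSqL2_eq hg ((memW_bFun ha hg).sub hg hv.memW)]
    have hfin : (⨅ p, mse γ a (pastPoly γ p) f) ≠ ∞ :=
      ((iInf_le _ 0).trans_lt (by rw [mse_pastPoly hγ ha hf]; exact ENNReal.ofReal_lt_top)).ne
    rw [← ENNReal.ofReal_toReal hfin]
    refine ENNReal.ofReal_le_ofReal (hv.le_nq_sub hg (memW_bFun ha hg) fun p => ?_)
    refine ENNReal.toReal_le_of_le_ofReal (nq_nonneg hg _) ?_
    rw [← mse_pastPoly hγ ha hf]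
    exact iInf_le _ p

theorem optMse_le_of_inPast (hγ : γ.Positive) (ha : IsAdmissible γ a) (hf : IsSpectralDensity f)
    {v : ℝ → Fin T → ℂ} (hv : InPast (wgt γ f) v) :
    optMse γ a f ≤ ENNReal.ofReal (nq (wgt γ f) (fun t => bFun γ a t - v t)) := by
  have hg := hf.wgt hγ
  rw [← normSqL2_eq hg ((memW_bFun ha hg).sub hg hv.memW), ← mse_smul]
  exact iInf₂_le _ (smul_mem_L2past hγ hf hv)

/-- The optimal error is the squared norm of the residual. -/
theorem IsResidual.optMse_eq (hγ : γ.Positive) (ha : IsAdmissible γ a) (hf : IsSpectralDensity f)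
    {w : ℝ → Fin T → ℂ} (hw : IsResidual (wgt γ f) (bFun γ a) w) :
    optMse γ a f = ENNReal.ofReal (nq (wgt γ f) w) := by
  have hg := hf.wgt hγ
  refine le_antisymm ?_ ?_
  · simpa using optMse_le_of_inPast hγ ha hf hw.inPast
  · rw [optMse_eq_iInf hγ ha hf]
    refine le_iInf fun p => ?_
    rw [mse_pastPoly hγ ha hf]
    refine ENNReal.ofReal_le_ofReal ?_
    rw [hw.nq_sub_eq hg (inPast_pastTrig hg p)]
    have := nq_nonneg hg (fun t => bFun γ a t - pastTrig p t - w t)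
    linarith

end translate

/-! ### The Toeplitz operator and the residual -/

theorem sf_single_right (M : Matrix (Fin T) (Fin T) ℂ) (u : Fin T → ℂ) (p : Fin T) :
    sf M u (Pi.single p 1) = (Mᵀ *ᵥ u) p := by
  rw [sf, mulVec_transpose, dotProduct_mulVec, ← Pi.single_star, star_one, dotProduct_single,
    mul_one]

/-- The form of `M` at `u` in terms of `Mᵀ u`. -/
theorem sf_self_eq {M : Matrix (Fin T) (Fin T) ℂ} (hM : M.IsHermitian) (u v : Fin T → ℂ) :
    sf M u v = star (Mᵀ *ᵥ v) ⬝ᵥ u := by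
  rw [sf, star_mulVec, dotProduct_comm u]
  congr 1
  have : Mᵀᴴ = Mᵀ := hM.transpose
  rw [this, vecMul_transpose]

section toeplitz

variable {g : ℝ → Matrix (Fin T) (Fin T) ℂ} {w : ℝ → Fin T → ℂ}

theorem memW_single (hg : IsSpectralDensity g) (k : ℤ) (p : Fin T) :
    MemW g (fun t => ee k t • (Pi.single p 1 : Fin T → ℂ)) := by
  refine MemW.of_bdd hg ((MeasV.of_continuous continuous_const).smul
    (continuous_ee k).aestronglyMeasurable) (M := 1) (Eventually.of_forall fun t l => ?_)
  rw [Pi.smul_apply, norm_smul, norm_ee, one_mul]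
  by_cases h : l = p
  · subst h; simp
  · simp [Pi.single_eq_of_ne h]

theorem integrable_transpose_mulVec (hg : IsSpectralDensity g) (hw : MemW g w) (p : Fin T) :
    Integrable (fun t => ((g t)ᵀ *ᵥ w t) p) circ := by
  refine (integrable_sf hg hw (memW_single hg 0 p)).congr (Eventually.of_forall fun t => ?_)
  simp only [ee_zero, one_smul, sf_single_right]

theorem sip_single (k : ℤ) (p : Fin T) :
    sip g w (fun t => ee k t • (Pi.single p 1 : Fin T → ℂ)) =
      fourierCoef (fun t => ((g t)ᵀ *ᵥ w t) p) k := by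
  rw [sip, fourierCoef_eq]
  simp only [sf_smul_right, conj_ee, sf_single_right]
  push_cast; rfl

/-- Orthogonality to the exponentials with negative frequencies implies orthogonality to the
past. -/
theorem sip_eq_zero_of_fourierCoef (hg : IsSpectralDensity g) (hw : MemW g w)
    (h0 : ∀ p (k : ℕ), fourierCoef (fun t => ((g t)ᵀ *ᵥ w t) p) (-((k : ℤ) + 1)) = 0)
    {v : ℝ → Fin T → ℂ} (hv : InPast g v) : sip g w v = 0 := by
  have h1 : ∀ p : ℕ →₀ (Fin T → ℂ), sip g w (pastTrig p) = 0 := by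
    intro p
    have hi : ∀ k ∈ p.support, ∀ l ∈ (Finset.univ : Finset (Fin T)), Integrable (fun t =>
        conj (p k l) * (ee ((k : ℤ) + 1) t * ((g t)ᵀ *ᵥ w t) l)) circ := fun k _ l _ =>
      (Integrable.ee_mul (integrable_transpose_mulVec hg hw l) _).const_mul _
    have h2 : ∀ t, sf (g t) (w t) (pastTrig p t) = ∑ k ∈ p.support, ∑ l,
        conj (p k l) * (ee ((k : ℤ) + 1) t * ((g t)ᵀ *ᵥ w t) l) := by
      intro t
      rw [sf, dotProduct_mulVec, ← mulVec_transpose, dotProduct, Finset.sum_comm]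
      refine Finset.sum_congr rfl fun l _ => ?_
      rw [Pi.star_apply, pastTrig_apply, star_sum, Finset.mul_sum]
      refine Finset.sum_congr rfl fun k _ => ?_
      rw [star_mul', RCLike.star_def, conj_ee, neg_neg]; ring
    rw [sip]
    simp only [h2]
    rw [integral_finsetSum _ fun k hk => integrable_finsetSum _ (hi k hk), Finset.mul_sum]
    refine Finset.sum_eq_zero fun k hk => ?_
    rw [integral_finsetSum _ (hi k hk), Finset.mul_sum]
    refine Finset.sum_eq_zero fun l _ => ?_
    have h3 := h0 l k
    rw [fourierCoef_eq, neg_neg, mul_eq_zero] at h3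
    rw [integral_const_mul, h3.resolve_left (by simp [Real.pi_ne_zero])]; simp
  rw [← norm_le_zero_iff]
  refine le_of_forall_pos_le_add fun ε hε => ?_
  set N := nq g w with hN
  have hN0 : 0 ≤ N := nq_nonneg hg w
  set η := ε / (N + 1) with hη
  have hη0 : 0 < η := by positivity
  obtain ⟨p, hp⟩ := hv.approx (η * ε) (by positivity)
  have hm := hv.memW.sub hg (memW_pastTrig hg p)
  have h4 : sip g w v = sip g w (fun t => v t - pastTrig p t) := by
    have := sip_add_right hg hm (memW_pastTrig hg p) hw
    rw [h1, add_zero] at this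
    rw [← this]
    congr 1; ext t : 1; abel
  have h5 := two_mul_norm_sip_le hg hw (hm.const_smul ((η⁻¹ : ℝ) : ℂ))
  rw [sip_smul_right, nq_const_smul, norm_mul, RCLike.norm_conj, Complex.norm_real,
    Real.norm_of_nonneg (by positivity), ← h4, ← hN] at h5
  rw [zero_add]
  have h6 : 2 * ‖sip g w v‖ ≤ η * N + η⁻¹ * nq g (fun t => v t - pastTrig p t) := by
    have := mul_le_mul_of_nonneg_left h5 hη0.le
    calc 2 * ‖sip g w v‖ = η * (2 * (η⁻¹ * ‖sip g w v‖)) := by field_simp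
      _ ≤ _ := this
      _ = _ := by field_simp
  have h7 : η * N ≤ ε := by
    rw [hη, div_mul_eq_mul_div, div_le_iff₀ (by positivity)]
    nlinarith
  have h8 : η⁻¹ * nq g (fun t => v t - pastTrig p t) ≤ ε := by
    rw [inv_mul_le_iff₀ hη0]; exact hp.le
  linarith

theorem IsResidual.fourierCoef_neg (hg : IsSpectralDensity g) {B : ℝ → Fin T → ℂ}
    (hw : IsResidual g B w) (p : Fin T) (k : ℕ) :
    fourierCoef (fun t => ((g t)ᵀ *ᵥ w t) p) (-((k : ℤ) + 1)) = 0 := by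
  rw [← sip_single]
  have h := hw.orth _ (inPast_pastTrig hg (Finsupp.single k (Pi.single p 1)))
  have e : pastTrig (Finsupp.single k (Pi.single p 1 : Fin T → ℂ)) =
      fun t => ee (-((k : ℤ) + 1)) t • (Pi.single p 1 : Fin T → ℂ) :=
    funext fun t => pastTrig_single k _ t
  rwa [e] at h

/-- Coercive weights are definite. -/
theorem Coercive.ae_eq_zero (hc : Coercive g) (hw : MemW g w) (h : nq g w = 0) :
    w =ᵐ[circ] 0 := by
  obtain ⟨K₀, hK₀, hK⟩ := hc.exists_bound
  have h1 : ∀ l, (fun t => w t l) =ᵐ[circ] 0 := by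
    intro l
    have h2 : ∫ t, ‖w t l‖ ∂circ = 0 := by
      refine le_antisymm (le_of_forall_pos_le_add fun ε hε => ?_)
        (integral_nonneg fun t => norm_nonneg _)
      have h3 := hK w hw l (ε / (K₀ + 1)) (by positivity)
      rw [h, mul_zero, mul_zero, zero_add] at h3
      rw [zero_add]
      refine h3.trans ?_
      rw [div_mul_eq_mul_div, div_le_iff₀ (by positivity)]
      nlinarith
    rw [integral_eq_zero_iff_of_nonneg (fun t => norm_nonneg _) (hc.integrable hw l).norm] at h2
    filter_upwards [h2] with t ht
    simpa using ht
  filter_upwards [ae_all_iff.mpr h1] with t ht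
  ext l
  exact ht l

theorem IsResidual.ae_eq (hg : IsSpectralDensity g) (hc : Coercive g) {B w' : ℝ → Fin T → ℂ}
    (hw : IsResidual g B w) (hw' : IsResidual g B w') : w =ᵐ[circ] w' := by
  have h1 := hw.nq_sub_eq hg hw'.inPast
  have h2 := hw'.nq_sub_eq hg hw.inPast
  simp only [sub_sub_cancel] at h1 h2
  rw [nq_sub_comm] at h2
  have h3 : nq g (fun t => w' t - w t) = 0 := by
    have := nq_nonneg hg (fun t => w' t - w t)
    linarith
  filter_upwards [hc.ae_eq_zero (hw'.memW.sub hg hw.memW) h3] with t ht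
  exact (sub_eq_zero.mp ht).symm

end toeplitz

section inverse

variable {γ : GMIndex r} {f : ℝ → Matrix (Fin T) (Fin T) ℂ} {a : ℕ → Fin T → ℂ}

theorem ae_symbolF_mulVec (hγ : γ.Positive) (hm : IsMinimal γ f) :
    ∀ᵐ t ∂circ, (∀ u, symbolF γ f t *ᵥ ((wgt γ f t)ᵀ *ᵥ u) = u) ∧
      ∀ u, (wgt γ f t)ᵀ *ᵥ (symbolF γ f t *ᵥ u) = u := by
  filter_upwards [hm.isUnit_det, ae_gain_pos γ hγ] with t h1 h2
  have h3 : ((gain γ t : ℝ) : ℂ) ≠ 0 := by exact_mod_cast h2.ne'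
  have h4 : symbolF γ f t * (wgt γ f t)ᵀ = 1 := by
    rw [symbolF, wgt, transpose_smul, smul_mul_smul_comm, ← transpose_mul, mul_nonsing_inv _ h1,
      transpose_one]
    push_cast
    rw [inv_mul_cancel₀ h3, one_smul]
  refine ⟨fun u => by rw [mulVec_mulVec, h4, one_mulVec], fun u => ?_⟩
  rw [mulVec_mulVec, mul_eq_one_comm.mp h4, one_mulVec]

/-- The residual `w` yields the solution `C = |χ|² / |β|² fᵀ w` of the Toeplitz equation. -/
theorem IsResidual.isFInverse (hγ : γ.Positive) (ha : IsAdmissible γ a) (hf : IsSpectralDensity f)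
    (hm : IsMinimal γ f) {w : ℝ → Fin T → ℂ} (hw : IsResidual (wgt γ f) (bFun γ a) w) :
    IsFInverse γ a f (fun k p => fourierCoef (fun t => ((wgt γ f t)ᵀ *ᵥ w t) p) k)
      (fun t => (wgt γ f t)ᵀ *ᵥ w t) := by
  have hg := hf.wgt hγ
  have hc := hm.coercive hγ hf
  have hs : ∀ᵐ t ∂circ, symbolF γ f t *ᵥ ((wgt γ f t)ᵀ *ᵥ w t) = w t :=
    (ae_symbolF_mulVec hγ hm).mono fun t ht => ht.1 _
  have hsp : ∀ p, (fun t => w t p) =ᵐ[circ] fun t =>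
      (symbolF γ f t *ᵥ ((wgt γ f t)ᵀ *ᵥ w t)) p :=
    fun p => hs.mono fun t ht => by simp only [ht]
  refine ⟨⟨fun p => integrable_transpose_mulVec hg hw.memW p, fun p k => rfl,
    fun p k => hw.fourierCoef_neg hg p k⟩, ?_, fun p => (hc.integrable hw.memW p).congr (hsp p),
    fun p j => ?_⟩
  · have h1 : ∀ᵐ t ∂circ, (star ((wgt γ f t)ᵀ *ᵥ w t) ⬝ᵥ
        (symbolF γ f t *ᵥ ((wgt γ f t)ᵀ *ᵥ w t))).re = qf (wgt γ f t) (w t) := by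
      filter_upwards [hs, hg.posSemidef] with t h1 h2
      rw [h1, qf, sf_self_eq h2.1]
    rw [lintegral_congr_ae (h1.mono fun t ht => by
      show ENNReal.ofReal _ = ENNReal.ofReal (qf (wgt γ f t) (w t)); rw [ht])]
    exact (hasFiniteIntegral_iff_ofReal (hg.posSemidef.mono fun t ht => qf_nonneg ht _)).mp
      hw.memW.int.2
  · rw [← fourierCoef_congr (hsp p), ← fourierCoef_bFun ha]
    have h1 := hw.inPast.fourierCoef_eq_zero hg hc p (n := j) (by positivity)
    simp only [Pi.sub_apply] at h1
    rw [fourierCoef_sub (integrable_bFun ha p) (hc.integrable hw.memW p)] at h1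
    exact (sub_eq_zero.mp h1).symm

/-- Every solution of the Toeplitz equation of finite energy comes from the residual. That
`bFun - symbolF C` belongs to the past rests on the description of the past by frequencies. -/
theorem IsFInverse.isResidual (hγ : γ.Positive) (ha : IsAdmissible γ a) (hf : IsSpectralDensity f)
    (hm : IsMinimal γ f) {c : ℕ → Fin T → ℂ} {C : ℝ → Fin T → ℂ} (h : IsFInverse γ a f c C) :
    IsResidual (wgt γ f) (bFun γ a) (fun t => symbolF γ f t *ᵥ C t) := by
  have hg := hf.wgt hγ
  set w : ℝ → Fin T → ℂ := fun t => symbolF γ f t *ᵥ C t with hw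
  have hC : ∀ᵐ t ∂circ, (wgt γ f t)ᵀ *ᵥ w t = C t :=
    (ae_symbolF_mulVec hγ hm).mono fun t ht => ht.2 _
  have hwm : MeasV w := fun p => (h.integrable p).1
  have hwW : MemW (wgt γ f) w := by
    refine ⟨hwm, aestronglyMeasurable_qf hg hwm, ?_⟩
    rw [hasFiniteIntegral_iff_ofReal (hg.posSemidef.mono fun t ht => qf_nonneg ht _)]
    refine lt_of_eq_of_lt (lintegral_congr_ae ?_) h.energy
    filter_upwards [hC, hg.posSemidef] with t h1 h2
    rw [qf, sf_self_eq h2.1, h1]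
  refine ⟨hwW, ?_, fun v hv => sip_eq_zero_of_fourierCoef hg hwW (fun p k => ?_) hv⟩
  · refine InPast.of_fourierCoef hg ((memW_bFun ha hg).sub hg hwW)
      (fun l => (integrable_bFun ha l).sub (h.integrable l)) fun l n hn => ?_
    simp only [Pi.sub_apply]
    rw [fourierCoef_sub (integrable_bFun ha l) (h.integrable l)]
    obtain ⟨j, rfl⟩ := Int.eq_ofNat_of_zero_le hn
    rw [fourierCoef_bFun ha, h.apply_eq, sub_self]
  · rw [← h.analytic.coef_neg p k]
    exact fourierCoef_congr (hC.mono fun t ht => by simp only [ht]) _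

/-- The squared norm of the residual is `⟨D a, F⁻¹ D a⟩`. -/
theorem IsFInverse.pairing_eq (hγ : γ.Positive) (ha : IsAdmissible γ a) (hf : IsSpectralDensity f)
    (hm : IsMinimal γ f) {c : ℕ → Fin T → ℂ} {C : ℝ → Fin T → ℂ} (h : IsFInverse γ a f c C) :
    pairing γ a c = nq (wgt γ f) (fun t => symbolF γ f t *ᵥ C t) := by
  have hg := hf.wgt hγ
  have hr := h.isResidual hγ ha hf hm
  set w : ℝ → Fin T → ℂ := fun t => symbolF γ f t *ᵥ C t with hw
  have hC : ∀ᵐ t ∂circ, (wgt γ f t)ᵀ *ᵥ w t = C t :=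
    (ae_symbolF_mulVec hγ hm).mono fun t ht => ht.2 _
  have hB := memW_bFun ha hg
  have h1 : sip (wgt γ f) w (bFun γ a) = nq (wgt γ f) w := by
    have h2 := sip_add_right hg hr.memW hr.inPast.memW hr.memW
    rw [hr.orth _ hr.inPast, add_zero, sip_self hg] at h2
    rw [← h2]
    congr 1; ext t : 1; abel
  have hCc : ∀ l, Integrable (fun t => conj (C t l)) circ := fun l =>
    (Complex.conjCLE.toContinuousLinearMap.integrable_comp (h.analytic.integrable l))
  have h3 : ∀ l, HasSum (fun k : ℕ => bCoef γ a k l * conj (c k l))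
      (fourierCoef (fun t => conj (C t l) * bFun γ a t l) 0) := by
    intro l
    have h4 := hasSum_fourierCoef_mul_series (hCc l) (summable_bCoef_apply ha l) 0
    simp only [← bFun_apply ha] at h4
    refine h4.congr_fun fun k => ?_
    rw [fourierCoef_conj, zero_sub, neg_neg, h.analytic.coef]
  have h5 : HasSum (fun k : ℕ => bCoef γ a k ⬝ᵥ star (c k))
      (∑ l, fourierCoef (fun t => conj (C t l) * bFun γ a t l) 0) := by
    simp only [dotProduct, Pi.star_apply]
    exact hasSum_sum fun l _ => h3 l
  have hi : ∀ l, Integrable (fun t => conj (C t l) * bFun γ a t l) circ := fun l =>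
    (hCc l).mul_bdd (c := ∑' k, ‖bCoef γ a k‖) (measV_bFun ha l)
      (Eventually.of_forall fun t => norm_bFun_le ha t l)
  have h6 : ∑ l, fourierCoef (fun t => conj (C t l) * bFun γ a t l) 0 =
      conj (sip (wgt γ f) w (bFun γ a)) := by
    rw [← fourierCoef_finsetSum _ fun l _ => hi l, fourierCoef_eq, sip, map_mul,
      Complex.conj_ofReal,
      ← integral_conj]
    push_cast
    congr 1
    refine integral_congr_ae ?_
    filter_upwards [hC, hg.posSemidef] with t h7 h8
    rw [sf_conj h8.1, sf_self_eq h8.1, h7, neg_zero, ee_zero, one_mul]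
    rfl
  rw [pairing, h5.tsum_eq, h6, h1, Complex.conj_ofReal, Complex.ofReal_re]

theorem IsFInverse.optMse_eq (hγ : γ.Positive) (ha : IsAdmissible γ a) (hf : IsSpectralDensity f)
    (hm : IsMinimal γ f) {c : ℕ → Fin T → ℂ} {C : ℝ → Fin T → ℂ} (h : IsFInverse γ a f c C) :
    optMse γ a f = ENNReal.ofReal (pairing γ a c) := by
  rw [(h.isResidual hγ ha hf hm).optMse_eq hγ ha hf, h.pairing_eq hγ ha hf hm]

theorem exists_isFInverse (hγ : γ.Positive) (ha : IsAdmissible γ a) (hf : IsSpectralDensity f)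
    (hm : IsMinimal γ f) : ∃ c C, IsFInverse γ a f c C := by
  obtain ⟨w, hw⟩ := exists_residual (hf.wgt hγ) (hm.coercive hγ hf) (memW_bFun ha (hf.wgt hγ))
  exact ⟨_, _, hw.isFInverse hγ ha hf hm⟩

theorem IsFInverse.unique (hγ : γ.Positive) (ha : IsAdmissible γ a) (hf : IsSpectralDensity f)
    (hm : IsMinimal γ f) {c c' : ℕ → Fin T → ℂ} {C C' : ℝ → Fin T → ℂ}
    (h : IsFInverse γ a f c C) (h' : IsFInverse γ a f c' C') : c' = c := by
  have h1 := (h.isResidual hγ ha hf hm).ae_eq (hf.wgt hγ) (hm.coercive hγ hf)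
    (h'.isResidual hγ ha hf hm)
  have h2 : C =ᵐ[circ] C' := by
    filter_upwards [h1, ae_symbolF_mulVec hγ hm] with t h3 h4
    rw [← h4.2 (C t), ← h4.2 (C' t), h3]
  ext k p
  rw [← h.analytic.coef p k, ← h'.analytic.coef p k]
  exact fourierCoef_congr (h2.mono fun t ht => by simp only [ht]) _

/-- The function `h⁰` is `χ / β` times the projection of `bFun` onto the past. -/
theorem specChar_ae_eq (hγ : γ.Positive) (C : ℝ → Fin T → ℂ) :
    (fun t => (chi γ t / beta γ t) • (bFun γ a t - symbolF γ f t *ᵥ C t)) =ᵐ[circ]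
      specChar γ a f C := by
  filter_upwards [ae_chi_ne_zero γ hγ, ae_beta_ne_zero γ hγ] with t h1 h2
  rw [specChar, smul_sub]
  congr 1
  rw [symbolF, smul_mulVec, mulVec_transpose, smul_smul]
  congr 1
  have h3 : (((gain γ t)⁻¹ : ℝ) : ℂ) =
      (conj (beta γ t) * beta γ t) / (conj (chi γ t) * chi γ t) := by
    rw [gain, Complex.conj_mul', Complex.conj_mul']; push_cast; rw [inv_div]
  have h4 : conj (chi γ t) ≠ 0 := (map_ne_zero _).mpr h1
  rw [h3]; field_simp

theorem IsFInverse.isOptimal (hγ : γ.Positive) (ha : IsAdmissible γ a) (hf : IsSpectralDensity f)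
    (hm : IsMinimal γ f) {c : ℕ → Fin T → ℂ} {C : ℝ → Fin T → ℂ} (h : IsFInverse γ a f c C) :
    IsOptimal γ a f (specChar γ a f C) := by
  have hr := h.isResidual hγ ha hf hm
  have h1 := smul_mem_L2past hγ hf hr.inPast
  refine ⟨mem_L2past_congr h1 (specChar_ae_eq hγ C), fun h' hh' => ?_⟩
  have h2 : mse γ a (specChar γ a f C) f = optMse γ a f := by
    rw [← mse_congr (specChar_ae_eq hγ C), mse_smul, hr.optMse_eq hγ ha hf]
    simp only [sub_sub_cancel]
    exact normSqL2_eq (hf.wgt hγ) hr.memW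
  rw [h2]
  exact iInf₂_le h' hh'

end inverse

/-! ### Mean square errors of linear estimates -/

section stochastic

variable {Ω : Type*} [MeasurableSpace Ω] {P : Measure Ω} {γ : GMIndex r}
  {f : ℝ → Matrix (Fin T) (Fin T) ℂ} {ξ : Fin T → ℤ → Ω → ℂ}

theorem HasSpectralDensity.memLp_gmInc (hγ : γ.Positive) (h : HasSpectralDensity P γ ξ f)
    (p : Fin T) (m : ℤ) : MemLp (fun ω => gmInc γ (fun k => ξ p k ω) m) 2 P :=
  h.memLp γ.mu (fun j => (hγ j).1) p m

theorem HasSpectralDensity.integrable_mul_conj (hγ : γ.Positive) (h : HasSpectralDensity P γ ξ f)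
    (p l : Fin T) (m k : ℤ) : Integrable (fun ω => gmInc γ (fun k => ξ p k ω) m *
      conj (gmInc γ (fun k => ξ l k ω) k)) P :=
  (h.memLp_gmInc hγ p m).integrable_mul (h.memLp_gmInc hγ l k).star

/-- The covariances of the increments are Fourier coefficients of the weight. -/
theorem HasSpectralDensity.integral_mul_conj (hγ : γ.Positive) (h : HasSpectralDensity P γ ξ f)
    (p l : Fin T) (m k : ℤ) : ∫ ω, gmInc γ (fun k => ξ p k ω) m *
      conj (gmInc γ (fun k => ξ l k ω) k) ∂P =
        (1 / (2 * (Real.pi : ℂ))) * ∫ t, ee (m - k) t * wgt γ f t p l ∂circ := by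
  have h1 := h.cov γ.mu γ.mu (fun j => (hγ j).1) (fun j => (hγ j).1) p l k (m - k)
  have h2 : k + (m - k) = m := by ring
  rw [h2] at h1
  refine h1.trans ?_
  congr 2
  ext t
  have h3 : chi (γ.withStep γ.mu) t = chi γ t := rfl
  rw [h3, Complex.mul_conj', wgt, Matrix.smul_apply, smul_eq_mul, gain, ee, mul_assoc]
  push_cast
  ring

/-- The increments are mapped isometrically to exponentials in `L₂` of the weight. -/
theorem HasSpectralDensity.lintegral_sum (hγ : γ.Positive) (hf : IsSpectralDensity f)
    (h : HasSpectralDensity P γ ξ f) {ι : Type*} (S : Finset ι) (n : ι → ℤ) (v : ι → Fin T → ℂ) :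
    ∫⁻ ω, ‖∑ i ∈ S, v i ⬝ᵥ fun p => gmInc γ (fun k => ξ p k ω) (n i)‖ₑ ^ 2 ∂P =
      ENNReal.ofReal (nq (wgt γ f) (fun t => ∑ i ∈ S, ee (n i) t • v i)) := by
  set Y : Fin T → ℤ → Ω → ℂ := fun p m ω => gmInc γ (fun k => ξ p k ω) m with hY
  set Z : Ω → ℂ := fun ω => ∑ x ∈ S ×ˢ (Finset.univ : Finset (Fin T)), v x.1 x.2 * Y x.2 (n x.1) ω
    with hZ
  have hZe : ∀ ω, ∑ i ∈ S, v i ⬝ᵥ (fun p => gmInc γ (fun k => ξ p k ω) (n i)) = Z ω := by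
    intro ω
    simp only [hZ]
    rw [Finset.sum_product]
    rfl
  simp only [hZe]
  have hZm : MemLp Z 2 P := memLp_finsetSum _ fun x _ => (h.memLp_gmInc hγ x.2 (n x.1)).const_mul _
  have hZ2 : Integrable (fun ω => ‖Z ω‖ ^ 2) P := hZm.integrable_norm_pow two_ne_zero
  have h1 : ∫⁻ ω, ‖Z ω‖ₑ ^ 2 ∂P = ENNReal.ofReal (∫ ω, ‖Z ω‖ ^ 2 ∂P) := by
    rw [ofReal_integral_eq_lintegral_ofReal hZ2 (Eventually.of_forall fun ω => by positivity)]
    refine lintegral_congr fun ω => ?_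
    rw [ENNReal.ofReal_pow (norm_nonneg _), ofReal_norm]
  rw [h1]
  congr 1
  have hg := hf.wgt hγ
  set U : ℝ → Fin T → ℂ := fun t => ∑ i ∈ S, ee (n i) t • v i with hU
  apply Complex.ofReal_injective
  rw [← sip_self hg]
  have h2 : ((∫ ω, ‖Z ω‖ ^ 2 ∂P : ℝ) : ℂ) = ∫ ω, Z ω * conj (Z ω) ∂P := by
    rw [← integral_complex_ofReal]
    congr 1; ext ω
    rw [Complex.mul_conj']; push_cast; rfl
  have h3 : ∀ ω, Z ω * conj (Z ω) = ∑ x ∈ S ×ˢ (Finset.univ : Finset (Fin T)),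
      ∑ y ∈ S ×ˢ (Finset.univ : Finset (Fin T)), v x.1 x.2 * conj (v y.1 y.2) *
        (Y x.2 (n x.1) ω * conj (Y y.2 (n y.1) ω)) := by
    intro ω
    rw [hZ]
    simp only
    rw [map_sum, Finset.sum_mul_sum]
    refine Finset.sum_congr rfl fun x _ => Finset.sum_congr rfl fun y _ => ?_
    rw [map_mul]; ring
  have h4 : ∀ t, sf (wgt γ f t) (U t) (U t) = ∑ x ∈ S ×ˢ (Finset.univ : Finset (Fin T)),
      ∑ y ∈ S ×ˢ (Finset.univ : Finset (Fin T)), v x.1 x.2 * conj (v y.1 y.2) *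
        (ee (n x.1 - n y.1) t * wgt γ f t x.2 y.2) := by
    intro t
    have hUp : ∀ p, U t p = ∑ i ∈ S, ee (n i) t * v i p := fun p => by
      simp [hU, Finset.sum_apply]
    rw [sf_eq_sum, Finset.sum_product_right]
    refine Finset.sum_congr rfl fun p _ => ?_
    simp only [hUp, Finset.sum_mul]
    rw [Finset.sum_comm]
    refine Finset.sum_congr rfl fun i _ => ?_
    rw [Finset.sum_product_right]
    refine Finset.sum_congr rfl fun l _ => ?_
    rw [map_sum, Finset.mul_sum, Finset.mul_sum]
    refine Finset.sum_congr rfl fun j _ => ?_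
    rw [map_mul, conj_ee, sub_eq_add_neg, ee_add]; ring
  have hi : ∀ x y : ι × Fin T, Integrable (fun ω => v x.1 x.2 * conj (v y.1 y.2) *
        (Y x.2 (n x.1) ω * conj (Y y.2 (n y.1) ω))) P := fun x y =>
    (h.integrable_mul_conj hγ x.2 y.2 (n x.1) (n y.1)).const_mul _
  have hj : ∀ x y : ι × Fin T, Integrable (fun t => v x.1 x.2 * conj (v y.1 y.2) *
        (ee (n x.1 - n y.1) t * wgt γ f t x.2 y.2)) circ := fun x y =>
    (Integrable.ee_mul (hg.integrable x.2 y.2) _).const_mul _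
  rw [h2, sip]
  simp only [h3, h4]
  rw [integral_finsetSum _ fun x _ => integrable_finsetSum _ fun y _ => hi x y,
    integral_finsetSum _ fun x _ => integrable_finsetSum _ fun y _ => hj x y, Finset.mul_sum]
  refine Finset.sum_congr rfl fun x _ => ?_
  rw [integral_finsetSum _ fun y _ => hi x y, integral_finsetSum _ fun y _ => hj x y,
    Finset.mul_sum]
  refine Finset.sum_congr rfl fun y _ => ?_
  rw [integral_const_mul, integral_const_mul, h.integral_mul_conj hγ]
  push_cast; ring

variable {a : ℕ → Fin T → ℂ}

theorem functionalA_sub_estimateA (p : ℕ →₀ (Fin T → ℂ)) (x : Fin T → ℤ → ℂ) :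
    functionalA γ a x - estimateA γ a p x =
      (∑' k : ℕ, bCoef γ a k ⬝ᵥ fun l => gmInc γ (x l) (k : ℤ)) -
        p.sum fun k v => v ⬝ᵥ fun l => gmInc γ (x l) (-((k : ℤ) + 1)) := by
  rw [functionalA, estimateA]; ring

theorem norm_dotProduct_le (u v : Fin T → ℂ) : ‖u ⬝ᵥ v‖ ≤ ‖u‖ * ∑ l, ‖v l‖ := by
  rw [dotProduct, Finset.mul_sum]
  refine norm_sum_le_of_le _ fun l _ => ?_
  rw [norm_mul]
  exact mul_le_mul_of_nonneg_right (norm_le_pi_norm _ _) (norm_nonneg _)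

/-- The mean square error of a finite linear estimate is `Δ(h; f)`. -/
theorem HasSpectralDensity.lintegral_error (hγ : γ.Positive) (ha : IsAdmissible γ a)
    (hf : IsSpectralDensity f) (h : HasSpectralDensity P γ ξ f) (p : ℕ →₀ (Fin T → ℂ)) :
    ∫⁻ ω, ‖functionalA γ a (fun p k => ξ p k ω) - estimateA γ a p (fun p k => ξ p k ω)‖ₑ ^ 2 ∂P =
      mse γ a (pastPoly γ p) f := by
  have hg := hf.wgt hγ
  rw [mse_pastPoly hγ ha hf]
  set Y : ℤ → Ω → Fin T → ℂ := fun m ω l => gmInc γ (fun k => ξ l k ω) m with hY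
  have hYm : ∀ m l, MemLp (fun ω => Y m ω l) 2 P := fun m l => h.memLp_gmInc hγ l m
  set E : Ω → ℂ := fun ω => ∑ k ∈ p.support, p k ⬝ᵥ Y (-((k : ℤ) + 1)) ω with hE
  set Z : ℕ → Ω → ℂ := fun N ω => ∑ k ∈ Finset.range N, bCoef γ a k ⬝ᵥ Y k ω - E ω with hZ
  have hgoal : ∀ ω, functionalA γ a (fun p k => ξ p k ω) - estimateA γ a p (fun p k => ξ p k ω) =
      (∑' k : ℕ, bCoef γ a k ⬝ᵥ Y k ω) - E ω := fun ω => functionalA_sub_estimateA p _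
  simp only [hgoal]
  -- the errors of the partial sums
  have hZN : ∀ N, ∫⁻ ω, ‖Z N ω‖ₑ ^ 2 ∂P = ENNReal.ofReal (nq (wgt γ f) (fun t =>
      ∑ k ∈ Finset.range N, ee k t • bCoef γ a k - pastTrig p t)) := by
    intro N
    have h1 := h.lintegral_sum hγ hf ((Finset.range N).disjSum p.support)
      (Sum.elim (fun k => (k : ℤ)) (fun k => -((k : ℤ) + 1)))
      (Sum.elim (fun k => bCoef γ a k) (fun k => -p k))
    simp only [Finset.sum_disjSum, Sum.elim_inl, Sum.elim_inr, neg_dotProduct,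
      Finset.sum_neg_distrib, smul_neg, ← sub_eq_add_neg] at h1
    refine h1.trans ?_
    congr 2; ext t : 1
    congr 1
    rw [pastTrig, Finsupp.sum]
    refine Finset.sum_congr rfl fun k _ => ?_
    rw [exp_eq_ee]
  have hYsm : ∀ m l, AEStronglyMeasurable (fun ω => Y m ω l) P := fun m l => (hYm m l).1
  have hdot : ∀ (m : ℤ) (u : Fin T → ℂ), AEStronglyMeasurable (fun ω => u ⬝ᵥ Y m ω) P := by
    intro m u
    simp only [dotProduct]
    exact Finset.aestronglyMeasurable_fun_sum _ fun l _ =>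
      aestronglyMeasurable_const.mul (hYsm m l)
  have hEm : AEStronglyMeasurable E P :=
    Finset.aestronglyMeasurable_fun_sum _ fun k _ => hdot _ _
  have hZm : ∀ N, AEStronglyMeasurable (Z N) P := fun N =>
    (Finset.aestronglyMeasurable_fun_sum _ fun k _ => hdot _ _).sub hEm
  -- a square integrable bound for the partial sums
  set S := ∑' k, ‖bCoef γ a k‖ with hS
  have hS0 : 0 ≤ S := tsum_nonneg fun _ => norm_nonneg _
  set y : ℕ → Ω → ℝ := fun k ω => ∑ l, ‖Y k ω l‖ with hy
  have hy0 : ∀ k ω, 0 ≤ y k ω := fun k ω => Finset.sum_nonneg fun l _ => norm_nonneg _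
  have hym : ∀ k, AEStronglyMeasurable (y k) P := fun k =>
    Finset.aestronglyMeasurable_fun_sum _ fun l _ => (hYsm _ l).norm
  set D : Ω → ℝ≥0∞ := fun ω => ENNReal.ofReal (2 * S) *
    (∑' k : ℕ, ENNReal.ofReal (‖bCoef γ a k‖ * y k ω ^ 2)) + 2 * ‖E ω‖ₑ ^ 2 with hD
  have hEfin : ∫⁻ ω, ‖E ω‖ₑ ^ 2 ∂P < ∞ := by
    have h1 := h.lintegral_sum hγ hf p.support (fun k => -((k : ℤ) + 1)) (fun k => p k)
    have h2 : ∫⁻ ω, ‖E ω‖ₑ ^ 2 ∂P = _ := h1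
    rw [h2]
    exact ENNReal.ofReal_lt_top
  set A : ℝ := T * ∑ l : Fin T, nq (wgt γ f) (fun _ => Pi.single l 1) with hA
  have hyA : ∀ k : ℕ, ∫⁻ ω, ENNReal.ofReal (y k ω ^ 2) ∂P ≤ ENNReal.ofReal A := by
    intro k
    have h1 : ∀ l, ∫⁻ ω, ‖Y k ω l‖ₑ ^ 2 ∂P =
        ENNReal.ofReal (nq (wgt γ f) (fun _ => Pi.single l 1)) := by
      intro l
      have h2 := h.lintegral_sum hγ hf {()} (fun _ => (k : ℤ)) (fun _ => Pi.single l 1)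
      simp only [Finset.sum_singleton, single_dotProduct, one_mul] at h2
      refine h2.trans ?_
      congr 1
      simp only [nq, qf_smul, norm_ee, one_pow, one_mul]
    calc ∫⁻ ω, ENNReal.ofReal (y k ω ^ 2) ∂P
        ≤ ∫⁻ ω, (T : ℝ≥0∞) * ∑ l, ‖Y k ω l‖ₑ ^ 2 ∂P := by
          refine lintegral_mono fun ω => ?_
          have h2 : y k ω ^ 2 ≤ T * ∑ l, ‖Y k ω l‖ ^ 2 := by
            have := sq_sum_le_card_mul_sum_sq (s := (Finset.univ : Finset (Fin T)))
              (f := fun l => ‖Y k ω l‖)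
            simpa using this
          refine (ENNReal.ofReal_le_ofReal h2).trans (le_of_eq ?_)
          rw [ENNReal.ofReal_mul (by positivity), ENNReal.ofReal_natCast,
            ENNReal.ofReal_sum_of_nonneg fun l _ => by positivity]
          congr 1
          refine Finset.sum_congr rfl fun l _ => ?_
          rw [ENNReal.ofReal_pow (norm_nonneg _), ofReal_norm]
      _ = ENNReal.ofReal A := by
          rw [lintegral_const_mul' _ _ (ENNReal.natCast_ne_top T), lintegral_finsetSum']
          · rw [hA, ENNReal.ofReal_mul (by positivity), ENNReal.ofReal_natCast,
              ENNReal.ofReal_sum_of_nonneg fun l _ => nq_nonneg hg _]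
            simp only [h1]
          · exact fun l _ => (hYsm _ l).enorm.pow_const 2
  have hym2 : ∀ k : ℕ, AEMeasurable (fun ω => ENNReal.ofReal (‖bCoef γ a k‖ * y k ω ^ 2)) P :=
    fun k => (((hym k).pow 2).const_mul _).aemeasurable.ennreal_ofReal
  have hser : ∫⁻ ω, (∑' k : ℕ, ENNReal.ofReal (‖bCoef γ a k‖ * y k ω ^ 2)) ∂P < ∞ := by
    rw [lintegral_tsum hym2]
    have h1 : ∀ k : ℕ, ∫⁻ ω, ENNReal.ofReal (‖bCoef γ a k‖ * y k ω ^ 2) ∂P ≤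
        ENNReal.ofReal (‖bCoef γ a k‖ * A) := by
      intro k
      have hA0 : 0 ≤ A := mul_nonneg (by positivity) (Finset.sum_nonneg fun l _ => nq_nonneg hg _)
      simp only [ENNReal.ofReal_mul (norm_nonneg (bCoef γ a k))]
      rw [lintegral_const_mul' _ _ ENNReal.ofReal_ne_top]
      exact mul_le_mul_right (hyA k) _
    have hA0 : 0 ≤ A := mul_nonneg (by positivity) (Finset.sum_nonneg fun l _ => nq_nonneg hg _)
    refine (ENNReal.tsum_le_tsum h1).trans_lt ?_
    rw [← ENNReal.ofReal_tsum_of_nonneg (fun k => by positivity) (ha.summable_b.mul_right A)]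
    exact ENNReal.ofReal_lt_top
  have hDfin : ∫⁻ ω, D ω ∂P ≠ ∞ := by
    rw [hD, lintegral_add_right' _ ((hEm.enorm.pow_const 2).const_mul 2),
      lintegral_const_mul' _ _ ENNReal.ofReal_ne_top, lintegral_const_mul' _ _ (by simp)]
    exact (ENNReal.add_lt_top.mpr ⟨ENNReal.mul_lt_top ENNReal.ofReal_lt_top hser,
      ENNReal.mul_lt_top (by simp) hEfin⟩).ne
  have hbound : ∀ N ω, ‖Z N ω‖ₑ ^ 2 ≤ D ω := by
    intro N ω
    have h1 : ‖∑ k ∈ Finset.range N, bCoef γ a k ⬝ᵥ Y k ω‖ ≤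
        ∑ k ∈ Finset.range N, ‖bCoef γ a k‖ * y k ω :=
      norm_sum_le_of_le _ fun k _ => norm_dotProduct_le _ _
    have h2 : (∑ k ∈ Finset.range N, ‖bCoef γ a k‖ * y k ω) ^ 2 ≤
        (∑ k ∈ Finset.range N, ‖bCoef γ a k‖) *
          ∑ k ∈ Finset.range N, ‖bCoef γ a k‖ * y k ω ^ 2 :=
      Finset.sum_sq_le_sum_mul_sum_of_sq_le_mul _ (fun k _ => norm_nonneg _)
        (fun k _ => by positivity) fun k _ => le_of_eq (by ring)
    have h3 : ∑ k ∈ Finset.range N, ‖bCoef γ a k‖ ≤ S :=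
      ha.summable_b.sum_le_tsum _ fun k _ => norm_nonneg _
    have h4 : 0 ≤ ∑ k ∈ Finset.range N, ‖bCoef γ a k‖ * y k ω ^ 2 :=
      Finset.sum_nonneg fun k _ => by positivity
    have h5 : ‖Z N ω‖ ^ 2 ≤ 2 * S * (∑ k ∈ Finset.range N, ‖bCoef γ a k‖ * y k ω ^ 2) +
        2 * ‖E ω‖ ^ 2 := by
      have h6 := norm_sub_le (∑ k ∈ Finset.range N, bCoef γ a k ⬝ᵥ Y k ω) (E ω)
      have h7 := pow_le_pow_left₀ (norm_nonneg _) h1 2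
      have h8 := mul_le_mul_of_nonneg_right h3 h4
      have h9 := pow_le_pow_left₀ (norm_nonneg _) h6 2
      rw [hZ]
      simp only
      nlinarith [sq_nonneg (‖∑ k ∈ Finset.range N, bCoef γ a k ⬝ᵥ Y k ω‖ - ‖E ω‖)]
    rw [← ofReal_norm, ← ENNReal.ofReal_pow (norm_nonneg _)]
    refine (ENNReal.ofReal_le_ofReal h5).trans ?_
    rw [ENNReal.ofReal_add (by positivity) (by positivity),
      ENNReal.ofReal_mul (p := 2 * S) (by positivity),
      ENNReal.ofReal_mul (p := 2) (q := ‖E ω‖ ^ 2) zero_le_two,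
      ENNReal.ofReal_pow (norm_nonneg _), ofReal_norm, hD,
      ENNReal.ofReal_sum_of_nonneg fun k _ => by positivity, ENNReal.ofReal_ofNat]
    exact add_le_add_left (mul_le_mul_right (ENNReal.sum_le_tsum _) _) _
  have hlim : ∀ᵐ ω ∂P, Tendsto (fun N => ‖Z N ω‖ₑ ^ 2) atTop
      (𝓝 (‖(∑' k : ℕ, bCoef γ a k ⬝ᵥ Y k ω) - E ω‖ₑ ^ 2)) := by
    have hae := ae_lt_top' (AEMeasurable.tsum hym2) hser.ne
    filter_upwards [hae] with ω hω
    have h1 : Summable fun k : ℕ => ‖bCoef γ a k‖ * y k ω ^ 2 := by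
      refine (ENNReal.summable_toReal hω.ne).congr fun k => ?_
      rw [ENNReal.toReal_ofReal (by positivity)]
    have h2 : Summable fun k : ℕ => bCoef γ a k ⬝ᵥ Y k ω := by
      refine Summable.of_norm_bounded (ha.summable_b.add h1) fun k => ?_
      refine (norm_dotProduct_le _ _).trans ?_
      have : y k ω ≤ 1 + y k ω ^ 2 := by nlinarith [sq_nonneg (y k ω - 1), hy0 k ω]
      have := mul_le_mul_of_nonneg_left this (norm_nonneg (bCoef γ a k))
      linarith
    have h3 := (h2.hasSum.tendsto_sum_nat.sub_const (E ω)).enorm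
    exact ((ENNReal.continuous_pow 2).tendsto _).comp h3
  have hL := tendsto_lintegral_of_dominated_convergence' D
    (fun N => ((hZm N).enorm.pow_const 2)) (fun N => Eventually.of_forall (hbound N)) hDfin hlim
  simp only [hZN] at hL
  -- the spectral side
  refine tendsto_nhds_unique hL ((ENNReal.continuous_ofReal.tendsto _).comp ?_)
  refine Tendsto.const_mul _ ?_
  have hpart : ∀ N t l, ‖(∑ k ∈ Finset.range N, ee k t • bCoef γ a k - pastTrig p t) l‖ ≤
      S + ∑ k ∈ p.support, ‖p k‖ := by
    intro N t l
    rw [Pi.sub_apply]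
    refine (norm_sub_le _ _).trans (add_le_add ?_ (norm_pastTrig_le p t l))
    rw [Finset.sum_apply]
    refine (norm_sum_le_of_le _ fun k _ => ?_).trans
      (ha.summable_b.sum_le_tsum (Finset.range N) fun k _ => norm_nonneg _)
    rw [Pi.smul_apply, norm_smul, norm_ee, one_mul]
    exact norm_le_pi_norm _ _
  have hcont : ∀ N : ℕ, Continuous fun t => ∑ k ∈ Finset.range N, ee k t • bCoef γ a k -
      pastTrig p t := fun N => by
    refine (continuous_finsetSum _ fun k _ => ?_).sub (continuous_pastTrig p)
    exact (continuous_ee _).smul continuous_const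
  set M := S + ∑ k ∈ p.support, ‖p k‖ with hM
  refine tendsto_integral_of_dominated_convergence
    (fun t => (∑ _l : Fin T, M ^ 2) * (wgt γ f t).trace.re)
    (fun N => aestronglyMeasurable_qf hg (MeasV.of_continuous (hcont N)))
    (hg.trace_integrable.const_mul _) (fun N => ?_) ?_
  · filter_upwards [hg.posSemidef] with t ht
    rw [Real.norm_of_nonneg (qf_nonneg ht _)]
    refine (qf_le_trace ht _).trans (mul_le_mul_of_nonneg_right
      (Finset.sum_le_sum fun l _ => pow_le_pow_left₀ (norm_nonneg _) (hpart N t l) 2) ?_)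
    rw [Matrix.trace, Complex.re_sum]
    exact Finset.sum_nonneg fun l _ => PosSemidef_diag_re_nonneg ht l
  · refine Eventually.of_forall fun t => ?_
    have hs : Summable fun k : ℕ => ee k t • bCoef γ a k := by
      refine Summable.of_norm ?_
      simpa only [norm_smul, norm_ee, one_mul] using ha.summable_b
    have h1 : Tendsto (fun N => ∑ k ∈ Finset.range N, ee k t • bCoef γ a k - pastTrig p t) atTop
        (𝓝 (bFun γ a t - pastTrig p t)) := hs.hasSum.tendsto_sum_nat.sub_const _
    simp only [qf, sf_eq_sum]
    refine (Complex.continuous_re.tendsto _).comp ?_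
    refine tendsto_finsetSum _ fun i _ => tendsto_finsetSum _ fun l _ => ?_
    refine ((tendsto_pi_nhds.mp h1) i).mul (tendsto_const_nhds.mul ?_)
    exact (Complex.continuous_conj.tendsto _).comp ((tendsto_pi_nhds.mp h1) l)

end stochastic

/-! ### Minimality of mixtures and convexity of the classes -/

theorem aestronglyMeasurable_det {m : ℕ} {A : ℝ → Matrix (Fin m) (Fin m) ℂ}
    (hA : ∀ p l, AEStronglyMeasurable (fun t => A t p l) circ) :
    AEStronglyMeasurable (fun t => (A t).det) circ := by
  simp only [det_apply]
  refine Finset.aestronglyMeasurable_fun_sum _ fun σ _ => AEStronglyMeasurable.const_smul ?_ _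
  exact Finset.aestronglyMeasurable_fun_prod _ fun i _ => hA _ _

theorem aestronglyMeasurable_inv_apply {m : ℕ} {A : ℝ → Matrix (Fin m) (Fin m) ℂ}
    (hA : ∀ p l, AEStronglyMeasurable (fun t => A t p l) circ) (p l : Fin m) :
    AEStronglyMeasurable (fun t => (A t)⁻¹ p l) circ := by
  have h0 : ∀ t, (A t)⁻¹ p l = ((A t).det)⁻¹ •
      ((A t).updateRow l (Pi.single p 1)).det := fun t => by
    rw [Matrix.inv_def, Matrix.smul_apply, Ring.inverse_eq_inv', adjugate_apply]
  simp only [h0]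
  refine AEStronglyMeasurable.smul
    (aestronglyMeasurable_det hA).aemeasurable.inv.aestronglyMeasurable
    (aestronglyMeasurable_det fun i j => ?_)
  by_cases h : i = l
  · subst h
    simp only [updateRow_self]
    exact aestronglyMeasurable_const
  · simp only [updateRow_ne h]
    exact hA i j

/-- Inversion is antitone on the diagonal. -/
theorem inv_diag_re_le {M N : Matrix (Fin T) (Fin T) ℂ} (hN : N.PosSemidef) (hNu : IsUnit N.det)
    (hMu : IsUnit M.det) (h : ∀ u, qf N u ≤ qf M u) (l : Fin T) :
    (M⁻¹ l l).re ≤ (N⁻¹ l l).re := by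
  set u : Fin T → ℂ := star (M⁻¹ *ᵥ Pi.single l 1) with hu
  have h1 : sf M u u = u l := by
    rw [sf, hu, star_star, mulVec_mulVec, mul_nonsing_inv _ hMu, one_mulVec]
    simp
  have h2 : u l = conj (M⁻¹ l l) := by
    rw [hu]; simp
  have h3 : qf M u = (M⁻¹ l l).re := by
    rw [qf, h1, h2, conj_re]
  have h4 := two_mul_norm_apply_le hN hNu u l
  have h5 : (M⁻¹ l l).re ≤ ‖u l‖ := by
    rw [h2, RCLike.norm_conj]
    exact re_le_norm _
  linarith [h u]

section mixtures

variable {γ : GMIndex r} {f f₀ : ℝ → Matrix (Fin T) (Fin T) ℂ}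

/-- A mixture with a minimal density is minimal. -/
theorem IsMinimal.mix (hf : IsSpectralDensity f) (hf₀ : IsSpectralDensity f₀)
    (hm : IsMinimal γ f₀) {s : ℝ} (hs : 0 < s) (hs1 : 0 ≤ 1 - s) :
    IsMinimal γ (fun t => ((1 - s : ℝ) : ℂ) • f t + (s : ℂ) • f₀ t) := by
  have hsum := (hf.const_smul hs1).add (hf₀.const_smul hs.le)
  have hs0 : (s : ℂ) ≠ 0 := by exact_mod_cast hs.ne'
  have key : ∀ᵐ t ∂circ, IsUnit (((1 - s : ℝ) : ℂ) • f t + (s : ℂ) • f₀ t).det ∧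
      ∀ l, ((((1 - s : ℝ) : ℂ) • f t + (s : ℂ) • f₀ t)⁻¹ l l).re ≤ s⁻¹ * ((f₀ t)⁻¹ l l).re := by
    filter_upwards [hf.posSemidef, hf₀.posSemidef, hsum.posSemidef, hm.isUnit_det]
      with t h1 h2 h3 h4
    have hN : ((s : ℂ) • f₀ t).PosSemidef := h2.smul (by exact_mod_cast hs.le)
    have hNu : IsUnit ((s : ℂ) • f₀ t).det := by
      rw [det_smul]
      exact (IsUnit.mk0 _ (pow_ne_zero _ hs0)).mul h4
    have hle : ∀ u, qf ((s : ℂ) • f₀ t) u ≤ qf (((1 - s : ℝ) : ℂ) • f t + (s : ℂ) • f₀ t) u := by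
      intro u
      rw [qf_add_weight, qf_smul_weight]
      exact le_add_of_nonneg_left (qf_nonneg (h1.smul (by exact_mod_cast hs1)) u)
    have hNp : ((s : ℂ) • f₀ t).PosDef :=
      hN.posDef_iff_isUnit.mpr ((Matrix.isUnit_iff_isUnit_det _).mpr hNu)
    have hMu := (Matrix.isUnit_iff_isUnit_det _).mp
      ((hNp.posSemidef_add (h1.smul (by exact_mod_cast hs1))).isUnit)
    refine ⟨hMu, fun l => (inv_diag_re_le hN hNu hMu hle l).trans (le_of_eq ?_)⟩
    have hinv : ((s : ℂ) • f₀ t)⁻¹ = (s : ℂ)⁻¹ • (f₀ t)⁻¹ := by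
      refine Matrix.inv_eq_right_inv ?_
      rw [smul_mul_smul_comm, mul_nonsing_inv _ h4, mul_inv_cancel₀ hs0, one_smul]
    rw [hinv, Matrix.smul_apply, smul_eq_mul, ← ofReal_inv, re_ofReal_mul]
  refine ⟨key.mono fun t h => h.1, ?_⟩
  have hmeas : AEStronglyMeasurable (fun t => (gain γ t)⁻¹ *
      ((((1 - s : ℝ) : ℂ) • f t + (s : ℂ) • f₀ t)⁻¹).trace.re) circ := by
    refine (measurable_gain γ).inv.aestronglyMeasurable.mul ?_
    refine Complex.continuous_re.comp_aestronglyMeasurable ?_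
    exact Finset.aestronglyMeasurable_fun_sum _ fun l _ =>
      aestronglyMeasurable_inv_apply hsum.meas l l
  refine (hm.integrable.const_mul s⁻¹).mono' hmeas ?_
  filter_upwards [key, hsum.posSemidef] with t ht h3
  have h0 : 0 ≤ ((((1 - s : ℝ) : ℂ) • f t + (s : ℂ) • f₀ t)⁻¹).trace.re := by
    rw [Matrix.trace, re_sum]
    exact Finset.sum_nonneg fun l _ => PosSemidef_diag_re_nonneg h3.inv l
  have hg0 : 0 ≤ (gain γ t)⁻¹ := inv_nonneg.mpr (gain_nonneg γ t)
  rw [Real.norm_of_nonneg (mul_nonneg hg0 h0), mul_left_comm]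
  refine mul_le_mul_of_nonneg_left ?_ hg0
  simp only [Matrix.trace, re_sum, Finset.mul_sum]
  exact Finset.sum_le_sum fun l _ => ht.2 l

theorem moment_mix (hγ : γ.Positive) {u v : ℝ → ℂ} (hu : Integrable u circ)
    (hv : Integrable v circ) (x y : ℂ) :
    moment γ (fun t => x * u t + y * v t) = x * moment γ u + y * moment γ v := by
  have h1 : Integrable (fun t => x * (((gain γ t : ℝ) : ℂ) * u t)) circ :=
    (Integrable.gain_mul hγ hu).const_mul x
  have h2 : Integrable (fun t => y * (((gain γ t : ℝ) : ℂ) * v t)) circ :=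
    (Integrable.gain_mul hγ hv).const_mul y
  have h3 : ∀ t, ((gain γ t : ℝ) : ℂ) * (x * u t + y * v t) =
      x * (((gain γ t : ℝ) : ℂ) * u t) + y * (((gain γ t : ℝ) : ℂ) * v t) := fun t => by ring
  rw [moment, moment, moment]
  simp only [h3]
  rw [integral_add h1 h2, integral_const_mul, integral_const_mul]
  ring

theorem IsSpectralDensity.integrable_trace_mul (hf : IsSpectralDensity f)
    (B : Matrix (Fin T) (Fin T) ℂ) : Integrable (fun t => (B * f t).trace) circ := by
  simp only [Matrix.trace, diag_apply, mul_apply]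
  exact integrable_finsetSum _ fun i _ => integrable_finsetSum _ fun j _ =>
    (hf.integrable j i).const_mul _

/-- The restriction on the trace is the weighted one with `B₁ = 1`. -/
theorem densities_trace_eq (ε p : ℝ) (f₁ : ℝ → Matrix (Fin T) (Fin T) ℂ) :
    (ContamClass.trace p : ContamClass T).densities γ ε f₁ =
      (ContamClass.weighted 1 p).densities γ ε f₁ := by
  simp only [ContamClass.densities, Matrix.one_mul]

variable {ε : ℝ} {f₁ : ℝ → Matrix (Fin T) (Fin T) ℂ} {κ : ContamClass T}

theorem isSpectralDensity_of_mem (hf : f ∈ κ.densities γ ε f₁) : IsSpectralDensity f := by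
  cases κ <;> exact hf.1

theorem mix_mem_densities (hγ : γ.Positive) (hf : f ∈ κ.densities γ ε f₁)
    (hf₀ : f₀ ∈ κ.densities γ ε f₁) {s : ℝ} (hs : 0 ≤ s) (hs1 : 0 ≤ 1 - s) :
    (fun t => ((1 - s : ℝ) : ℂ) • f t + (s : ℂ) • f₀ t) ∈ κ.densities γ ε f₁ := by
  have hd := ((isSpectralDensity_of_mem hf).const_smul hs1).add
    ((isSpectralDensity_of_mem hf₀).const_smul hs)
  have h1 : ((1 - s : ℝ) : ℂ) + (s : ℂ) = 1 := by push_cast; ring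
  have hw : ∀ B₁ p, f ∈ (ContamClass.weighted B₁ p).densities γ ε f₁ →
      f₀ ∈ (ContamClass.weighted B₁ p).densities γ ε f₁ →
      (fun t => ((1 - s : ℝ) : ℂ) • f t + (s : ℂ) • f₀ t) ∈
        (ContamClass.weighted B₁ p).densities γ ε f₁ := by
    rintro B₁ p ⟨hf, ⟨W, hW, hfW⟩, hfm⟩ ⟨hf₀, ⟨V, hV, hfV⟩, hfm₀⟩
    have he : ∀ t, (B₁ * (((1 - s : ℝ) : ℂ) • f t + (s : ℂ) • f₀ t)).trace =
        ((1 - s : ℝ) : ℂ) * (B₁ * f t).trace + (s : ℂ) * (B₁ * f₀ t).trace := fun t => by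
      rw [Matrix.mul_add, Matrix.mul_smul, Matrix.mul_smul, trace_add, trace_smul, trace_smul,
        smul_eq_mul, smul_eq_mul]
    refine ⟨hd, ⟨_, (hW.const_smul hs1).add (hV.const_smul hs), ?_⟩, ?_⟩
    · filter_upwards [hfW, hfV] with t h2 h3
      rw [he, h2, h3, Matrix.mul_add, Matrix.mul_smul, Matrix.mul_smul, trace_add, trace_smul,
        trace_smul, smul_eq_mul, smul_eq_mul]
      linear_combination (1 - (ε : ℂ)) * (B₁ * f₁ t).trace * h1
    · simp only [he]
      rw [moment_mix hγ (hf.integrable_trace_mul B₁) (hf₀.integrable_trace_mul B₁), hfm, hfm₀,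
        ← add_mul, h1, one_mul]
  cases κ with
  | trace p =>
    rw [densities_trace_eq] at hf hf₀ ⊢
    exact hw 1 p hf hf₀
  | weighted B₁ p => exact hw B₁ p hf hf₀
  | diagonal p =>
    obtain ⟨hf, ⟨W, hW, hfW⟩, hfm⟩ := hf
    obtain ⟨hf₀, ⟨V, hV, hfV⟩, hfm₀⟩ := hf₀
    refine ⟨hd, ⟨_, (hW.const_smul hs1).add (hV.const_smul hs), ?_⟩, fun k => ?_⟩
    · filter_upwards [hfW, hfV] with t h2 h3 k
      simp only [Matrix.add_apply, Matrix.smul_apply, smul_eq_mul]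
      rw [h2, h3]
      linear_combination (1 - (ε : ℂ)) * (f₁ t k k) * h1
    · simp only [Matrix.add_apply, Matrix.smul_apply, smul_eq_mul]
      rw [moment_mix hγ (hf.integrable k k) (hf₀.integrable k k), hfm, hfm₀, ← add_mul, h1,
        one_mul]
  | full P =>
    obtain ⟨hf, ⟨W, hW, hfW⟩, hfm⟩ := hf
    obtain ⟨hf₀, ⟨V, hV, hfV⟩, hfm₀⟩ := hf₀
    refine ⟨hd, ⟨_, (hW.const_smul hs1).add (hV.const_smul hs), ?_⟩, fun k l => ?_⟩
    · filter_upwards [hfW, hfV] with t h2 h3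
      rw [h2, h3]
      ext k l
      simp only [Matrix.add_apply, Matrix.smul_apply, smul_eq_mul]
      linear_combination (1 - (ε : ℂ)) * (f₁ t k l) * h1
    · simp only [Matrix.add_apply, Matrix.smul_apply, smul_eq_mul]
      rw [moment_mix hγ (hf.integrable k l) (hf₀.integrable k l), hfm, hfm₀, ← add_mul, h1,
        one_mul]

end mixtures

/-! ### The saddle point -/

section saddle

variable {γ : GMIndex r} {a : ℕ → Fin T → ℂ} {f f₀ : ℝ → Matrix (Fin T) (Fin T) ℂ}

theorem wgt_mix (s : ℝ) (t : ℝ) :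
    wgt γ (fun t => ((1 - s : ℝ) : ℂ) • f t + (s : ℂ) • f₀ t) t =
      ((1 - s : ℝ) : ℂ) • wgt γ f t + (s : ℂ) • wgt γ f₀ t := by
  simp only [wgt, smul_add]
  rw [smul_comm, smul_comm (gain γ t : ℂ) (s : ℂ)]

theorem nq_wgt_mix (s : ℝ) {u : ℝ → Fin T → ℂ} (hu : MemW (wgt γ f) u)
    (hu₀ : MemW (wgt γ f₀) u) :
    nq (wgt γ (fun t => ((1 - s : ℝ) : ℂ) • f t + (s : ℂ) • f₀ t)) u =
      (1 - s) * nq (wgt γ f) u + s * nq (wgt γ f₀) u := by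
  have h1 : wgt γ (fun t => ((1 - s : ℝ) : ℂ) • f t + (s : ℂ) • f₀ t) =
      fun t => ((1 - s : ℝ) : ℂ) • wgt γ f t + (s : ℂ) • wgt γ f₀ t := funext (wgt_mix s)
  rw [h1, nq_add_weight (hu.smul_weight _) (hu₀.smul_weight _), nq_smul_weight, nq_smul_weight]

theorem memW_bFun_sub (ha : IsAdmissible γ a) {g : ℝ → Matrix (Fin T) (Fin T) ℂ}
    (hg : IsSpectralDensity g) (p : ℕ →₀ (Fin T → ℂ)) :
    MemW g (fun t => bFun γ a t - pastTrig p t) :=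
  (memW_bFun ha hg).sub hg (memW_pastTrig hg p)

/-- `Δ` is concave in the density, as a minimum of linear functionals. -/
theorem optMse_mix_le (hγ : γ.Positive) (ha : IsAdmissible γ a) (hf : IsSpectralDensity f)
    (hf₀ : IsSpectralDensity f₀) {s : ℝ} (hs : 0 ≤ s) (hs1 : 0 ≤ 1 - s) :
    ENNReal.ofReal (1 - s) * optMse γ a f + ENNReal.ofReal s * optMse γ a f₀ ≤
      optMse γ a (fun t => ((1 - s : ℝ) : ℂ) • f t + (s : ℂ) • f₀ t) := by
  have hd := (hf.const_smul hs1).add (hf₀.const_smul hs)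
  rw [optMse_eq_iInf hγ ha hd, optMse_eq_iInf hγ ha hf, optMse_eq_iInf hγ ha hf₀]
  refine le_iInf fun p => ?_
  rw [mse_pastPoly hγ ha hd, nq_wgt_mix s (memW_bFun_sub ha (hf.wgt hγ) p)
    (memW_bFun_sub ha (hf₀.wgt hγ) p), ENNReal.ofReal_add
    (mul_nonneg hs1 (nq_nonneg (hf.wgt hγ) _)) (mul_nonneg hs (nq_nonneg (hf₀.wgt hγ) _)),
    ENNReal.ofReal_mul hs1, ENNReal.ofReal_mul hs, ← mse_pastPoly hγ ha hf,
    ← mse_pastPoly hγ ha hf₀]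
  exact add_le_add (mul_le_mul_right (iInf_le _ p) _) (mul_le_mul_right (iInf_le _ p) _)

theorem optMse_lt_top (hγ : γ.Positive) (ha : IsAdmissible γ a) (hf : IsSpectralDensity f) :
    optMse γ a f < ∞ :=
  (optMse_le_of_inPast hγ ha hf (inPast_pastTrig (hf.wgt hγ) 0)).trans_lt ENNReal.ofReal_lt_top

/-- Convergence in the norm of a coercive weight gives convergence almost everywhere along a
subsequence. -/
theorem Coercive.exists_subseq {g : ℝ → Matrix (Fin T) (Fin T) ℂ} (hc : Coercive g)
    {U : ℕ → ℝ → Fin T → ℂ} (hU : ∀ n, MemW g (U n))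
    (h : Tendsto (fun n => nq g (U n)) atTop (𝓝 0)) : ∃ ns : ℕ → ℕ, StrictMono ns ∧
      ∀ᵐ t ∂circ, Tendsto (fun i => U (ns i) t) atTop (𝓝 0) := by
  obtain ⟨K₀, hK₀, hK⟩ := hc.exists_bound
  have h1 : ∀ l, Tendsto (fun n => ∫ t, ‖U n t l‖ ∂circ) atTop (𝓝 0) := by
    intro l
    refine tendsto_order.mpr ⟨fun x hx => Eventually.of_forall fun n =>
      hx.trans_le (integral_nonneg fun t => norm_nonneg _), fun x hx => ?_⟩
    have hη : 0 < x / (2 * (K₀ + 1)) := by positivity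
    have h2 := (h.const_mul (2 * Real.pi)).const_mul (x / (2 * (K₀ + 1)))⁻¹
    rw [mul_zero, mul_zero] at h2
    filter_upwards [h2.eventually (gt_mem_nhds (half_pos hx))] with n hn
    have h3 := hK _ (hU n) l _ hη
    have h4 : x / (2 * (K₀ + 1)) * K₀ ≤ x / 2 := by
      rw [div_mul_eq_mul_div, div_le_div_iff₀ (by positivity) (by positivity)]
      nlinarith
    linarith
  have hi : ∀ n l, Integrable (fun t => ‖U n t l‖) circ := fun n l => (hc.integrable (hU n) l).norm
  obtain ⟨ns, hns, hlim⟩ := exists_subseq_ae_tendsto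
    (u := fun n t => ((∑ l, ‖U n t l‖ : ℝ) : ℂ)) (v := fun _ => 0)
    (fun n => (integrable_finsetSum _ fun l _ => hi n l).ofReal) (integrable_zero _ _ _) (by
      have h2 : ∀ n t, ‖((∑ l, ‖U n t l‖ : ℝ) : ℂ) - 0‖ = ∑ l, ‖U n t l‖ := fun n t => by
        rw [sub_zero, norm_real, Real.norm_of_nonneg (Finset.sum_nonneg fun l _ => norm_nonneg _)]
      simp only [h2]
      simp only [integral_finsetSum _ fun l _ => hi _ l]
      simpa using tendsto_finsetSum Finset.univ fun l _ => h1 l)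
  refine ⟨ns, hns, hlim.mono fun t ht => tendsto_pi_nhds.mpr fun l => ?_⟩
  refine squeeze_zero_norm (fun n => ?_) (by simpa only [norm_zero] using ht.norm)
  rw [norm_real, Real.norm_of_nonneg (Finset.sum_nonneg fun l _ => norm_nonneg _)]
  exact Finset.single_le_sum (f := fun l => ‖U (ns n) t l‖) (fun _ _ => norm_nonneg _)
    (Finset.mem_univ l)

/-- Suppose that the error under `g₀ + τ g` is at most `(1 + τ)` times the error under `g₀`, for
every `τ > 0`. Then the residual under `g₀` has finite norm under `g`, not exceeding its norm under
`g₀`. Polynomials optimal up to `τ²` for `g₀ + τ g` approach the projection under `g₀` as `τ → 0`,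
and their errors under `g` stay bounded; Fatou's lemma passes to the limit. -/
theorem IsResidual.nq_le {g g₀ : ℝ → Matrix (Fin T) (Fin T) ℂ} (hg : IsSpectralDensity g)
    (hg₀ : IsSpectralDensity g₀) (hc : Coercive g₀) {B w : ℝ → Fin T → ℂ}
    (hB : MemW g B) (hB₀ : MemW g₀ B) (hw : IsResidual g₀ B w)
    (h : ∀ τ : ℝ, 0 < τ → ∀ δ : ℝ, 0 < δ → ∃ p,
      nq g₀ (fun t => B t - pastTrig p t) + τ * nq g (fun t => B t - pastTrig p t) <
        (1 + τ) * nq g₀ w + δ) : MemW g w ∧ nq g w ≤ nq g₀ w := by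
  have hτ : ∀ n : ℕ, (0 : ℝ) < 1 / ((n : ℝ) + 1) := fun n => by positivity
  choose p hp using fun n : ℕ => h _ (hτ n) _ (pow_pos (hτ n) 2)
  set τ : ℕ → ℝ := fun n => 1 / ((n : ℝ) + 1) with hτdef
  have hτlim : Tendsto τ atTop (𝓝 0) := tendsto_one_div_add_atTop_nhds_zero_nat
  have hpyth : ∀ n, nq g₀ (fun t => B t - pastTrig (p n) t) = nq g₀ w +
      nq g₀ (fun t => B t - pastTrig (p n) t - w t) := fun n =>
    hw.nq_sub_eq hg₀ (inPast_pastTrig hg₀ (p n))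
  have hm : ∀ n, MemW g (fun t => B t - pastTrig (p n) t) := fun n =>
    hB.sub hg (memW_pastTrig hg _)
  have hm₀ : ∀ n, MemW g₀ (fun t => B t - pastTrig (p n) t - w t) := fun n =>
    (hB₀.sub hg₀ (memW_pastTrig hg₀ _)).sub hg₀ hw.memW
  have hle : ∀ n, nq g (fun t => B t - pastTrig (p n) t) ≤ nq g₀ w + τ n := by
    intro n
    have h1 := hp n
    rw [hpyth n] at h1
    have h2 := nq_nonneg hg₀ (fun t => B t - pastTrig (p n) t - w t)
    have h3 := hτ n
    refine le_of_mul_le_mul_left ?_ h3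
    simp only [hτdef]
    nlinarith
  have hle₀ : ∀ n, nq g₀ (fun t => B t - pastTrig (p n) t - w t) ≤
      τ n * nq g₀ w + τ n ^ 2 := by
    intro n
    have h1 := hp n
    rw [hpyth n] at h1
    have h2 := mul_nonneg (hτ n).le (nq_nonneg hg (fun t => B t - pastTrig (p n) t))
    simp only [hτdef]
    nlinarith
  have hlim₀ : Tendsto (fun n => nq g₀ (fun t => B t - pastTrig (p n) t - w t)) atTop (𝓝 0) := by
    refine squeeze_zero (fun n => nq_nonneg hg₀ _) hle₀ ?_
    simpa using (hτlim.mul_const (nq g₀ w)).add (hτlim.pow 2)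
  obtain ⟨ns, hns, hlim⟩ := hc.exists_subseq hm₀ hlim₀
  refine MemW.of_tendsto hg (fun i => hm (ns i)) (hlim.mono fun t ht => ?_)
    (b := fun i => nq g₀ w + τ (ns i))
    (by simpa using (hτlim.comp hns.tendsto_atTop).const_add (nq g₀ w)) fun i => hle (ns i)
  simpa using ht.add_const (w t)

variable {ε : ℝ} {f₁ : ℝ → Matrix (Fin T) (Fin T) ℂ} {κ : ContamClass T}

/-- At a least favourable density, the residual is a saddle point. The hypothesis of
`IsResidual.nq_le` holds because the mixtures of `f₀` with `f` stay in the class. No minimality of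
`f` is needed. -/
theorem IsLeastFavorable.nq_le (hγ : γ.Positive) (ha : IsAdmissible γ a)
    (hm : IsMinimal γ f₀) {w : ℝ → Fin T → ℂ}
    (h : IsLeastFavorable γ a (κ.densities γ ε f₁) f₀)
    (hw : IsResidual (wgt γ f₀) (bFun γ a) w) (hf : f ∈ κ.densities γ ε f₁) :
    MemW (wgt γ f) w ∧ nq (wgt γ f) w ≤ nq (wgt γ f₀) w := by
  have hfs := isSpectralDensity_of_mem hf
  have hfs₀ := isSpectralDensity_of_mem h.1
  have hg := hfs.wgt hγ
  have hg₀ := hfs₀.wgt hγ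
  refine hw.nq_le hg hg₀ (hm.coercive hγ hfs₀) (memW_bFun ha hg) (memW_bFun ha hg₀)
    fun τ hτ δ hδ => ?_
  -- the mixture with weights proportional to `1` and `τ`
  set s : ℝ := 1 / (1 + τ) with hs
  have hs0 : 0 ≤ s := by positivity
  have hs1 : 1 - s = τ / (1 + τ) := by rw [hs]; field_simp; ring
  have hs1' : 0 ≤ 1 - s := by rw [hs1]; positivity
  have hmem := mix_mem_densities hγ hf h.1 hs0 hs1'
  have hd := isSpectralDensity_of_mem hmem
  have h1 := h.2 _ hmem
  rw [hw.optMse_eq hγ ha hfs₀, optMse_eq_iInf hγ ha hd] at h1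
  have h2 : ENNReal.ofReal (nq (wgt γ f₀) w) < ENNReal.ofReal (nq (wgt γ f₀) w + δ / (1 + τ)) :=
    (ENNReal.ofReal_lt_ofReal_iff (add_pos_of_nonneg_of_pos (nq_nonneg hg₀ _) (by positivity))).mpr
      (lt_add_of_pos_right _ (by positivity))
  obtain ⟨p, hp⟩ := iInf_lt_iff.mp (h1.trans_lt h2)
  refine ⟨p, ?_⟩
  rw [mse_pastPoly hγ ha hd, nq_wgt_mix s (memW_bFun_sub ha hg p) (memW_bFun_sub ha hg₀ p),
    ENNReal.ofReal_lt_ofReal_iff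
      (add_pos_of_nonneg_of_pos (nq_nonneg hg₀ _) (by positivity)), hs1, hs] at hp
  have h3 := mul_lt_mul_of_pos_left hp (show 0 < 1 + τ by positivity)
  have h4 : (1 + τ) * (τ / (1 + τ) * nq (wgt γ f) (fun t => bFun γ a t - pastTrig p t) +
      1 / (1 + τ) * nq (wgt γ f₀) (fun t => bFun γ a t - pastTrig p t)) =
      nq (wgt γ f₀) (fun t => bFun γ a t - pastTrig p t) +
        τ * nq (wgt γ f) (fun t => bFun γ a t - pastTrig p t) := by
    field_simp; ring
  have h5 : (1 + τ) * (nq (wgt γ f₀) w + δ / (1 + τ)) = (1 + τ) * nq (wgt γ f₀) w + δ := by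
    field_simp
  rwa [h4, h5] at h3

/-- The estimation function of the residual under `f₀` is admissible under every density under
which the residual has finite norm. -/
theorem IsResidual.inPast_sub (ha : IsAdmissible γ a) {g g₀ : ℝ → Matrix (Fin T) (Fin T) ℂ}
    (hg : IsSpectralDensity g) (hg₀ : IsSpectralDensity g₀) (hc : Coercive g₀)
    {w : ℝ → Fin T → ℂ} (hw : IsResidual g₀ (bFun γ a) w) (hwg : MemW g w) :
    InPast g (fun t => bFun γ a t - w t) := by
  refine InPast.of_fourierCoef hg ((memW_bFun ha hg).sub hg hwg)
    (fun l => (integrable_bFun ha l).sub (hc.integrable hw.memW l)) fun l n hn => ?_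
  exact hw.inPast.fourierCoef_eq_zero hg₀ hc l hn

theorem IsLeastFavorable.isMinimaxRobust (hγ : γ.Positive) (ha : IsAdmissible γ a)
    (hm : IsMinimal γ f₀) {c : ℕ → Fin T → ℂ} {C : ℝ → Fin T → ℂ}
    (hC : IsFInverse γ a f₀ c C) (h : IsLeastFavorable γ a (κ.densities γ ε f₁) f₀) :
    IsMinimaxRobust γ a (κ.densities γ ε f₁) (specChar γ a f₀ C) := by
  have hfs₀ := isSpectralDensity_of_mem h.1
  have hg₀ := hfs₀.wgt hγ
  have hw := hC.isResidual hγ ha hfs₀ hm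
  have hsc := specChar_ae_eq (γ := γ) (a := a) (f := f₀) hγ C
  refine ⟨fun f hf => ?_, fun h' hh' => ?_⟩
  · have hfs := isSpectralDensity_of_mem hf
    exact mem_L2past_congr (smul_mem_L2past hγ hfs (hw.inPast_sub ha (hfs.wgt hγ) hg₀
      (hm.coercive hγ hfs₀) (h.nq_le hγ ha hm hw hf).1)) hsc
  · refine iSup₂_le fun f hf => ?_
    have hfs := isSpectralDensity_of_mem hf
    obtain ⟨hmem, hle⟩ := h.nq_le hγ ha hm hw hf
    have h1 : mse γ a (specChar γ a f₀ C) f ≤ optMse γ a f₀ := by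
      rw [← mse_congr hsc, mse_smul, hw.optMse_eq hγ ha hfs₀]
      simp only [sub_sub_cancel]
      rw [normSqL2_eq (hfs.wgt hγ) hmem]
      exact ENNReal.ofReal_le_ofReal hle
    refine h1.trans (le_trans ?_ (le_iSup₂ (f := fun f _ => mse γ a h' f) f₀ h.1))
    exact iInf₂_le _ (hh' f₀ h.1)

/-- A least favourable density is a solution of the extremal problem, in which only the minimal
densities compete. -/
theorem isLeastFavorable_iff (hγ : γ.Positive) (ha : IsAdmissible γ a)
    (hf₀ : f₀ ∈ κ.densities γ ε f₁) (hm : IsMinimal γ f₀) {c : ℕ → Fin T → ℂ}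
    {C : ℝ → Fin T → ℂ} (hC : IsFInverse γ a f₀ c C) :
    IsLeastFavorable γ a (κ.densities γ ε f₁) f₀ ↔
      SolvesMaxProblem γ a (κ.densities γ ε f₁) c := by
  have hfs₀ := isSpectralDensity_of_mem hf₀
  have hpos : 0 ≤ pairing γ a c := by
    rw [hC.pairing_eq hγ ha hfs₀ hm]
    exact nq_nonneg (hfs₀.wgt hγ) _
  constructor
  · intro h f hf hmf c' C' hC'
    have h1 := h.2 f hf
    rwa [hC'.optMse_eq hγ ha (isSpectralDensity_of_mem hf) hmf, hC.optMse_eq hγ ha hfs₀ hm,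
      ENNReal.ofReal_le_ofReal_iff hpos] at h1
  · refine fun h => ⟨hf₀, fun f hf => ?_⟩
    have hfs := isSpectralDensity_of_mem hf
    -- a density that is not minimal is replaced by its midpoint with `f₀`, which is
    have hhalf : (0 : ℝ) ≤ 1 - 1 / 2 := by norm_num
    have hmem := mix_mem_densities hγ hf hf₀ (s := 1 / 2) (by norm_num) hhalf
    have hmin := hm.mix hfs hfs₀ (s := 1 / 2) (by norm_num) hhalf
    have hd := isSpectralDensity_of_mem hmem
    obtain ⟨c', C', hC'⟩ := exists_isFInverse hγ ha hd hmin
    have h1 := optMse_mix_le hγ ha hfs hfs₀ (s := 1 / 2) (by norm_num) hhalf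
    have h2 : optMse γ a (fun t => ((1 - 1 / 2 : ℝ) : ℂ) • f t + ((1 / 2 : ℝ) : ℂ) • f₀ t) ≤
        optMse γ a f₀ := by
      rw [hC'.optMse_eq hγ ha hd hmin, hC.optMse_eq hγ ha hfs₀ hm]
      exact ENNReal.ofReal_le_ofReal (h _ hmem hmin c' C' hC')
    have h3 := h1.trans h2
    rw [← ENNReal.ofReal_toReal (optMse_lt_top hγ ha hfs).ne,
      ← ENNReal.ofReal_toReal (optMse_lt_top hγ ha hfs₀).ne] at h3 ⊢
    have t1 : 0 ≤ (optMse γ a f).toReal := ENNReal.toReal_nonneg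
    have t2 : 0 ≤ (optMse γ a f₀).toReal := ENNReal.toReal_nonneg
    rw [← ENNReal.ofReal_mul (by norm_num), ← ENNReal.ofReal_mul (by norm_num),
      ← ENNReal.ofReal_add (by positivity) (by positivity),
      ENNReal.ofReal_le_ofReal_iff t2] at h3
    exact ENNReal.ofReal_le_ofReal (by linarith)

end saddle

/-! ### Sufficiency of the equation for the residual -/

open scoped MatrixOrder in
theorem posSemidef_trace_mul {M N : Matrix (Fin T) (Fin T) ℂ} (hM : M.PosSemidef)
    (hN : N.PosSemidef) : 0 ≤ (M * N).trace ∧ ((M * N).trace.re = 0 → M * N = 0) := by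
  obtain ⟨R, rfl⟩ := CStarAlgebra.nonneg_iff_eq_star_mul_self.mp hM.nonneg
  obtain ⟨S, rfl⟩ := CStarAlgebra.nonneg_iff_eq_star_mul_self.mp hN.nonneg
  simp only [star_eq_conjTranspose]
  have h1 : (Rᴴ * R * (Sᴴ * S)).trace = ((R * Sᴴ)ᴴ * (R * Sᴴ)).trace := by
    rw [conjTranspose_mul, conjTranspose_conjTranspose, Matrix.mul_assoc S, ← Matrix.mul_assoc Rᴴ,
      Matrix.trace_mul_comm S, Matrix.mul_assoc, Matrix.mul_assoc, Matrix.mul_assoc]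
  have h2 := posSemidef_conjTranspose_mul_self (R * Sᴴ)
  have h3 := h2.trace_nonneg
  rw [h1]
  refine ⟨h3, fun h0 => ?_⟩
  have h4 : ((R * Sᴴ)ᴴ * (R * Sᴴ)).trace = 0 :=
    Complex.ext h0 (Complex.le_def.mp h3).2.symm
  have h5 : R * Sᴴ = 0 := trace_conjTranspose_mul_self_eq_zero_iff.mp h4
  rw [Matrix.mul_assoc, ← Matrix.mul_assoc R, h5, Matrix.zero_mul, Matrix.mul_zero]

theorem trace_mul_re_nonneg {M N : Matrix (Fin T) (Fin T) ℂ} (hM : M.PosSemidef)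
    (hN : N.PosSemidef) : 0 ≤ (M * N).trace.re :=
  (Complex.le_def.mp (posSemidef_trace_mul hM hN).1).1

theorem qf_eq_trace (M : Matrix (Fin T) (Fin T) ℂ) (u : Fin T → ℂ) :
    qf M u = (M * (vecMulVec u (star u))ᵀ).trace.re := by
  rw [transpose_vecMulVec, mul_vecMulVec, trace_vecMulVec, dotProduct_comm, qf, sf]

section sufficiency

variable {γ : GMIndex r} {a : ℕ → Fin T → ℂ} {f f₀ f₁ X : ℝ → Matrix (Fin T) (Fin T) ℂ} {ε : ℝ}
  {κ : ContamClass T}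

/-- The equation for `C` amounts to `w w* = X` for the residual `w` with `C = (G f₀)ᵀ w`. -/
theorem spectralEquation_iff (hγ : γ.Positive) (hf₀ : IsSpectralDensity f₀)
    (hm : IsMinimal γ f₀) {C : ℝ → Fin T → ℂ} : SpectralEquation γ f₀ X C ↔
      ∀ᵐ t ∂circ, vecMulVec (symbolF γ f₀ t *ᵥ C t) (star (symbolF γ f₀ t *ᵥ C t)) = X t := by
  refine eventually_congr ?_
  filter_upwards [ae_symbolF_mulVec hγ hm, (hf₀.wgt hγ).posSemidef] with t h1 h2
  have e1 : symbolF γ f₀ t * (wgt γ f₀ t)ᵀ = 1 := by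
    refine Matrix.ext_of_mulVec_single fun i => ?_
    rw [← mulVec_mulVec, h1.1, one_mulVec]
  have e2 : (wgt γ f₀ t)ᵀ * symbolF γ f₀ t = 1 := by
    refine Matrix.ext_of_mulVec_single fun i => ?_
    rw [← mulVec_mulVec, h1.2, one_mulVec]
  have e3 : (wgt γ f₀ t)ᵀᴴ = (wgt γ f₀ t)ᵀ := h2.1.transpose
  have e4 : ((gain γ t : ℝ) : ℂ) • (f₀ t)ᵀ = (wgt γ f₀ t)ᵀ := by rw [wgt, transpose_smul]
  set w := symbolF γ f₀ t *ᵥ C t with hw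
  have e5 : C t = (wgt γ f₀ t)ᵀ *ᵥ w := (h1.2 _).symm
  have e6 : vecMulVec (C t) (star (C t)) =
      (wgt γ f₀ t)ᵀ * vecMulVec w (star w) * (wgt γ f₀ t)ᵀ := by
    rw [e5, mul_vecMulVec, vecMulVec_mul, star_mulVec, e3]
  rw [e4, e6]
  refine ⟨fun h => ?_, fun h => by rw [h]⟩
  have h5 := congrArg (fun Y => symbolF γ f₀ t * Y * symbolF γ f₀ t) h
  have h6 : ∀ Y, symbolF γ f₀ t * ((wgt γ f₀ t)ᵀ * Y * (wgt γ f₀ t)ᵀ) * symbolF γ f₀ t = Y := by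
    intro Y
    rw [Matrix.mul_assoc, Matrix.mul_assoc, e2, Matrix.mul_one, ← Matrix.mul_assoc, e1,
      Matrix.one_mul]
  simpa only [h6] using h5

theorem integral_gain_re (hγ : γ.Positive) {u : ℝ → ℂ} (hu : Integrable u circ) :
    Integrable (fun t => gain γ t * (u t).re) circ ∧
      ∫ t, gain γ t * (u t).re ∂circ = 2 * Real.pi * (moment γ u).re := by
  have h1 := Integrable.gain_mul hγ hu
  have h2 : ∀ t, gain γ t * (u t).re = (((gain γ t : ℝ) : ℂ) * u t).re := fun t => by
    rw [re_ofReal_mul]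
  simp only [h2]
  refine ⟨h1.re, ?_⟩
  have h3 : ∫ t, (((gain γ t : ℝ) : ℂ) * u t).re ∂circ =
      (∫ t, ((gain γ t : ℝ) : ℂ) * u t ∂circ).re := integral_re h1
  have h4 : (1 / (2 * (Real.pi : ℂ))) = ((1 / (2 * Real.pi) : ℝ) : ℂ) := by push_cast; rfl
  rw [h3, moment, h4, re_ofReal_mul]
  have := Real.pi_pos
  field_simp

/-- The difference of two functions with the same moment, for instance of the restricted
functionals of two densities of a class, has mean zero with respect to the gain. -/
theorem integral_gain_sub_eq_zero (hγ : γ.Positive) {u v : ℝ → ℂ} (hu : Integrable u circ)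
    (hv : Integrable v circ) (h : moment γ u = moment γ v) (c : ℝ) :
    Integrable (fun t => gain γ t * (c * ((u t).re - (v t).re))) circ ∧
      ∫ t, gain γ t * (c * ((u t).re - (v t).re)) ∂circ = 0 := by
  have h1 := integral_gain_re hγ hu
  have h2 := integral_gain_re hγ hv
  have h3 : ∀ t, gain γ t * (c * ((u t).re - (v t).re)) =
      c * (gain γ t * (u t).re - gain γ t * (v t).re) := fun t => by ring
  simp only [h3]
  refine ⟨(h1.1.sub h2.1).const_mul c, ?_⟩
  rw [integral_const_mul, integral_sub h1.1 h2.1, h1.2, h2.2, h, sub_self, mul_zero]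

/-- The matrix of the moments of the entries. -/
def momentMatrix (γ : GMIndex r) (f : ℝ → Matrix (Fin T) (Fin T) ℂ) : Matrix (Fin T) (Fin T) ℂ :=
  Matrix.of fun k l => moment γ fun t => f t k l

theorem momentMatrix_eq_iff {P : Matrix (Fin T) (Fin T) ℂ} :
    momentMatrix γ f = P ↔ ∀ k l, moment γ (fun t => f t k l) = P k l := by
  rw [← Matrix.ext_iff]; rfl

theorem moment_trace_mul (hγ : γ.Positive) (hf : ∀ k l, Integrable (fun t => f t k l) circ)
    (N : Matrix (Fin T) (Fin T) ℂ) :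
    moment γ (fun t => (N * f t).trace) = (N * momentMatrix γ f).trace := by
  have hi : ∀ i j, Integrable (fun t => N i j * (((gain γ t : ℝ) : ℂ) * f t j i)) circ :=
    fun i j => (Integrable.gain_mul hγ (hf j i)).const_mul _
  have he : ∀ t, ((gain γ t : ℝ) : ℂ) * (N * f t).trace =
      ∑ i, ∑ j, N i j * (((gain γ t : ℝ) : ℂ) * f t j i) := by
    intro t
    simp only [Matrix.trace, diag_apply, mul_apply, Finset.mul_sum]
    refine Finset.sum_congr rfl fun i _ => Finset.sum_congr rfl fun j _ => by ring
  rw [moment]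
  simp only [he]
  rw [integral_finsetSum _ fun i _ => integrable_finsetSum _ fun j _ => hi i j, Finset.mul_sum,
    Matrix.trace]
  refine Finset.sum_congr rfl fun i _ => ?_
  rw [integral_finsetSum _ fun j _ => hi i j, Finset.mul_sum, diag_apply, mul_apply]
  refine Finset.sum_congr rfl fun j _ => ?_
  rw [integral_const_mul, momentMatrix, of_apply, moment]; ring

theorem qf_wgt (f : ℝ → Matrix (Fin T) (Fin T) ℂ) (t : ℝ) (u : Fin T → ℂ) :
    qf (wgt γ f t) u = gain γ t * qf (f t) u := by
  rw [wgt, qf_smul_weight]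

theorem nq_le_of_ae_le {g g₀ : ℝ → Matrix (Fin T) (Fin T) ℂ} (hg : IsSpectralDensity g)
    {w : ℝ → Fin T → ℂ} (hw : MemW g₀ w) {E : ℝ → ℝ} (hE : Integrable E circ)
    (hE0 : ∫ t, E t ∂circ = 0) (h : ∀ᵐ t ∂circ, qf (g t) (w t) ≤ qf (g₀ t) (w t) + E t) :
    MemW g w ∧ nq g w ≤ nq g₀ w := by
  have hF : Integrable (fun t => qf (g₀ t) (w t) + E t) circ := hw.int.add hE
  have hm := MemW.of_le hg hw.meas hF h
  refine ⟨hm, mul_le_mul_of_nonneg_left ?_ inv_two_pi_nonneg⟩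
  have h1 := integral_mono_ae hm.int hF h
  rwa [integral_add hw.int hE, hE0, add_zero] at h1

theorem nq_le_of_weighted (hγ : γ.Positive) {B₁ : Matrix (Fin T) (Fin T) ℂ} {p : ℝ}
    (hB : B₁.PosSemidef) (hε₀ : 0 ≤ ε) {w : ℝ → Fin T → ℂ} (hw : MemW (wgt γ f₀) w)
    (hf₀ : f₀ ∈ (ContamClass.weighted B₁ p).densities γ ε f₁)
    (hX : (ContamClass.weighted B₁ p).IsMultiplier ε f₁ f₀ X)
    (hwX : ∀ᵐ t ∂circ, vecMulVec (w t) (star (w t)) = X t)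
    (hf : f ∈ (ContamClass.weighted B₁ p).densities γ ε f₁) :
    MemW (wgt γ f) w ∧ nq (wgt γ f) w ≤ nq (wgt γ f₀) w := by
  obtain ⟨α, η, hη⟩ := hX
  obtain ⟨hfs, ⟨W, hW, hfW⟩, hfm⟩ := hf
  obtain ⟨hfs₀, -, hfm₀⟩ := hf₀
  obtain ⟨hE, hE0⟩ := integral_gain_sub_eq_zero hγ (hfs.integrable_trace_mul B₁)
    (hfs₀.integrable_trace_mul B₁) (hfm.trans hfm₀.symm) (α ^ 2)
  refine nq_le_of_ae_le (hfs.wgt hγ) hw hE hE0 ?_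
  filter_upwards [hη, hwX, hfW, hW.posSemidef] with t h1 h2 h3 h4
  have hq : ∀ M : Matrix (Fin T) (Fin T) ℂ, qf M (w t) = (α ^ 2 + η t) * (B₁ * M).trace.re := by
    intro M
    rw [qf_eq_trace, h2, h1.2.2, transpose_smul, transpose_transpose, Matrix.mul_smul, trace_smul,
      smul_eq_mul, re_ofReal_mul, trace_mul_comm]
  have h5 : (1 - ε) * (B₁ * f₁ t).trace.re ≤ (B₁ * f t).trace.re := by
    rw [h3]
    have e1 : (1 - (ε : ℂ)) = ((1 - ε : ℝ) : ℂ) := by push_cast; rfl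
    rw [e1, add_re, re_ofReal_mul, re_ofReal_mul]
    exact le_add_of_nonneg_right (mul_nonneg hε₀ (trace_mul_re_nonneg hB h4))
  rw [qf_wgt, qf_wgt, ← mul_add]
  refine mul_le_mul_of_nonneg_left ?_ (gain_nonneg γ t)
  rw [hq, hq]
  by_cases h6 : (1 - ε) * (B₁ * f₁ t).trace.re < (B₁ * f₀ t).trace.re
  · rw [h1.2.1 h6]; linarith
  · have := mul_le_mul_of_nonpos_left ((not_lt.mp h6).trans h5) h1.1
    linarith

theorem nq_le_of_diagonal (hγ : γ.Positive) {p : Fin T → ℝ}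
    (hε₀ : 0 ≤ ε) {w : ℝ → Fin T → ℂ} (hw : MemW (wgt γ f₀) w)
    (hf₀ : f₀ ∈ (ContamClass.diagonal p).densities γ ε f₁)
    (hX : (ContamClass.diagonal p).IsMultiplier ε f₁ f₀ X)
    (hwX : ∀ᵐ t ∂circ, vecMulVec (w t) (star (w t)) = X t)
    (hf : f ∈ (ContamClass.diagonal p).densities γ ε f₁) :
    MemW (wgt γ f) w ∧ nq (wgt γ f) w ≤ nq (wgt γ f₀) w := by
  obtain ⟨α, η, hη⟩ := hX
  obtain ⟨hfs, ⟨W, hW, hfW⟩, hfm⟩ := hf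
  obtain ⟨hfs₀, -, hfm₀⟩ := hf₀
  have hE := fun k => integral_gain_sub_eq_zero hγ (hfs.integrable k k)
    (hfs₀.integrable k k) ((hfm k).trans (hfm₀ k).symm) (α k ^ 2)
  refine nq_le_of_ae_le (hfs.wgt hγ) hw (E := fun t => ∑ k, gain γ t * (α k ^ 2 *
    ((f t k k).re - (f₀ t k k).re))) (integrable_finsetSum _ fun k _ => (hE k).1) ?_ ?_
  · rw [integral_finsetSum _ fun k _ => (hE k).1]
    exact Finset.sum_eq_zero fun k _ => (hE k).2
  filter_upwards [hη, hwX, hfW, hW.posSemidef] with t h1 h2 h3 h4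
  have hq : ∀ M : Matrix (Fin T) (Fin T) ℂ, qf M (w t) = ∑ k, (α k ^ 2 + η k t) * (M k k).re := by
    intro M
    rw [qf_eq_trace, h2, h1.2, diagonal_transpose, Matrix.trace, re_sum]
    refine Finset.sum_congr rfl fun k _ => ?_
    rw [diag_apply, mul_diagonal, mul_comm, re_ofReal_mul]
  rw [qf_wgt, qf_wgt, ← Finset.mul_sum, ← mul_add]
  refine mul_le_mul_of_nonneg_left ?_ (gain_nonneg γ t)
  rw [hq, hq, ← Finset.sum_add_distrib]
  refine Finset.sum_le_sum fun k _ => ?_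
  have h5 : (1 - ε) * (f₁ t k k).re ≤ (f t k k).re := by
    rw [h3 k]
    have e1 : (1 - (ε : ℂ)) = ((1 - ε : ℝ) : ℂ) := by push_cast; rfl
    rw [e1, add_re, re_ofReal_mul, re_ofReal_mul]
    exact le_add_of_nonneg_right (mul_nonneg hε₀ (PosSemidef_diag_re_nonneg h4 k))
  by_cases h6 : (1 - ε) * (f₁ t k k).re < (f₀ t k k).re
  · rw [(h1.1 k).2 h6]; linarith
  · have := mul_le_mul_of_nonpos_left ((not_lt.mp h6).trans h5) (h1.1 k).1
    linarith

theorem nq_le_of_full (hγ : γ.Positive) {P : Matrix (Fin T) (Fin T) ℂ}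
    (hε₀ : 0 ≤ ε) {w : ℝ → Fin T → ℂ} (hw : MemW (wgt γ f₀) w)
    (hf₀ : f₀ ∈ (ContamClass.full P).densities γ ε f₁)
    (hX : (ContamClass.full P).IsMultiplier ε f₁ f₀ X)
    (hwX : ∀ᵐ t ∂circ, vecMulVec (w t) (star (w t)) = X t)
    (hf : f ∈ (ContamClass.full P).densities γ ε f₁) :
    MemW (wgt γ f) w ∧ nq (wgt γ f) w ≤ nq (wgt γ f₀) w := by
  obtain ⟨A, Γ, -, -, hΓ⟩ := hX
  obtain ⟨hfs, ⟨W, hW, hfW⟩, hfm⟩ := hf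
  obtain ⟨hfs₀, -, hfm₀⟩ := hf₀
  obtain ⟨hE, hE0⟩ := integral_gain_sub_eq_zero hγ (hfs.integrable_trace_mul Aᵀ)
    (hfs₀.integrable_trace_mul Aᵀ) (by
      rw [moment_trace_mul hγ hfs.integrable, moment_trace_mul hγ hfs₀.integrable,
        momentMatrix_eq_iff.mpr hfm, momentMatrix_eq_iff.mpr hfm₀]) 1
  refine nq_le_of_ae_le (hfs.wgt hγ) hw hE hE0 ?_
  filter_upwards [hΓ, hwX, hfW, hW.posSemidef] with t h1 h2 h3 h4
  have hq : ∀ M : Matrix (Fin T) (Fin T) ℂ, qf M (w t) =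
      (Aᵀ * M).trace.re + ((Γ t)ᵀ * M).trace.re := by
    intro M
    rw [qf_eq_trace, h2, h1.2.2, transpose_add, trace_mul_comm, Matrix.add_mul, trace_add, add_re]
  rw [qf_wgt, qf_wgt, ← mul_add]
  refine mul_le_mul_of_nonneg_left ?_ (gain_nonneg γ t)
  rw [hq, hq]
  have h5 : ((Γ t)ᵀ * (f₀ t - (1 - (ε : ℂ)) • f₁ t)).trace = 0 := by
    rw [trace_mul_comm, ← trace_transpose, transpose_mul, transpose_transpose, h1.2.1, trace_zero]
  have h6 : ((Γ t)ᵀ * (f t - (1 - (ε : ℂ)) • f₁ t)).trace.re ≤ 0 := by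
    rw [h3, add_sub_cancel_left, Matrix.mul_smul, trace_smul, smul_eq_mul, re_ofReal_mul]
    have h7 := trace_mul_re_nonneg h1.1.transpose h4
    rw [transpose_neg, Matrix.neg_mul, trace_neg, neg_re] at h7
    nlinarith
  rw [Matrix.mul_sub, trace_sub] at h5 h6
  have h8 := congrArg Complex.re h5
  simp only [sub_re, zero_re] at h6 h8
  linarith

/-- The residual whose square `w w*` is a multiplier is a saddle point. -/
theorem nq_le_of_isMultiplier (hγ : γ.Positive) (hκ : κ.Valid) (hε₀ : 0 ≤ ε)
    {w : ℝ → Fin T → ℂ} (hw : MemW (wgt γ f₀) w)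
    (hf₀ : f₀ ∈ κ.densities γ ε f₁) (hX : κ.IsMultiplier ε f₁ f₀ X)
    (hwX : ∀ᵐ t ∂circ, vecMulVec (w t) (star (w t)) = X t) (hf : f ∈ κ.densities γ ε f₁) :
    MemW (wgt γ f) w ∧ nq (wgt γ f) w ≤ nq (wgt γ f₀) w := by
  cases κ with
  | trace p =>
    rw [densities_trace_eq] at hf hf₀
    refine nq_le_of_weighted (p := p) hγ PosSemidef.one hε₀ hw hf₀ ?_ hwX hf
    simpa only [ContamClass.IsMultiplier, Matrix.one_mul, transpose_one] using hX
  | weighted B₁ p => exact nq_le_of_weighted hγ hκ.posSemidef hε₀ hw hf₀ hX hwX hf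
  | diagonal p => exact nq_le_of_diagonal hγ hε₀ hw hf₀ hX hwX hf
  | full P => exact nq_le_of_full hγ hε₀ hw hf₀ hX hwX hf

theorem isLeastFavorable_of_isMultiplier (hγ : γ.Positive) (ha : IsAdmissible γ a)
    (hκ : κ.Valid) (hε₀ : 0 ≤ ε) (hf₀ : f₀ ∈ κ.densities γ ε f₁) (hm : IsMinimal γ f₀)
    {c : ℕ → Fin T → ℂ} {C : ℝ → Fin T → ℂ} (hC : IsFInverse γ a f₀ c C)
    (hX : κ.IsMultiplier ε f₁ f₀ X) (heq : SpectralEquation γ f₀ X C) :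
    IsLeastFavorable γ a (κ.densities γ ε f₁) f₀ := by
  have hfs₀ := isSpectralDensity_of_mem hf₀
  have hw := hC.isResidual hγ ha hfs₀ hm
  refine ⟨hf₀, fun f hf => ?_⟩
  have hfs := isSpectralDensity_of_mem hf
  obtain ⟨hmem, hle⟩ := nq_le_of_isMultiplier hγ hκ hε₀ hw.memW hf₀ hX
    ((spectralEquation_iff hγ hfs₀ hm).mp heq) hf
  have h1 := optMse_le_of_inPast hγ ha hfs
    (hw.inPast_sub ha (hfs.wgt hγ) (hfs₀.wgt hγ) (hm.coercive hγ hfs₀) hmem)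
  simp only [sub_sub_cancel] at h1
  rw [hw.optMse_eq hγ ha hfs₀]
  exact h1.trans (ENNReal.ofReal_le_ofReal hle)

end sufficiency

/-! ### Necessity of the equation: perturbations and levels -/

theorem sum_norm_sq_le {M : Matrix (Fin T) (Fin T) ℂ} (hM : M.PosSemidef) (hu : IsUnit M.det)
    (u : Fin T → ℂ) : ∑ l, ‖u l‖ ^ 2 ≤ qf M u * (M⁻¹).trace.re := by
  have h1 : ∀ l, ‖u l‖ ^ 2 ≤ qf M u * (M⁻¹ l l).re := by
    intro l
    have h2 : ∀ x : ℝ, 0 ≤ qf M u * (x * x) + -(2 * ‖u l‖) * x + (M⁻¹ l l).re := by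
      intro x
      have h3 := two_mul_norm_apply_le hM hu ((x : ℂ) • u) l
      rw [qf_smul, Pi.smul_apply, norm_smul, norm_real, Real.norm_eq_abs, sq_abs] at h3
      have h4 := mul_le_mul_of_nonneg_right (le_abs_self x) (norm_nonneg (u l))
      nlinarith
    have h5 := discrim_le_zero h2
    rw [discrim] at h5
    nlinarith
  rw [Matrix.trace, re_sum, Finset.mul_sum]
  exact Finset.sum_le_sum fun l _ => h1 l

theorem abs_qf_le (H : Matrix (Fin T) (Fin T) ℂ) (u : Fin T → ℂ) :
    |qf H u| ≤ (∑ p, ∑ l, ‖H p l‖) * ∑ l, ‖u l‖ ^ 2 := by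
  refine (abs_re_le_norm _).trans ?_
  rw [sf_eq_sum, Finset.sum_mul]
  refine norm_sum_le_of_le _ fun p _ => ?_
  rw [Finset.sum_mul]
  refine norm_sum_le_of_le _ fun l _ => ?_
  rw [norm_mul, norm_mul, RCLike.norm_conj]
  have h1 : ∀ j, ‖u j‖ ^ 2 ≤ ∑ l, ‖u l‖ ^ 2 := fun j =>
    Finset.single_le_sum (f := fun l => ‖u l‖ ^ 2) (fun _ _ => sq_nonneg _) (Finset.mem_univ j)
  have h2 : ‖u p‖ * ‖u l‖ ≤ ∑ l, ‖u l‖ ^ 2 := by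
    nlinarith [h1 p, h1 l, sq_nonneg (‖u p‖ - ‖u l‖)]
  calc ‖u p‖ * (‖H p l‖ * ‖u l‖) = ‖H p l‖ * (‖u p‖ * ‖u l‖) := by ring
    _ ≤ _ := mul_le_mul_of_nonneg_left h2 (norm_nonneg _)

theorem aestronglyMeasurable_qf_const (H : Matrix (Fin T) (Fin T) ℂ) {w : ℝ → Fin T → ℂ}
    (hw : MeasV w) : AEStronglyMeasurable (fun t => qf H (w t)) circ :=
  Complex.continuous_re.comp_aestronglyMeasurable
    (aestronglyMeasurable_sf (g := fun _ => H) (fun _ _ => aestronglyMeasurable_const) hw hw)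

theorem isHermitian_real_smul {H : Matrix (Fin T) (Fin T) ℂ} (hH : H.IsHermitian) (x : ℝ) :
    ((x : ℂ) • H).IsHermitian := by
  rw [IsHermitian, conjTranspose_smul, hH.eq, RCLike.star_def, conj_ofReal]

section perturbation

variable {γ : GMIndex r} {f₀ : ℝ → Matrix (Fin T) (Fin T) ℂ} {w : ℝ → Fin T → ℂ}

/-- If no perturbation `f₀ + θ H` of the density increases the norm of `w`, then the form of `H`
vanishes at `w`. -/
theorem ae_qf_eq_zero (hγ : γ.Positive) (hf₀ : IsSpectralDensity f₀) (hm : IsMinimal γ f₀)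
    (hw : MemW (wgt γ f₀) w) {H : Matrix (Fin T) (Fin T) ℂ} (hH : H.IsHermitian)
    (h : ∀ θ : ℝ → ℝ, IsSpectralDensity (fun t => f₀ t + (θ t : ℂ) • H) →
      MemW (wgt γ fun t => f₀ t + (θ t : ℂ) • H) w ∧
        nq (wgt γ fun t => f₀ t + (θ t : ℂ) • H) w ≤ nq (wgt γ f₀) w) :
    ∀ᵐ t ∂circ, qf H (w t) = 0 := by
  set h0 : ℝ := ∑ p, ∑ l, ‖H p l‖ with hh0
  have h00 : 0 ≤ h0 := Finset.sum_nonneg fun p _ => Finset.sum_nonneg fun l _ => norm_nonneg _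
  set τ : ℝ → ℝ := fun t => ((f₀ t)⁻¹).trace.re with hτ
  have hτm : AEStronglyMeasurable τ circ := Complex.continuous_re.comp_aestronglyMeasurable
    (Finset.aestronglyMeasurable_fun_sum _ fun l _ => aestronglyMeasurable_inv_apply hf₀.meas l l)
  have hqm := aestronglyMeasurable_qf_const H hw.meas
  -- the sign of the perturbation is that of the form, its size keeps the density positive
  set θ : ℝ → ℝ := fun t => (1 + h0 * |τ t|)⁻¹ * (qf H (w t) / (1 + |qf H (w t)|)) with hθ
  have hpos1 : ∀ t, 0 < 1 + h0 * |τ t| := fun t => by positivity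
  have hpos2 : ∀ t, 0 < 1 + |qf H (w t)| := fun t => by positivity
  have hθm : AEStronglyMeasurable θ circ := by
    have e1 : AEMeasurable (fun t => 1 + h0 * |τ t|) circ :=
      (hτm.norm.aemeasurable.const_mul h0).const_add 1
    have e2 : AEMeasurable (fun t => 1 + |qf H (w t)|) circ := hqm.norm.aemeasurable.const_add 1
    exact (e1.inv.mul (hqm.aemeasurable.div e2)).aestronglyMeasurable
  have hθle : ∀ t, |θ t| ≤ (1 + h0 * |τ t|)⁻¹ := by
    intro t
    simp only [hθ]
    rw [abs_mul, abs_of_pos (inv_pos.mpr (hpos1 t)), abs_div, abs_of_pos (hpos2 t)]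
    refine mul_le_of_le_one_right (inv_pos.mpr (hpos1 t)).le ?_
    rw [div_le_one (hpos2 t)]
    linarith
  have hθ1 : ∀ t, |θ t| ≤ 1 := fun t => (hθle t).trans (inv_le_one_of_one_le₀ (by
    have := mul_nonneg h00 (abs_nonneg (τ t)); linarith))
  have hd : IsSpectralDensity (fun t => f₀ t + (θ t : ℂ) • H) := by
    constructor
    · filter_upwards [hf₀.posSemidef, hm.isUnit_det] with t h1 h2
      refine posSemidef_of_qf (h1.1.add (isHermitian_real_smul hH _)) fun u => ?_
      rw [qf_add_weight, qf_smul_weight]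
      have h3 := sum_norm_sq_le h1 h2 u
      have h4 := abs_qf_le H u
      have h5 : |θ t * qf H u| ≤ qf (f₀ t) u := by
        rw [abs_mul]
        have h6 : |qf H u| ≤ h0 * |τ t| * qf (f₀ t) u := by
          refine h4.trans ?_
          rw [mul_assoc]
          refine mul_le_mul_of_nonneg_left (h3.trans ?_) h00
          rw [mul_comm]
          exact mul_le_mul_of_nonneg_right (le_abs_self _) (qf_nonneg h1 u)
        have h7 := qf_nonneg h1 u
        calc |θ t| * |qf H u| ≤ (1 + h0 * |τ t|)⁻¹ * (h0 * |τ t| * qf (f₀ t) u) :=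
              mul_le_mul (hθle t) h6 (abs_nonneg _) (inv_pos.mpr (hpos1 t)).le
          _ ≤ (1 + h0 * |τ t|)⁻¹ * ((1 + h0 * |τ t|) * qf (f₀ t) u) := by
              refine mul_le_mul_of_nonneg_left ?_ (inv_pos.mpr (hpos1 t)).le
              linarith
          _ = qf (f₀ t) u := by rw [inv_mul_cancel_left₀ (hpos1 t).ne']
      have h8 := neg_abs_le (θ t * qf H u)
      linarith
    · intro p l
      have hi : Integrable (fun t => (θ t : ℂ)) circ :=
        (integrable_const (1 : ℝ)).mono' (Complex.continuous_ofReal.comp_aestronglyMeasurable hθm)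
          (Eventually.of_forall fun t => by rw [norm_real]; exact hθ1 t)
      exact (hf₀.integrable p l).add (hi.mul_const _)
  obtain ⟨h1, h2⟩ := h θ hd
  have h3 : ∀ t, qf (wgt γ (fun t => f₀ t + (θ t : ℂ) • H) t) (w t) =
      qf (wgt γ f₀ t) (w t) + gain γ t * (θ t * qf H (w t)) := by
    intro t
    rw [qf_wgt, qf_wgt, qf_add_weight, qf_smul_weight, mul_add]
  have h4 : Integrable (fun t => gain γ t * (θ t * qf H (w t))) circ := by
    refine (h1.int.sub hw.int).congr (Eventually.of_forall fun t => ?_)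
    simp only [Pi.sub_apply]
    rw [h3]; ring
  have h5 : ∫ t, gain γ t * (θ t * qf H (w t)) ∂circ ≤ 0 := by
    rw [nq, nq] at h2
    have h6 := le_of_mul_le_mul_left h2 inv_two_pi_pos
    simp only [h3] at h6
    rw [integral_add hw.int h4] at h6
    linarith
  have h6 : ∀ t, θ t * qf H (w t) = (1 + h0 * |τ t|)⁻¹ * (qf H (w t) ^ 2 / (1 + |qf H (w t)|)) :=
    fun t => by simp only [hθ]; ring
  have h7 : ∀ t, 0 ≤ gain γ t * (θ t * qf H (w t)) := fun t => by
    rw [h6]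
    exact mul_nonneg (gain_nonneg γ t) (mul_nonneg (inv_pos.mpr (hpos1 t)).le
      (div_nonneg (sq_nonneg _) (hpos2 t).le))
  have h8 := (integral_eq_zero_iff_of_nonneg h7 h4).mp (le_antisymm h5 (integral_nonneg h7))
  filter_upwards [h8, ae_gain_pos γ hγ] with t h9 h10
  simp only [Pi.zero_apply] at h9
  rw [h6] at h9
  have h11 : qf H (w t) ^ 2 / (1 + |qf H (w t)|) = 0 := by
    rcases mul_eq_zero.mp h9 with h | h
    · exact absurd h h10.ne'
    · exact (mul_eq_zero.mp h).resolve_left (inv_pos.mpr (hpos1 t)).ne'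
  rcases div_eq_zero_iff.mp h11 with h | h
  · exact pow_eq_zero_iff two_ne_zero |>.mp h
  · exact absurd h (hpos2 t).ne'

end perturbation

section levels

variable {γ : GMIndex r}

/-- If all averages of `ρ` against bounded probability densities with respect to `gain γ / 2π` are
at most `M`, then `ρ ≤ M` almost everywhere. -/
theorem ae_le_of_forall_average_le (hγ : γ.Positive) {ρ : ℝ → ℝ}
    (hρ : AEStronglyMeasurable ρ circ) {M : ℝ}
    (h : ∀ θ : ℝ → ℝ, Measurable θ → (∀ t, 0 ≤ θ t) → (∃ K, ∀ t, θ t ≤ K) →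
      ∫ t, gain γ t * θ t ∂circ = 2 * Real.pi →
      Integrable (fun t => gain γ t * (θ t * ρ t)) circ ∧
        ∫ t, gain γ t * (θ t * ρ t) ∂circ ≤ 2 * Real.pi * M) : ∀ᵐ t ∂circ, ρ t ≤ M := by
  set S : Set ℝ := {t | M < hρ.mk ρ t} with hS
  have hSm : MeasurableSet S :=
    measurableSet_lt measurable_const hρ.stronglyMeasurable_mk.measurable
  -- the density to test with is concentrated on the set where the bound fails
  set χ : ℝ → ℝ := S.indicator 1 with hχ
  have hχm : Measurable χ := measurable_one.indicator hSm
  have hχ0 : ∀ t, 0 ≤ χ t := fun t => Set.indicator_nonneg (fun _ _ => zero_le_one) t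
  have hχ1 : ∀ t, χ t ≤ 1 := fun t => Set.indicator_le_self' (fun _ _ => zero_le_one) t
  obtain ⟨K, hK⟩ := exists_gain_le γ hγ
  have hgi : Integrable (fun t => gain γ t * χ t) circ := by
    refine (integrable_const K).mono' ((measurable_gain γ).mul hχm).aestronglyMeasurable ?_
    filter_upwards [hK] with t ht
    rw [Real.norm_of_nonneg (mul_nonneg (gain_nonneg γ t) (hχ0 t))]
    exact (mul_le_of_le_one_right (gain_nonneg γ t) (hχ1 t)).trans ht
  have hg0 : 0 ≤ᵐ[circ] fun t => gain γ t * χ t :=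
    Eventually.of_forall fun t => mul_nonneg (gain_nonneg γ t) (hχ0 t)
  have key : ∀ᵐ t ∂circ, χ t = 0 := by
    by_cases h0 : ∫ t, gain γ t * χ t ∂circ = 0
    · filter_upwards [(integral_eq_zero_iff_of_nonneg_ae hg0 hgi).mp h0, ae_gain_pos γ hγ]
        with t h1 h2
      exact (mul_eq_zero.mp h1).resolve_left h2.ne'
    · set V := ∫ t, gain γ t * χ t ∂circ with hV
      have hVpos : 0 < V := lt_of_le_of_ne (integral_nonneg_of_ae hg0) (Ne.symm h0)
      have hpi := Real.pi_pos
      obtain ⟨h1, h2⟩ := h (fun t => 2 * Real.pi / V * χ t) (hχm.const_mul _)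
        (fun t => mul_nonneg (by positivity) (hχ0 t))
        ⟨2 * Real.pi / V, fun t => mul_le_of_le_one_right (by positivity) (hχ1 t)⟩ (by
          have e : ∀ t, gain γ t * (2 * Real.pi / V * χ t) = 2 * Real.pi / V * (gain γ t * χ t) :=
            fun t => by ring
          simp only [e]
          rw [integral_const_mul, ← hV]
          field_simp)
      have e : ∀ t, gain γ t * (2 * Real.pi / V * χ t * ρ t) =
          2 * Real.pi / V * (gain γ t * (χ t * ρ t)) := fun t => by ring
      simp only [e] at h1 h2
      have h3 : Integrable (fun t => gain γ t * (χ t * ρ t)) circ :=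
        (integrable_const_mul_iff (IsUnit.mk0 _ (by positivity : (2 * Real.pi / V) ≠ 0)) _).mp h1
      rw [integral_const_mul] at h2
      have h4 : ∫ t, gain γ t * (χ t * ρ t) ∂circ ≤ M * V := by
        rw [div_mul_eq_mul_div, div_le_iff₀ hVpos] at h2
        nlinarith
      have h5 : Integrable (fun t => gain γ t * (χ t * ρ t) - M * (gain γ t * χ t)) circ :=
        h3.sub (hgi.const_mul M)
      have h6 : 0 ≤ᵐ[circ] fun t => gain γ t * (χ t * ρ t) - M * (gain γ t * χ t) := by
        filter_upwards [hρ.ae_eq_mk] with t ht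
        have e2 : gain γ t * (χ t * ρ t) - M * (gain γ t * χ t) = gain γ t * (χ t * (ρ t - M)) := by
          ring
        simp only [Pi.zero_apply]
        rw [e2]
        refine mul_nonneg (gain_nonneg γ t) ?_
        by_cases hts : t ∈ S
        · have : M < ρ t := by rw [ht]; exact hts
          exact mul_nonneg (hχ0 t) (by linarith)
        · rw [hχ, Set.indicator_of_notMem hts, zero_mul]
      have h7 : ∫ t, gain γ t * (χ t * ρ t) - M * (gain γ t * χ t) ∂circ = 0 := by
        refine le_antisymm ?_ (integral_nonneg_of_ae h6)
        rw [integral_sub h3 (hgi.const_mul M), integral_const_mul, ← hV]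
        linarith
      filter_upwards [(integral_eq_zero_iff_of_nonneg_ae h6 h5).mp h7, ae_gain_pos γ hγ,
        hρ.ae_eq_mk] with t h8 h9 h10
      simp only [Pi.zero_apply] at h8
      by_contra hne
      have hts : t ∈ S := by
        by_contra hts
        exact hne (by rw [hχ, Set.indicator_of_notMem hts])
      have h11 : M < ρ t := by rw [h10]; exact hts
      have h12 : χ t = 1 := by rw [hχ, Set.indicator_of_mem hts]; rfl
      rw [h12] at h8
      nlinarith
  filter_upwards [key, hρ.ae_eq_mk] with t h1 h2
  by_contra hlt
  have hts : t ∈ S := by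
    rw [hS, Set.mem_ofPred_eq, ← h2]; exact not_le.mp hlt
  rw [hχ, Set.indicator_of_mem hts] at h1
  exact one_ne_zero h1

/-- If moving the mass of `g₀` elsewhere does not increase the integral of `ρ`, then `g₀` is
concentrated where `ρ` attains its maximum. -/
theorem exists_level (hγ : γ.Positive) {ρ g₀ : ℝ → ℝ} (hρ : AEStronglyMeasurable ρ circ)
    (hρ0 : ∀ t, 0 ≤ ρ t) (hg₀ : ∀ᵐ t ∂circ, 0 ≤ g₀ t)
    (hi : Integrable (fun t => gain γ t * g₀ t) circ)
    (hρi : Integrable (fun t => gain γ t * (g₀ t * ρ t)) circ) {m : ℝ} (hm : 0 < m)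
    (hgm : ∫ t, gain γ t * g₀ t ∂circ = 2 * Real.pi * m)
    (h : ∀ θ : ℝ → ℝ, Measurable θ → (∀ t, 0 ≤ θ t) → (∃ K, ∀ t, θ t ≤ K) →
      ∫ t, gain γ t * θ t ∂circ = 2 * Real.pi →
      Integrable (fun t => gain γ t * (m * θ t * ρ t)) circ ∧
        ∫ t, gain γ t * (m * θ t * ρ t) ∂circ ≤ ∫ t, gain γ t * (g₀ t * ρ t) ∂circ) :
    ∃ M : ℝ, 0 ≤ M ∧ ∀ᵐ t ∂circ, ρ t ≤ M ∧ (0 < g₀ t → ρ t = M) := by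
  set J := ∫ t, gain γ t * (g₀ t * ρ t) ∂circ with hJ
  have hpi := Real.pi_pos
  have hJ0 : 0 ≤ J := integral_nonneg_of_ae (hg₀.mono fun t ht =>
    mul_nonneg (gain_nonneg γ t) (mul_nonneg ht (hρ0 t)))
  -- the maximum of `ρ` can only be the average of `ρ` with respect to `g₀`
  set M := J / (2 * Real.pi * m) with hM
  have hle : ∀ᵐ t ∂circ, ρ t ≤ M := by
    refine ae_le_of_forall_average_le hγ hρ fun θ h1 h2 h3 h4 => ?_
    obtain ⟨h5, h6⟩ := h θ h1 h2 h3 h4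
    have e : ∀ t, gain γ t * (m * θ t * ρ t) = m * (gain γ t * (θ t * ρ t)) := fun t => by ring
    simp only [e] at h5 h6
    refine ⟨(integrable_const_mul_iff (IsUnit.mk0 _ hm.ne') _).mp h5, ?_⟩
    rw [integral_const_mul] at h6
    have e2 : 2 * Real.pi * M = J / m := by rw [hM]; field_simp
    rw [e2, le_div_iff₀ hm]
    linarith
  refine ⟨M, by positivity, ?_⟩
  have e : ∀ t, gain γ t * (g₀ t * (M - ρ t)) =
      M * (gain γ t * g₀ t) - gain γ t * (g₀ t * ρ t) := fun t => by ring
  have h5 : Integrable (fun t => gain γ t * (g₀ t * (M - ρ t))) circ := by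
    simp only [e]; exact (hi.const_mul M).sub hρi
  have h6 : 0 ≤ᵐ[circ] fun t => gain γ t * (g₀ t * (M - ρ t)) := by
    filter_upwards [hle, hg₀] with t h1 h2
    exact mul_nonneg (gain_nonneg γ t) (mul_nonneg h2 (sub_nonneg.mpr h1))
  have h7 : ∫ t, gain γ t * (g₀ t * (M - ρ t)) ∂circ = 0 := by
    simp only [e]
    rw [integral_sub (hi.const_mul M) hρi, integral_const_mul, hgm, ← hJ, hM]
    field_simp
    ring
  filter_upwards [hle, (integral_eq_zero_iff_of_nonneg_ae h6 h5).mp h7, ae_gain_pos γ hγ]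
    with t h1 h2 h3
  refine ⟨h1, fun h4 => ?_⟩
  have h8 := (mul_eq_zero.mp h2).resolve_left h3.ne'
  have h9 := (mul_eq_zero.mp h8).resolve_left h4.ne'
  linarith

end levels

/-! ### Necessity of the equation: scalar restrictions -/

section hermitianBasis

theorem qf_single_matrix (z : ℂ) (p l : Fin T) (u : Fin T → ℂ) :
    qf (Matrix.single p l z) u = (z * (u p * conj (u l))).re := by
  rw [qf, sf_eq_sum, Finset.sum_eq_single p, Finset.sum_eq_single l]
  · rw [single_apply_same]; congr 1; ring
  · intro j _ hj
    simp [Ne.symm hj]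
  · simp
  · intro j _ hj
    refine Finset.sum_eq_zero fun i _ => ?_
    simp [Ne.symm hj]
  · simp

/-- The Hermitian matrices with entries `z` at `(p, l)` and `conj z` at `(l, p)`; for `z = 1, I`
their forms are the real and imaginary parts of `u p * conj (u l)`. -/
def hermUnit (z : ℂ) (p l : Fin T) : Matrix (Fin T) (Fin T) ℂ :=
  Matrix.single p l z + Matrix.single l p (conj z)

theorem isHermitian_hermUnit (z : ℂ) (p l : Fin T) : (hermUnit z p l).IsHermitian := by
  rw [IsHermitian, hermUnit, conjTranspose_add, conjTranspose_single, conjTranspose_single,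
    add_comm]
  simp

theorem qf_hermUnit (z : ℂ) (p l : Fin T) (u : Fin T → ℂ) :
    qf (hermUnit z p l) u = 2 * (z * (u p * conj (u l))).re := by
  rw [hermUnit, qf_add_weight, qf_single_matrix, qf_single_matrix]
  simp only [mul_re, mul_im, conj_re, conj_im]
  ring

theorem trace_mul_hermUnit {B : Matrix (Fin T) (Fin T) ℂ} (hB : B.IsHermitian) (z : ℂ)
    (p l : Fin T) : (B * hermUnit z p l).trace = ((2 * (z * B l p).re : ℝ) : ℂ) := by
  have h1 : B p l = conj (B l p) := (hB.apply p l).symm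
  have h2 : ∀ (i j : Fin T) (x : ℂ), (B * Matrix.single i j x).trace = x * B j i := by
    intro i j x
    rw [trace_mul_single]
    simp [mul_comm]
  rw [hermUnit, Matrix.mul_add, trace_add, h2, h2, h1, ← map_mul, Complex.add_conj]

theorem eq_of_re_mul_eq {x y : ℂ} (h1 : (1 * x).re = (1 * y).re) (h2 : (I * x).re = (I * y).re) :
    x = y := by
  simp only [one_mul, I_mul_re, neg_inj] at h1 h2
  exact Complex.ext h1 h2

end hermitianBasis

section scalar

variable {γ : GMIndex r} {f₀ f₁ : ℝ → Matrix (Fin T) (Fin T) ℂ} {ε : ℝ} {w : ℝ → Fin T → ℂ}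

theorem moment_ofReal (θ : ℝ → ℝ) :
    moment γ (fun t => (θ t : ℂ)) = ((1 / (2 * Real.pi) * ∫ t, gain γ t * θ t ∂circ : ℝ) : ℂ) := by
  have h : ∀ t, ((gain γ t : ℝ) : ℂ) * (θ t : ℂ) = ((gain γ t * θ t : ℝ) : ℂ) := fun t => by
    push_cast; rfl
  rw [moment]
  simp only [h]
  rw [integral_complex_ofReal]
  push_cast; rfl

theorem moment_congr {u v : ℝ → ℂ} (h : u =ᵐ[circ] v) : moment γ u = moment γ v := by
  rw [moment, moment]
  congr 1
  exact integral_congr_ae (h.mono fun t ht => by simp only [ht])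

theorem moment_eq_re {u : ℝ → ℂ} (h : ∀ᵐ t ∂circ, 0 ≤ u t) :
    moment γ u = ((moment γ u).re : ℂ) := by
  have h1 : moment γ u = moment γ (fun t => ((u t).re : ℂ)) := moment_congr (h.mono fun t ht =>
    Complex.ext rfl (Complex.le_def.mp ht).2.symm)
  rw [h1, moment_ofReal, ofReal_re]

theorem moment_eq_one {θ : ℝ → ℝ} (h : ∫ t, gain γ t * θ t ∂circ = 2 * Real.pi) :
    moment γ (fun t => (θ t : ℂ)) = 1 := by
  rw [moment_ofReal, h]
  have := Real.pi_pos
  rw [one_div, inv_mul_cancel₀ (by positivity), ofReal_one]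

theorem integrable_ofReal_of_bdd {θ : ℝ → ℝ} (hθ : Measurable θ) (h0 : ∀ t, 0 ≤ θ t)
    (hK : ∃ K, ∀ t, θ t ≤ K) : Integrable (fun t => (θ t : ℂ)) circ := by
  obtain ⟨K, hK⟩ := hK
  refine (integrable_const K).mono'
    (Complex.measurable_ofReal.comp hθ).aestronglyMeasurable (Eventually.of_forall fun t => ?_)
  rw [norm_real, Real.norm_of_nonneg (h0 t)]
  exact hK t

theorem integral_le_of_ae_eq {E F F₀ G : ℝ → ℝ} (hF : Integrable F circ)
    (hF₀ : Integrable F₀ circ) (hG : Integrable G circ)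
    (hle : ∫ t, F t ∂circ ≤ ∫ t, F₀ t ∂circ) (h : ∀ᵐ t ∂circ, E t = F t - F₀ t + G t) :
    Integrable E circ ∧ ∫ t, E t ∂circ ≤ ∫ t, G t ∂circ := by
  have h1 : Integrable (fun t => F t - F₀ t) circ := hF.sub hF₀
  have h2 : Integrable (fun t => F t - F₀ t + G t) circ := h1.add hG
  refine ⟨h2.congr (h.mono fun t ht => ht.symm), ?_⟩
  rw [integral_congr_ae h, integral_add h1 hG, integral_sub hF hF₀]
  linarith

theorem integral_qf_le_of_nq_le {g g₀ : ℝ → Matrix (Fin T) (Fin T) ℂ}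
    (h : nq g w ≤ nq g₀ w) : ∫ t, qf (g t) (w t) ∂circ ≤ ∫ t, qf (g₀ t) (w t) ∂circ :=
  le_of_mul_le_mul_left h inv_two_pi_pos

theorem one_sub_nonneg_complex (hε₁ : ε ≤ 1) : (0 : ℂ) ≤ 1 - (ε : ℂ) := by
  have e1 : (1 - (ε : ℂ)) = ((1 - ε : ℝ) : ℂ) := by push_cast; rfl
  rw [e1]
  exact_mod_cast sub_nonneg.mpr hε₁

theorem re_one_sub_mul (ε : ℝ) (z : ℂ) : ((1 - (ε : ℂ)) * z).re = (1 - ε) * z.re := by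
  have e1 : (1 - (ε : ℂ)) = ((1 - ε : ℝ) : ℂ) := by push_cast; rfl
  rw [e1, re_ofReal_mul]

/-- Under the restriction on `⟨B₁, f⟩`, the residual at a least favourable density satisfies the
equation. -/
theorem isMultiplier_weighted (hT : 0 < T) (hγ : γ.Positive) {B₁ : Matrix (Fin T) (Fin T) ℂ}
    {p : ℝ} (hB : B₁.PosDef) (hε₀ : 0 ≤ ε) (hε₁ : ε ≤ 1) (hf₁ : IsSpectralDensity f₁)
    (hf₀ : f₀ ∈ (ContamClass.weighted B₁ p).densities γ ε f₁) (hm : IsMinimal γ f₀)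
    (hnd : (ContamClass.weighted B₁ p).Nondegenerate γ ε f₁) (hw : MemW (wgt γ f₀) w)
    (hS : ∀ f ∈ (ContamClass.weighted B₁ p).densities γ ε f₁,
      MemW (wgt γ f) w ∧ nq (wgt γ f) w ≤ nq (wgt γ f₀) w) :
    (ContamClass.weighted B₁ p).IsMultiplier ε f₁ f₀
      (fun t => vecMulVec (w t) (star (w t))) := by
  have : NeZero T := ⟨hT.ne'⟩
  obtain ⟨hfs₀, ⟨W₀, hW₀, hfW₀⟩, hfm₀⟩ := hf₀
  set b : ℝ := B₁.trace.re with hb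
  have hbtr : B₁.trace = (b : ℂ) :=
    Complex.ext rfl (Complex.le_def.mp hB.posSemidef.trace_nonneg).2.symm
  have hb0 : 0 < b := (Complex.lt_def.mp hB.trace_pos).1
  have hbne : (b : ℂ) ≠ 0 := by exact_mod_cast hb0.ne'
  -- perturbations that do not change `⟨B₁, f⟩`
  have hpert : ∀ H : Matrix (Fin T) (Fin T) ℂ, H.IsHermitian → (B₁ * H).trace = 0 →
      ∀ᵐ t ∂circ, qf H (w t) = 0 := by
    intro H hH h0
    refine ae_qf_eq_zero hγ hfs₀ hm hw hH fun θ hθ => hS _ ?_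
    have he : ∀ t, (B₁ * (f₀ t + (θ t : ℂ) • H)).trace = (B₁ * f₀ t).trace := fun t => by
      rw [Matrix.mul_add, Matrix.mul_smul, trace_add, trace_smul, h0, smul_zero, add_zero]
    exact ⟨hθ, ⟨W₀, hW₀, hfW₀.mono fun t ht => by rw [he, ht]⟩, by simpa only [he] using hfm₀⟩
  set ρ : ℝ → ℝ := fun t => (∑ l, ‖w t l‖ ^ 2) / b with hρ
  have hρ0 : ∀ t, 0 ≤ ρ t := fun t =>
    div_nonneg (Finset.sum_nonneg fun l _ => sq_nonneg _) hb0.le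
  have hρm : AEStronglyMeasurable ρ circ :=
    (Finset.aestronglyMeasurable_fun_sum Finset.univ fun l _ =>
      (hw.meas l).norm.pow 2).aemeasurable.div_const b |>.aestronglyMeasurable
  have hone : ∀ u : Fin T → ℂ, qf (1 : Matrix (Fin T) (Fin T) ℂ) u = ∑ l, ‖u l‖ ^ 2 := by
    intro u
    rw [qf, sf, one_mulVec, dotProduct, re_sum]
    refine Finset.sum_congr rfl fun l _ => ?_
    rw [Pi.star_apply, RCLike.star_def, mul_conj', ← ofReal_pow, ofReal_re]
  have hK : ∀ (z : ℂ) (i j : Fin T), ∀ᵐ t ∂circ,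
      (z * (w t i * conj (w t j))).re = (z * ((ρ t : ℂ) * B₁ j i)).re := by
    intro z i j
    set x : ℝ := 2 * (z * B₁ j i).re / b with hx
    have h1 := hpert (hermUnit z i j + ((-x : ℝ) : ℂ) • (1 : Matrix (Fin T) (Fin T) ℂ))
      ((isHermitian_hermUnit z i j).add (isHermitian_real_smul isHermitian_one _)) (by
        rw [Matrix.mul_add, trace_add, trace_mul_hermUnit hB.1, Matrix.mul_smul, trace_smul,
          Matrix.mul_one, hbtr, hx]
        push_cast
        rw [smul_eq_mul]
        field_simp
        ring)
    filter_upwards [h1] with t h2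
    rw [qf_add_weight, qf_smul_weight, qf_hermUnit, hone] at h2
    have h3 : (z * ((ρ t : ℂ) * B₁ j i)).re = ρ t * (z * B₁ j i).re := by
      rw [mul_left_comm, re_ofReal_mul]
    rw [h3]
    simp only [hρ]
    rw [hx] at h2
    field_simp at h2 ⊢
    linarith
  have hwB : ∀ᵐ t ∂circ, vecMulVec (w t) (star (w t)) = ((ρ t : ℝ) : ℂ) • B₁ᵀ := by
    have h1 := ae_all_iff.mpr fun i => ae_all_iff.mpr fun j => hK 1 i j
    have h2 := ae_all_iff.mpr fun i => ae_all_iff.mpr fun j => hK I i j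
    filter_upwards [h1, h2] with t h3 h4
    ext i j
    exact eq_of_re_mul_eq (h3 i j) (h4 i j)
  have hqf : ∀ᵐ t ∂circ, ∀ M : Matrix (Fin T) (Fin T) ℂ,
      qf M (w t) = ρ t * (B₁ * M).trace.re := by
    filter_upwards [hwB] with t h M
    rw [qf_eq_trace, h, transpose_smul, transpose_transpose, Matrix.mul_smul, trace_smul,
      smul_eq_mul, re_ofReal_mul, trace_mul_comm]
  -- the level of `ρ`
  set g₀ : ℝ → ℝ := fun t => (B₁ * f₀ t).trace.re - (1 - ε) * (B₁ * f₁ t).trace.re with hg₀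
  have hg₀W : ∀ᵐ t ∂circ, g₀ t = ε * (B₁ * W₀ t).trace.re := by
    filter_upwards [hfW₀] with t h
    simp only [hg₀]
    rw [h, add_re, re_one_sub_mul, re_ofReal_mul]; ring
  have hg₀0 : ∀ᵐ t ∂circ, 0 ≤ g₀ t := by
    filter_upwards [hg₀W, hW₀.posSemidef] with t h h'
    rw [h]; exact mul_nonneg hε₀ (trace_mul_re_nonneg hB.posSemidef h')
  obtain ⟨hi0, hI0⟩ := integral_gain_re hγ (hfs₀.integrable_trace_mul B₁)
  obtain ⟨hi1, hI1⟩ := integral_gain_re hγ (hf₁.integrable_trace_mul B₁)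
  have hge : ∀ t, gain γ t * g₀ t = gain γ t * (B₁ * f₀ t).trace.re -
      (1 - ε) * (gain γ t * (B₁ * f₁ t).trace.re) := fun t => by simp only [hg₀]; ring
  have hgi : Integrable (fun t => gain γ t * g₀ t) circ := by
    simp only [hge]; exact hi0.sub (hi1.const_mul _)
  set m : ℝ := p - (1 - ε) * (moment γ fun t => (B₁ * f₁ t).trace).re with hmdef
  have hm0 : 0 < m := sub_pos.mpr hnd
  have hgm : ∫ t, gain γ t * g₀ t ∂circ = 2 * Real.pi * m := by
    simp only [hge]
    rw [integral_sub hi0 (hi1.const_mul _), integral_const_mul, hI0, hI1, hfm₀, ofReal_re, hmdef]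
    ring
  have hε : 0 < ε := by
    refine lt_of_le_of_ne hε₀ fun h0 => ?_
    have h1 : ∫ t, gain γ t * g₀ t ∂circ = 0 := integral_eq_zero_of_ae (hg₀W.mono fun t ht => by
      simp only [Pi.zero_apply]; rw [ht, ← h0, zero_mul, mul_zero])
    rw [hgm] at h1
    exact (mul_pos (by positivity) hm0).ne' h1
  have hf₁0 : ∀ᵐ t ∂circ, 0 ≤ (B₁ * f₁ t).trace := hf₁.posSemidef.mono fun t ht =>
    (posSemidef_trace_mul hB.posSemidef ht).1
  have hρi : Integrable (fun t => gain γ t * (g₀ t * ρ t)) circ := by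
    refine hw.int.mono' ((measurable_gain γ).aestronglyMeasurable.mul
      (AEStronglyMeasurable.mul ?_ hρm)) ?_
    · exact (hfs₀.integrable_trace_mul B₁).re.1.sub
        ((hf₁.integrable_trace_mul B₁).re.1.const_mul _)
    · filter_upwards [hqf, hg₀0, hf₁0] with t h1 h2 h3
      rw [Real.norm_of_nonneg (mul_nonneg (gain_nonneg γ t) (mul_nonneg h2 (hρ0 t))), qf_wgt, h1]
      refine mul_le_mul_of_nonneg_left ?_ (gain_nonneg γ t)
      rw [mul_comm]
      refine mul_le_mul_of_nonneg_left ?_ (hρ0 t)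
      exact sub_le_self _ (mul_nonneg (sub_nonneg.mpr hε₁) (Complex.le_def.mp h3).1)
  obtain ⟨M, hM0, hM⟩ := exists_level hγ hρm hρ0 hg₀0 hgi hρi hm0 hgm fun θ h1 h2 h3 h4 => by
    have hθi := integrable_ofReal_of_bdd h1 h2 h3
    set ψ : ℝ → ℂ := fun t => (b : ℂ)⁻¹ * ((1 - (ε : ℂ)) * (B₁ * f₁ t).trace + (m : ℂ) * θ t)
      with hψ
    have hb0' : (0 : ℂ) ≤ (b : ℂ)⁻¹ := by
      rw [← ofReal_inv]; exact_mod_cast (inv_pos.mpr hb0).le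
    have hθ0 : ∀ t, (0 : ℂ) ≤ (m : ℂ) * θ t := fun t => by
      exact_mod_cast mul_nonneg hm0.le (h2 t)
    have hψi : Integrable ψ circ :=
      (((hf₁.integrable_trace_mul B₁).const_mul _).add (hθi.const_mul _)).const_mul _
    have hdiag : ∀ {φ : ℝ → ℂ}, Integrable φ circ → (∀ᵐ t ∂circ, 0 ≤ φ t) →
        IsSpectralDensity (fun t => φ t • (1 : Matrix (Fin T) (Fin T) ℂ)) := fun hφ h0 =>
      ⟨h0.mono fun t ht => PosSemidef.one.smul ht, fun p l => hφ.mul_const _⟩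
    have htr : ∀ z : ℂ, (B₁ * z • (1 : Matrix (Fin T) (Fin T) ℂ)).trace = z * b := fun z => by
      rw [Matrix.mul_smul, Matrix.mul_one, trace_smul, hbtr, smul_eq_mul]
    have hψb : ∀ t, ψ t * b = (1 - (ε : ℂ)) * (B₁ * f₁ t).trace + (m : ℂ) * θ t := fun t => by
      simp only [hψ]; field_simp
    have hεne : (ε : ℂ) ≠ 0 := by exact_mod_cast hε.ne'
    have hmem : (fun t => ψ t • (1 : Matrix (Fin T) (Fin T) ℂ)) ∈
        (ContamClass.weighted B₁ p).densities γ ε f₁ := by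
      refine ⟨hdiag hψi (hf₁0.mono fun t ht => mul_nonneg hb0' (add_nonneg
        (mul_nonneg (one_sub_nonneg_complex hε₁) ht) (hθ0 t))),
        ⟨fun t => ((b : ℂ)⁻¹ * ((ε : ℂ)⁻¹ * ((m : ℂ) * θ t))) • 1, hdiag
          (((hθi.const_mul _).const_mul _).const_mul _) (Eventually.of_forall fun t =>
            mul_nonneg hb0' (mul_nonneg ?_ (hθ0 t))), Eventually.of_forall fun t => ?_⟩, ?_⟩
      · rw [← ofReal_inv]; exact_mod_cast (inv_pos.mpr hε).le
      · rw [htr, htr, hψb]; field_simp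
      · simp only [htr, hψb]
        rw [moment_mix hγ (hf₁.integrable_trace_mul B₁) hθi, moment_eq_one h4,
          moment_eq_re hf₁0, hmdef]
        push_cast; ring
    obtain ⟨h5, h6⟩ := hS _ hmem
    refine integral_le_of_ae_eq h5.int hw.int hρi (integral_qf_le_of_nq_le h6) ?_
    filter_upwards [hqf] with t h7
    rw [qf_wgt, qf_wgt, h7, h7, htr, hψb, add_re, re_one_sub_mul]
    have h8 : ((m : ℂ) * (θ t : ℂ)).re = m * θ t := by rw [← ofReal_mul, ofReal_re]
    rw [h8]
    simp only [hg₀]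
    ring
  refine ⟨Real.sqrt M, fun t => ρ t - M, ?_⟩
  filter_upwards [hM, hwB] with t h1 h2
  refine ⟨sub_nonpos.mpr h1.1, fun h3 => sub_eq_zero.mpr (h1.2 (sub_pos.mpr h3)), ?_⟩
  rw [h2, Real.sq_sqrt hM0, add_sub_cancel]

/-- Under the restrictions on the diagonal entries, the residual at a least favourable density
satisfies the equation. -/
theorem isMultiplier_diagonal (hγ : γ.Positive)
    {p : Fin T → ℝ} (hε₀ : 0 ≤ ε) (hε₁ : ε ≤ 1) (hf₁ : IsSpectralDensity f₁)
    (hf₀ : f₀ ∈ (ContamClass.diagonal p).densities γ ε f₁) (hm : IsMinimal γ f₀)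
    (hnd : (ContamClass.diagonal p).Nondegenerate γ ε f₁) (hw : MemW (wgt γ f₀) w)
    (hS : ∀ f ∈ (ContamClass.diagonal p).densities γ ε f₁,
      MemW (wgt γ f) w ∧ nq (wgt γ f) w ≤ nq (wgt γ f₀) w) :
    (ContamClass.diagonal p).IsMultiplier ε f₁ f₀
      (fun t => vecMulVec (w t) (star (w t))) := by
  obtain ⟨hfs₀, ⟨W₀, hW₀, hfW₀⟩, hfm₀⟩ := hf₀
  -- perturbations that do not change the diagonal
  have hpert : ∀ (z : ℂ) (i j : Fin T), i ≠ j → ∀ᵐ t ∂circ,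
      (z * (w t i * conj (w t j))).re = (z * 0).re := by
    intro z i j hij
    have hz : ∀ k, hermUnit z i j k k = 0 := by
      intro k
      rw [hermUnit, Matrix.add_apply, Matrix.single_apply, Matrix.single_apply, if_neg, if_neg,
        add_zero]
      · rintro ⟨rfl, h⟩; exact hij h
      · rintro ⟨rfl, h⟩; exact hij h.symm
    have h1 := ae_qf_eq_zero hγ hfs₀ hm hw (isHermitian_hermUnit z i j) fun θ hθ => hS _ (by
      have he : ∀ t k, (f₀ t + (θ t : ℂ) • hermUnit z i j) k k = f₀ t k k := fun t k => by
        rw [Matrix.add_apply, Matrix.smul_apply, hz, smul_zero, add_zero]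
      exact ⟨hθ, ⟨W₀, hW₀, hfW₀.mono fun t ht k => (he t k).trans (ht k)⟩,
        by simpa only [he] using hfm₀⟩)
    filter_upwards [h1] with t h2
    rw [qf_hermUnit] at h2
    rw [mul_zero, zero_re]
    linarith
  have hwD : ∀ᵐ t ∂circ, vecMulVec (w t) (star (w t)) =
      Matrix.diagonal fun k => ((‖w t k‖ ^ 2 : ℝ) : ℂ) := by
    have h1 := ae_all_iff.mpr fun i => ae_all_iff.mpr fun j =>
      ae_all_iff.mpr fun h : i ≠ j => hpert 1 i j h
    have h2 := ae_all_iff.mpr fun i => ae_all_iff.mpr fun j =>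
      ae_all_iff.mpr fun h : i ≠ j => hpert I i j h
    filter_upwards [h1, h2] with t h3 h4
    ext i j
    by_cases hij : i = j
    · subst hij
      rw [vecMulVec_apply, Pi.star_apply, RCLike.star_def, mul_conj', diagonal_apply_eq]
      push_cast; rfl
    · rw [diagonal_apply_ne _ hij]
      exact eq_of_re_mul_eq (h3 i j hij) (h4 i j hij)
  have hqf : ∀ᵐ t ∂circ, ∀ M : Matrix (Fin T) (Fin T) ℂ,
      qf M (w t) = ∑ k, ‖w t k‖ ^ 2 * (M k k).re := by
    filter_upwards [hwD] with t h M
    rw [qf_eq_trace, h, diagonal_transpose, Matrix.trace, re_sum]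
    refine Finset.sum_congr rfl fun k _ => ?_
    rw [diag_apply, mul_diagonal, mul_comm, re_ofReal_mul]
  have hlevel : ∀ k, ∃ M : ℝ, 0 ≤ M ∧ ∀ᵐ t ∂circ, ‖w t k‖ ^ 2 ≤ M ∧
      (0 < (f₀ t k k).re - (1 - ε) * (f₁ t k k).re → ‖w t k‖ ^ 2 = M) := by
    intro k
    set ρ : ℝ → ℝ := fun t => ‖w t k‖ ^ 2 with hρ
    have hρ0 : ∀ t, 0 ≤ ρ t := fun t => sq_nonneg _
    have hρm : AEStronglyMeasurable ρ circ := (hw.meas k).norm.pow 2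
    set g₀ : ℝ → ℝ := fun t => (f₀ t k k).re - (1 - ε) * (f₁ t k k).re with hg₀
    have hg₀W : ∀ᵐ t ∂circ, g₀ t = ε * (W₀ t k k).re := by
      filter_upwards [hfW₀] with t h
      simp only [hg₀]
      rw [h, add_re, re_one_sub_mul, re_ofReal_mul]; ring
    have hg₀0 : ∀ᵐ t ∂circ, 0 ≤ g₀ t := by
      filter_upwards [hg₀W, hW₀.posSemidef] with t h h'
      rw [h]; exact mul_nonneg hε₀ (PosSemidef_diag_re_nonneg h' k)
    obtain ⟨hi0, hI0⟩ := integral_gain_re hγ (hfs₀.integrable k k)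
    obtain ⟨hi1, hI1⟩ := integral_gain_re hγ (hf₁.integrable k k)
    have hge : ∀ t, gain γ t * g₀ t = gain γ t * (f₀ t k k).re -
        (1 - ε) * (gain γ t * (f₁ t k k).re) := fun t => by simp only [hg₀]; ring
    have hgi : Integrable (fun t => gain γ t * g₀ t) circ := by
      simp only [hge]; exact hi0.sub (hi1.const_mul _)
    set m : ℝ := p k - (1 - ε) * (moment γ fun t => f₁ t k k).re with hmdef
    have hm0 : 0 < m := sub_pos.mpr (hnd k)
    have hgm : ∫ t, gain γ t * g₀ t ∂circ = 2 * Real.pi * m := by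
      simp only [hge]
      rw [integral_sub hi0 (hi1.const_mul _), integral_const_mul, hI0, hI1, hfm₀, ofReal_re, hmdef]
      ring
    have hε : 0 < ε := by
      refine lt_of_le_of_ne hε₀ fun h0 => ?_
      have h1 : ∫ t, gain γ t * g₀ t ∂circ = 0 := integral_eq_zero_of_ae (hg₀W.mono fun t ht => by
        simp only [Pi.zero_apply]; rw [ht, ← h0, zero_mul, mul_zero])
      rw [hgm] at h1
      exact (mul_pos (by positivity) hm0).ne' h1
    have hf₁0 : ∀ᵐ t ∂circ, 0 ≤ f₁ t k k := hf₁.posSemidef.mono fun t ht => ht.diag_nonneg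
    have hρi : Integrable (fun t => gain γ t * (g₀ t * ρ t)) circ := by
      refine hw.int.mono' ((measurable_gain γ).aestronglyMeasurable.mul
        (AEStronglyMeasurable.mul ?_ hρm)) ?_
      · exact (hfs₀.integrable k k).re.1.sub ((hf₁.integrable k k).re.1.const_mul _)
      · filter_upwards [hqf, hg₀0, hf₁0, hfs₀.posSemidef] with t h1 h2 h3 h4
        rw [Real.norm_of_nonneg (mul_nonneg (gain_nonneg γ t) (mul_nonneg h2 (hρ0 t))), qf_wgt, h1]
        refine mul_le_mul_of_nonneg_left ?_ (gain_nonneg γ t)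
        rw [mul_comm]
        refine le_trans (mul_le_mul_of_nonneg_left ?_ (hρ0 t)) (Finset.single_le_sum
          (f := fun k => ‖w t k‖ ^ 2 * (f₀ t k k).re) (fun j _ => mul_nonneg (sq_nonneg _)
            (PosSemidef_diag_re_nonneg h4 j)) (Finset.mem_univ k))
        exact sub_le_self _ (mul_nonneg (sub_nonneg.mpr hε₁) (Complex.le_def.mp h3).1)
    refine exists_level hγ hρm hρ0 hg₀0 hgi hρi hm0 hgm fun θ h1 h2 h3 h4 => ?_
    have hθi := integrable_ofReal_of_bdd h1 h2 h3
    have hθ0 : ∀ t, (0 : ℂ) ≤ (m : ℂ) * θ t := fun t => by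
      exact_mod_cast mul_nonneg hm0.le (h2 t)
    have hεne : (ε : ℂ) ≠ 0 := by exact_mod_cast hε.ne'
    -- only the `k`-th diagonal entry is changed
    have hdiag : ∀ {F : ℝ → Matrix (Fin T) (Fin T) ℂ} {φ : ℝ → ℂ}, IsSpectralDensity F →
        Integrable φ circ → (∀ᵐ t ∂circ, 0 ≤ φ t) → IsSpectralDensity (fun t =>
          Matrix.diagonal fun j => if j = k then φ t else F t j j) := by
      intro F φ hF hφ h0
      refine ⟨?_, fun i j => ?_⟩
      · filter_upwards [hF.posSemidef, h0] with t h5 h6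
        refine PosSemidef.diagonal fun j => ?_
        by_cases hj : j = k
        · simp only [hj, if_true]; exact h6
        · simp only [hj, if_false]; exact h5.diag_nonneg
      · by_cases hij : i = j
        · subst hij
          simp only [diagonal_apply_eq]
          by_cases hj : i = k
          · simpa only [hj, if_true] using hφ
          · simpa only [hj, if_false] using hF.integrable i i
        · simp only [diagonal_apply_ne _ hij]
          exact integrable_zero _ _ _
    set φ : ℝ → ℂ := fun t => (1 - (ε : ℂ)) * f₁ t k k + (m : ℂ) * θ t with hφ
    have hφi : Integrable φ circ := ((hf₁.integrable k k).const_mul _).add (hθi.const_mul _)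
    have hφ0 : ∀ᵐ t ∂circ, 0 ≤ φ t := hf₁0.mono fun t ht =>
      add_nonneg (mul_nonneg (one_sub_nonneg_complex hε₁) ht) (hθ0 t)
    have hmem : (fun t => Matrix.diagonal fun j => if j = k then φ t else f₀ t j j) ∈
        (ContamClass.diagonal p).densities γ ε f₁ := by
      refine ⟨hdiag hfs₀ hφi hφ0, ⟨_, hdiag hW₀ (φ := fun t => (ε : ℂ)⁻¹ * ((m : ℂ) * θ t))
        ((hθi.const_mul _).const_mul _) (Eventually.of_forall fun t => mul_nonneg ?_ (hθ0 t)),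
        hfW₀.mono fun t ht j => ?_⟩, fun j => ?_⟩
      · rw [← ofReal_inv]; exact_mod_cast (inv_pos.mpr hε).le
      · simp only [diagonal_apply_eq]
        by_cases hj : j = k
        · simp only [hj, if_true, hφ]; field_simp
        · simpa only [hj, if_false] using ht j
      · simp only [diagonal_apply_eq]
        by_cases hj : j = k
        · simp only [hj, if_true, hφ]
          rw [moment_mix hγ (hf₁.integrable k k) hθi, moment_eq_one h4, moment_eq_re hf₁0, hmdef]
          push_cast; ring
        · simpa only [hj, if_false] using hfm₀ j
    obtain ⟨h5, h6⟩ := hS _ hmem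
    refine integral_le_of_ae_eq h5.int hw.int hρi (integral_qf_le_of_nq_le h6) ?_
    filter_upwards [hqf] with t h7
    have h8 : ((m : ℂ) * (θ t : ℂ)).re = m * θ t := by rw [← ofReal_mul, ofReal_re]
    have h9 : ∑ j, ‖w t j‖ ^ 2 * (Matrix.diagonal (fun j => if j = k then φ t else f₀ t j j) j j).re
        - ∑ j, ‖w t j‖ ^ 2 * (f₀ t j j).re = ‖w t k‖ ^ 2 * ((φ t).re - (f₀ t k k).re) := by
      rw [← Finset.sum_sub_distrib, Finset.sum_eq_single k]
      · rw [diagonal_apply_eq, if_pos rfl]; ring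
      · intro j _ hj
        rw [diagonal_apply_eq, if_neg hj, sub_self]
      · simp
    rw [qf_wgt, qf_wgt, h7, h7, ← mul_sub, h9, hφ]
    simp only [add_re, re_one_sub_mul, h8]
    ring
  choose M hM0 hM using hlevel
  refine ⟨fun k => Real.sqrt (M k), fun k t => ‖w t k‖ ^ 2 - M k, ?_⟩
  filter_upwards [ae_all_iff.mpr hM, hwD] with t h1 h2
  refine ⟨fun k => ⟨sub_nonpos.mpr (h1 k).1, fun h3 =>
    sub_eq_zero.mpr ((h1 k).2 (sub_pos.mpr h3))⟩, ?_⟩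
  rw [h2]
  congr 1; ext k
  rw [Real.sq_sqrt (hM0 k), add_sub_cancel]

end scalar

/-! ### Necessity of the equation: the matrix restriction -/

theorem continuous_qf (M : Matrix (Fin T) (Fin T) ℂ) : Continuous (qf M) := by
  unfold qf
  simp only [sf_eq_sum]
  refine Complex.continuous_re.comp (continuous_finsetSum _ fun p _ =>
    continuous_finsetSum _ fun l _ => ?_)
  exact (continuous_apply p).mul (continuous_const.mul
    (Complex.continuous_conj.comp (continuous_apply l)))

theorem qf_conjTranspose (M : Matrix (Fin T) (Fin T) ℂ) (u : Fin T → ℂ) : qf Mᴴ u = qf M u := by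
  have h : sf Mᴴ u u = conj (sf M u u) := by
    rw [sf_eq_sum, sf_eq_sum, map_sum, Finset.sum_comm]
    refine Finset.sum_congr rfl fun i _ => ?_
    rw [map_sum]
    refine Finset.sum_congr rfl fun j _ => ?_
    rw [conjTranspose_apply, map_mul, map_mul, Complex.conj_conj, RCLike.star_def]
    ring
  rw [qf, h, conj_re, qf]

theorem qf_vecMulVec_left (w v : Fin T → ℂ) : qf (vecMulVec (star w) w) v = ‖w ⬝ᵥ star v‖ ^ 2 := by
  have h1 : v ⬝ᵥ star w = conj (w ⬝ᵥ star v) := by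
    rw [← RCLike.star_def, ← star_dotProduct_star, star_star]
  rw [qf, sf, vecMulVec_mulVec, op_smul_eq_smul, dotProduct_smul, smul_eq_mul, h1, mul_conj',
    ← ofReal_pow, ofReal_re]

section full

variable {γ : GMIndex r} {f₀ f₁ g : ℝ → Matrix (Fin T) (Fin T) ℂ} {ε : ℝ} {w : ℝ → Fin T → ℂ}

theorem momentMatrix_conj (hγ : γ.Positive) (hg : ∀ k l, Integrable (fun t => g t k l) circ)
    (M N : Matrix (Fin T) (Fin T) ℂ) :
    momentMatrix γ (fun t => M * g t * N) = M * momentMatrix γ g * N := by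
  have h : ∀ (k l : Fin T) (X : Matrix (Fin T) (Fin T) ℂ),
      (N * Matrix.single l k 1 * M * X).trace = (M * X * N) k l := by
    intro k l X
    rw [Matrix.mul_assoc, Matrix.mul_assoc, trace_mul_comm, Matrix.mul_assoc, trace_single_mul]
    simp
  ext k l
  rw [momentMatrix, of_apply]
  simp only [← h]
  exact moment_trace_mul hγ hg _

theorem moment_mul_const (u : ℝ → ℂ) (z : ℂ) : moment γ (fun t => u t * z) = moment γ u * z := by
  rw [moment, moment]
  simp only [← mul_assoc]
  rw [integral_mul_const, mul_assoc]

theorem IsSpectralDensity.conj_mul (hg : IsSpectralDensity g) (M : Matrix (Fin T) (Fin T) ℂ) :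
    IsSpectralDensity (fun t => M * g t * Mᴴ) := by
  refine ⟨hg.posSemidef.mono fun t ht => ht.mul_mul_conjTranspose_same M, fun p l => ?_⟩
  simp only [mul_apply]
  exact integrable_finsetSum _ fun j _ => (integrable_finsetSum _ fun i _ =>
    (hg.integrable i j).const_mul _).mul_const _

theorem isSpectralDensity_ofReal_smul {θ : ℝ → ℝ} (h1 : Measurable θ) (h2 : ∀ t, 0 ≤ θ t)
    (h3 : ∃ K, ∀ t, θ t ≤ K) {Q : Matrix (Fin T) (Fin T) ℂ} (hQ : Q.PosSemidef) :
    IsSpectralDensity (fun t => (θ t : ℂ) • Q) :=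
  ⟨Eventually.of_forall fun t => hQ.smul (by exact_mod_cast h2 t),
    fun _ _ => (integrable_ofReal_of_bdd h1 h2 h3).mul_const _⟩

theorem momentMatrix_ofReal_smul {θ : ℝ → ℝ} (h : ∫ t, gain γ t * θ t ∂circ = 2 * Real.pi)
    (Q : Matrix (Fin T) (Fin T) ℂ) : momentMatrix γ (fun t => (θ t : ℂ) • Q) = Q := by
  ext k l
  rw [momentMatrix, of_apply]
  simp only [Matrix.smul_apply, smul_eq_mul]
  rw [moment_mul_const, moment_eq_one h, one_mul]

theorem wgt_add (f k : ℝ → Matrix (Fin T) (Fin T) ℂ) :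
    wgt γ (fun t => f t + k t) = fun t => wgt γ f t + wgt γ k t :=
  funext fun t => by simp only [wgt, smul_add]

theorem wgt_smul (c : ℂ) (f : ℝ → Matrix (Fin T) (Fin T) ℂ) :
    wgt γ (fun t => c • f t) = fun t => c • wgt γ f t :=
  funext fun t => by simp only [wgt]; rw [smul_comm]

/-- `M Q M* + (2δ - κδ²) u u* = Q` for `M = 1 - δ u u* Q⁻¹` and `κ = u* Q⁻¹ u`. Hence, if `g` has
the moment `Q` and the scalar density `θ` the moment `1`, then `M g M* + (2δ - κδ²) θ u u*` has the
moment `Q` as well. -/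
theorem conj_add_rankOne_eq {Q : Matrix (Fin T) (Fin T) ℂ} (hQ : Q.PosDef) (u : Fin T → ℂ)
    (δ : ℝ) : (1 - (δ : ℂ) • vecMulVec u (star u ᵥ* Q⁻¹)) * Q *
      (1 - (δ : ℂ) • vecMulVec u (star u ᵥ* Q⁻¹))ᴴ +
        ((2 * δ - qf Q⁻¹ (star u) * δ ^ 2 : ℝ) : ℂ) • vecMulVec u (star u) = Q := by
  have hdet : IsUnit Q.det := (Matrix.isUnit_iff_isUnit_det _).mp hQ.isUnit
  have hQi : (Q⁻¹).IsHermitian := hQ.inv.1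
  have h1 : star (star u ᵥ* Q⁻¹) = Q⁻¹ *ᵥ u := by
    rw [star_vecMul, star_star, hQi.eq]
  have hκ : star u ⬝ᵥ (Q⁻¹ *ᵥ u) = (qf Q⁻¹ (star u) : ℂ) := by
    have h2 : star u ⬝ᵥ (Q⁻¹ *ᵥ u) = sf Q⁻¹ (star u) (star u) := by rw [sf, star_star]
    have h3 := congrArg Complex.im (sf_conj hQi (star u) (star u))
    rw [h2]
    refine Complex.ext rfl ?_
    rw [conj_im] at h3
    rw [ofReal_im]; linarith
  have h4 : (1 - (δ : ℂ) • vecMulVec u (star u ᵥ* Q⁻¹)) * Q =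
      Q - (δ : ℂ) • vecMulVec u (star u) := by
    rw [Matrix.sub_mul, Matrix.one_mul, Matrix.smul_mul, vecMulVec_mul, vecMul_vecMul,
      nonsing_inv_mul _ hdet, vecMul_one]
  have h5 : (1 - (δ : ℂ) • vecMulVec u (star u ᵥ* Q⁻¹))ᴴ =
      1 - (δ : ℂ) • vecMulVec (Q⁻¹ *ᵥ u) (star u) := by
    rw [conjTranspose_sub, conjTranspose_one, conjTranspose_smul, conjTranspose_vecMulVec, h1,
      RCLike.star_def, conj_ofReal]
  have h6 : Q * vecMulVec (Q⁻¹ *ᵥ u) (star u) = vecMulVec u (star u) := by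
    rw [mul_vecMulVec, mulVec_mulVec, mul_nonsing_inv _ hdet, one_mulVec]
  have h7 : vecMulVec u (star u) * vecMulVec (Q⁻¹ *ᵥ u) (star u) =
      (qf Q⁻¹ (star u) : ℂ) • vecMulVec u (star u) := by
    rw [vecMulVec_mul_vecMulVec, hκ, vecMulVec_smul]
  rw [h4, h5, Matrix.mul_sub, Matrix.mul_one, Matrix.sub_mul, Matrix.mul_smul, h6,
    Matrix.smul_mul, Matrix.mul_smul, h7]
  push_cast
  module

theorem qf_conj_rankOne (M : Matrix (Fin T) (Fin T) ℂ) (u y v : Fin T → ℂ) (δ : ℝ) :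
    qf ((1 - (δ : ℂ) • vecMulVec u y) * M * (1 - (δ : ℂ) • vecMulVec u y)ᴴ) v =
      qf M (v + (-(δ : ℂ)) • (v ⬝ᵥ u) • y) := by
  set N := 1 - (δ : ℂ) • vecMulVec u y with hN
  have h1 : v ᵥ* N = v + (-(δ : ℂ)) • (v ⬝ᵥ u) • y := by
    rw [hN, vecMul_sub, vecMul_one, vecMul_smul, vecMul_vecMulVec, neg_smul, sub_eq_add_neg]
  rw [← h1, qf, qf, sf, sf, star_vecMul, ← mulVec_mulVec, ← mulVec_mulVec, dotProduct_mulVec]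

theorem le_of_forall_small {E b κ : ℝ} (hE : 0 ≤ E) (hκ : 0 ≤ κ)
    (h : ∀ δ : ℝ, 0 < δ → κ * δ ≤ 2 → (2 * δ - κ * δ ^ 2) * E ≤ 2 * δ * b) : E ≤ b := by
  by_contra hlt
  have hd : 0 < E - b := by linarith
  set δ := min (1 / (κ + 1)) ((E - b) / (κ * E + 1)) with hδ
  have hκE : 0 ≤ κ * E := mul_nonneg hκ hE
  have hδ0 : 0 < δ := lt_min (by positivity) (by positivity)
  have h1 : κ * δ ≤ 2 := by
    have : δ * (κ + 1) ≤ 1 := (le_div_iff₀ (by positivity)).mp (min_le_left _ _)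
    nlinarith
  have h2 : δ * (κ * E + 1) ≤ E - b := (le_div_iff₀ (by positivity)).mp (min_le_right _ _)
  have h3 := h δ hδ0 h1
  have h4 : (2 * δ - κ * δ ^ 2) * E - 2 * δ * b = δ * (2 * (E - b) - κ * E * δ) := by ring
  have h5 : 0 < δ * (2 * (E - b) - κ * E * δ) := mul_pos hδ0 (by nlinarith)
  linarith

/-- If `g` maximizes `∫ k(w, w)` among the densities `k` with a given moment `Q`, then `w̄ wᵀ` has a
constant majorant `A`, and `g (A - w̄ wᵀ) = 0`. The majorant is the Hermitian part of
`N Q⁻¹` with `N = (1 / 2π) ∫ w̄ (wᵀ G g)`: moving an infinitesimal mass of `g` towards `θ u u*` at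
constant moment changes the objective by a multiple of the difference between the average of
`|wᵀ u|²` and `Re u* N Q⁻¹ u`. -/
theorem exists_majorant (hγ : γ.Positive) (hg : IsSpectralDensity g)
    {Q : Matrix (Fin T) (Fin T) ℂ} (hQ : Q.PosDef) (hgQ : momentMatrix γ g = Q)
    (hw : MemW (wgt γ g) w)
    (hS : ∀ k : ℝ → Matrix (Fin T) (Fin T) ℂ, IsSpectralDensity k → momentMatrix γ k = Q →
      MemW (wgt γ k) w ∧ nq (wgt γ k) w ≤ nq (wgt γ g) w) :
    ∃ A : Matrix (Fin T) (Fin T) ℂ, A.PosSemidef ∧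
      ∀ᵐ t ∂circ, (A - vecMulVec (star (w t)) (w t)).PosSemidef ∧
        g t * (A - vecMulVec (star (w t)) (w t)) = 0 := by
  have hG := hg.wgt hγ
  have hdet : IsUnit Q.det := (Matrix.isUnit_iff_isUnit_det _).mp hQ.isUnit
  have hpi := Real.pi_pos
  set J := nq (wgt γ g) w with hJ
  -- `w` is bounded
  have hbd : ∀ᵐ t ∂circ, qf Q (w t) ≤ J := by
    refine ae_le_of_forall_average_le hγ (aestronglyMeasurable_qf_const Q hw.meas)
      fun θ h1 h2 h3 h4 => ?_
    obtain ⟨h5, h6⟩ := hS _ (isSpectralDensity_ofReal_smul h1 h2 h3 hQ.posSemidef)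
      (momentMatrix_ofReal_smul h4 Q)
    have e : ∀ t, qf (wgt γ (fun t => (θ t : ℂ) • Q) t) (w t) =
        gain γ t * (θ t * qf Q (w t)) := fun t => by rw [qf_wgt, qf_smul_weight]
    have h7 := h5.int
    rw [nq] at h6
    simp only [e] at h6 h7
    refine ⟨h7, ?_⟩
    rw [one_div, inv_mul_le_iff₀ (by positivity)] at h6
    exact h6
  set K := Real.sqrt (J * (Q⁻¹).trace.re) with hK
  have hτ : 0 ≤ (Q⁻¹).trace.re := (Complex.le_def.mp hQ.inv.posSemidef.trace_nonneg).1
  have hwK : ∀ᵐ t ∂circ, ∀ l, ‖w t l‖ ≤ K := by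
    filter_upwards [hbd] with t ht l
    refine Real.le_sqrt_of_sq_le ?_
    refine le_trans ?_ ((sum_norm_sq_le hQ.posSemidef hdet (w t)).trans
      (mul_le_mul_of_nonneg_right ht hτ))
    exact Finset.single_le_sum (f := fun l => ‖w t l‖ ^ 2) (fun _ _ => sq_nonneg _)
      (Finset.mem_univ l)
  have hdot : ∀ v : Fin T → ℂ, ∀ᵐ t ∂circ, ‖w t ⬝ᵥ v‖ ≤ K * ∑ l, ‖v l‖ := by
    intro v
    filter_upwards [hwK] with t ht
    refine (norm_dotProduct_le _ _).trans (mul_le_mul_of_nonneg_right ?_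
      (Finset.sum_nonneg fun l _ => norm_nonneg _))
    exact (pi_norm_le_iff_of_nonneg (Real.sqrt_nonneg _)).mpr ht
  have hdotm : ∀ v : Fin T → ℂ, AEStronglyMeasurable (fun t => w t ⬝ᵥ v) circ := fun v =>
    Finset.aestronglyMeasurable_fun_sum _ fun l _ => (hw.meas l).mul aestronglyMeasurable_const
  -- the matrix of the majorant
  have hNi : ∀ i j, Integrable (fun t => conj (w t i) * ((wgt γ g t)ᵀ *ᵥ w t) j) circ := by
    intro i j
    refine (integrable_transpose_mulVec hG hw j).bdd_mul (c := K)
      (Complex.continuous_conj.comp_aestronglyMeasurable (hw.meas i)) ?_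
    filter_upwards [hwK] with t ht
    rw [RCLike.norm_conj]; exact ht i
  set N : Matrix (Fin T) (Fin T) ℂ := Matrix.of fun i j =>
    ((1 / (2 * Real.pi) : ℝ) : ℂ) * ∫ t, conj (w t i) * ((wgt γ g t)ᵀ *ᵥ w t) j ∂circ with hN
  -- `z u` is the direction in which the competitors below change `w`
  set R := N * Q⁻¹ with hR
  set z : (Fin T → ℂ) → ℝ → Fin T → ℂ := fun u t => (w t ⬝ᵥ u) • (star u ᵥ* Q⁻¹) with hz
  have hzm : ∀ u, MemW (wgt γ g) (z u) := by
    intro u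
    refine MemW.of_bdd hG (fun l => (hdotm u).mul aestronglyMeasurable_const)
      (M := K * (∑ l, ‖u l‖) * ‖star u ᵥ* Q⁻¹‖) ?_
    filter_upwards [hdot u] with t ht l
    simp only [hz]
    rw [Pi.smul_apply, norm_smul]
    exact mul_le_mul ht (norm_le_pi_norm _ _) (norm_nonneg _) ((norm_nonneg _).trans ht)
  have hsip : ∀ u, (sip (wgt γ g) w (z u)).re = qf R (star u) := by
    intro u
    have h1 : star (star u ᵥ* Q⁻¹) = Q⁻¹ *ᵥ u := by
      rw [star_vecMul, star_star, hQ.inv.1.eq]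
    have h2 : ∀ t, sf (wgt γ g t) (w t) (z u t) = ∑ i, ∑ j, star u i * (Q⁻¹ *ᵥ u) j *
        (conj (w t i) * ((wgt γ g t)ᵀ *ᵥ w t) j) := by
      intro t
      have h3 : conj (w t ⬝ᵥ u) = ∑ i, star u i * conj (w t i) := by
        rw [dotProduct, map_sum]
        refine Finset.sum_congr rfl fun i _ => ?_
        rw [map_mul, mul_comm]; rfl
      have h4 : sf (wgt γ g t) (w t) (star u ᵥ* Q⁻¹) =
          ∑ j, ((wgt γ g t)ᵀ *ᵥ w t) j * (Q⁻¹ *ᵥ u) j := by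
        rw [sf, h1, dotProduct_mulVec, ← mulVec_transpose]; rfl
      simp only [hz]
      rw [sf_smul_right, h3, h4, Finset.sum_mul_sum]
      refine Finset.sum_congr rfl fun i _ => Finset.sum_congr rfl fun j _ => by ring
    have h5 : sip (wgt γ g) w (z u) = star u ⬝ᵥ (R *ᵥ u) := by
      rw [sip]
      simp only [h2]
      rw [integral_finsetSum _ fun i _ => integrable_finsetSum _ fun j _ =>
        (hNi i j).const_mul _, Finset.mul_sum, hR, ← mulVec_mulVec, dotProduct]
      refine Finset.sum_congr rfl fun i _ => ?_
      rw [integral_finsetSum _ fun j _ => (hNi i j).const_mul _, mulVec, dotProduct,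
        Finset.mul_sum, Finset.mul_sum]
      refine Finset.sum_congr rfl fun j _ => ?_
      rw [integral_const_mul, hN, of_apply]
      push_cast; ring
    rw [h5, qf, sf, star_star]
  have hkey : ∀ u : Fin T → ℂ, ∀ᵐ t ∂circ, ‖w t ⬝ᵥ u‖ ^ 2 ≤ qf R (star u) := by
    intro u
    refine ae_le_of_forall_average_le (ρ := fun t => ‖w t ⬝ᵥ u‖ ^ 2) hγ ((hdotm u).norm.pow 2)
      fun θ h1 h2 h3 h4 => ?_
    set κ := qf Q⁻¹ (star u) with hκ
    have hκ0 : 0 ≤ κ := qf_nonneg hQ.inv.posSemidef _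
    have huu : (vecMulVec u (star u)).PosSemidef := posSemidef_vecMulVec_self_star u
    have hkθ := isSpectralDensity_ofReal_smul h1 h2 h3 huu
    have hqu : ∀ v : Fin T → ℂ, qf (vecMulVec u (star u)) v = ‖v ⬝ᵥ u‖ ^ 2 := by
      intro v
      have := qf_vecMulVec_left (star u) v
      rw [star_star] at this
      rw [this, star_dotProduct_star, norm_star]
    have hθm : MemW (wgt γ fun t => (θ t : ℂ) • vecMulVec u (star u)) w :=
      MemW.of_bdd (hkθ.wgt hγ) hw.meas hwK
    have e1 : ∀ t, qf (wgt γ (fun t => (θ t : ℂ) • vecMulVec u (star u)) t) (w t) =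
        gain γ t * (θ t * ‖w t ⬝ᵥ u‖ ^ 2) := fun t => by rw [qf_wgt, qf_smul_weight, hqu]
    have h5 := hθm.int
    simp only [e1] at h5
    refine ⟨h5, ?_⟩
    suffices h6 : nq (wgt γ fun t => (θ t : ℂ) • vecMulVec u (star u)) w ≤
        (sip (wgt γ g) w (z u)).re by
      rw [hsip, nq, one_div, inv_mul_le_iff₀ (by positivity)] at h6
      simpa only [e1] using h6
    refine le_of_forall_small (nq_nonneg (hkθ.wgt hγ) w) hκ0 fun δ hδ0 hδ => ?_
    -- the competitor that moves mass towards `u u*`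
    set M := 1 - (δ : ℂ) • vecMulVec u (star u ᵥ* Q⁻¹) with hM
    have hs : 0 ≤ 2 * δ - κ * δ ^ 2 := by nlinarith
    have hMg := hg.conj_mul M
    have hMgm : MemW (wgt γ fun t => M * g t * Mᴴ) w := MemW.of_bdd (hMg.wgt hγ) hw.meas hwK
    obtain ⟨-, h7⟩ := hS _ (hMg.add (hkθ.const_smul hs)) (by
      have e2 : (fun t => M * g t * Mᴴ + ((2 * δ - κ * δ ^ 2 : ℝ) : ℂ) •
          (θ t : ℂ) • vecMulVec u (star u)) = fun t => M * g t * Mᴴ +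
            (θ t : ℂ) • (((2 * δ - κ * δ ^ 2 : ℝ) : ℂ) • vecMulVec u (star u)) :=
        funext fun t => by rw [smul_comm]
      have e3 := momentMatrix_ofReal_smul h4
        (((2 * δ - κ * δ ^ 2 : ℝ) : ℂ) • vecMulVec u (star u))
      have e4 := momentMatrix_conj hγ hg.integrable M Mᴴ
      rw [e2, momentMatrix_eq_iff]
      intro i j
      have e5 := moment_mix hγ (hMg.integrable i j)
        ((isSpectralDensity_ofReal_smul h1 h2 h3 (huu.smul
          (by exact_mod_cast hs : (0 : ℂ) ≤ ((2 * δ - κ * δ ^ 2 : ℝ) : ℂ)))).integrable i j) 1 1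
      simp only [one_mul] at e5
      refine e5.trans ?_
      have e6 := congrFun (congrFun e3 i) j
      have e7 := congrFun (congrFun e4 i) j
      rw [momentMatrix, of_apply] at e6 e7
      rw [e6, e7, hgQ, ← Matrix.add_apply, hM, hκ, conj_add_rankOne_eq hQ])
    have e2 : nq (wgt γ fun t => M * g t * Mᴴ) w =
        nq (wgt γ g) (fun t => w t + (-(δ : ℂ)) • z u t) := by
      rw [nq, nq]
      congr 2; ext t
      rw [qf_wgt, qf_wgt, hM, qf_conj_rankOne]
    rw [wgt_add, wgt_smul, nq_add_weight hMgm (hθm.smul_weight _), nq_smul_weight, e2,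
      nq_add_smul hG hw (hzm u)] at h7
    have e3 : (conj (-(δ : ℂ)) * sip (wgt γ g) w (z u)).re =
        -(δ * (sip (wgt γ g) w (z u)).re) := by
      rw [map_neg, conj_ofReal, neg_mul, neg_re, re_ofReal_mul]
    rw [e3] at h7
    have h8 : 0 ≤ ‖-(δ : ℂ)‖ ^ 2 * nq (wgt γ g) (z u) :=
      mul_nonneg (sq_nonneg _) (nq_nonneg hG _)
    linarith
  set A : Matrix (Fin T) (Fin T) ℂ := ((1 / 2 : ℝ) : ℂ) • (R + Rᴴ) with hA
  have hAh : A.IsHermitian := isHermitian_real_smul (isHermitian_add_transpose_self R) _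
  have hAq : ∀ v, qf A v = qf R v := by
    intro v
    rw [hA, qf_smul_weight, qf_add_weight, qf_conjTranspose]; ring
  have hDpsd : ∀ᵐ t ∂circ, (A - vecMulVec (star (w t)) (w t)).PosSemidef := by
    -- countably many vectors suffice, since the forms are continuous
    have h1 := ae_all_iff.mpr fun n : ℕ => hkey (star (TopologicalSpace.denseSeq (Fin T → ℂ) n))
    filter_upwards [h1] with t h2
    have hww : (vecMulVec (star (w t)) (w t)).PosSemidef := by
      have := posSemidef_vecMulVec_self_star (star (w t))
      rwa [star_star] at this
    refine posSemidef_of_qf (hAh.sub hww.1) fun v => ?_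
    refine (TopologicalSpace.denseRange_denseSeq (Fin T → ℂ)).induction_on
      (p := fun v => 0 ≤ qf (A - vecMulVec (star (w t)) (w t)) v) v
      (isClosed_le continuous_const (continuous_qf _)) fun n => ?_
    have h3 := h2 n
    rw [star_star] at h3
    rw [qf_sub_weight, hAq, qf_vecMulVec_left]
    exact sub_nonneg.mpr h3
  refine ⟨A, ?_, ?_⟩
  · obtain ⟨t, ht⟩ := hDpsd.exists
    have hww : (vecMulVec (star (w t)) (w t)).PosSemidef := by
      have := posSemidef_vecMulVec_self_star (star (w t))
      rwa [star_star] at this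
    simpa using ht.add hww
  · -- the integral of the nonnegative function `tr (g (A - w̄ wᵀ))` vanishes
    obtain ⟨hi, hI⟩ := integral_gain_re hγ (hg.integrable_trace_mul A)
    have htrN : N.trace.re = J := by
      have h1 : N.trace = (J : ℂ) := by
        rw [Matrix.trace]
        simp only [diag_apply, hN, of_apply]
        rw [← Finset.mul_sum, ← integral_finsetSum _ fun i _ => hNi i i, hJ, ← sip_self hG, sip]
        congr 2; ext t
        rw [sf, dotProduct_mulVec, ← mulVec_transpose, dotProduct]
        exact Finset.sum_congr rfl fun i _ => mul_comm _ _
      rw [h1, ofReal_re]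
    have hAQ : (A * Q).trace.re = J := by
      have h1 : R * Q = N := by rw [hR, Matrix.mul_assoc, nonsing_inv_mul _ hdet, Matrix.mul_one]
      have h2 : (Rᴴ * Q).trace = conj (N.trace) := by
        have h3 : (R * Q)ᴴ = Q * Rᴴ := by
          have := conjTranspose_mul R Q
          rwa [hQ.1.eq] at this
        rw [← h1, ← RCLike.star_def, ← trace_conjTranspose, h3, trace_mul_comm]
      rw [hA, Matrix.smul_mul, Matrix.add_mul, trace_smul, trace_add, h1, h2, smul_eq_mul,
        re_ofReal_mul, add_re, conj_re, htrN]
      ring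
    have he : ∀ t, gain γ t * (g t * (A - vecMulVec (star (w t)) (w t))).trace.re =
        gain γ t * (A * g t).trace.re - qf (wgt γ g t) (w t) := by
      intro t
      rw [qf_wgt, qf_eq_trace, transpose_vecMulVec, Matrix.mul_sub, trace_sub, sub_re,
        trace_mul_comm A]
      ring
    have h1 : Integrable (fun t => gain γ t *
        (g t * (A - vecMulVec (star (w t)) (w t))).trace.re) circ := by
      simp only [he]; exact hi.sub hw.int
    have h2 : 0 ≤ᵐ[circ] fun t => gain γ t *
        (g t * (A - vecMulVec (star (w t)) (w t))).trace.re := by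
      filter_upwards [hDpsd, hg.posSemidef] with t h3 h4
      exact mul_nonneg (gain_nonneg γ t) (trace_mul_re_nonneg h4 h3)
    have h3 : ∫ t, gain γ t * (g t * (A - vecMulVec (star (w t)) (w t))).trace.re ∂circ = 0 := by
      simp only [he]
      have h4 : ∫ t, qf (wgt γ g t) (w t) ∂circ = 2 * Real.pi * J := by
        rw [hJ, nq]; field_simp
      rw [integral_sub hi hw.int, hI, moment_trace_mul hγ hg.integrable, hgQ, hAQ, h4, sub_self]
    filter_upwards [(integral_eq_zero_iff_of_nonneg_ae h2 h1).mp h3, hDpsd, hg.posSemidef,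
      ae_gain_pos γ hγ] with t h4 h5 h6 h7
    exact ⟨h5, (posSemidef_trace_mul h6 h5).2 ((mul_eq_zero.mp h4).resolve_left h7.ne')⟩

/-- Under the restriction on the matrix moment, the residual at a least favourable density
satisfies the equation. -/
theorem isMultiplier_full (hT : 0 < T) (hγ : γ.Positive) {P : Matrix (Fin T) (Fin T) ℂ}
    (hε₀ : 0 ≤ ε) (hε₁ : ε ≤ 1) (hf₁ : IsSpectralDensity f₁)
    (hf₀ : f₀ ∈ (ContamClass.full P).densities γ ε f₁)
    (hnd : (ContamClass.full P).Nondegenerate γ ε f₁) (hw : MemW (wgt γ f₀) w)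
    (hS : ∀ f ∈ (ContamClass.full P).densities γ ε f₁,
      MemW (wgt γ f) w ∧ nq (wgt γ f) w ≤ nq (wgt γ f₀) w) :
    (ContamClass.full P).IsMultiplier ε f₁ f₀
      (fun t => vecMulVec (w t) (star (w t))) := by
  have : NeZero T := ⟨hT.ne'⟩
  obtain ⟨hfs₀, ⟨W₀, hW₀, hfW₀⟩, hfm₀⟩ := hf₀
  have ec : (1 - (ε : ℂ)) = ((1 - ε : ℝ) : ℂ) := by push_cast; rfl
  have hε₁' : 0 ≤ 1 - ε := sub_nonneg.mpr hε₁
  set Q : Matrix (Fin T) (Fin T) ℂ := P - (1 - (ε : ℂ)) • momentMatrix γ f₁ with hQdef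
  have hQ : Q.PosDef := hnd
  set g : ℝ → Matrix (Fin T) (Fin T) ℂ := fun t => f₀ t - (1 - (ε : ℂ)) • f₁ t with hgdef
  have hgW : ∀ᵐ t ∂circ, g t = (ε : ℂ) • W₀ t := by
    filter_upwards [hfW₀] with t h
    simp only [hgdef]
    rw [h, add_sub_cancel_left]
  have hg : IsSpectralDensity g := by
    refine ⟨?_, fun p l => (hfs₀.integrable p l).sub ((hf₁.integrable p l).const_mul _)⟩
    filter_upwards [hgW, hW₀.posSemidef] with t h h'
    rw [h]; exact h'.smul (by exact_mod_cast hε₀)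
  have hgQ : momentMatrix γ g = Q := by
    rw [momentMatrix_eq_iff]
    intro k l
    have h1 := moment_mix hγ (hfs₀.integrable k l) (hf₁.integrable k l) 1 (-(1 - (ε : ℂ)))
    rw [one_mul, hfm₀] at h1
    rw [hQdef, Matrix.sub_apply, Matrix.smul_apply, momentMatrix, of_apply, smul_eq_mul,
      sub_eq_add_neg, ← neg_mul, ← h1]
    congr 1; ext t
    simp only [hgdef, Matrix.sub_apply, Matrix.smul_apply, smul_eq_mul]
    ring
  have hε : 0 < ε := by
    refine lt_of_le_of_ne hε₀ fun h0 => ?_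
    have h1 : Q = 0 := by
      rw [← hgQ, momentMatrix_eq_iff]
      intro k l
      have h2 : (fun t => g t k l) =ᵐ[circ] fun _ => 0 := by
        filter_upwards [hgW] with t ht
        rw [ht, ← h0]; simp
      rw [moment_congr h2]
      simp [moment]
    have h2 := hQ.trace_pos
    rw [h1, trace_zero] at h2
    exact lt_irrefl _ h2
  -- `f₀` splits into `(1 - ε) f₁` and `g`
  have hf₁s : IsSpectralDensity fun t => ((1 - ε : ℝ) : ℂ) • f₁ t := hf₁.const_smul hε₁'
  have hsplit : wgt γ f₀ = fun t => wgt γ (fun t => ((1 - ε : ℝ) : ℂ) • f₁ t) t + wgt γ g t := by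
    rw [← wgt_add]
    congr 1; ext1 t
    simp only [hgdef, ec]
    rw [add_sub_cancel]
  have hq : ∀ k : ℝ → Matrix (Fin T) (Fin T) ℂ, ∀ t,
      qf (wgt γ (fun t => ((1 - ε : ℝ) : ℂ) • f₁ t + k t) t) (w t) =
        qf (wgt γ (fun t => ((1 - ε : ℝ) : ℂ) • f₁ t) t) (w t) + qf (wgt γ k t) (w t) := by
    intro k t
    rw [wgt_add, qf_add_weight]
  have hq₀ : ∀ t, qf (wgt γ f₀ t) (w t) =
      qf (wgt γ (fun t => ((1 - ε : ℝ) : ℂ) • f₁ t) t) (w t) + qf (wgt γ g t) (w t) := by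
    intro t
    rw [hsplit, qf_add_weight]
  have hm₁ : MemW (wgt γ fun t => ((1 - ε : ℝ) : ℂ) • f₁ t) w := by
    refine MemW.of_le (hf₁s.wgt hγ) hw.meas hw.int ?_
    filter_upwards [(hg.wgt hγ).posSemidef] with t ht
    rw [hq₀]
    exact le_add_of_nonneg_right (qf_nonneg ht _)
  have hmg : MemW (wgt γ g) w := by
    refine MemW.of_le (hg.wgt hγ) hw.meas hw.int ?_
    filter_upwards [(hf₁s.wgt hγ).posSemidef] with t ht
    rw [hq₀]
    exact le_add_of_nonneg_left (qf_nonneg ht _)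
  obtain ⟨A, hA, hAg⟩ := exists_majorant hγ hg hQ hgQ hmg fun k hk hkQ => by
    have hmem : (fun t => ((1 - ε : ℝ) : ℂ) • f₁ t + k t) ∈
        (ContamClass.full P).densities γ ε f₁ := by
      refine ⟨hf₁s.add hk, ⟨fun t => ((ε⁻¹ : ℝ) : ℂ) • k t,
        hk.const_smul (inv_pos.mpr hε).le, Eventually.of_forall fun t => ?_⟩, fun i j => ?_⟩
      · have hεne : (ε : ℂ) ≠ 0 := by exact_mod_cast hε.ne'
        simp only
        rw [ec, smul_smul, ofReal_inv, mul_inv_cancel₀ hεne, one_smul]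
      · have h1 := moment_mix hγ (hf₁.integrable i j) (hk.integrable i j) (1 - (ε : ℂ)) 1
        have h2 := momentMatrix_eq_iff.mp hkQ i j
        simp only [one_mul] at h1
        simp only [Matrix.add_apply, Matrix.smul_apply, smul_eq_mul]
        rw [← ec, h1, h2, hQdef, Matrix.sub_apply, Matrix.smul_apply, momentMatrix, of_apply,
          smul_eq_mul, add_sub_cancel]
    obtain ⟨h1, h2⟩ := hS _ hmem
    have h3 : MemW (wgt γ k) w := by
      refine MemW.of_le (hk.wgt hγ) hw.meas h1.int ?_
      filter_upwards [(hf₁s.wgt hγ).posSemidef] with t ht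
      rw [hq]
      exact le_add_of_nonneg_left (qf_nonneg ht _)
    rw [wgt_add, hsplit, nq_add_weight hm₁ h3, nq_add_weight hm₁ hmg] at h2
    exact ⟨h3, le_of_add_le_add_left h2⟩
  refine ⟨Aᵀ, fun t => vecMulVec (w t) (star (w t)) - Aᵀ, hA.transpose, fun hfr => ?_, ?_⟩
  · obtain ⟨t, h1, -, h2⟩ := (hfr.and_eventually hAg).exists
    have h3 : IsUnit (g t).det := (Matrix.isUnit_iff_isUnit_det _).mp h1.isUnit
    have h4 := congrArg (fun Y => (g t)⁻¹ * Y) h2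
    simp only [Matrix.mul_zero] at h4
    rw [← Matrix.mul_assoc, nonsing_inv_mul _ h3, Matrix.one_mul] at h4
    exact ⟨w t, by rw [sub_eq_zero.mp h4, transpose_vecMulVec]⟩
  · filter_upwards [hAg] with t ht
    have h1 : vecMulVec (w t) (star (w t)) - Aᵀ = -(A - vecMulVec (star (w t)) (w t))ᵀ := by
      rw [transpose_sub, transpose_vecMulVec, neg_sub]
    refine ⟨?_, ?_, (add_sub_cancel _ _).symm⟩
    · rw [h1, neg_neg]; exact ht.1.transpose
    · rw [h1, Matrix.neg_mul, ← transpose_mul, ht.2, transpose_zero, neg_zero]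

/-- At a least favourable density, `w w*` is a multiplier for the residual `w`. -/
theorem IsLeastFavorable.isMultiplier {κ : ContamClass T} {a : ℕ → Fin T → ℂ} (hT : 0 < T)
    (hγ : γ.Positive) (ha : IsAdmissible γ a) (hκ : κ.Valid) (hε₀ : 0 ≤ ε) (hε₁ : ε ≤ 1)
    (hf₁ : IsSpectralDensity f₁) (hm : IsMinimal γ f₀) (hnd : κ.Nondegenerate γ ε f₁)
    (h : IsLeastFavorable γ a (κ.densities γ ε f₁) f₀)
    (hw : IsResidual (wgt γ f₀) (bFun γ a) w) :
    κ.IsMultiplier ε f₁ f₀ (fun t => vecMulVec (w t) (star (w t))) := by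
  have hS := fun f (hf : f ∈ κ.densities γ ε f₁) => h.nq_le hγ ha hm hw hf
  have hf₀ := h.1
  cases κ with
  | trace p =>
    rw [densities_trace_eq] at hS hf₀
    have h1 := isMultiplier_weighted hT hγ PosDef.one hε₀ hε₁ hf₁ hf₀ hm
      (by simpa only [ContamClass.Nondegenerate, Matrix.one_mul] using hnd) hw.memW hS
    simpa only [ContamClass.IsMultiplier, Matrix.one_mul, transpose_one] using h1
  | weighted B₁ p => exact isMultiplier_weighted hT hγ hκ hε₀ hε₁ hf₁ hf₀ hm hnd hw.memW hS
  | diagonal p => exact isMultiplier_diagonal hγ hε₀ hε₁ hf₁ hf₀ hm hnd hw.memW hS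
  | full P => exact isMultiplier_full hT hγ hε₀ hε₁ hf₁ hf₀ hnd hw.memW hS

end full

/-! ### Canonical factorization -/

theorem qf_mul_conjTranspose (Φ : Matrix (Fin T) (Fin q) ℂ) (u : Fin T → ℂ) :
    qf (Φ * Φᴴ) u = ∑ i, ‖(Φᵀ *ᵥ u) i‖ ^ 2 := by
  have h1 : sf (Φ * Φᴴ) u u = (Φᵀ *ᵥ u) ⬝ᵥ star (Φᵀ *ᵥ u) := by
    rw [sf, ← mulVec_mulVec, dotProduct_mulVec, mulVec_transpose, star_vecMul]
  rw [qf, h1, dotProduct, re_sum]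
  refine Finset.sum_congr rfl fun i _ => ?_
  rw [Pi.star_apply, RCLike.star_def, mul_conj', ← ofReal_pow, ofReal_re]

/-- A function whose `L₁`-distance to functions with vanishing `n`-th Fourier coefficient is
arbitrarily small has vanishing `n`-th Fourier coefficient. -/
theorem fourierCoef_eq_zero_of_approx {u : ℝ → ℂ} (hu : Integrable u circ) {n : ℤ}
    (h : ∀ δ : ℝ, 0 < δ → ∃ v : ℝ → ℂ, Integrable v circ ∧ fourierCoef v n = 0 ∧
      ∫ t, ‖u t - v t‖ ∂circ ≤ δ) : fourierCoef u n = 0 := by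
  have hle : ∀ δ : ℝ, 0 < δ → ‖fourierCoef u n‖ ≤ δ := by
    intro δ hδ
    have hpi := Real.pi_pos
    obtain ⟨v, hv, h0, h1⟩ := h (2 * Real.pi * δ) (by positivity)
    have h2 := norm_fourierCoef_le (u := fun t => u t - v t) n
    rw [fourierCoef_sub hu hv, h0, sub_zero] at h2
    refine h2.trans ?_
    rw [one_div, inv_mul_le_iff₀ (by positivity)]
    exact h1
  exact norm_le_zero_iff.mp (le_of_forall_pos_le_add fun δ hδ => by simpa using hle δ hδ)

section factorization

variable {γ : GMIndex r} {a : ℕ → Fin T → ℂ} {f₀ X : ℝ → Matrix (Fin T) (Fin T) ℂ}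
  {φ : ℕ → Matrix (Fin T) (Fin q) ℂ} {Φ : ℝ → Matrix (Fin T) (Fin q) ℂ} {w : ℝ → Fin T → ℂ}

theorem IsCanonicalFactorization.integrable (h : IsCanonicalFactorization γ f₀ φ Φ) (p : Fin T)
    (l : Fin q) : Integrable (fun t => Φ t p l) circ :=
  (h.memLp p l).integrable one_le_two

theorem IsCanonicalFactorization.ae_qf_eq (h : IsCanonicalFactorization γ f₀ φ Φ) :
    ∀ᵐ t ∂circ, ∀ u : Fin T → ℂ, qf (wgt γ f₀ t) u = ∑ i, ‖((Φ t)ᵀ *ᵥ u) i‖ ^ 2 :=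
  h.factor.mono fun t ht u => by rw [wgt, ht, qf_mul_conjTranspose]

theorem IsCanonicalFactorization.measV (h : IsCanonicalFactorization γ f₀ φ Φ) (hw : MeasV w) :
    MeasV (fun t => (Φ t)ᵀ *ᵥ w t) := fun i => by
  simp only [mulVec, dotProduct, transpose_apply]
  exact Finset.aestronglyMeasurable_fun_sum _ fun p _ => (h.integrable p i).1.mul (hw p)

/-- `Φᵀ` maps `L₂(G f₀)` isometrically to `L₂`. -/
theorem IsCanonicalFactorization.integral_norm_sq (h : IsCanonicalFactorization γ f₀ φ Φ)
    (hw : MemW (wgt γ f₀) w) : Integrable (fun t => ∑ i, ‖((Φ t)ᵀ *ᵥ w t) i‖ ^ 2) circ ∧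
      ∫ t, ∑ i, ‖((Φ t)ᵀ *ᵥ w t) i‖ ^ 2 ∂circ = 2 * Real.pi * nq (wgt γ f₀) w := by
  have h1 : (fun t => qf (wgt γ f₀ t) (w t)) =ᵐ[circ] fun t => ∑ i, ‖((Φ t)ᵀ *ᵥ w t) i‖ ^ 2 :=
    h.ae_qf_eq.mono fun t ht => ht (w t)
  refine ⟨hw.int.congr h1, ?_⟩
  have := Real.pi_pos
  rw [← integral_congr_ae h1, nq]
  field_simp

theorem norm_le_of_sq (η : ℝ) (hη : 0 < η) (x : ℝ) : x ≤ η⁻¹ * x ^ 2 + η := by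
  have h : η * x ≤ x ^ 2 + η ^ 2 := by nlinarith [sq_nonneg (x - η), sq_nonneg (x + η)]
  have h1 := mul_le_mul_of_nonneg_left h (inv_pos.mpr hη).le
  rw [inv_mul_cancel_left₀ hη.ne'] at h1
  refine h1.trans (le_of_eq ?_)
  field_simp

theorem IsCanonicalFactorization.integral_norm_le (h : IsCanonicalFactorization γ f₀ φ Φ)
    (hw : MemW (wgt γ f₀) w) (i : Fin q) {η : ℝ} (hη : 0 < η) :
    Integrable (fun t => ((Φ t)ᵀ *ᵥ w t) i) circ ∧
      ∫ t, ‖((Φ t)ᵀ *ᵥ w t) i‖ ∂circ ≤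
        η⁻¹ * (2 * Real.pi * nq (wgt γ f₀) w) + η * (2 * Real.pi) := by
  obtain ⟨h1, h2⟩ := h.integral_norm_sq hw
  have h3 : Integrable (fun t => η⁻¹ * (∑ i, ‖((Φ t)ᵀ *ᵥ w t) i‖ ^ 2) + η) circ :=
    (h1.const_mul _).add (integrable_const η)
  have h4 : ∀ t, ‖((Φ t)ᵀ *ᵥ w t) i‖ ≤ η⁻¹ * (∑ i, ‖((Φ t)ᵀ *ᵥ w t) i‖ ^ 2) + η := by
    intro t
    refine (norm_le_of_sq η hη _).trans (add_le_add (mul_le_mul_of_nonneg_left ?_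
      (inv_pos.mpr hη).le) le_rfl)
    exact Finset.single_le_sum (f := fun i => ‖((Φ t)ᵀ *ᵥ w t) i‖ ^ 2) (fun _ _ => sq_nonneg _)
      (Finset.mem_univ i)
  have h5 := h3.mono' (h.measV hw.meas i) (Eventually.of_forall h4)
  refine ⟨h5, (integral_mono h5.norm h3 h4).trans (le_of_eq ?_)⟩
  rw [integral_add (h1.const_mul _) (integrable_const η), integral_const_mul, h2, integral_const,
    circ_real_univ, smul_eq_mul]
  ring

/-- Multiplication by `Φᵀ` takes the past to functions with negative frequencies. -/
theorem IsCanonicalFactorization.fourierCoef_inPast (h : IsCanonicalFactorization γ f₀ φ Φ)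
    (hg : IsSpectralDensity (wgt γ f₀)) {v : ℝ → Fin T → ℂ} (hv : InPast (wgt γ f₀) v)
    (i : Fin q) (n : ℕ) : fourierCoef (fun t => ((Φ t)ᵀ *ᵥ v t) i) n = 0 := by
  have hpi := Real.pi_pos
  refine fourierCoef_eq_zero_of_approx (h.integral_norm_le hv.memW i one_pos).1 fun δ hδ => ?_
  set η := δ / (4 * Real.pi) with hη
  have hη0 : 0 < η := by positivity
  obtain ⟨p, hp⟩ := hv.approx (η ^ 2) (by positivity)
  refine ⟨fun t => ((Φ t)ᵀ *ᵥ pastTrig p t) i,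
    (h.integral_norm_le (memW_pastTrig hg p) i one_pos).1, ?_, ?_⟩
  · have hi : ∀ k ∈ p.support, ∀ l ∈ (Finset.univ : Finset (Fin T)), Integrable (fun t =>
        p k l * (ee (-((k : ℤ) + 1)) t * Φ t l i)) circ := fun k _ l _ =>
      (Integrable.ee_mul (h.integrable l i) _).const_mul _
    have he : (fun t => ((Φ t)ᵀ *ᵥ pastTrig p t) i) = fun t => ∑ k ∈ p.support, ∑ l,
        p k l * (ee (-((k : ℤ) + 1)) t * Φ t l i) := by
      ext t
      rw [mulVec, dotProduct, Finset.sum_comm]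
      refine Finset.sum_congr rfl fun l _ => ?_
      rw [pastTrig_apply, Finset.mul_sum]
      refine Finset.sum_congr rfl fun k _ => ?_
      rw [transpose_apply]; ring
    rw [he, fourierCoef_finsetSum _ fun k hk => integrable_finsetSum _ (hi k hk)]
    refine Finset.sum_eq_zero fun k hk => ?_
    rw [fourierCoef_finsetSum _ (hi k hk)]
    refine Finset.sum_eq_zero fun l _ => ?_
    rw [fourierCoef_const_mul, fourierCoef_ee_mul]
    have h1 := h.coef_pos l i (n + k)
    have h2 : (((n + k : ℕ) : ℤ) + 1) = (n : ℤ) - -((k : ℤ) + 1) := by push_cast; ring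
    rw [h2] at h1
    rw [h1, mul_zero]
  · have h1 := (h.integral_norm_le (hv.memW.sub hg (memW_pastTrig hg p)) i hη0).2
    have h2 : ∀ t, ((Φ t)ᵀ *ᵥ v t) i - ((Φ t)ᵀ *ᵥ pastTrig p t) i =
        ((Φ t)ᵀ *ᵥ (v t - pastTrig p t)) i := fun t => by rw [mulVec_sub]; rfl
    simp only [h2]
    refine h1.trans ?_
    have h3 : η⁻¹ * (2 * Real.pi * nq (wgt γ f₀) fun t => v t - pastTrig p t) ≤
        η⁻¹ * (2 * Real.pi * η ^ 2) :=
      mul_le_mul_of_nonneg_left (mul_le_mul_of_nonneg_left hp.le (by positivity)) (by positivity)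
    have h4 : η⁻¹ * (2 * Real.pi * η ^ 2) = η * (2 * Real.pi) := by field_simp
    have h5 : η * (2 * Real.pi) + η * (2 * Real.pi) = δ := by rw [hη]; field_simp; ring
    linarith

theorem IsCanonicalFactorization.hasSum_fourierCoef (h : IsCanonicalFactorization γ f₀ φ Φ)
    (ha : IsAdmissible γ a) (k : ℕ) (i : Fin q) :
    HasSum (fun m => ((φ m)ᵀ *ᵥ bCoef γ a (m + k)) i)
      (fourierCoef (fun t => ((Φ t)ᵀ *ᵥ bFun γ a t) i) k) := by
  have hB : ∀ l t, bFun γ a t l = ∑' k : ℕ, ee k t * bCoef γ a k l := fun l t => bFun_apply ha t l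
  have h1 : ∀ l, HasSum (fun m => φ m l i * bCoef γ a (m + k) l)
      (fourierCoef (fun t => Φ t l i * bFun γ a t l) k) := by
    intro l
    have h2 := hasSum_fourierCoef_mul_series (h.integrable l i) (summable_bCoef_apply ha l) k
    simp only [← hB] at h2
    rw [← hasSum_nat_add_iff' k] at h2
    have h3 : ∑ j ∈ Finset.range k, bCoef γ a j l *
        fourierCoef (fun t => Φ t l i) ((k : ℤ) - j) = 0 := by
      refine Finset.sum_eq_zero fun j hj => ?_
      have h4 : j < k := Finset.mem_range.mp hj
      have h5 := h.coef_pos l i (k - j - 1)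
      have h6 : (((k - j - 1 : ℕ) : ℤ) + 1) = (k : ℤ) - j := by omega
      rw [h6] at h5
      rw [h5, mul_zero]
    rw [h3, sub_zero] at h2
    refine h2.congr_fun fun m => ?_
    have h7 : (k : ℤ) - ((m + k : ℕ) : ℤ) = -(m : ℤ) := by push_cast; ring
    rw [h7, h.coef, mul_comm]
  have h2 : fourierCoef (fun t => ((Φ t)ᵀ *ᵥ bFun γ a t) i) k =
      ∑ l, fourierCoef (fun t => Φ t l i * bFun γ a t l) k := by
    rw [← fourierCoef_finsetSum]
    · rfl
    · intro l _
      refine (h.integrable l i).mul_bdd (c := ∑' k, ‖bCoef γ a k‖) ((measV_bFun ha) l)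
        (Eventually.of_forall fun t => norm_bFun_le ha t l)
  rw [h2]
  exact hasSum_sum fun l _ => h1 l

/-- The function `Φᵀ w` is the analytic function `R` of the factorized equation. -/
theorem IsCanonicalFactorization.isAnalyticSum (hγ : γ.Positive) (ha : IsAdmissible γ a)
    (hf₀ : IsSpectralDensity f₀) (h : IsCanonicalFactorization γ f₀ φ Φ)
    (hw : IsResidual (wgt γ f₀) (bFun γ a) w) :
    IsAnalyticSum (rCoef γ a φ) (fun t => (Φ t)ᵀ *ᵥ w t) := by
  have hg := hf₀.wgt hγ
  have hpi := Real.pi_pos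
  have hint := fun i => (h.integral_norm_le hw.memW i one_pos).1
  refine ⟨hint, fun i k => ?_, fun l j => ?_⟩
  · have h1 : rCoef γ a φ k i = fourierCoef (fun t => ((Φ t)ᵀ *ᵥ bFun γ a t) i) k := by
      have h2 : HasSum (fun m => (φ m)ᵀ *ᵥ bCoef γ a (m + k))
          (fun i => fourierCoef (fun t => ((Φ t)ᵀ *ᵥ bFun γ a t) i) k) :=
        Pi.hasSum.mpr fun i => h.hasSum_fourierCoef ha k i
      rw [rCoef, h2.tsum_eq]
    have h3 := h.fourierCoef_inPast hg hw.inPast i k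
    have h4 : ∀ t, ((Φ t)ᵀ *ᵥ (bFun γ a t - w t)) i =
        ((Φ t)ᵀ *ᵥ bFun γ a t) i - ((Φ t)ᵀ *ᵥ w t) i := fun t => by rw [mulVec_sub]; rfl
    simp only [h4] at h3
    rw [fourierCoef_sub (h.integral_norm_le (memW_bFun ha hg) i one_pos).1 (hint i)] at h3
    rw [h1]
    exact (sub_eq_zero.mp h3).symm
  · refine fourierCoef_eq_zero_of_approx (hint l) fun δ hδ => ?_
    obtain ⟨hR, hRE⟩ := h.integral_norm_sq hw.memW
    set E := 2 * Real.pi * nq (wgt γ f₀) w with hE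
    have hE0 : 0 ≤ E := mul_nonneg (by positivity) (nq_nonneg hg w)
    set η := δ / (E + 1) with hη
    have hη0 : 0 < η := by positivity
    obtain ⟨p, hp⟩ := h.canonical l (η * δ) (by positivity)
    -- the polynomial combination of the rows of `Φ` close to the `l`-th unit row
    set P : ℝ → Fin T → ℂ := fun t => p.sum fun k v => exp (-(I * (k : ℂ) * (t : ℂ))) • v with hP
    have hPe : ∀ t, P t = ∑ k ∈ p.support, ee (-(k : ℤ)) t • p k := by
      intro t
      simp only [hP, Finsupp.sum]
      refine Finset.sum_congr rfl fun k _ => ?_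
      rw [ee]; congr 2; push_cast; ring
    have hPm : MeasV P := by
      refine MeasV.of_continuous ?_
      simp only [funext hPe]
      exact continuous_finsetSum _ fun k _ => (continuous_ee _).smul continuous_const
    set D : ℝ → Fin q → ℂ := fun t i => (P t ᵥ* Φ t) i - (Pi.single l 1 : Fin q → ℂ) i with hD
    have hDm : MeasV D := fun i => by
      have := h.measV hPm i
      simp only [mulVec_transpose] at this
      exact this.sub aestronglyMeasurable_const
    have hDsm : AEStronglyMeasurable (fun t => ∑ i, ‖D t i‖ ^ 2) circ :=
      Finset.aestronglyMeasurable_fun_sum _ fun i _ => (hDm i).norm.pow 2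
    have hDl : ∫⁻ t, ENNReal.ofReal (∑ i, ‖D t i‖ ^ 2) ∂circ < ENNReal.ofReal (η * δ) := by
      refine lt_of_eq_of_lt (lintegral_congr fun t => ?_) hp
      rw [ENNReal.ofReal_sum_of_nonneg fun i _ => sq_nonneg _]
      refine Finset.sum_congr rfl fun i _ => ?_
      rw [ENNReal.ofReal_pow (norm_nonneg _), ofReal_norm]
    have hD0 : ∀ t, 0 ≤ ∑ i, ‖D t i‖ ^ 2 := fun t => Finset.sum_nonneg fun i _ => sq_nonneg _
    have hDi : Integrable (fun t => ∑ i, ‖D t i‖ ^ 2) circ := by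
      refine ⟨hDsm, ?_⟩
      rw [hasFiniteIntegral_iff_ofReal (Eventually.of_forall hD0)]
      exact hDl.trans ENNReal.ofReal_lt_top
    have hDI : ∫ t, ∑ i, ‖D t i‖ ^ 2 ∂circ < η * δ := by
      rw [← ofReal_integral_eq_lintegral_ofReal hDi (Eventually.of_forall hD0)] at hDl
      exact (ENNReal.ofReal_lt_ofReal_iff (by positivity)).mp hDl
    -- the corresponding combination of the analytic function `C`
    set S : ℝ → ℂ := fun t => ∑ k ∈ p.support, ∑ i,
      conj (p k i) * (ee k t * ((wgt γ f₀ t)ᵀ *ᵥ w t) i) with hS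
    have hSi : ∀ k ∈ p.support, ∀ i ∈ (Finset.univ : Finset (Fin T)), Integrable (fun t =>
        conj (p k i) * (ee k t * ((wgt γ f₀ t)ᵀ *ᵥ w t) i)) circ := fun k _ i _ =>
      (Integrable.ee_mul (integrable_transpose_mulVec hg hw.memW i) _).const_mul _
    have hSD : ∀ᵐ t ∂circ, ((Φ t)ᵀ *ᵥ w t) l - S t =
        -∑ i, conj (D t i) * ((Φ t)ᵀ *ᵥ w t) i := by
      filter_upwards [h.factor] with t ht
      have e1 : S t = ((wgt γ f₀ t)ᵀ *ᵥ w t) ⬝ᵥ star (P t) := by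
        rw [hPe, dotProduct]
        simp only [hS]
        rw [Finset.sum_comm]
        refine Finset.sum_congr rfl fun i _ => ?_
        rw [Pi.star_apply, Finset.sum_apply, star_sum, Finset.mul_sum]
        refine Finset.sum_congr rfl fun k _ => ?_
        rw [Pi.smul_apply, smul_eq_mul, star_mul', RCLike.star_def, conj_ee, neg_neg]
        ring
      have e2 : S t = ((Φ t)ᵀ *ᵥ w t) ⬝ᵥ star (P t ᵥ* Φ t) := by
        rw [e1, wgt, ht, mulVec_transpose, ← dotProduct_mulVec, ← mulVec_mulVec,
          dotProduct_mulVec, mulVec_transpose, star_vecMul]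
      have e3 : ((Φ t)ᵀ *ᵥ w t) l = ∑ i, conj ((Pi.single l 1 : Fin q → ℂ) i) *
          ((Φ t)ᵀ *ᵥ w t) i := by
        rw [Finset.sum_eq_single l]
        · simp
        · intro i _ hi
          rw [Pi.single_eq_of_ne hi, map_zero, zero_mul]
        · simp
      rw [e2, e3, dotProduct, ← Finset.sum_sub_distrib, ← Finset.sum_neg_distrib]
      refine Finset.sum_congr rfl fun i _ => ?_
      simp only [hD, map_sub, Pi.star_apply, RCLike.star_def]
      ring
    refine ⟨S, integrable_finsetSum _ fun k hk => integrable_finsetSum _ (hSi k hk), ?_, ?_⟩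
    · rw [fourierCoef_finsetSum _ fun k hk => integrable_finsetSum _ (hSi k hk)]
      refine Finset.sum_eq_zero fun k hk => ?_
      rw [fourierCoef_finsetSum _ (hSi k hk)]
      refine Finset.sum_eq_zero fun i _ => ?_
      rw [fourierCoef_const_mul, fourierCoef_ee_mul]
      have h1 := hw.fourierCoef_neg hg i (j + k)
      have h2 : -(((j + k : ℕ) : ℤ) + 1) = -((j : ℤ) + 1) - k := by push_cast; ring
      rw [h2] at h1
      rw [h1, mul_zero]
    · have hb : Integrable (fun t => η⁻¹ * (∑ i, ‖D t i‖ ^ 2) +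
          η * ∑ i, ‖((Φ t)ᵀ *ᵥ w t) i‖ ^ 2) circ := (hDi.const_mul _).add (hR.const_mul _)
      have hle : (fun t => ‖((Φ t)ᵀ *ᵥ w t) l - S t‖) ≤ᵐ[circ] fun t =>
          (1 / 2) * (η⁻¹ * (∑ i, ‖D t i‖ ^ 2) + η * ∑ i, ‖((Φ t)ᵀ *ᵥ w t) i‖ ^ 2) := by
        filter_upwards [hSD] with t ht
        rw [ht, norm_neg, Finset.mul_sum, Finset.mul_sum, ← Finset.sum_add_distrib, Finset.mul_sum]
        refine norm_sum_le_of_le _ fun i _ => ?_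
        rw [norm_mul, RCLike.norm_conj]
        set x := ‖D t i‖
        set y := ‖((Φ t)ᵀ *ᵥ w t) i‖
        have h1 : η⁻¹ * (x - η * y) ^ 2 = η⁻¹ * x ^ 2 + η * y ^ 2 - 2 * (x * y) := by
          field_simp; ring
        have h2 : 0 ≤ η⁻¹ * (x - η * y) ^ 2 := by positivity
        linarith
      refine (integral_mono_of_nonneg (Eventually.of_forall fun t => norm_nonneg _)
        (hb.const_mul _) hle).trans ?_
      rw [integral_const_mul, integral_add (hDi.const_mul _) (hR.const_mul _), integral_const_mul,
        integral_const_mul, hRE]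
      have h1 : η⁻¹ * ∫ t, ∑ i, ‖D t i‖ ^ 2 ∂circ ≤ δ := by
        rw [inv_mul_le_iff₀ hη0]; exact hDI.le
      have h2 : η * E ≤ δ := by
        rw [hη, div_mul_eq_mul_div, div_le_iff₀ (by positivity)]
        nlinarith
      linarith

theorem IsCanonicalFactorization.spectralEquation (hγ : γ.Positive) (hm : IsMinimal γ f₀)
    (h : IsCanonicalFactorization γ f₀ φ Φ) {C : ℝ → Fin T → ℂ}
    (heq : FactorizedEquation Φ X (fun t => (Φ t)ᵀ *ᵥ (symbolF γ f₀ t *ᵥ C t))) :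
    SpectralEquation γ f₀ X C := by
  filter_upwards [heq, h.factor, ae_symbolF_mulVec hγ hm] with t h1 h2 h3
  set w := symbolF γ f₀ t *ᵥ C t with hw
  have e1 : ((gain γ t : ℝ) : ℂ) • (f₀ t)ᵀ = ((Φ t)ᵀ)ᴴ * (Φ t)ᵀ := by
    rw [← transpose_smul, h2, transpose_mul]; rfl
  have e2 : C t = ((Φ t)ᵀ)ᴴ *ᵥ ((Φ t)ᵀ *ᵥ w) := by
    have h4 := h3.2 (C t)
    rw [wgt, transpose_smul, e1, ← hw] at h4
    rw [mulVec_mulVec, h4]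
  have e3 : vecMulVec (C t) (star (C t)) = ((Φ t)ᵀ)ᴴ *
      vecMulVec ((Φ t)ᵀ *ᵥ w) (star ((Φ t)ᵀ *ᵥ w)) * (Φ t)ᵀ := by
    rw [e2, star_mulVec ((Φ t)ᵀ)ᴴ, conjTranspose_conjTranspose, mul_vecMulVec, vecMulVec_mul]
  have e4 : (Φ t).map star = ((Φ t)ᵀ)ᴴ := rfl
  rw [e3, h1, e1, e4]
  simp only [Matrix.mul_assoc]

theorem factorizedEquation_vecMulVec (Φ : ℝ → Matrix (Fin T) (Fin q) ℂ) (w : ℝ → Fin T → ℂ) :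
    FactorizedEquation Φ (fun t => vecMulVec (w t) (star (w t))) (fun t => (Φ t)ᵀ *ᵥ w t) := by
  refine Eventually.of_forall fun t => ?_
  have e4 : (Φ t).map star = ((Φ t)ᵀ)ᴴ := rfl
  simp only [e4]
  rw [mul_vecMulVec, vecMulVec_mul, star_mulVec]

end factorization

end GMForecast

end

theorem mainTheorem11 {r T : ℕ} (hT : 0 < T)
    (γ : GMForecast.GMIndex r) (hγ : γ.Positive)
    (a : ℕ → Fin T → ℂ) (ha : GMForecast.IsAdmissible γ a)
    (ε : ℝ) (hε₀ : 0 ≤ ε) (hε₁ : ε ≤ 1)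
    (f₁ : ℝ → Matrix (Fin T) (Fin T) ℂ) (hf₁ : GMForecast.IsSpectralDensity f₁)
    (κ : GMForecast.ContamClass T) (hκ : κ.Valid)
    (f₀ : ℝ → Matrix (Fin T) (Fin T) ℂ) (hf₀ : f₀ ∈ κ.densities γ ε f₁)
    (hmin : GMForecast.IsMinimal γ f₀) :
    -- meaning of the mean square errors for sequences with the given spectral density
    (∀ (f : ℝ → Matrix (Fin T) (Fin T) ℂ), GMForecast.IsSpectralDensity f →
      ∀ (Ω : Type) [MeasurableSpace Ω] (P : MeasureTheory.Measure Ω)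
        [MeasureTheory.IsProbabilityMeasure P] (ξ : Fin T → ℤ → Ω → ℂ),
        GMForecast.HasSpectralDensity P γ ξ f →
        (∀ g : ℕ →₀ (Fin T → ℂ),
          ∫⁻ ω, ‖GMForecast.functionalA γ a (fun p k => ξ p k ω) -
            GMForecast.estimateA γ a g (fun p k => ξ p k ω)‖ₑ ^ 2 ∂P =
          GMForecast.mse γ a (GMForecast.pastPoly γ g) f) ∧
        (⨅ g : ℕ →₀ (Fin T → ℂ),
          ∫⁻ ω, ‖GMForecast.functionalA γ a (fun p k => ξ p k ω) -
            GMForecast.estimateA γ a g (fun p k => ξ p k ω)‖ₑ ^ 2 ∂P) =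
          GMForecast.optMse γ a f) ∧
    ∃ (c : ℕ → Fin T → ℂ) (C : ℝ → Fin T → ℂ),
      -- the coefficients `c = F₀⁻¹ D a` exist and are unique
      GMForecast.IsFInverse γ a f₀ c C ∧
      (∀ c' C', GMForecast.IsFInverse γ a f₀ c' C' → c' = c) ∧
      -- optimal spectral characteristic and error under `f₀`
      GMForecast.IsOptimal γ a f₀ (GMForecast.specChar γ a f₀ C) ∧
      GMForecast.optMse γ a f₀ = ENNReal.ofReal (GMForecast.pairing γ a c) ∧
      -- the constrained optimization problem
      (GMForecast.IsLeastFavorable γ a (κ.densities γ ε f₁) f₀ ↔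
        GMForecast.SolvesMaxProblem γ a (κ.densities γ ε f₁) c) ∧
      -- the equations for the least favorable density
      (∀ X, κ.IsMultiplier ε f₁ f₀ X → GMForecast.SpectralEquation γ f₀ X C →
        GMForecast.IsLeastFavorable γ a (κ.densities γ ε f₁) f₀) ∧
      (κ.Nondegenerate γ ε f₁ → GMForecast.IsLeastFavorable γ a (κ.densities γ ε f₁) f₀ →
        ∃ X, κ.IsMultiplier ε f₁ f₀ X ∧ GMForecast.SpectralEquation γ f₀ X C) ∧
      -- the equations in the case of a canonical factorization
      (∀ (q : ℕ) (φ : ℕ → Matrix (Fin T) (Fin q) ℂ) (Φ : ℝ → Matrix (Fin T) (Fin q) ℂ),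
        GMForecast.IsCanonicalFactorization γ f₀ φ Φ →
        ∃ R : ℝ → Fin q → ℂ, GMForecast.IsAnalyticSum (GMForecast.rCoef γ a φ) R ∧
          (∀ X, κ.IsMultiplier ε f₁ f₀ X → GMForecast.FactorizedEquation Φ X R →
            GMForecast.IsLeastFavorable γ a (κ.densities γ ε f₁) f₀) ∧
          (κ.Nondegenerate γ ε f₁ → GMForecast.IsLeastFavorable γ a (κ.densities γ ε f₁) f₀ →
            ∃ X, κ.IsMultiplier ε f₁ f₀ X ∧ GMForecast.FactorizedEquation Φ X R)) ∧
      -- the minimax-robust spectral characteristic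
      (GMForecast.IsLeastFavorable γ a (κ.densities γ ε f₁) f₀ →
        GMForecast.IsMinimaxRobust γ a (κ.densities γ ε f₁)
          (GMForecast.specChar γ a f₀ C)) := by 
  have hfs₀ := GMForecast.isSpectralDensity_of_mem hf₀
  obtain ⟨c, C, hC⟩ := GMForecast.exists_isFInverse hγ ha hfs₀ hmin
  have hw := hC.isResidual hγ ha hfs₀ hmin
  refine ⟨fun f hf Ω _ P _ ξ hξ => ⟨hξ.lintegral_error hγ ha hf, ?_⟩, c, C, hC,
    fun c' C' hC' => hC.unique hγ ha hfs₀ hmin hC', hC.isOptimal hγ ha hfs₀ hmin,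
    hC.optMse_eq hγ ha hfs₀ hmin, GMForecast.isLeastFavorable_iff hγ ha hf₀ hmin hC,
    fun X hX heq => GMForecast.isLeastFavorable_of_isMultiplier hγ ha hκ hε₀ hf₀ hmin hC hX heq,
    fun hnd h => ⟨_, h.isMultiplier hT hγ ha hκ hε₀ hε₁ hf₁ hmin hnd hw,
      (GMForecast.spectralEquation_iff hγ hfs₀ hmin).mpr (.of_forall fun _ => rfl)⟩,
    fun q φ Φ hΦ => ⟨_, hΦ.isAnalyticSum hγ ha hfs₀ hw, fun X hX heq =>
      GMForecast.isLeastFavorable_of_isMultiplier hγ ha hκ hε₀ hf₀ hmin hC hX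
        (hΦ.spectralEquation hγ hmin heq),
      fun hnd h => ⟨_, h.isMultiplier hT hγ ha hκ hε₀ hε₁ hf₁ hmin hnd hw,
        GMForecast.factorizedEquation_vecMulVec Φ _⟩⟩,
    fun h => h.isMinimaxRobust hγ ha hmin hC⟩
  rw [GMForecast.optMse_eq_iInf hγ ha hf]
  exact iInf_congr fun g => hξ.lintegral_error hγ ha hf g
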